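/- **Setting.** Let $X$ be a measurable space, $f:X\to X$ measurable, $Z\subset X$ measurable, and $\sigma:Z\to\{1,2,\dots\}$ measurable with $f^{\sigma(z)}(z)\in Z$ for all $z\in Z$; put $G=f^\sigma:Z\to Z$. Let $\alpha$ be an at most countable measurable partition of $Z$ on whose elements $\sigma$ is constant. Let $s(z,z')$ be the least $n\ge0$ such that $G^nz,G^nz'$ lie in distinct elements of $\alpha$, and $d_\vartheta(z,z')=\vartheta^{s(z,z')}$ for $\vartheta\in(0,1)$. Fix $\theta_0\in(0,1)$. Assume that $G$ is a full branch Gibbs–Markov map with ergodic invariant probability measure $\mu_Z$: each $a\in\alpha$ has positive measure and is mapped by $G$ bijectively and bimeasurably onto $Z$; $s(z,z')<\infty$ for $z\ne z'$; and $\xi=d\mu_Z/d(\mu_Z\circ G)$ exists, is positive, and satisfies $|\log\xi(z)-\log\xi(z')|\le C\,d_{\theta_0}(Gz,Gz')$ for $z,z'\in a$, $a\in\alpha$. Assume exponential tails: $\mu_Z(\sigma>n)=O(e^{-dn})$ for some $d>0$. The Young tower is $Y=\{(z,\ell):z\in Z,\ 0\le\ell\le\sigma(z)-1\}$ with $F(z,\ell)=(z,\ell+1)$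 if $\ell\le\sigma(z)-2$ and $F(z,\sigma(z)-1)=(Gz,0)$, with the $F$-invariant probability measure $\mu=(\mu_Z\times\text{counting})/\int\sigma\,d\mu_Z$. Let $\pi_Y(z,\ell)=f^\ell z$ and $\mu_X=(\pi_Y)_*\mu$. Let $\tau_0:X\to(0,\infty)$ be measurable, $\operatorname{ess\,inf}\tau_0>1$, with $\mu_X(\tau_0>t)=ct^{-\beta}+O(t^{-\kappa})$, where $c>0$, $\beta\in(\frac12,1)$, $\kappa\in(1,2\beta]$. Write $\tau=\tau_0\circ\pi_Y$, $\tau_\ell=\sum_{j<\ell}\tau_0\circ f^j$, $\varphi=\tau_\sigma$, $\psi(z,\ell)=\tau_\ell(z)$, $\psi_*(z,\ell)=\max_{0\le j\le\ell-1}\tau_0(f^jz)$, and assume $|\tau_\ell(z)-\tau_\ell(z')|\le C(\inf_a\varphi)\,d_{\theta_0}(z,z')$ for all $a\in\alpha$, $z,z'\in a$, $\ell\le\sigma(a)$. Fix $\beta'\in(0,\beta)$ and $\theta\in[\theta_0^{\beta'},1)$. For $\varepsilon>0$ let $\mathcal B(Y)$ be the space of $v:Y\to\mathbb C$ such that both $\sup_{(z,\ell)\in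 Y}e^{-\varepsilon\ell}|v(z,\ell)|$ and $\sup e^{-\varepsilon\ell}\varphi(z)^{-\beta'}|v(z,\ell)-v(z',\ell)|/d_\theta(z,z')$ (over $\ell\ge0$, $a\in\alpha$ with $\sigma(a)>\ell$, and $z\ne z'$ in $a$) are finite. Let $R$ be the transfer operator of $F$ on $L^1(Y)$, $\hat R(s)v=R(e^{-s\tau}v)$, $\overline{\mathbb H}=\{\operatorname{Re}s\ge0\}$, and $B_\delta(0)=\{|s|<\delta\}$. An *eigenfamily* on $\overline{\mathbb H}\cap B_\delta(0)$, $\delta>0$, consists of a continuous family $\lambda(s)$ of (algebraically) simple eigenvalues of $\hat R(s)$ on $\mathcal B(Y)$ with $\lambda(0)=1$, and of eigenfunctions $\zeta(s)\in\mathcal B(Y)$, $\hat R(s)\zeta(s)=\lambda(s)\zeta(s)$, with $\int_Y\zeta(s)\,d\mu=1$. Given an eigenfamily, condition (A1)(iii) with exponent $\beta_+$ says that $$\Big|\int_Y(e^{-s\tau}-1)(\zeta(s)-1)\,d\mu\Big|=O(|s|^{\beta_+})\quad\text{for } s\in\overline{\mathbb H}\cap B_{\delta'}(0),\ \text{some }\delta'>0.$$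 **Theorem.** For all sufficiently small $\varepsilon>0$ an eigenfamily exists for some $\delta>0$, and every eigenfamily (for any $\delta>0$) has the following properties. 1. For all $\beta_-\in(0,\beta)$ and $p\in[1,\infty)$ there is $\delta'>0$ such that $|\zeta(s)-e^{-s\psi}|_{L^p(\mu)}=O(|s|^{\beta_-})$ for $s\in\overline{\mathbb H}\cap B_{\delta'}(0)$. 2. For every $\beta_+\in(\beta,2\beta)$, (A1)(iii) with exponent $\beta_+$ is equivalent to $\big|\int_Y(e^{-s\tau}-1)(e^{-s\psi}-1)\,d\mu\big|=O(|s|^{\beta_+})$ for $s\in\overline{\mathbb H}\cap B_{\delta'}(0)$, some $\delta'>0$. 3. Call $d_*>0$ admissible if there are $d>0$ with $\mu_Z(\sigma>n)=O(e^{-dn})$, $d_0>1/d$ and $M_1,M_2>0$ such that $\sigma<d_0\log\psi$ implies $\sigma<M_1\log\psi_*+M_2$ on $Y$, and $M_1\log n+M_2\le d_*\log n$ for all $n\ge2$. All sufficiently large $d_*$ are admissible. Let $d_*$ be admissible and assume that the density $d\mu_X/d\mu_Z$ is bounded below on $Z$, that is, $\mu_X(A)\ge c'\mu_Z(A)$ for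 some $c'>0$ and all measurable $A\subset Z$. Suppose that there are $C>0$ and $p,q\in(0,1)$ such that the sets $$X_q^+(n)=\{[\tau_0]\ge n\text{ and }\tau_0\circ f^j\ge n^{1-q}\text{ for some }1\le j<d_*\log n\},$$ $$X_q'(n)=\{[\tau_0]\ge n\text{ and }\tau_0\circ f^j\ge n^{1-q}\text{ for some }d_*\log n\le j<d_*\log(n+1)\}$$ satisfy $\mu_X(X_q^+(n))\le Cn^{-(\beta+p)}$ and $\mu_X(X_q'(n))\le Cn^{-(\beta+p)}$ for all $n\ge1$. Then (A1)(iii) holds for every exponent $\beta_+\in(\beta,\min\{1,\beta+p,\beta/(1-q)\})$. -/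

import Mathlib

open MeasureTheory Set
open scoped ENNReal

noncomputable section

/-- The induced map `G = f ^ σ : Z → Z` of an inducing time `σ` on `Z ⊆ X`. -/
def inducedMap {X : Type*} (f : X → X) (Z : Set X) (σ : Z → ℕ)
    (h : ∀ z : Z, f^[σ z] (z : X) ∈ Z) : Z → Z :=
  fun z => ⟨f^[σ z] (z : X), h z⟩

/-- `G ^ n z` and `G ^ n z'` lie in distinct elements of the partition `α`. -/
def SeparatedAt {Z : Type*} (G : Z → Z) (α : Set (Set Z)) (z z' : Z) (n : ℕ) : Prop :=
  ¬ ∃ a ∈ α, G^[n] z ∈ a ∧ G^[n] z' ∈ a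

open Classical in
/-- The symbolic metric `d_θ(z, z') = θ ^ s(z, z')`, where `s(z, z')` is the least `n ≥ 0` such that
`G ^ n z`, `G ^ n z'` lie in distinct elements of `α` (and `d_θ(z, z') = 0` if there is none). -/
def symbDist {Z : Type*} (G : Z → Z) (α : Set (Set Z)) (θ : ℝ) (z z' : Z) : ℝ :=
  if h : ∃ n, SeparatedAt G α z z' n then θ ^ Nat.find h else 0

/-- `G : Z → Z` is a full branch Gibbs-Markov map with respect to the at most countable measurable
partition `α` and the ergodic invariant probability measure `m`: `G` maps each partition element
bijectively and bimeasurably onto `Z`, the partition separates points, and the logarithm of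
`ξ = dm / d(m ∘ G)` satisfies `|log ξ(z) - log ξ(z')| ≤ C d_θ(Gz, Gz')` on partition elements. -/
structure IsFullBranchGibbsMarkov {Z : Type*} [MeasurableSpace Z] (G : Z → Z) (α : Set (Set Z))
    (m : Measure Z) (θ : ℝ) : Prop where
  countable : α.Countable
  partition : Setoid.IsPartition α
  measurableSet : ∀ a ∈ α, MeasurableSet a
  pos : ∀ a ∈ α, m a ≠ 0
  isProbability : IsProbabilityMeasure m
  ergodic : Ergodic G m
  bijOn : ∀ a ∈ α, BijOn G a univ
  measurableSet_image : ∀ a ∈ α, ∀ A ⊆ a, MeasurableSet A → MeasurableSet (G '' A)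
  separates : ∀ z z' : Z, z ≠ z' → ∃ n, SeparatedAt G α z z' n
  distortion : ∃ ξ : Z → ℝ, Measurable ξ ∧ (∀ z, 0 < ξ z) ∧
    (∀ a ∈ α, ∀ A ⊆ a, MeasurableSet A →
      m (G '' A) = ∫⁻ z in A, ENNReal.ofReal (ξ z)⁻¹ ∂m) ∧
    ∃ C : ℝ, ∀ a ∈ α, ∀ z ∈ a, ∀ z' ∈ a,
      |Real.log (ξ z) - Real.log (ξ z')| ≤ C * symbDist G α θ (G z) (G z')

/-- A measurable map `f : X → X` modelled by a one-sided Young tower with exponential tails: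
a set `Z ⊆ X` with a (not necessarily first) return time `σ : Z → {1, 2, …}`, such that
`G = f ^ σ : Z → Z` is full branch Gibbs-Markov, `σ` is constant on partition elements and
`μ_Z(σ > n) = O(e ^ (-d n))` for some `d > 0`. -/
structure YoungTower (X : Type*) [MeasurableSpace X] (θ₀ : ℝ) where
  f : X → X
  measurable_f : Measurable f
  Z : Set X
  measurableSet_Z : MeasurableSet Z
  σ : Z → ℕ
  measurable_σ : Measurable σ
  σ_pos : ∀ z, 0 < σ z
  return_mem : ∀ z : Z, f^[σ z] (z : X) ∈ Z
  α : Set (Set Z)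
  μZ : Measure Z
  gibbsMarkov : IsFullBranchGibbsMarkov (inducedMap f Z σ return_mem) α μZ θ₀
  σ_const : ∀ a ∈ α, ∀ z ∈ a, ∀ z' ∈ a, σ z = σ z'
  exp_tail : ∃ d > 0, ∃ C : ℝ, ∀ n : ℕ, μZ.real {z | n < σ z} ≤ C * Real.exp (-d * n)

namespace YoungTower

variable {X : Type*} [MeasurableSpace X] {θ₀ : ℝ} (T : YoungTower X θ₀)

/-- The induced map `G = f ^ σ`. -/
def G : T.Z → T.Z := inducedMap T.f T.Z T.σ T.return_mem

/-- The tower `Y = {(z, ℓ) : 0 ≤ ℓ ≤ σ(z) - 1}`. -/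
abbrev Y : Type _ := {y : T.Z × ℕ // y.2 < T.σ y.1}

/-- The tower map. -/
def F (y : T.Y) : T.Y :=
  if h : y.1.2 + 1 < T.σ y.1.1 then ⟨(y.1.1, y.1.2 + 1), h⟩
  else ⟨(T.G y.1.1, 0), T.σ_pos _⟩

/-- The probability measure `μ = (μ_Z × counting) / σ̄`, `σ̄ = ∫ σ dμ_Z`, on the tower. -/
def μ : Measure T.Y :=
  (∫⁻ z, (T.σ z : ℝ≥0∞) ∂T.μZ)⁻¹ •
    (T.μZ.prod (Measure.count : Measure ℕ)).comap (Subtype.val : T.Y → T.Z × ℕ)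

/-- The semiconjugacy `π_Y(z, ℓ) = f ^ ℓ z`. -/
def proj (y : T.Y) : X := T.f^[y.1.2] (y.1.1 : X)

/-- `μ_X = (π_Y)_* μ`. -/
def μX : Measure X := T.μ.map T.proj

variable (τ₀ : X → ℝ)

/-- The lifted roof function `τ = τ₀ ∘ π_Y`. -/
def τ (y : T.Y) : ℝ := τ₀ (T.proj y)

/-- The Birkhoff sum `τ_ℓ = ∑_{j < ℓ} τ₀ ∘ f ^ j` on `Z`. -/
def birk (ℓ : ℕ) (z : T.Z) : ℝ := ∑ j ∈ Finset.range ℓ, τ₀ (T.f^[j] (z : X))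

/-- The induced roof function `φ = τ_σ`. -/
def φ (z : T.Z) : ℝ := T.birk τ₀ (T.σ z) z

/-- `ψ(z, ℓ) = τ_ℓ(z)`. -/
def ψ (y : T.Y) : ℝ := T.birk τ₀ y.1.2 y.1.1

/-- `ψ_*(z, ℓ) = max_{0 ≤ j ≤ ℓ - 1} τ₀(f ^ j z)` (and `0` for `ℓ = 0`). -/
def ψStar (y : T.Y) : ℝ := ⨆ j : Fin y.1.2, τ₀ (T.f^[(j : ℕ)] (y.1.1 : X))

/-- The standing assumptions on the roof function: it is positive and measurable, with essential
infimum greater than `1`; `μ_X(τ₀ > t) = c t ^ (-β) + O(t ^ (-κ))`; and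
`|τ_ℓ(z) - τ_ℓ(z')| ≤ C (inf_a φ) d_{θ₀}(z, z')` for `z, z' ∈ a`, `a ∈ α`, `ℓ ≤ σ(a)`. -/
structure IsRoof (β κ : ℝ) : Prop where
  measurable : Measurable τ₀
  pos : ∀ x, 0 < τ₀ x
  essInf : ∃ b > 1, ∀ᵐ x ∂T.μX, b ≤ τ₀ x
  tail : ∃ c > 0, ∃ K : ℝ, ∀ t : ℝ, 1 ≤ t →
    |T.μX.real {x | t < τ₀ x} - c * t ^ (-β)| ≤ K * t ^ (-κ)
  holder : ∃ C > 0, ∀ a ∈ T.α, ∀ z ∈ a, ∀ z' ∈ a, ∀ ℓ ≤ T.σ z,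
    |T.birk τ₀ ℓ z - T.birk τ₀ ℓ z'| ≤
      C * sInf (T.φ τ₀ '' a) * symbDist T.G T.α θ₀ z z'

/-- `‖v‖_{w,∞} = sup_ℓ e ^ (-ε ℓ) |1_{Y_ℓ} v|_∞`. -/
def weightedSup (ε : ℝ) (v : T.Y → ℂ) : ℝ≥0∞ :=
  ⨆ y : T.Y, ENNReal.ofReal (Real.exp (-ε * y.1.2) * ‖v y‖)

/-- `‖v‖_θ`: the supremum of `e ^ (-ε ℓ) φ(z) ^ (-β') |v(z, ℓ) - v(z', ℓ)| / d_θ(z, z')` over `ℓ`,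
over `a ∈ α` with `σ(a) > ℓ` and over `z ≠ z'` in `a`. -/
def weightedLip (β' θ ε : ℝ) (v : T.Y → ℂ) : ℝ≥0∞ :=
  ⨆ (y : T.Y) (y' : T.Y)
    (_ : y.1.2 = y'.1.2 ∧ y.1.1 ≠ y'.1.1 ∧ ∃ a ∈ T.α, y.1.1 ∈ a ∧ y'.1.1 ∈ a),
    ENNReal.ofReal (Real.exp (-ε * y.1.2) * T.φ τ₀ y.1.1 ^ (-β') * ‖v y - v y'‖ /
      symbDist T.G T.α θ y.1.1 y'.1.1)

/-- The function space `𝓑(Y)`: the functions with `max (‖v‖_{w,∞}) (‖v‖_θ) < ∞`. -/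
def spaceB (β' θ ε : ℝ) : Set (T.Y → ℂ) :=
  {v | max (T.weightedSup ε v) (T.weightedLip τ₀ β' θ ε v) < ∞}

/-- `u = R v` in `L¹(Y)`, where `R` is the transfer operator of `F`, characterized by
`∫ (R v) g dμ = ∫ v (g ∘ F) dμ` for all bounded measurable `g`. -/
def IsTransfer (v u : T.Y → ℂ) : Prop :=
  Integrable v T.μ ∧ Integrable u T.μ ∧
    ∀ g : T.Y → ℂ, Measurable g → (∃ C : ℝ, ∀ y, ‖g y‖ ≤ C) →
      ∫ y, u y * g y ∂T.μ = ∫ y, v y * g (T.F y) ∂T.μ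

/-- `u = R̂(s) v = R (e ^ (-s τ) v)` in `L¹(Y)`. -/
def IsTwistedTransfer (s : ℂ) (v u : T.Y → ℂ) : Prop :=
  T.IsTransfer (fun y => Complex.exp (-s * (T.τ τ₀ y : ℂ)) * v y) u

/-- `{Re s ≥ 0} ∩ B_δ(0)`. -/
def halfDisc (δ : ℝ) : Set ℂ := {s | 0 ≤ s.re ∧ ‖s‖ < δ}

/-- `lam(s)`, `s ∈ {Re s ≥ 0} ∩ B_δ(0)`, is a continuous family of simple eigenvalues of `R̂(s)` on
`𝓑(Y)` with `lam(0) = 1`, and `ζ(s) ∈ 𝓑(Y)` are the eigenfunctions normalized by `∫ ζ(s) dμ = 1`.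
Simplicity is algebraic: the kernel of `(R̂(s) - lam(s))²` in `𝓑(Y)` is spanned by `ζ(s)`. -/
structure IsEigenfamily (β' θ ε δ : ℝ) (lam : ℂ → ℂ) (ζ : ℂ → T.Y → ℂ) : Prop where
  continuousOn : ContinuousOn lam (halfDisc δ)
  lam_zero : lam 0 = 1
  mem : ∀ s ∈ halfDisc δ, ζ s ∈ T.spaceB τ₀ β' θ ε
  eigen : ∀ s ∈ halfDisc δ, T.IsTwistedTransfer τ₀ s (ζ s) (fun y => lam s * ζ s y)
  normalized : ∀ s ∈ halfDisc δ, Integrable (ζ s) T.μ ∧ ∫ y, ζ s y ∂T.μ = 1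
  simple : ∀ s ∈ halfDisc δ, ∀ v ∈ T.spaceB τ₀ β' θ ε, ∀ u : T.Y → ℂ,
    T.IsTwistedTransfer τ₀ s v (fun y => lam s * v y + u y) →
    T.IsTwistedTransfer τ₀ s u (fun y => lam s * u y) →
    ∃ k : ℂ, ∀ᵐ y ∂T.μ, v y = k * ζ s y

/-- The eigenfunction condition with exponent `βp` for the family `ζ(s)`:
`|∫ (e ^ (-s τ) - 1) (ζ(s) - 1) dμ| ≤ C |s| ^ βp` for `Re s ≥ 0`, `|s| < δ`. -/
def CondA1iii (ζ : ℂ → T.Y → ℂ) (βp : ℝ) : Prop :=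
  ∃ δ > 0, ∃ C : ℝ, ∀ s ∈ halfDisc δ,
    ‖∫ y, (Complex.exp (-s * (T.τ τ₀ y : ℂ)) - 1) * (ζ s y - 1) ∂T.μ‖ ≤ C * ‖s‖ ^ βp

/-- `|∫ (e ^ (-s τ) - 1) (e ^ (-s ψ) - 1) dμ| ≤ C |s| ^ βp` for `Re s ≥ 0`, `|s| < δ`. -/
def CondPsi (βp : ℝ) : Prop :=
  ∃ δ > 0, ∃ C : ℝ, ∀ s ∈ halfDisc δ,
    ‖∫ y, (Complex.exp (-s * (T.τ τ₀ y : ℂ)) - 1) *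
      (Complex.exp (-s * (T.ψ τ₀ y : ℂ)) - 1) ∂T.μ‖ ≤ C * ‖s‖ ^ βp

/-- The admissible constants `d_*`: for some exponential tail rate `d` of `σ`, some `d₀ > 1 / d`, and
some `M₁, M₂ > 0` such that `σ < d₀ log ψ` implies `σ < M₁ log ψ_* + M₂`, one has
`M₁ log n + M₂ ≤ d_* log n` for all `n ≥ 2`. -/
def IsAdmissible (dstar : ℝ) : Prop :=
  ∃ d > 0, (∃ C : ℝ, ∀ n : ℕ, T.μZ.real {z | n < T.σ z} ≤ C * Real.exp (-d * n)) ∧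
  ∃ d₀ > d⁻¹, ∃ M₁ > 0, ∃ M₂ > 0,
    (∀ y : T.Y, (T.σ y.1.1 : ℝ) < d₀ * Real.log (T.ψ τ₀ y) →
      (T.σ y.1.1 : ℝ) < M₁ * Real.log (T.ψStar τ₀ y) + M₂) ∧
    ∀ n : ℕ, 2 ≤ n → M₁ * Real.log n + M₂ ≤ dstar * Real.log n

/-- `X_q⁺(n) = {[τ₀] ≥ n and τ₀ ∘ f ^ j ≥ n ^ (1 - q) for some 1 ≤ j < d_* log n}`. -/
def XPlus (dstar q : ℝ) (n : ℕ) : Set X :=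
  {x | n ≤ ⌊τ₀ x⌋₊ ∧ ∃ j : ℕ, 1 ≤ j ∧ (j : ℝ) < dstar * Real.log n ∧
    (n : ℝ) ^ (1 - q) ≤ τ₀ (T.f^[j] x)}

/-- `X_q'(n) = {[τ₀] ≥ n and τ₀ ∘ f ^ j ≥ n ^ (1 - q) for some d_* log n ≤ j < d_* log (n + 1)}`. -/
def XPrime (dstar q : ℝ) (n : ℕ) : Set X :=
  {x | n ≤ ⌊τ₀ x⌋₊ ∧ ∃ j : ℕ, dstar * Real.log n ≤ (j : ℝ) ∧
    (j : ℝ) < dstar * Real.log ((n : ℝ) + 1) ∧ (n : ℝ) ^ (1 - q) ≤ τ₀ (T.f^[j] x)}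

end YoungTower

end

/-! Put x = 1/λ. Along a column of the tower the equation for an eigenfunction of `R̂(s)` with
eigenvalue λ is a recursion, so ζ(z, ℓ) = x^ℓ e^{-sψ(z, ℓ)} w(z). Closing it up at the base says
that w is fixed by L(s, x) w = R_Z(x^σ e^{-sφ} w), where R_Z is the transfer operator of G. The
problem thus moves to bounded Lipschitz functions on Z. The weights in `𝓑(Y)` disappear there,
because R_Z averages over all branches against their measures.

On that space R_Z satisfies a Doeblin estimate: subtracting η ∫ w preserves a cone of log-Lipschitz
functions and multiplies the mass by 1 - η (`exists_cone_transferOp_sub_rankOne`). Hence A(0, 1) = 1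
- R_Z + ηP is invertible, where P w = ∫ w. For every γ < β the moments of (1 + φ^γ) e^{eσ} with
small e are finite, so L(s, x) is Hölder in (s, x) and A(s, x) = 1 - L(s, x) + ηP stays invertible
near (0, 1). Put W = A⁻¹ 1. Every fixed point of L(s, x) is a multiple of W (`eq_smul_baseFn`), and
W is itself fixed as soon as x J + (x - 1) N = 0, where N and J are the integrals over the tower of
x^ℓ e^{-sψ} W and of its product with e^{-sτ} - 1. A contraction solves this scalar equation for
x(s) (`exists_implicit_function`). A Jordan block is excluded by integrating the generalized
eigenvalue equation (`Regime.simple`).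

Closeness to e^{-sψ} holds because W(0, 1) is the constant 1/η and W(s, x) differs from it by
O(|s|^γ + |x - 1|), while λ - 1 = ∫ (e^{-sτ} - 1) ζ = O(|s|^γ). Together they give |ζ - e^{-sψ}| =
O(|s|^γ e^{eσ/2}) pointwise, with e as small as desired, hence the bound in every L^p. Replacing ζ
by e^{-sψ} in (A1)(iii) gains one factor |s|^γ from this difference and another from e^{-sτ} - 1.
For γ close to β the product is O(|s|^{β_+}), which is the equivalence.

For the sufficient condition the product (e^{-sτ} - 1)(e^{-sψ} - 1) is bounded pointwise by the
trichotomy `IsRoof.ψ_cases`. Either ψ is at most a constant times e^{σ/d₀}, or τ is at most φ^{1-q},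
or the column contains a long excursion followed within logarithmic time by another one. The first
two cases have finite moments of the required order. The third is controlled by the measures of
X_q⁺(n) and X_q'(n), once the observable is averaged along the column. -/

noncomputable section

/-! ### The symbolic metric. -/

section SymbDist

variable {Z : Type*} {G : Z → Z} {α : Set (Set Z)}

theorem symbDist_nonneg {θ : ℝ} (hθ : 0 ≤ θ) (z z' : Z) : 0 ≤ symbDist G α θ z z' := by
  unfold symbDist
  split_ifs <;> positivity

theorem symbDist_le_one {θ : ℝ} (hθ : 0 ≤ θ) (hθ' : θ ≤ 1) (z z' : Z) :
    symbDist G α θ z z' ≤ 1 := by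
  unfold symbDist
  split_ifs
  · exact pow_le_one₀ hθ hθ'
  · exact zero_le_one

theorem symbDist_mono {θ θ' : ℝ} (hθ : 0 ≤ θ) (h : θ ≤ θ') (z z' : Z) :
    symbDist G α θ z z' ≤ symbDist G α θ' z z' := by
  unfold symbDist
  split_ifs
  · gcongr
  · exact le_rfl

/-- The roof is Hölder for the base θ₀, while e^{-sφ} is estimated through γ-th powers of its
increments. Replacing the base θ₀ by θ₀^γ turns these powers back into Lipschitz bounds. -/
theorem symbDist_rpow {θ γ : ℝ} (hθ : 0 ≤ θ) (hγ : 0 < γ) (z z' : Z) :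
    symbDist G α θ z z' ^ γ = symbDist G α (θ ^ γ) z z' := by
  unfold symbDist
  split_ifs
  · rw [← Real.rpow_natCast, ← Real.rpow_mul hθ, mul_comm, Real.rpow_mul hθ, Real.rpow_natCast]
  · exact Real.zero_rpow hγ.ne'

theorem not_separatedAt_zero {a : Set Z} (ha : a ∈ α) {z z' : Z} (hz : z ∈ a) (hz' : z' ∈ a) :
    ¬ SeparatedAt G α z z' 0 :=
  not_not.2 ⟨a, ha, hz, hz'⟩

/-- Time 0 does not separate points of one partition element, so the separation time drops by
exactly one under G. Inverse branches therefore contract by θ. -/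
theorem symbDist_of_mem {θ : ℝ} {a : Set Z} (ha : a ∈ α) {z z' : Z} (hz : z ∈ a) (hz' : z' ∈ a) :
    symbDist G α θ z z' = θ * symbDist G α θ (G z) (G z') := by
  have h0 := not_separatedAt_zero (G := G) ha hz hz'
  by_cases h : ∃ n, SeparatedAt G α z z' n
  · have h' : ∃ n, SeparatedAt G α (G z) (G z') n := by
      obtain ⟨n, hn⟩ := h
      cases n with
      | zero => exact absurd hn h0
      | succ n => exact ⟨n, hn⟩
    have h'' : ∃ n, SeparatedAt G α z z' (n + 1) := h'
    classical
    have key : Nat.find h = Nat.find h' + 1 := Nat.find_comp_succ h h'' h0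
    unfold symbDist
    rw [dif_pos h, dif_pos h', ← pow_succ']
    convert! congrArg (fun n => θ ^ n) key
  · have h' : ¬ ∃ n, SeparatedAt G α (G z) (G z') n := fun ⟨n, hn⟩ => h ⟨n + 1, hn⟩
    simp [symbDist, h, h']

theorem symbDist_self (hα : Setoid.IsPartition α) (θ : ℝ) (z : Z) : symbDist G α θ z z = 0 := by
  have h : ¬ ∃ n, SeparatedAt G α z z n := by
    rintro ⟨n, hn⟩
    obtain ⟨a, ⟨ha, hz⟩, -⟩ := hα.2 (G^[n] z)
    exact hn ⟨a, ha, hz, hz⟩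
  simp [symbDist, h]

theorem symbDist_comm (θ : ℝ) (z z' : Z) : symbDist G α θ z z' = symbDist G α θ z' z := by
  have : SeparatedAt G α z z' = SeparatedAt G α z' z := funext fun n => by
    simp only [SeparatedAt, and_comm]
  unfold symbDist
  rw [this]

end SymbDist

/-! ### Inverse branches, distortion, and measurability of Lipschitz functions. -/

namespace IsFullBranchGibbsMarkov

variable {Z : Type*} [MeasurableSpace Z] {G : Z → Z} {α : Set (Set Z)} {m : Measure Z} {θ₀ : ℝ}
  (h : IsFullBranchGibbsMarkov G α m θ₀)

include h in
theorem symbDist_pos {θ : ℝ} (hθ : 0 < θ) {z z' : Z} (hz : z ≠ z') : 0 < symbDist G α θ z z' := by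
  unfold symbDist
  rw [dif_pos (h.separates z z' hz)]
  positivity

include h in
theorem measurable_map : Measurable G := h.ergodic.measurable

include h in
theorem exists_mem (z : Z) : ∃ a : α, z ∈ a.1 := by
  obtain ⟨a, ⟨ha, hz⟩, -⟩ := h.partition.2 z
  exact ⟨⟨a, ha⟩, hz⟩

include h in
theorem eq_of_mem {a b : α} {z : Z} (ha : z ∈ a.1) (hb : z ∈ b.1) : a = b :=
  Subtype.ext ((h.partition.2 z).unique ⟨a.2, ha⟩ ⟨b.2, hb⟩)

/-- The inverse branch of `G` with values in the partition element `a`. -/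
def branch (a : α) (z : Z) : Z := ((h.bijOn a a.2).surjOn (mem_univ z)).choose

theorem branch_mem (a : α) (z : Z) : h.branch a z ∈ a.1 :=
  ((h.bijOn a a.2).surjOn (mem_univ z)).choose_spec.1

theorem map_branch (a : α) (z : Z) : G (h.branch a z) = z :=
  ((h.bijOn a a.2).surjOn (mem_univ z)).choose_spec.2

theorem branch_map {a : α} {z : Z} (hz : z ∈ a.1) : h.branch a (G z) = z :=
  (h.bijOn a a.2).injOn (h.branch_mem a _) hz (h.map_branch a _)

theorem symbDist_branch (θ : ℝ) (a : α) (z z' : Z) :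
    symbDist G α θ (h.branch a z) (h.branch a z') = θ * symbDist G α θ z z' := by
  rw [symbDist_of_mem a.2 (h.branch_mem a z) (h.branch_mem a z'), h.map_branch, h.map_branch]

theorem preimage_branch (a : α) (A : Set Z) : h.branch a ⁻¹' A = G '' (A ∩ a.1) := by
  ext z
  constructor
  · intro hz
    exact ⟨h.branch a z, ⟨hz, h.branch_mem a z⟩, h.map_branch a z⟩
  · rintro ⟨y, ⟨hy, hya⟩, rfl⟩
    rwa [mem_preimage, h.branch_map hya]

theorem measurable_branch (a : α) : Measurable (h.branch a) := fun A hA => by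
  rw [h.preimage_branch]
  exact h.measurableSet_image a a.2 _ inter_subset_right (hA.inter (h.measurableSet a a.2))

/-- The density `ξ = dm / d(m ∘ G)`. -/
def xi : Z → ℝ := h.distortion.choose

theorem measurable_xi : Measurable h.xi := h.distortion.choose_spec.1

theorem xi_pos (z : Z) : 0 < h.xi z := h.distortion.choose_spec.2.1 z

theorem measure_image {a : Set Z} (ha : a ∈ α) {A : Set Z} (hA : A ⊆ a) (hm : MeasurableSet A) :
    m (G '' A) = ∫⁻ z in A, ENNReal.ofReal (h.xi z)⁻¹ ∂m :=
  h.distortion.choose_spec.2.2.1 a ha A hA hm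

/-- A nonnegative distortion constant. -/
def distConst : ℝ := max h.distortion.choose_spec.2.2.2.choose 0

theorem distConst_nonneg : 0 ≤ h.distConst := le_max_right _ _

/-- The distortion bound involves the distance of the images under G, and on an inverse branch these
are z and z' themselves. Passing from θ₀ to a larger θ only enlarges the distance. -/
theorem xi_branch_le_exp {θ : ℝ} (hθ₀ : 0 ≤ θ₀) (hθ : θ₀ ≤ θ) (a : α) (z z' : Z) :
    h.xi (h.branch a z) ≤
      Real.exp (h.distConst * symbDist G α θ z z') * h.xi (h.branch a z') := by
  have hd := h.distortion.choose_spec.2.2.2.choose_spec a a.2 _ (h.branch_mem a z) _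
    (h.branch_mem a z')
  rw [h.map_branch, h.map_branch] at hd
  have h1 : Real.log (h.xi (h.branch a z)) - Real.log (h.xi (h.branch a z')) ≤
      h.distConst * symbDist G α θ z z' := by
    refine (le_abs_self _).trans (hd.trans ?_)
    exact mul_le_mul (le_max_left _ _) (symbDist_mono hθ₀ hθ z z') (symbDist_nonneg hθ₀ _ _)
      h.distConst_nonneg
  have h2 := Real.exp_le_exp.2 (sub_le_iff_le_add.1 h1)
  rwa [Real.exp_add, Real.exp_log (h.xi_pos _), Real.exp_log (h.xi_pos _)] at h2

/-- The preimage of A under the branch is G(A ∩ a), whose measure is the integral of 1/ξ over A ∩ a.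
This change of variables underlies the duality of the transfer operator. -/
theorem map_branch_measure (a : α) :
    m.map (h.branch a) = (m.restrict a.1).withDensity (fun z => ENNReal.ofReal (h.xi z)⁻¹) := by
  ext A hA
  rw [Measure.map_apply (h.measurable_branch a) hA, h.preimage_branch, withDensity_apply _ hA,
    Measure.restrict_restrict hA]
  exact h.measure_image a.2 inter_subset_right (hA.inter (h.measurableSet a a.2))

theorem lintegral_branch (a : α) {f : Z → ℝ≥0∞} (hf : Measurable f) :
    ∫⁻ z, ENNReal.ofReal (h.xi (h.branch a z)) * f (h.branch a z) ∂m = ∫⁻ z in a.1, f z ∂m := by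
  have hx : Measurable fun z => ENNReal.ofReal (h.xi z) := h.measurable_xi.ennreal_ofReal
  have hx' : Measurable fun z => ENNReal.ofReal (h.xi z)⁻¹ := h.measurable_xi.inv.ennreal_ofReal
  rw [← lintegral_map (f := fun z => ENNReal.ofReal (h.xi z) * f z) (hx.mul hf)
    (h.measurable_branch a), h.map_branch_measure,
    lintegral_withDensity_eq_lintegral_mul _ hx'
      (g := fun z => ENNReal.ofReal (h.xi z) * f z) (hx.mul hf)]
  refine lintegral_congr fun z => ?_
  simp only [Pi.mul_apply]
  rw [← mul_assoc, ← ENNReal.ofReal_mul (inv_nonneg.2 (h.xi_pos z).le),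
    inv_mul_cancel₀ (h.xi_pos z).ne', ENNReal.ofReal_one, one_mul]

theorem integral_branch (a : α) {v : Z → ℂ} (hv : Measurable v) :
    ∫ z, (h.xi (h.branch a z) : ℂ) * v (h.branch a z) ∂m = ∫ z in a.1, v z ∂m := by
  have hx : Measurable fun z => (h.xi z : ℂ) := Complex.measurable_ofReal.comp h.measurable_xi
  rw [← integral_map (f := fun z => (h.xi z : ℂ) * v z) (h.measurable_branch a).aemeasurable
    (hx.mul hv).aestronglyMeasurable, h.map_branch_measure,
    integral_withDensity_eq_integral_toReal_smul
      (f := fun z => ENNReal.ofReal (h.xi z)⁻¹) h.measurable_xi.inv.ennreal_ofReal (by simp)]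
  refine integral_congr_ae (Filter.Eventually.of_forall fun z => ?_)
  have := (h.xi_pos z).ne'
  simp only [ENNReal.toReal_ofReal (inv_nonneg.2 (h.xi_pos z).le), Complex.real_smul,
    Complex.ofReal_inv]
  rw [← mul_assoc, inv_mul_cancel₀ (Complex.ofReal_ne_zero.2 this), one_mul]

theorem lintegral_xi_branch (a : α) :
    ∫⁻ z, ENNReal.ofReal (h.xi (h.branch a z)) ∂m = m a.1 := by
  simpa using h.lintegral_branch a (f := fun _ => 1) measurable_const

/-- The values of ξ on a differ by a factor of at most e^C, and the mean of ξ along the branch is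
m(a). Comparing one value with the mean gives the bound. -/
theorem xi_branch_le (hθ₀ : θ₀ ∈ Ioo (0 : ℝ) 1) (a : α) (z : Z) :
    h.xi (h.branch a z) ≤ Real.exp h.distConst * m.real a.1 := by
  have := h.isProbability
  have h1 : ∀ z', h.xi (h.branch a z) ≤ Real.exp h.distConst * h.xi (h.branch a z') := fun z' =>
    (h.xi_branch_le_exp hθ₀.1.le le_rfl a z z').trans (mul_le_mul_of_nonneg_right
      (Real.exp_le_exp.2 (mul_le_of_le_one_right h.distConst_nonneg
        (symbDist_le_one hθ₀.1.le hθ₀.2.le _ _))) (h.xi_pos _).le)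
  have h2 : ENNReal.ofReal (h.xi (h.branch a z)) ≤
      ENNReal.ofReal (Real.exp h.distConst) * m a.1 := by
    rw [← h.lintegral_xi_branch a, ← lintegral_const_mul' _ _
      ENNReal.ofReal_ne_top]
    calc ENNReal.ofReal (h.xi (h.branch a z)) = ∫⁻ _, ENNReal.ofReal (h.xi (h.branch a z)) ∂m := by
          simp
      _ ≤ _ := lintegral_mono fun z' => by
          rw [← ENNReal.ofReal_mul (Real.exp_pos _).le]
          exact ENNReal.ofReal_le_ofReal (h1 z')
  rw [← ofReal_measureReal, ← ENNReal.ofReal_mul (Real.exp_pos _).le] at h2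
  exact (ENNReal.ofReal_le_ofReal_iff (by positivity)).1 h2

theorem abs_xi_branch_sub_le (hθ₀ : θ₀ ∈ Ioo (0 : ℝ) 1) {θ : ℝ} (hθ : θ₀ ≤ θ) (hθ' : θ ≤ 1)
    (a : α) (z z' : Z) :
    |h.xi (h.branch a z) - h.xi (h.branch a z')| ≤
      h.distConst * Real.exp (2 * h.distConst) * m.real a.1 * symbDist G α θ z z' := by
  have key : ∀ z z', h.xi (h.branch a z) - h.xi (h.branch a z') ≤
      h.distConst * Real.exp (2 * h.distConst) * m.real a.1 * symbDist G α θ z z' := by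
    intro z z'
    set d := symbDist G α θ z z'
    have hd0 : 0 ≤ d := symbDist_nonneg (hθ₀.1.le.trans hθ) z z'
    have hd1 : d ≤ 1 := symbDist_le_one (hθ₀.1.le.trans hθ) hθ' z z'
    have hC := h.distConst_nonneg
    have e1 : Real.exp (h.distConst * d) - 1 ≤ h.distConst * d * Real.exp h.distConst := by
      have h1 := Real.add_one_le_exp (-(h.distConst * d))
      have h2 : Real.exp (h.distConst * d) ≤ Real.exp h.distConst :=
        Real.exp_le_exp.2 (mul_le_of_le_one_right hC hd1)
      have h3 : Real.exp (h.distConst * d) * Real.exp (-(h.distConst * d)) = 1 := by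
        rw [← Real.exp_add]; simp
      have h4 : 0 ≤ h.distConst * d := by positivity
      nlinarith [Real.exp_pos (h.distConst * d)]
    calc h.xi (h.branch a z) - h.xi (h.branch a z')
        ≤ (Real.exp (h.distConst * d) - 1) * h.xi (h.branch a z') := by
          have := h.xi_branch_le_exp hθ₀.1.le hθ a z z'
          linarith
      _ ≤ (h.distConst * d * Real.exp h.distConst) * (Real.exp h.distConst * m.real a.1) :=
          mul_le_mul e1 (h.xi_branch_le hθ₀ a z') (h.xi_pos _).le (by positivity)
      _ = _ := by rw [two_mul, Real.exp_add]; ring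
  refine abs_sub_le_iff.2 ⟨key z z', ?_⟩
  rw [symbDist_comm]
  exact key z' z

include h in
theorem iUnion_eq_univ : ⋃ a : α, a.1 = univ :=
  eq_univ_of_forall fun z => mem_iUnion.2 (h.exists_mem z)

include h in
theorem pairwise_disjoint : Pairwise (Function.onFun Disjoint fun a : α => a.1) :=
  fun _ _ hab => disjoint_left.2 fun _ hz hz' => hab (h.eq_of_mem hz hz')

include h in
theorem hasSum_measureReal : HasSum (fun a : α => m.real a.1) 1 := by
  have := h.isProbability
  have := h.countable.to_subtype
  have h1 : ∑' a : α, m a.1 = 1 := by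
    rw [← measure_iUnion h.pairwise_disjoint (fun a => h.measurableSet a a.2), h.iUnion_eq_univ,
      measure_univ]
  have h2 : Summable fun a : α => m.real a.1 := ENNReal.summable_toReal (by rw [h1]; simp)
  have h3 : ∑' a : α, m.real a.1 = 1 := by
    have := ENNReal.tsum_toReal_eq (f := fun a : α => m a.1) (fun a => measure_ne_top m a.1)
    rw [h1] at this
    simpa [Measure.real] using this.symm
  exact h3 ▸ h2.hasSum

/-- Null sets pull back to null sets under inverse branches. -/
theorem measure_preimage_branch_eq_zero (a : α) {N : Set Z} (hN : m N = 0) :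
    m (h.branch a ⁻¹' N) = 0 := by
  refine measure_mono_null (preimage_mono (subset_toMeasurable m N)) ?_
  rw [← Measure.map_apply (h.measurable_branch a) (measurableSet_toMeasurable m N),
    h.map_branch_measure, withDensity_apply _ (measurableSet_toMeasurable m N),
    Measure.restrict_restrict (measurableSet_toMeasurable m N)]
  exact setLIntegral_measure_zero _ _ (measure_mono_null inter_subset_left
    ((measure_toMeasurable N).trans hN))

theorem ae_branch {p : Z → Prop} (hp : ∀ᵐ z ∂m, p z) : ∀ᵐ z ∂m, ∀ a : α, p (h.branch a z) := by
  have := h.countable.to_subtype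
  exact ae_all_iff.2 fun a => h.measure_preimage_branch_eq_zero a hp

include h in
/-- The complement of a null set is dense for the symbolic metric. -/
theorem exists_symbDist_le {θ : ℝ} (hθ : 0 ≤ θ) (hθ' : θ ≤ 1) (n : ℕ) :
    ∀ {p : Z → Prop}, (∀ᵐ z ∂m, p z) → ∀ z, ∃ z', p z' ∧ symbDist G α θ z z' ≤ θ ^ n := by
  have := h.isProbability
  induction n with
  | zero =>
    intro p hp z
    obtain ⟨z', hz'⟩ := hp.exists
    exact ⟨z', hz', by simpa using symbDist_le_one hθ hθ' z z'⟩
  | succ n ih =>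
    intro p hp z
    obtain ⟨a, ha⟩ := h.exists_mem z
    -- Almost every point has all its inverse images in the good set. A point with this property
    -- close to G z is pulled back into the element of z, which gains one factor θ.
    obtain ⟨y, hy, hd⟩ := ih (h.ae_branch hp) (G z)
    refine ⟨h.branch a y, hy a, ?_⟩
    conv_lhs => rw [← h.branch_map ha]
    rw [h.symbDist_branch, pow_succ']
    exact mul_le_mul_of_nonneg_left hd hθ

include h in
/-- Lipschitz functions that agree almost everywhere are equal. -/
theorem eq_of_ae_eq {θ : ℝ} (hθ : θ ∈ Ioo (0 : ℝ) 1) {w w' : Z → ℂ} {K : ℝ}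
    (hw : ∀ z z', ‖w z - w z'‖ ≤ K * symbDist G α θ z z')
    (hw' : ∀ z z', ‖w' z - w' z'‖ ≤ K * symbDist G α θ z z') (he : w =ᵐ[m] w') : w = w' := by
  funext z
  have hz : symbDist G α θ z z = 0 := symbDist_self h.partition θ z
  have key : ∀ n : ℕ, ‖w z - w' z‖ ≤ 2 * |K| * θ ^ n := by
    intro n
    obtain ⟨y, hy, hd⟩ := h.exists_symbDist_le hθ.1.le hθ.2.le n he z
    have h0 := symbDist_nonneg (G := G) (α := α) hθ.1.le z y
    have h1 : K * symbDist G α θ z y ≤ |K| * θ ^ n :=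
      (mul_le_mul_of_nonneg_right (le_abs_self K) h0).trans
        (mul_le_mul_of_nonneg_left hd (abs_nonneg K))
    calc ‖w z - w' z‖ = ‖(w z - w y) - (w' z - w' y)‖ := by rw [hy]; ring_nf
      _ ≤ ‖w z - w y‖ + ‖w' z - w' y‖ := norm_sub_le _ _
      _ ≤ _ := by linarith [hw z y, hw' z y]
  have hlim : Filter.Tendsto (fun n : ℕ => 2 * |K| * θ ^ n) Filter.atTop (nhds 0) := by
    simpa using (tendsto_pow_atTop_nhds_zero_of_lt_one hθ.1.le hθ.2).const_mul (2 * |K|)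
  have := ge_of_tendsto' hlim key
  exact sub_eq_zero.1 (norm_le_zero_iff.1 this)

/-- A function glued from measurable functions on partition elements is measurable. -/
theorem measurable_of_comp_branch {E : Type*} [MeasurableSpace E] {v : Z → E}
    (hv : ∀ a : α, Measurable fun z => v (h.branch a z)) : Measurable v := by
  have := h.countable.to_subtype
  intro A hA
  have : v ⁻¹' A = ⋃ a : α, a.1 ∩ G ⁻¹' ((fun z => v (h.branch a z)) ⁻¹' A) := by
    ext z
    simp only [mem_preimage, mem_iUnion, mem_inter_iff]
    constructor
    · intro hz
      obtain ⟨a, ha⟩ := h.exists_mem z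
      exact ⟨a, ha, by rwa [h.branch_map ha]⟩
    · rintro ⟨a, ha, hz⟩
      rwa [h.branch_map ha] at hz
  rw [this]
  exact MeasurableSet.iUnion fun a => (h.measurableSet a a.2).inter (h.measurable_map (hv a hA))

-- The approximant is constant on cylinders of length n: on each element the induction applies to w
-- composed with the branch, whose Lipschitz constant is Kθ. Neither Lipschitz functions nor
-- elements of `𝓑(Y)` come with measurability, so it has to be derived.
include h in
theorem exists_measurable_approx {θ : ℝ} (hθ : 0 ≤ θ) (hθ' : θ ≤ 1) (n : ℕ) :
    ∀ {w : Z → ℂ} {K : ℝ}, 0 ≤ K → (∀ z z', ‖w z - w z'‖ ≤ K * symbDist G α θ z z') →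
      ∃ u : Z → ℂ, Measurable u ∧ ∀ z, ‖u z - w z‖ ≤ K * θ ^ n := by
  have := h.isProbability
  induction n with
  | zero =>
    intro w K hK hw
    obtain ⟨z₀⟩ : Nonempty Z := m.nonempty_of_neZero
    refine ⟨fun _ => w z₀, measurable_const, fun z => (hw z₀ z).trans ?_⟩
    simpa using mul_le_mul_of_nonneg_left (symbDist_le_one hθ hθ' z₀ z) hK
  | succ n ih =>
    intro w K hK hw
    have h1 : ∀ a : α, ∃ u : Z → ℂ, Measurable u ∧
        ∀ z, ‖u z - w (h.branch a z)‖ ≤ K * θ * θ ^ n := fun a =>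
      ih (mul_nonneg hK hθ) fun z z' => by
        have := hw (h.branch a z) (h.branch a z')
        rwa [h.symbDist_branch, ← mul_assoc] at this
    choose u hu hub using h1
    choose i hi using h.exists_mem
    refine ⟨fun z => u (i z) (G z), h.measurable_of_comp_branch fun a => ?_, fun z => ?_⟩
    · have : ∀ z, i (h.branch a z) = a := fun z => h.eq_of_mem (hi _) (h.branch_mem a z)
      simpa [this, h.map_branch] using hu a
    · have := hub (i z) (G z)
      rw [h.branch_map (hi z)] at this
      rwa [pow_succ', ← mul_assoc]

include h in
/-- Lipschitz functions are measurable. -/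
theorem measurable_of_lipschitz {θ : ℝ} (hθ : θ ∈ Ioo (0 : ℝ) 1) {w : Z → ℂ} {K : ℝ}
    (hw : ∀ z z', ‖w z - w z'‖ ≤ K * symbDist G α θ z z') : Measurable w := by
  have hw' : ∀ z z', ‖w z - w z'‖ ≤ |K| * symbDist G α θ z z' := fun z z' =>
    (hw z z').trans (mul_le_mul_of_nonneg_right (le_abs_self K) (symbDist_nonneg hθ.1.le _ _))
  choose u hu hub using fun n =>
    h.exists_measurable_approx hθ.1.le hθ.2.le n (abs_nonneg K) hw'
  refine measurable_of_tendsto_metrizable hu (tendsto_pi_nhds.2 fun z => ?_)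
  rw [tendsto_iff_norm_sub_tendsto_zero]
  refine squeeze_zero (fun _ => norm_nonneg _) (fun n => hub n z) ?_
  simpa using (tendsto_pow_atTop_nhds_zero_of_lt_one hθ.1.le hθ.2).const_mul |K|

/-- The transfer operator of `G`, as an operator on functions. -/
def transfer (v : Z → ℂ) (z : Z) : ℂ := ∑' a : α, (h.xi (h.branch a z) : ℂ) * v (h.branch a z)

/-- `v` is bounded by `V a` and `V a`-Lipschitz (after composing with the inverse branch) on each
partition element `a`, and `V` is summable against the measure. -/
structure BranchBound (θ : ℝ) (v : Z → ℂ) (V : α → ℝ) : Prop where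
  bound : ∀ a z, ‖v (h.branch a z)‖ ≤ V a
  lip : ∀ a z z', ‖v (h.branch a z) - v (h.branch a z')‖ ≤ V a * symbDist G α θ z z'
  summable : Summable fun a : α => V a * m.real a.1

end IsFullBranchGibbsMarkov
end

/-! ### The transfer operator of the induced map. -/

noncomputable section
namespace IsFullBranchGibbsMarkov

variable {Z : Type*} [MeasurableSpace Z] {G : Z → Z} {α : Set (Set Z)} {m : Measure Z} {θ₀ : ℝ}
  {h : IsFullBranchGibbsMarkov G α m θ₀} {θ : ℝ} {v v' : Z → ℂ} {V V' : α → ℝ}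

variable (h) in
/-- The constant in the norm bound for the transfer operator. -/
def transferConst : ℝ := h.distConst * Real.exp (2 * h.distConst) + Real.exp h.distConst

variable (h) in
theorem transferConst_pos : 0 < h.transferConst :=
  add_pos_of_nonneg_of_pos (mul_nonneg h.distConst_nonneg (Real.exp_pos _).le) (Real.exp_pos _)

theorem BranchBound.nonneg (hv : h.BranchBound θ v V) (a : α) : 0 ≤ V a := by
  have := h.isProbability
  obtain ⟨z₀⟩ : Nonempty Z := m.nonempty_of_neZero
  exact (norm_nonneg _).trans (hv.bound a z₀)

theorem BranchBound.tsum_nonneg (hv : h.BranchBound θ v V) : 0 ≤ ∑' a : α, V a * m.real a.1 :=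
  _root_.tsum_nonneg fun a => mul_nonneg (hv.nonneg a) measureReal_nonneg

theorem BranchBound.measurable (hv : h.BranchBound θ v V) (hθ : θ ∈ Ioo (0 : ℝ) 1) :
    Measurable v :=
  h.measurable_of_comp_branch fun a => h.measurable_of_lipschitz hθ (hv.lip a)

theorem BranchBound.norm_term_le (hv : h.BranchBound θ v V) (hθ₀ : θ₀ ∈ Ioo (0 : ℝ) 1) (a : α)
    (z : Z) : ‖(h.xi (h.branch a z) : ℂ) * v (h.branch a z)‖ ≤
      Real.exp h.distConst * (V a * m.real a.1) := by
  rw [norm_mul, Complex.norm_real, Real.norm_of_nonneg (h.xi_pos _).le]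
  calc _ ≤ (Real.exp h.distConst * m.real a.1) * V a :=
        mul_le_mul (h.xi_branch_le hθ₀ a z) (hv.bound a z) (norm_nonneg _) (by positivity)
    _ = _ := by ring

theorem BranchBound.summable_term (hv : h.BranchBound θ v V) (hθ₀ : θ₀ ∈ Ioo (0 : ℝ) 1) (z : Z) :
    Summable fun a : α => (h.xi (h.branch a z) : ℂ) * v (h.branch a z) :=
  Summable.of_norm_bounded (hv.summable.mul_left _) fun a => hv.norm_term_le hθ₀ a z

theorem BranchBound.norm_transfer_le (hv : h.BranchBound θ v V) (hθ₀ : θ₀ ∈ Ioo (0 : ℝ) 1)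
    (z : Z) : ‖h.transfer v z‖ ≤ h.transferConst * ∑' a : α, V a * m.real a.1 := by
  have h1 : ‖h.transfer v z‖ ≤ ∑' a : α, Real.exp h.distConst * (V a * m.real a.1) :=
    tsum_of_norm_bounded (hv.summable.mul_left _).hasSum fun a => hv.norm_term_le hθ₀ a z
  rw [tsum_mul_left] at h1
  refine h1.trans (mul_le_mul_of_nonneg_right ?_ hv.tsum_nonneg)
  exact le_add_of_nonneg_left (mul_nonneg h.distConst_nonneg (Real.exp_pos _).le)

/-- The function v is controlled only on one partition element at a time, with bounds V a that may
grow. Weighting by m(a) makes their sum finite, so the transfer is Lipschitz on all of Z. This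
smoothing removes the weights of `𝓑(Y)`. -/
theorem BranchBound.norm_transfer_sub_le (hv : h.BranchBound θ v V) (hθ₀ : θ₀ ∈ Ioo (0 : ℝ) 1)
    (hθ : θ ∈ Ico θ₀ 1) (z z' : Z) : ‖h.transfer v z - h.transfer v z'‖ ≤
      h.transferConst * (∑' a : α, V a * m.real a.1) * symbDist G α θ z z' := by
  have hd := symbDist_nonneg (G := G) (α := α) (hθ₀.1.le.trans hθ.1) z z'
  rw [transfer, transfer, ← (hv.summable_term hθ₀ z).tsum_sub (hv.summable_term hθ₀ z')]
  refine (tsum_of_norm_bounded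
    ((hv.summable.mul_left (h.transferConst * symbDist G α θ z z')).hasSum) fun a => ?_).trans
    (by rw [tsum_mul_left]; apply le_of_eq; ring)
  have e : (h.xi (h.branch a z) : ℂ) * v (h.branch a z) - h.xi (h.branch a z') *
      v (h.branch a z') = ((h.xi (h.branch a z) - h.xi (h.branch a z') : ℝ) : ℂ) *
      v (h.branch a z) + h.xi (h.branch a z') * (v (h.branch a z) - v (h.branch a z')) := by
    push_cast; ring
  have hm : 0 ≤ m.real a.1 := measureReal_nonneg
  rw [e]
  refine (norm_add_le _ _).trans ?_
  rw [norm_mul, norm_mul, Complex.norm_real, Complex.norm_real, Real.norm_eq_abs,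
    Real.norm_of_nonneg (h.xi_pos _).le]
  have h1 := mul_le_mul (h.abs_xi_branch_sub_le hθ₀ hθ.1 hθ.2.le a z z') (hv.bound a z)
    (norm_nonneg _) (by have := h.distConst_nonneg; positivity)
  have h2 := mul_le_mul (h.xi_branch_le hθ₀ a z') (hv.lip a z z') (norm_nonneg _) (by positivity)
  unfold transferConst
  linarith

theorem BranchBound.add (hv : h.BranchBound θ v V) (hv' : h.BranchBound θ v' V') :
    h.BranchBound θ (fun z => v z + v' z) (fun a => V a + V' a) where
  bound a z := (norm_add_le _ _).trans (add_le_add (hv.bound a z) (hv'.bound a z))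
  lip a z z' := by
    rw [add_sub_add_comm, add_mul]
    exact (norm_add_le _ _).trans (add_le_add (hv.lip a z z') (hv'.lip a z z'))
  summable := by simpa only [add_mul] using hv.summable.add hv'.summable

theorem BranchBound.const_mul (hv : h.BranchBound θ v V) (c : ℂ) :
    h.BranchBound θ (fun z => c * v z) (fun a => ‖c‖ * V a) where
  bound a z := by
    rw [norm_mul]
    exact mul_le_mul_of_nonneg_left (hv.bound a z) (norm_nonneg _)
  lip a z z' := by
    rw [← mul_sub, norm_mul, mul_assoc]
    exact mul_le_mul_of_nonneg_left (hv.lip a z z') (norm_nonneg _)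
  summable := by simpa only [mul_assoc] using hv.summable.mul_left ‖c‖

theorem BranchBound.sub (hv : h.BranchBound θ v V) (hv' : h.BranchBound θ v' V') :
    h.BranchBound θ (fun z => v z - v' z) (fun a => V a + V' a) where
  bound a z := (norm_sub_le _ _).trans (add_le_add (hv.bound a z) (hv'.bound a z))
  lip a z z' := by
    rw [sub_sub_sub_comm, add_mul]
    exact (norm_sub_le _ _).trans (add_le_add (hv.lip a z z') (hv'.lip a z z'))
  summable := by simpa only [add_mul] using hv.summable.add hv'.summable

/-- Products with bounded Lipschitz functions. -/
theorem BranchBound.mul_lipschitz (hv : h.BranchBound θ v V) (hθ : θ ∈ Ioo (0 : ℝ) 1)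
    {w : Z → ℂ} {B : ℝ} (hw : ∀ z, ‖w z‖ ≤ B)
    (hw' : ∀ z z', ‖w z - w z'‖ ≤ B * symbDist G α θ z z') :
    h.BranchBound θ (fun z => v z * w z) (fun a => 2 * B * V a) where
  bound a z := by
    have hB := (norm_nonneg _).trans (hw z)
    have hV := hv.nonneg a
    rw [norm_mul]
    have := mul_le_mul (hv.bound a z) (hw (h.branch a z)) (norm_nonneg _) (hv.nonneg a)
    nlinarith [mul_nonneg hV hB]
  lip a z z' := by
    have hB := (norm_nonneg _).trans (hw z)
    have hV := hv.nonneg a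
    have hd := symbDist_nonneg (G := G) (α := α) hθ.1.le z z'
    have e : v (h.branch a z) * w (h.branch a z) - v (h.branch a z') * w (h.branch a z') =
      (v (h.branch a z) - v (h.branch a z')) * w (h.branch a z) +
      v (h.branch a z') * (w (h.branch a z) - w (h.branch a z')) := by ring
    rw [e]
    refine (norm_add_le _ _).trans ?_
    rw [norm_mul, norm_mul]
    have h1 := mul_le_mul (hv.lip a z z') (hw (h.branch a z)) (norm_nonneg _) (by positivity)
    have h2 := mul_le_mul (hv.bound a z') (hw' (h.branch a z) (h.branch a z')) (norm_nonneg _)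
      (hv.nonneg a)
    rw [h.symbDist_branch] at h2
    have h3 : V a * (B * (θ * symbDist G α θ z z')) ≤ V a * (B * symbDist G α θ z z') := by
      gcongr
      exact mul_le_of_le_one_left hd hθ.2.le
    linarith
  summable := by simpa only [mul_assoc] using hv.summable.mul_left (2 * B)

theorem BranchBound.transfer_add (hv : h.BranchBound θ v V) (hv' : h.BranchBound θ v' V')
    (hθ₀ : θ₀ ∈ Ioo (0 : ℝ) 1) (z : Z) :
    h.transfer (fun z => v z + v' z) z = h.transfer v z + h.transfer v' z := by
  simp only [transfer, mul_add]
  exact (hv.summable_term hθ₀ z).tsum_add (hv'.summable_term hθ₀ z)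

theorem BranchBound.transfer_sub (hv : h.BranchBound θ v V) (hv' : h.BranchBound θ v' V')
    (hθ₀ : θ₀ ∈ Ioo (0 : ℝ) 1) (z : Z) :
    h.transfer (fun z => v z - v' z) z = h.transfer v z - h.transfer v' z := by
  simp only [transfer, mul_sub]
  exact (hv.summable_term hθ₀ z).tsum_sub (hv'.summable_term hθ₀ z)

variable (h) in
theorem transfer_const_mul (c : ℂ) (v : Z → ℂ) (z : Z) :
    h.transfer (fun z => c * v z) z = c * h.transfer v z := by
  simp only [transfer, ← tsum_mul_left]
  exact tsum_congr fun a => by ring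

variable (h) in
theorem transfer_congr_ae (he : v =ᵐ[m] v') : h.transfer v =ᵐ[m] h.transfer v' := by
  filter_upwards [h.ae_branch he] with z hz
  simp only [transfer, hz]

theorem BranchBound.integrable (hv : h.BranchBound θ v V) (hθ : θ ∈ Ioo (0 : ℝ) 1) :
    Integrable v m := by
  have := h.isProbability
  have := h.countable.to_subtype
  have hb : ∀ a : α, ∀ z ∈ a.1, ‖v z‖ ≤ V a := fun a z hz => by
    rw [← h.branch_map hz]
    exact hv.bound a _
  rw [← integrableOn_univ, ← h.iUnion_eq_univ]
  have hi : ∀ a : α, IntegrableOn v a.1 m := fun a =>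
    Measure.integrableOn_of_bounded (M := V a) (measure_ne_top _ _)
      (hv.measurable hθ).aestronglyMeasurable
      ((ae_restrict_iff' (h.measurableSet a a.2)).2 (Filter.Eventually.of_forall (hb a)))
  refine integrableOn_iUnion_of_summable_integral_norm hi ?_
  refine Summable.of_nonneg_of_le (fun a => integral_nonneg fun _ => norm_nonneg _)
    (fun a => ?_) hv.summable
  have := norm_setIntegral_le_of_norm_le_const (f := fun z => ‖v z‖) (C := V a)
    (measure_lt_top m a.1) (fun z hz => by simpa using hb a z hz)
  exact (le_abs_self _).trans this

theorem BranchBound.measurable_transfer (hv : h.BranchBound θ v V) (hθ₀ : θ₀ ∈ Ioo (0 : ℝ) 1)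
    (hθ : θ ∈ Ico θ₀ 1) : Measurable (h.transfer v) :=
  h.measurable_of_lipschitz ⟨hθ₀.1.trans_le hθ.1, hθ.2⟩ (hv.norm_transfer_sub_le hθ₀ hθ)

/-- The transfer operator is dual to composition with `G`. -/
theorem BranchBound.integral_transfer_mul (hv : h.BranchBound θ v V) (hθ₀ : θ₀ ∈ Ioo (0 : ℝ) 1)
    (hθ : θ ∈ Ico θ₀ 1) {g : Z → ℂ} (hg : Measurable g) {B : ℝ} (hB : ∀ z, ‖g z‖ ≤ B) :
    ∫ z, h.transfer v z * g z ∂m = ∫ z, v z * g (G z) ∂m := by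
  have := h.isProbability
  have := h.countable.to_subtype
  have hθ1 : θ ∈ Ioo (0 : ℝ) 1 := ⟨hθ₀.1.trans_le hθ.1, hθ.2⟩
  have hvm := hv.measurable hθ1
  obtain ⟨z₀⟩ : Nonempty Z := m.nonempty_of_neZero
  have hB0 : 0 ≤ B := (norm_nonneg _).trans (hB z₀)
  have hint : Integrable (fun z => v z * g (G z)) m :=
    (hv.integrable hθ1).mul_bdd (c := B) (hg.comp h.measurable_map).aestronglyMeasurable
      (Filter.Eventually.of_forall fun z => hB _)
  have h1 : ∫ z, v z * g (G z) ∂m = ∑' a : α, ∫ z in a.1, v z * g (G z) ∂m := by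
    rw [← setIntegral_univ, ← h.iUnion_eq_univ]
    exact integral_iUnion (fun a => h.measurableSet a a.2) h.pairwise_disjoint hint.integrableOn
  have hterm : ∀ a : α, ∀ z, ‖(h.xi (h.branch a z) : ℂ) * v (h.branch a z) * g z‖ ≤
      Real.exp h.distConst * (V a * m.real a.1) * B := fun a z => by
    rw [norm_mul]
    exact mul_le_mul (hv.norm_term_le hθ₀ a z) (hB z) (norm_nonneg _)
      (by have := hv.nonneg a; positivity)
  have hmeas : ∀ a : α, Measurable fun z => (h.xi (h.branch a z) : ℂ) * v (h.branch a z) * g z :=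
    fun a => (((Complex.measurable_ofReal.comp h.measurable_xi).comp (h.measurable_branch a)).mul
      (hvm.comp (h.measurable_branch a))).mul hg
  have h2 : ∫ z, h.transfer v z * g z ∂m =
      ∑' a : α, ∫ z, (h.xi (h.branch a z) : ℂ) * v (h.branch a z) * g z ∂m := by
    simp only [transfer, ← tsum_mul_right]
    refine (hasSum_integral_of_summable_integral_norm (fun a => ?_) ?_).tsum_eq.symm
    · exact Integrable.of_bound (hmeas a).aestronglyMeasurable _
        (Filter.Eventually.of_forall (hterm a))
    · refine Summable.of_nonneg_of_le (fun a => integral_nonneg fun _ => norm_nonneg _)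
        (fun a => ?_) ((hv.summable.mul_left (Real.exp h.distConst)).mul_right B)
      have := norm_integral_le_of_norm_le_const (μ := m) (f := fun z =>
        ‖(h.xi (h.branch a z) : ℂ) * v (h.branch a z) * g z‖) (Filter.Eventually.of_forall
          (fun z => by simpa only [norm_norm] using hterm a z))
      refine (le_abs_self _).trans (this.trans ?_)
      simp
  rw [h1, h2]
  refine tsum_congr fun a => ?_
  rw [← h.integral_branch a (v := fun z => v z * g (G z)) (hvm.mul (hg.comp h.measurable_map))]
  refine integral_congr_ae (Filter.Eventually.of_forall fun z => ?_)
  simp only [h.map_branch, mul_assoc]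

variable (h) in
theorem branchBound_one (hθ : 0 ≤ θ) : h.BranchBound θ (fun _ => 1) (fun _ => 1) where
  bound a z := by simp
  lip a z z' := by simpa using symbDist_nonneg hθ z z'
  summable := by simpa using h.hasSum_measureReal.summable

-- By duality the equality holds almost everywhere because m is invariant. Both sides are Lipschitz,
-- and this upgrades it to every point.
variable (h) in
theorem transfer_one (hθ₀ : θ₀ ∈ Ioo (0 : ℝ) 1) (z : Z) : h.transfer (fun _ => 1) z = 1 := by
  have := h.isProbability
  have hb := h.branchBound_one hθ₀.1.le
  have hθ : θ₀ ∈ Ico θ₀ 1 := ⟨le_rfl, hθ₀.2⟩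
  have hi : Integrable (h.transfer fun _ => 1) m :=
    Integrable.of_bound (hb.measurable_transfer hθ₀ hθ).aestronglyMeasurable _
      (Filter.Eventually.of_forall (hb.norm_transfer_le hθ₀))
  have hae : h.transfer (fun _ => 1) =ᵐ[m] fun _ => 1 := by
    refine hi.ae_eq_of_forall_setIntegral_eq _ _ (integrable_const _) fun s hs _ => ?_
    have e := hb.integral_transfer_mul hθ₀ hθ (g := s.indicator fun _ => 1)
      (measurable_const.indicator hs) (B := 1) (fun z => by
        by_cases hz : z ∈ s <;> simp [hz])
    have e1 : ∀ z, h.transfer (fun _ => 1) z * s.indicator (fun _ => (1 : ℂ)) z =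
        s.indicator (h.transfer fun _ => 1) z := fun z => by
      by_cases hz : z ∈ s <;> simp [hz]
    simp only [e1, one_mul] at e
    rw [integral_indicator hs] at e
    rw [e]
    have hmap := integral_map (μ := m) (f := s.indicator fun _ => (1 : ℂ))
      h.measurable_map.aemeasurable (measurable_const.indicator hs).aestronglyMeasurable
    rw [h.ergodic.toMeasurePreserving.map_eq] at hmap
    rw [← integral_indicator hs, hmap]
  have hlip := hb.norm_transfer_sub_le hθ₀ hθ
  exact congrFun (h.eq_of_ae_eq hθ₀ hlip (fun z z' => by
    simpa using (norm_nonneg _).trans (hlip z z')) hae) z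

end IsFullBranchGibbsMarkov
end

/-! ### The Banach space of bounded Lipschitz functions and its multiplication-transfer operators.
-/

noncomputable section

section LipSpace

variable {Z : Type*}

/-- The bounded families that consist of a function and its difference quotients for
`symbDist G α θ`. -/
def lipSubmodule (G : Z → Z) (α : Set (Set Z)) (θ : ℝ) :
    Submodule ℂ (lp (fun _ : Z ⊕ Z × Z => ℂ) ∞) where
  -- The supremum norm of the pair (values, difference quotients) is the Lipschitz norm. On the
  -- diagonal the quotient is undetermined; setting it to zero makes the pair a function of its
  -- values.
  carrier := {g | ∀ z z', g (.inr (z, z')) * symbDist G α θ z z' = g (.inl z) - g (.inl z') ∧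
    (z = z' → g (.inr (z, z')) = 0)}
  add_mem' {f g} hf hg z z' := by
    simp only [lp.coeFn_add, Pi.add_apply]
    refine ⟨?_, fun hz => by rw [(hf z z').2 hz, (hg z z').2 hz, add_zero]⟩
    rw [add_mul, (hf z z').1, (hg z z').1]
    ring
  zero_mem' z z' := by simp
  smul_mem' c g hg z z' := by
    simp only [lp.coeFn_smul, Pi.smul_apply, smul_eq_mul]
    refine ⟨?_, fun hz => by rw [(hg z z').2 hz, mul_zero]⟩
    rw [mul_assoc, (hg z z').1]
    ring

variable {G : Z → Z} {α : Set (Set Z)} {θ : ℝ}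

/-- Every defining condition involves finitely many coordinates, and coordinates are continuous.
Completeness of `LipSpace` is then inherited from the ambient ℓ^∞ space. -/
theorem lipSubmodule_isClosed : IsClosed (lipSubmodule G α θ : Set (lp (fun _ : Z ⊕ Z × Z => ℂ) ∞)) := by
  have hc : ∀ i, Continuous fun g : lp (fun _ : Z ⊕ Z × Z => ℂ) ∞ => g i := fun i =>
    (lp.evalCLM ℂ (fun _ : Z ⊕ Z × Z => ℂ) ∞ i).continuous
  have : (lipSubmodule G α θ : Set (lp (fun _ : Z ⊕ Z × Z => ℂ) ∞)) = ⋂ (z) (z'),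
      {g | g (.inr (z, z')) * (symbDist G α θ z z' : ℂ) = g (.inl z) - g (.inl z')} ∩
      {g | z = z' → g (.inr (z, z')) = 0} := by
    ext g
    simp only [mem_iInter]
    rfl
  rw [this]
  refine isClosed_iInter fun z => isClosed_iInter fun z' => IsClosed.inter
    (isClosed_eq ((hc _).mul continuous_const) ((hc _).sub (hc _))) ?_
  by_cases hz : z = z'
  · simpa [hz] using isClosed_eq (hc (.inr (z', z'))) continuous_const
  · simp [hz]

/-- The Banach space of bounded functions that are Lipschitz for `symbDist G α θ`. -/
def LipSpace (G : Z → Z) (α : Set (Set Z)) (θ : ℝ) : Type _ := lipSubmodule G α θ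

instance : NormedAddCommGroup (LipSpace G α θ) :=
  inferInstanceAs (NormedAddCommGroup (lipSubmodule G α θ))

instance : NormedSpace ℂ (LipSpace G α θ) :=
  inferInstanceAs (NormedSpace ℂ (lipSubmodule G α θ))

instance : CompleteSpace (LipSpace G α θ) :=
  lipSubmodule_isClosed.completeSpace_coe

namespace LipSpace

/-- The underlying function. -/
def fn (w : LipSpace G α θ) (z : Z) : ℂ := w.1 (.inl z)

@[simp] theorem fn_add (w w' : LipSpace G α θ) (z : Z) : fn (w + w') z = fn w z + fn w' z := rfl

@[simp] theorem fn_sub (w w' : LipSpace G α θ) (z : Z) : fn (w - w') z = fn w z - fn w' z := rfl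

@[simp] theorem fn_smul (c : ℂ) (w : LipSpace G α θ) (z : Z) : fn (c • w) z = c * fn w z := rfl

theorem norm_fn_le (w : LipSpace G α θ) (z : Z) : ‖fn w z‖ ≤ ‖w‖ :=
  lp.norm_apply_le_norm ENNReal.top_ne_zero w.1 _

theorem norm_fn_sub_le (hθ : 0 ≤ θ) (w : LipSpace G α θ) (z z' : Z) :
    ‖fn w z - fn w z'‖ ≤ ‖w‖ * symbDist G α θ z z' := by
  rw [fn, fn, ← (w.2 z z').1, norm_mul, Complex.norm_real,
    Real.norm_of_nonneg (symbDist_nonneg hθ z z')]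
  exact mul_le_mul_of_nonneg_right (lp.norm_apply_le_norm ENNReal.top_ne_zero w.1 _)
    (symbDist_nonneg hθ z z')

/-- The function `w` satisfies the bounds that define `LipSpace`, with constant `C`. -/
def Bound (G : Z → Z) (α : Set (Set Z)) (θ : ℝ) (w : Z → ℂ) (C : ℝ) : Prop :=
  0 ≤ C ∧ (∀ z, ‖w z‖ ≤ C) ∧ ∀ z z', ‖w z - w z'‖ ≤ C * symbDist G α θ z z'

theorem exists_of_bound (hd : ∀ z z' : Z, z ≠ z' → 0 < symbDist G α θ z z') (hθ : 0 ≤ θ)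
    {w : Z → ℂ} {C : ℝ} (hw : Bound G α θ w C) : ∃ u : LipSpace G α θ, fn u = w ∧ ‖u‖ ≤ C := by
  let g : Z ⊕ Z × Z → ℂ :=
    Sum.elim w fun p => (w p.1 - w p.2) / (symbDist G α θ p.1 p.2 : ℂ)
  have hg : ∀ i, ‖g i‖ ≤ C := by
    rintro (z | ⟨z, z'⟩)
    · exact hw.2.1 z
    · change ‖(w z - w z') / (symbDist G α θ z z' : ℂ)‖ ≤ C
      rw [norm_div, Complex.norm_real, Real.norm_of_nonneg (symbDist_nonneg hθ z z')]
      exact div_le_of_le_mul₀ (symbDist_nonneg hθ z z') hw.1 (hw.2.2 z z')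
  let u : lp (fun _ : Z ⊕ Z × Z => ℂ) ∞ := ⟨g, memℓp_infty ⟨C, by rintro _ ⟨i, rfl⟩; exact hg i⟩⟩
  have hu : u ∈ lipSubmodule G α θ := by
    intro z z'
    change (w z - w z') / (symbDist G α θ z z' : ℂ) * symbDist G α θ z z' = w z - w z' ∧
      (z = z' → (w z - w z') / (symbDist G α θ z z' : ℂ) = 0)
    refine ⟨?_, fun hz => by simp [hz]⟩
    by_cases hz : z = z'
    · simp [hz]
    · exact div_mul_cancel₀ _ (Complex.ofReal_ne_zero.2 (hd z z' hz).ne')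
  exact ⟨⟨u, hu⟩, rfl, lp.norm_le_of_forall_le hw.1 hg⟩

theorem fn_injective (hd : ∀ z z' : Z, z ≠ z' → 0 < symbDist G α θ z z') :
    Function.Injective (fn : LipSpace G α θ → Z → ℂ) := by
  intro u u' he
  refine Subtype.ext (lp.ext (funext ?_))
  rintro (z | ⟨z, z'⟩)
  · exact congrFun he z
  · by_cases hz : z = z'
    · exact ((u.2 z z').2 hz).trans ((u'.2 z z').2 hz).symm
    · have h1 : (symbDist G α θ z z' : ℂ) ≠ 0 := Complex.ofReal_ne_zero.2 (hd z z' hz).ne'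
      refine mul_right_cancel₀ h1 ((u.2 z z').1.trans (Eq.trans ?_ (u'.2 z z').1.symm))
      exact congrArg₂ _ (congrFun he z) (congrFun he z')

theorem bound_fn (hθ : 0 ≤ θ) (w : LipSpace G α θ) : Bound G α θ (fn w) ‖w‖ :=
  ⟨norm_nonneg _, norm_fn_le w, norm_fn_sub_le hθ w⟩

end LipSpace

end LipSpace

namespace IsFullBranchGibbsMarkov

open LipSpace

variable {Z : Type*} [MeasurableSpace Z] {G : Z → Z} {α : Set (Set Z)} {m : Measure Z} {θ₀ : ℝ}
  {h : IsFullBranchGibbsMarkov G α m θ₀} {θ : ℝ} {v v' : Z → ℂ} {V V' : α → ℝ}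

include h in
theorem lipSpace_ext (hθ : 0 < θ) {w w' : LipSpace G α θ} (he : ∀ z, fn w z = fn w' z) : w = w' :=
  fn_injective (fun _ _ => h.symbDist_pos hθ) (funext he)

include h in
theorem lipSpace_ext_ae (hθ : θ ∈ Ioo (0 : ℝ) 1) {w w' : LipSpace G α θ}
    (he : fn w =ᵐ[m] fn w') : w = w' := by
  refine h.lipSpace_ext hθ.1 (congrFun (h.eq_of_ae_eq hθ (K := max ‖w‖ ‖w'‖) (fun z z' => ?_)
    (fun z z' => ?_) he))
  · exact (norm_fn_sub_le hθ.1.le w z z').trans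
      (mul_le_mul_of_nonneg_right (le_max_left _ _) (symbDist_nonneg hθ.1.le _ _))
  · exact (norm_fn_sub_le hθ.1.le w' z z').trans
      (mul_le_mul_of_nonneg_right (le_max_right _ _) (symbDist_nonneg hθ.1.le _ _))

include h in
theorem exists_lipSpace (hθ : 0 < θ) {w : Z → ℂ} {C : ℝ} (hw : Bound G α θ w C) :
    ∃ u : LipSpace G α θ, fn u = w ∧ ‖u‖ ≤ C :=
  exists_of_bound (fun _ _ => h.symbDist_pos hθ) hθ.le hw

include h in
theorem measurable_fn (hθ : θ ∈ Ioo (0 : ℝ) 1) (w : LipSpace G α θ) : Measurable (fn w) :=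
  h.measurable_of_lipschitz hθ (norm_fn_sub_le hθ.1.le w)

include h in
theorem integrable_fn (hθ : θ ∈ Ioo (0 : ℝ) 1) (w : LipSpace G α θ) : Integrable (fn w) m := by
  have := h.isProbability
  exact Integrable.of_bound (h.measurable_fn hθ w).aestronglyMeasurable ‖w‖
    (Filter.Eventually.of_forall (norm_fn_le w))

theorem BranchBound.bound_transfer (hv : h.BranchBound θ v V) (hθ₀ : θ₀ ∈ Ioo (0 : ℝ) 1)
    (hθ : θ ∈ Ico θ₀ 1) :
    Bound G α θ (h.transfer v) (h.transferConst * ∑' a : α, V a * m.real a.1) :=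
  ⟨mul_nonneg h.transferConst_pos.le hv.tsum_nonneg, hv.norm_transfer_le hθ₀,
    hv.norm_transfer_sub_le hθ₀ hθ⟩

theorem BranchBound.mul_fn (hv : h.BranchBound θ v V) (hθ : θ ∈ Ioo (0 : ℝ) 1)
    (w : LipSpace G α θ) :
    h.BranchBound θ (fun z => v z * fn w z) (fun a => 2 * ‖w‖ * V a) :=
  hv.mul_lipschitz hθ (norm_fn_le w) (norm_fn_sub_le hθ.1.le w)

/-- The operator `w ↦ R (v w)` on `LipSpace`, where `R` is the transfer operator of `G`. -/
theorem BranchBound.exists_mulTransfer (hv : h.BranchBound θ v V) (hθ₀ : θ₀ ∈ Ioo (0 : ℝ) 1)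
    (hθ : θ ∈ Ico θ₀ 1) : ∃ L : LipSpace G α θ →L[ℂ] LipSpace G α θ,
      (∀ w z, fn (L w) z = h.transfer (fun y => v y * fn w y) z) ∧
      ‖L‖ ≤ 2 * h.transferConst * ∑' a : α, V a * m.real a.1 := by
  have hθ1 : θ ∈ Ioo (0 : ℝ) 1 := ⟨hθ₀.1.trans_le hθ.1, hθ.2⟩
  have key : ∀ w : LipSpace G α θ, ∃ u : LipSpace G α θ,
      fn u = h.transfer (fun y => v y * fn w y) ∧
      ‖u‖ ≤ 2 * h.transferConst * (∑' a : α, V a * m.real a.1) * ‖w‖ := fun w => by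
    obtain ⟨u, hu, hn⟩ := h.exists_lipSpace hθ1.1 ((hv.mul_fn hθ1 w).bound_transfer hθ₀ hθ)
    refine ⟨u, hu, hn.trans (le_of_eq ?_)⟩
    simp only [mul_assoc, tsum_mul_left]
    ring
  choose T hT hn using key
  let L : LipSpace G α θ →ₗ[ℂ] LipSpace G α θ :=
    { toFun := T
      map_add' := fun w w' => h.lipSpace_ext hθ1.1 fun z => by
        rw [fn_add, hT, hT, hT, ← (hv.mul_fn hθ1 w).transfer_add (hv.mul_fn hθ1 w') hθ₀]
        simp only [fn_add, mul_add]
      map_smul' := fun c w => h.lipSpace_ext hθ1.1 fun z => by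
        rw [RingHom.id_apply, fn_smul, hT, hT, ← h.transfer_const_mul]
        simp only [fn_smul, mul_left_comm] }
  refine ⟨L.mkContinuous _ hn, fun w z => congrFun (hT w) z,
    LinearMap.mkContinuous_norm_le _ ?_ _⟩
  have := h.transferConst_pos
  have := hv.tsum_nonneg
  positivity

/-- The operator `w ↦ R (v w)` on `LipSpace`, where `R` is the transfer operator of `G`. -/
def BranchBound.mulTransfer (hv : h.BranchBound θ v V) (hθ₀ : θ₀ ∈ Ioo (0 : ℝ) 1)
    (hθ : θ ∈ Ico θ₀ 1) : LipSpace G α θ →L[ℂ] LipSpace G α θ :=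
  (hv.exists_mulTransfer hθ₀ hθ).choose

theorem BranchBound.fn_mulTransfer (hv : h.BranchBound θ v V) (hθ₀ : θ₀ ∈ Ioo (0 : ℝ) 1)
    (hθ : θ ∈ Ico θ₀ 1) (w : LipSpace G α θ) (z : Z) :
    fn (hv.mulTransfer hθ₀ hθ w) z = h.transfer (fun y => v y * fn w y) z :=
  (hv.exists_mulTransfer hθ₀ hθ).choose_spec.1 w z

theorem BranchBound.norm_mulTransfer_le (hv : h.BranchBound θ v V) (hθ₀ : θ₀ ∈ Ioo (0 : ℝ) 1)
    (hθ : θ ∈ Ico θ₀ 1) :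
    ‖hv.mulTransfer hθ₀ hθ‖ ≤ 2 * h.transferConst * ∑' a : α, V a * m.real a.1 :=
  (hv.exists_mulTransfer hθ₀ hθ).choose_spec.2

/-- The difference of two multipliers has its own bound V'', much smaller than V and V' when the
parameters are close. By linearity it controls the difference of the operators. -/
theorem BranchBound.norm_mulTransfer_sub_le {V'' : α → ℝ} (hv : h.BranchBound θ v V)
    (hv' : h.BranchBound θ v' V') (hd : h.BranchBound θ (fun z => v z - v' z) V'')
    (hθ₀ : θ₀ ∈ Ioo (0 : ℝ) 1) (hθ : θ ∈ Ico θ₀ 1) :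
    ‖hv.mulTransfer hθ₀ hθ - hv'.mulTransfer hθ₀ hθ‖ ≤
      2 * h.transferConst * ∑' a : α, V'' a * m.real a.1 := by
  have hθ1 : θ ∈ Ioo (0 : ℝ) 1 := ⟨hθ₀.1.trans_le hθ.1, hθ.2⟩
  have : hv.mulTransfer hθ₀ hθ - hv'.mulTransfer hθ₀ hθ = hd.mulTransfer hθ₀ hθ := by
    refine ContinuousLinearMap.ext fun w => h.lipSpace_ext hθ1.1 fun z => ?_
    rw [sub_apply, fn_sub, BranchBound.fn_mulTransfer,
      BranchBound.fn_mulTransfer, BranchBound.fn_mulTransfer,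
      ← (hv.mul_fn hθ1 w).transfer_sub (hv'.mul_fn hθ1 w) hθ₀]
    simp only [sub_mul]
  rw [this]
  exact hd.norm_mulTransfer_le hθ₀ hθ

include h in
theorem exists_mean (hθ : θ ∈ Ioo (0 : ℝ) 1) :
    ∃ P : LipSpace G α θ →L[ℂ] ℂ, ∀ w, P w = ∫ z, fn w z ∂m := by
  have := h.isProbability
  let P : LipSpace G α θ →ₗ[ℂ] ℂ :=
    { toFun := fun w => ∫ z, fn w z ∂m
      map_add' := fun w w' => integral_add (h.integrable_fn hθ w) (h.integrable_fn hθ w')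
      map_smul' := fun c w => integral_const_mul c _ }
  have hP : ∀ w, ‖P w‖ ≤ 1 * ‖w‖ := fun w => by
    have := norm_integral_le_of_norm_le_const (μ := m)
      (Filter.Eventually.of_forall (norm_fn_le w))
    change ‖∫ z, fn w z ∂m‖ ≤ _
    simpa using this
  exact ⟨P.mkContinuous 1 hP, fun _ => rfl⟩

variable (h) in
/-- The mean value functional on `LipSpace`. -/
def mean (hθ : θ ∈ Ioo (0 : ℝ) 1) : LipSpace G α θ →L[ℂ] ℂ := (h.exists_mean hθ).choose

variable (h) in
theorem mean_apply (hθ : θ ∈ Ioo (0 : ℝ) 1) (w : LipSpace G α θ) :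
    h.mean hθ w = ∫ z, fn w z ∂m := (h.exists_mean hθ).choose_spec w

include h in
theorem exists_lipSpace_one (hθ : θ ∈ Ioo (0 : ℝ) 1) :
    ∃ u : LipSpace G α θ, fn u = (fun _ => 1) ∧ ‖u‖ ≤ 1 :=
  h.exists_lipSpace hθ.1 ⟨zero_le_one, fun z => by simp, fun z z' => by
    simpa using symbDist_nonneg hθ.1.le z z'⟩

variable (h) in
/-- The constant function `1`. -/
def lipOne (hθ : θ ∈ Ioo (0 : ℝ) 1) : LipSpace G α θ := (h.exists_lipSpace_one hθ).choose

variable (h) in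
theorem fn_lipOne (hθ : θ ∈ Ioo (0 : ℝ) 1) (z : Z) : fn (h.lipOne hθ) z = 1 :=
  congrFun (h.exists_lipSpace_one hθ).choose_spec.1 z

variable (h) in
theorem norm_lipOne_le (hθ : θ ∈ Ioo (0 : ℝ) 1) : ‖h.lipOne hθ‖ ≤ 1 :=
  (h.exists_lipSpace_one hθ).choose_spec.2

variable (h) in
theorem mean_lipOne (hθ : θ ∈ Ioo (0 : ℝ) 1) : h.mean hθ (h.lipOne hθ) = 1 := by
  have := h.isProbability
  simp [mean_apply, fn_lipOne]

end IsFullBranchGibbsMarkov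
end

/-! ### Cone contraction and invertibility of 1 - R + ηP. -/

noncomputable section
namespace IsFullBranchGibbsMarkov

open LipSpace

variable {Z : Type*} [MeasurableSpace Z] {G : Z → Z} {α : Set (Set Z)} {m : Measure Z} {θ₀ : ℝ}
  {θ : ℝ}

theorem mem_Ioo_of_mem_Ico (hθ₀ : θ₀ ∈ Ioo (0 : ℝ) 1) (hθ : θ ∈ Ico θ₀ 1) : θ ∈ Ioo (0 : ℝ) 1 :=
  ⟨hθ₀.1.trans_le hθ.1, hθ.2⟩

/-- The cone of nonnegative functions whose logarithm is `D`-Lipschitz. -/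
def Cone (G : Z → Z) (α : Set (Set Z)) (θ D : ℝ) (r : Z → ℝ) : Prop :=
  (∀ z, 0 ≤ r z) ∧ ∀ z z', r z ≤ Real.exp (D * symbDist G α θ z z') * r z'

variable (h : IsFullBranchGibbsMarkov G α m θ₀)

/-- The aperture of an invariant cone. -/
def coneConst (θ : ℝ) : ℝ := (h.distConst + 1) / (1 - θ)

/-- The proportion of mass that is split off in each step. -/
def minorConst (θ : ℝ) : ℝ := Real.exp (-2 * h.coneConst θ) / h.coneConst θ

theorem one_le_coneConst (hθ : θ ∈ Ioo (0 : ℝ) 1) : 1 ≤ h.coneConst θ := by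
  have := h.distConst_nonneg
  rw [coneConst, le_div_iff₀ (by linarith [hθ.2])]
  linarith [hθ.1]

/-- The transfer operator turns aperture D into C + Dθ, and D is chosen to make this D - 1. The
spare unit pays for subtracting a multiple of the mean. -/
theorem distConst_add_coneConst_mul (hθ : θ < 1) :
    h.distConst + h.coneConst θ * θ = h.coneConst θ - 1 := by
  have : (1 : ℝ) - θ ≠ 0 := by linarith
  unfold coneConst
  field_simp
  ring

theorem minorConst_pos (hθ : θ ∈ Ioo (0 : ℝ) 1) : 0 < h.minorConst θ :=
  div_pos (Real.exp_pos _) (zero_lt_one.trans_le (h.one_le_coneConst hθ))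

theorem minorConst_lt_one (hθ : θ ∈ Ioo (0 : ℝ) 1) : h.minorConst θ < 1 := by
  have := h.one_le_coneConst hθ
  rw [minorConst, div_lt_one (by linarith)]
  exact (Real.exp_lt_one_iff.2 (by linarith)).trans_le this

/-- The transfer operator of `G` on `LipSpace`. -/
def transferOp (hθ₀ : θ₀ ∈ Ioo (0 : ℝ) 1) (hθ : θ ∈ Ico θ₀ 1) :
    LipSpace G α θ →L[ℂ] LipSpace G α θ :=
  (h.branchBound_one (mem_Ioo_of_mem_Ico hθ₀ hθ).1.le).mulTransfer hθ₀ hθ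

theorem fn_transferOp (hθ₀ : θ₀ ∈ Ioo (0 : ℝ) 1) (hθ : θ ∈ Ico θ₀ 1) (w : LipSpace G α θ) (z : Z) :
    fn (h.transferOp hθ₀ hθ w) z = h.transfer (fn w) z := by
  rw [transferOp, BranchBound.fn_mulTransfer]
  simp only [one_mul]

theorem mean_transferOp (hθ₀ : θ₀ ∈ Ioo (0 : ℝ) 1) (hθ : θ ∈ Ico θ₀ 1) (w : LipSpace G α θ) :
    h.mean (mem_Ioo_of_mem_Ico hθ₀ hθ) (h.transferOp hθ₀ hθ w) =
      h.mean (mem_Ioo_of_mem_Ico hθ₀ hθ) w := by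
  have hθ1 := mem_Ioo_of_mem_Ico hθ₀ hθ
  have := ((h.branchBound_one hθ1.1.le).mul_fn hθ1 w).integral_transfer_mul hθ₀ hθ
    (g := fun _ => 1) measurable_const (B := 1) (fun z => by simp)
  simp only [one_mul, mul_one] at this
  rw [mean_apply, mean_apply, ← this]
  simp only [fn_transferOp]

theorem transferOp_lipOne (hθ₀ : θ₀ ∈ Ioo (0 : ℝ) 1) (hθ : θ ∈ Ico θ₀ 1) :
    h.transferOp hθ₀ hθ (h.lipOne (mem_Ioo_of_mem_Ico hθ₀ hθ)) =
      h.lipOne (mem_Ioo_of_mem_Ico hθ₀ hθ) := by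
  have hθ1 := mem_Ioo_of_mem_Ico hθ₀ hθ
  refine h.lipSpace_ext hθ1.1 fun z => ?_
  rw [fn_transferOp, fn_lipOne, show fn (h.lipOne hθ1) = fun _ => 1 from funext (h.fn_lipOne hθ1),
    h.transfer_one hθ₀]

/-- The rank one operator `w ↦ η (∫ w) 1`. -/
def rankOne (hθ : θ ∈ Ioo (0 : ℝ) 1) : LipSpace G α θ →L[ℂ] LipSpace G α θ :=
  (h.minorConst θ : ℂ) • (h.mean hθ).smulRight (h.lipOne hθ)

theorem rankOne_apply (hθ : θ ∈ Ioo (0 : ℝ) 1) (w : LipSpace G α θ) :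
    h.rankOne hθ w = ((h.minorConst θ : ℂ) * h.mean hθ w) • h.lipOne hθ := by
  simp [rankOne, mul_smul]

include h in
theorem norm_le_of_bound (hθ : 0 < θ) {w : LipSpace G α θ} {C : ℝ} (hw : Bound G α θ (fn w) C) :
    ‖w‖ ≤ C := by
  obtain ⟨u, hu, hC⟩ := h.exists_lipSpace hθ hw
  rwa [h.lipSpace_ext hθ (congrFun hu)] at hC

omit [MeasurableSpace Z] in
theorem Cone.le_exp_mul {D : ℝ} {r : Z → ℝ} (hr : Cone G α θ D r) (hD : 0 ≤ D)
    (hθ : θ ∈ Ioo (0 : ℝ) 1) (z z' : Z) : r z ≤ Real.exp D * r z' :=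
  (hr.2 z z').trans (mul_le_mul_of_nonneg_right (Real.exp_le_exp.2
    (mul_le_of_le_one_right hD (symbDist_le_one hθ.1.le hθ.2.le z z'))) (hr.1 z'))

include h in
theorem integrable_of_fn_eq (hθ : θ ∈ Ioo (0 : ℝ) 1) {w : LipSpace G α θ} {r : Z → ℝ}
    (hw : ∀ z, fn w z = r z) : Integrable r m := by
  have := (h.integrable_fn hθ w).re
  simpa only [hw, Complex.ofReal_re, RCLike.re_eq_complex_re] using this

theorem mean_of_fn_eq (hθ : θ ∈ Ioo (0 : ℝ) 1) {w : LipSpace G α θ} {r : Z → ℝ}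
    (hw : ∀ z, fn w z = r z) : h.mean hθ w = ((∫ z, r z ∂m : ℝ) : ℂ) := by
  rw [mean_apply, ← integral_complex_ofReal]
  simp only [hw]

include h in
/-- The norm of an element of the cone is controlled by its mean. -/
theorem norm_le_of_cone (hθ : θ ∈ Ioo (0 : ℝ) 1) {w : LipSpace G α θ} {r : Z → ℝ} {D : ℝ}
    (hD : 1 ≤ D) (hw : ∀ z, fn w z = r z) (hr : Cone G α θ D r) :
    ‖w‖ ≤ D * Real.exp (2 * D) * ∫ z, r z ∂m := by
  have := h.isProbability
  have hI : 0 ≤ ∫ z, r z ∂m := integral_nonneg hr.1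
  have hsup : ∀ z, r z ≤ Real.exp D * ∫ z, r z ∂m := fun z => by
    rw [← integral_const_mul]
    calc r z = ∫ _, r z ∂m := by simp
      _ ≤ _ := integral_mono (integrable_const _)
        ((h.integrable_of_fn_eq hθ hw).const_mul _) (hr.le_exp_mul (by linarith) hθ z)
  have hlip : ∀ z z', r z - r z' ≤
      D * Real.exp (2 * D) * (∫ z, r z ∂m) * symbDist G α θ z z' := fun z z' => by
    set d := symbDist G α θ z z'
    have hd0 : 0 ≤ d := symbDist_nonneg hθ.1.le z z'
    have hd1 : d ≤ 1 := symbDist_le_one hθ.1.le hθ.2.le z z'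
    have e1 : Real.exp (D * d) - 1 ≤ D * d * Real.exp D := by
      have h1 := Real.add_one_le_exp (-(D * d))
      have h2 : Real.exp (D * d) ≤ Real.exp D :=
        Real.exp_le_exp.2 (mul_le_of_le_one_right (by linarith) hd1)
      have h3 : Real.exp (D * d) * Real.exp (-(D * d)) = 1 := by
        rw [← Real.exp_add]; simp
      have h4 : 0 ≤ D * d := by positivity
      nlinarith [Real.exp_pos (D * d)]
    calc r z - r z' ≤ (Real.exp (D * d) - 1) * r z' := by linarith [hr.2 z z']
      _ ≤ (D * d * Real.exp D) * (Real.exp D * ∫ z, r z ∂m) :=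
        mul_le_mul e1 (hsup z') (hr.1 z') (by positivity)
      _ = _ := by rw [two_mul, Real.exp_add]; ring
  refine h.norm_le_of_bound hθ.1 ⟨by positivity, fun z => ?_, fun z z' => ?_⟩
  · rw [hw, Complex.norm_real, Real.norm_of_nonneg (hr.1 z)]
    refine (hsup z).trans (mul_le_mul_of_nonneg_right ?_ hI)
    calc Real.exp D ≤ 1 * Real.exp (2 * D) := by
          rw [one_mul]; exact Real.exp_le_exp.2 (by linarith)
      _ ≤ _ := mul_le_mul_of_nonneg_right hD (Real.exp_pos _).le
  · rw [hw, hw, ← Complex.ofReal_sub, Complex.norm_real, Real.norm_eq_abs]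
    refine abs_sub_le_iff.2 ⟨hlip z z', ?_⟩
    rw [symbDist_comm]
    exact hlip z' z

/-- A Doeblin argument. The image s of r has aperture D - 1 and the same mean I, so s ≥ e^{-D} I.
Subtracting ηI keeps it nonnegative, and the increase of its relative oscillation fits between
e^{(D-1)d} and e^{Dd} because ηD = e^{-2D}. The mass drops by the factor 1 - η, and in the cone the
mass controls the norm. -/
theorem exists_cone_transferOp_sub_rankOne (hθ₀ : θ₀ ∈ Ioo (0 : ℝ) 1) (hθ : θ ∈ Ico θ₀ 1)
    {w : LipSpace G α θ} {r : Z → ℝ} (hw : ∀ z, fn w z = r z)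
    (hr : Cone G α θ (h.coneConst θ) r) :
    ∃ r' : Z → ℝ, (∀ z, fn ((h.transferOp hθ₀ hθ - h.rankOne (mem_Ioo_of_mem_Ico hθ₀ hθ)) w) z =
      r' z) ∧ Cone G α θ (h.coneConst θ) r' ∧
      ∫ z, r' z ∂m = (1 - h.minorConst θ) * ∫ z, r z ∂m := by
  have := h.isProbability
  have hθ1 := mem_Ioo_of_mem_Ico hθ₀ hθ
  set D := h.coneConst θ with hDdef
  set η := h.minorConst θ with hη
  have hD1 : 1 ≤ D := h.one_le_coneConst hθ1
  have hD0 : 0 < D := by linarith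
  set s : Z → ℝ := fun z => ∑' a : α, h.xi (h.branch a z) * r (h.branch a z) with hs
  have hRw : ∀ z, fn (h.transferOp hθ₀ hθ w) z = s z := fun z => by
    rw [fn_transferOp, transfer, hs, Complex.ofReal_tsum]
    simp only [hw, Complex.ofReal_mul]
  have hsum : ∀ z, Summable fun a : α => h.xi (h.branch a z) * r (h.branch a z) := fun z => by
    have := ((h.branchBound_one hθ1.1.le).mul_fn hθ1 w).summable_term hθ₀ z
    simp only [one_mul, hw, ← Complex.ofReal_mul] at this
    exact Complex.summable_ofReal.1 this
  have hs0 : ∀ z, 0 ≤ s z := fun z =>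
    tsum_nonneg fun a => mul_nonneg (h.xi_pos _).le (hr.1 _)
  have hs1 : ∀ z z', s z ≤ Real.exp ((D - 1) * symbDist G α θ z z') * s z' := fun z z' => by
    simp only [hs]
    rw [← tsum_mul_left]
    refine (hsum z).tsum_le_tsum (fun a => ?_) ((hsum z').mul_left _)
    have h1 := mul_le_mul (h.xi_branch_le_exp hθ₀.1.le hθ.1 a z z')
      (hr.2 (h.branch a z) (h.branch a z')) (hr.1 _)
      (mul_nonneg (Real.exp_pos _).le (h.xi_pos _).le)
    rw [h.symbDist_branch] at h1
    refine h1.trans (le_of_eq ?_)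
    rw [← h.distConst_add_coneConst_mul hθ.2, add_mul, Real.exp_add,
      show D * (θ * symbDist G α θ z z') = h.coneConst θ * θ * symbDist G α θ z z' by
        rw [hDdef]; ring]
    ring
  set I := ∫ z, r z ∂m with hI
  have hI0 : 0 ≤ I := integral_nonneg hr.1
  have hsI : ∫ z, s z ∂m = I := by
    have h1 := h.mean_transferOp hθ₀ hθ w
    rw [h.mean_of_fn_eq hθ1 hRw, h.mean_of_fn_eq hθ1 hw] at h1
    exact_mod_cast h1
  have hsi : Integrable s m := h.integrable_of_fn_eq hθ1 hRw
  have hlow : ∀ z, Real.exp (-D) * I ≤ s z := fun z => by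
    have h1 : I ≤ Real.exp D * s z := by
      rw [← hsI]
      calc ∫ y, s y ∂m ≤ ∫ _, Real.exp D * s z ∂m :=
            integral_mono hsi (integrable_const _) fun y => (hs1 y z).trans
              (mul_le_mul_of_nonneg_right (Real.exp_le_exp.2 (by
                have := symbDist_le_one (G := G) (α := α) hθ1.1.le hθ1.2.le y z
                have := symbDist_nonneg (G := G) (α := α) hθ1.1.le y z
                nlinarith)) (hs0 z))
        _ = _ := by simp
    rw [Real.exp_neg]
    exact (inv_mul_le_iff₀ (Real.exp_pos _)).2 h1
  have hηD : η * D = Real.exp (-D) * Real.exp (-D) := by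
    rw [hη, minorConst, div_mul_cancel₀ _ hD0.ne', ← Real.exp_add]
    congr 1
    ring
  have hη0 : 0 < η := h.minorConst_pos hθ1
  have hηle : η ≤ Real.exp (-D) := by
    have : Real.exp (-D) ≤ 1 := Real.exp_le_one_iff.2 (by linarith)
    nlinarith [Real.exp_pos (-D)]
  refine ⟨fun z => s z - η * I, fun z => ?_, ⟨fun z => ?_, fun z z' => ?_⟩, ?_⟩
  · rw [sub_apply, fn_sub, hRw, rankOne_apply, fn_smul, fn_lipOne, h.mean_of_fn_eq hθ1 hw]
    push_cast
    ring
  · have := mul_le_mul_of_nonneg_right hηle hI0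
    linarith [hlow z]
  · set d := symbDist G α θ z z'
    have hd0 : 0 ≤ d := symbDist_nonneg hθ1.1.le z z'
    have hd1 : d ≤ 1 := symbDist_le_one hθ1.1.le hθ1.2.le z z'
    have e1 : Real.exp (D * d) - 1 ≤ D * d * Real.exp D := by
      have h1 := Real.add_one_le_exp (-(D * d))
      have h2 : Real.exp (D * d) ≤ Real.exp D :=
        Real.exp_le_exp.2 (mul_le_of_le_one_right hD0.le hd1)
      have h3 : Real.exp (D * d) * Real.exp (-(D * d)) = 1 := by
        rw [← Real.exp_add]; simp
      have h4 : 0 ≤ D * d := by positivity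
      nlinarith [Real.exp_pos (D * d)]
    have e2 : d ≤ Real.exp (D * d) - Real.exp ((D - 1) * d) := by
      have h1 : Real.exp (D * d) = Real.exp ((D - 1) * d) * Real.exp d := by
        rw [← Real.exp_add]; congr 1; ring
      have h2 := Real.add_one_le_exp d
      have h3 : 1 ≤ Real.exp ((D - 1) * d) :=
        Real.one_le_exp (mul_nonneg (by linarith) hd0)
      rw [h1]
      nlinarith
    have e3 : η * I * (Real.exp (D * d) - 1) ≤ Real.exp (-D) * I * d := by
      have h1 : η * I * (Real.exp (D * d) - 1) ≤ η * I * (D * d * Real.exp D) :=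
        mul_le_mul_of_nonneg_left e1 (by positivity)
      have h2 : η * I * (D * d * Real.exp D) = Real.exp (-D) * I * d := by
        have h3 : Real.exp (-D) * Real.exp D = 1 := by rw [← Real.exp_add]; simp
        calc η * I * (D * d * Real.exp D) = (η * D) * Real.exp D * (I * d) := by ring
          _ = Real.exp (-D) * (Real.exp (-D) * Real.exp D) * (I * d) := by rw [hηD]; ring
          _ = _ := by rw [h3]; ring
      linarith
    have e4 : Real.exp (-D) * I * d ≤
        s z' * (Real.exp (D * d) - Real.exp ((D - 1) * d)) :=
      mul_le_mul (hlow z') e2 hd0 (hs0 z')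
    nlinarith [hs1 z z']
  · rw [integral_sub hsi (integrable_const _), hsI]
    simp
    ring

theorem norm_pow_le_of_cone (hθ₀ : θ₀ ∈ Ioo (0 : ℝ) 1) (hθ : θ ∈ Ico θ₀ 1) (n : ℕ) :
    ∀ {w : LipSpace G α θ} {r : Z → ℝ}, (∀ z, fn w z = r z) → Cone G α θ (h.coneConst θ) r →
    ‖((h.transferOp hθ₀ hθ - h.rankOne (mem_Ioo_of_mem_Ico hθ₀ hθ)) ^ n) w‖ ≤
      h.coneConst θ * Real.exp (2 * h.coneConst θ) * ((1 - h.minorConst θ) ^ n * ∫ z, r z ∂m) := by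
  have hθ1 := mem_Ioo_of_mem_Ico hθ₀ hθ
  induction n with
  | zero =>
    intro w r hw hr
    simpa using h.norm_le_of_cone hθ1 (h.one_le_coneConst hθ1) hw hr
  | succ n ih =>
    intro w r hw hr
    obtain ⟨r', hw', hr', hI⟩ := h.exists_cone_transferOp_sub_rankOne hθ₀ hθ hw hr
    have := ih hw' hr'
    rw [hI] at this
    rw [pow_succ, pow_succ, mul_assoc ((1 - h.minorConst θ) ^ n)]
    exact this

/-- Adding the constant 2B moves a real function of norm at most B into the cone: it is then at
least B and oscillates by at most B d. The masses of the sum and of the constant are at most 3B and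
2B, whence the factor 5. -/
theorem norm_pow_le_of_real (hθ₀ : θ₀ ∈ Ioo (0 : ℝ) 1) (hθ : θ ∈ Ico θ₀ 1) (n : ℕ)
    {w : LipSpace G α θ} {r : Z → ℝ} (hw : ∀ z, fn w z = r z) {B : ℝ} (hB : ‖w‖ ≤ B) :
    ‖((h.transferOp hθ₀ hθ - h.rankOne (mem_Ioo_of_mem_Ico hθ₀ hθ)) ^ n) w‖ ≤
      5 * (h.coneConst θ * Real.exp (2 * h.coneConst θ)) * (1 - h.minorConst θ) ^ n * B := by
  have := h.isProbability
  have hθ1 := mem_Ioo_of_mem_Ico hθ₀ hθ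
  set D := h.coneConst θ
  have hD1 : 1 ≤ D := h.one_le_coneConst hθ1
  set K := h.transferOp hθ₀ hθ - h.rankOne (mem_Ioo_of_mem_Ico hθ₀ hθ)
  have hB0 : 0 ≤ B := (norm_nonneg _).trans hB
  have hrB : ∀ z, |r z| ≤ B := fun z => by
    have := (norm_fn_le w z).trans hB
    rwa [hw, Complex.norm_real] at this
  have hc1 : Cone G α θ D fun z => r z + 2 * B := by
    refine ⟨fun z => by linarith [neg_le_of_abs_le (hrB z)], fun z z' => ?_⟩
    have h1 : r z - r z' ≤ B * symbDist G α θ z z' := by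
      have := norm_fn_sub_le hθ1.1.le w z z'
      rw [hw, hw, ← Complex.ofReal_sub, Complex.norm_real] at this
      exact (le_abs_self _).trans (this.trans
        (mul_le_mul_of_nonneg_right hB (symbDist_nonneg hθ1.1.le _ _)))
    set d := symbDist G α θ z z'
    have hd0 : 0 ≤ d := symbDist_nonneg hθ1.1.le z z'
    have h2 := Real.add_one_le_exp (D * d)
    have h3 : d ≤ D * d := le_mul_of_one_le_left hd0 hD1
    have h4 : B ≤ r z' + 2 * B := by linarith [neg_le_of_abs_le (hrB z')]
    nlinarith
  have hc2 : Cone G α θ D fun _ => 2 * B := by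
    refine ⟨fun z => by positivity, fun z z' => le_mul_of_one_le_left (by positivity) ?_⟩
    exact Real.one_le_exp (mul_nonneg (by linarith) (symbDist_nonneg hθ1.1.le z z'))
  have hw2 : ∀ z, fn (((2 * B : ℝ) : ℂ) • h.lipOne hθ1) z = ((2 * B : ℝ) : ℂ) := fun z => by
    rw [fn_smul, fn_lipOne, mul_one]
  have hw1 : ∀ z, fn (w + ((2 * B : ℝ) : ℂ) • h.lipOne hθ1) z = ((r z + 2 * B : ℝ) : ℂ) :=
    fun z => by rw [fn_add, hw2, hw, Complex.ofReal_add]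
  have b1 := h.norm_pow_le_of_cone hθ₀ hθ n hw1 hc1
  have b2 := h.norm_pow_le_of_cone hθ₀ hθ n hw2 hc2
  have i2 : ∫ _, 2 * B ∂m = 2 * B := by simp
  have i1 : ∫ z, (r z + 2 * B) ∂m ≤ 3 * B := by
    have hint := h.integrable_of_fn_eq hθ1 hw
    have : ∫ z, (r z + 2 * B) ∂m ≤ ∫ _, 3 * B ∂m :=
      integral_mono (hint.add (integrable_const _)) (integrable_const _) fun z => by
        change r z + 2 * B ≤ 3 * B
        linarith [le_of_abs_le (hrB z)]
    simpa using this
  have hη1 : 0 ≤ 1 - h.minorConst θ := by linarith [h.minorConst_lt_one hθ1]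
  have hdec : (K ^ n) w = (K ^ n) (w + ((2 * B : ℝ) : ℂ) • h.lipOne hθ1) -
      (K ^ n) (((2 * B : ℝ) : ℂ) • h.lipOne hθ1) := by rw [map_add, add_sub_cancel_right]
  rw [hdec]
  refine (norm_sub_le _ _).trans ((add_le_add b1 b2).trans ?_)
  rw [i2]
  have : D * Real.exp (2 * D) * ((1 - h.minorConst θ) ^ n * ∫ z, (r z + 2 * B) ∂m) ≤
      D * Real.exp (2 * D) * ((1 - h.minorConst θ) ^ n * (3 * B)) := by gcongr
  linarith

theorem norm_pow_le (hθ₀ : θ₀ ∈ Ioo (0 : ℝ) 1) (hθ : θ ∈ Ico θ₀ 1) (n : ℕ) :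
    ‖(h.transferOp hθ₀ hθ - h.rankOne (mem_Ioo_of_mem_Ico hθ₀ hθ)) ^ n‖ ≤
      10 * (h.coneConst θ * Real.exp (2 * h.coneConst θ)) * (1 - h.minorConst θ) ^ n := by
  have hθ1 := mem_Ioo_of_mem_Ico hθ₀ hθ
  have hD1 := h.one_le_coneConst hθ1
  have hη1 : 0 ≤ 1 - h.minorConst θ := by linarith [h.minorConst_lt_one hθ1]
  refine ContinuousLinearMap.opNorm_le_bound _ (by positivity) fun w => ?_
  have hb := bound_fn hθ1.1.le w
  obtain ⟨u, hu, hun⟩ := h.exists_lipSpace hθ1.1 (w := fun z => ((fn w z).re : ℂ)) (C := ‖w‖)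
    ⟨hb.1, fun z => by
      rw [Complex.norm_real]; exact (Complex.abs_re_le_norm _).trans (hb.2.1 z), fun z z' => by
      rw [← Complex.ofReal_sub, Complex.norm_real, ← Complex.sub_re]
      exact (Complex.abs_re_le_norm _).trans (hb.2.2 z z')⟩
  obtain ⟨v, hv, hvn⟩ := h.exists_lipSpace hθ1.1 (w := fun z => ((fn w z).im : ℂ)) (C := ‖w‖)
    ⟨hb.1, fun z => by
      rw [Complex.norm_real]; exact (Complex.abs_im_le_norm _).trans (hb.2.1 z), fun z z' => by
      rw [← Complex.ofReal_sub, Complex.norm_real, ← Complex.sub_im]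
      exact (Complex.abs_im_le_norm _).trans (hb.2.2 z z')⟩
  have hdec : w = u + Complex.I • v := h.lipSpace_ext hθ1.1 fun z => by
    rw [fn_add, fn_smul, hu, hv, mul_comm]
    exact (Complex.re_add_im _).symm
  have b1 := h.norm_pow_le_of_real hθ₀ hθ n (congrFun hu) hun
  have b2 := h.norm_pow_le_of_real hθ₀ hθ n (congrFun hv) hvn
  conv_lhs => rw [hdec, map_add, map_smul]
  refine (norm_add_le _ _).trans ?_
  rw [norm_smul, Complex.norm_I, one_mul]
  linarith

theorem isUnit_one_sub_transferOp_add_rankOne (hθ₀ : θ₀ ∈ Ioo (0 : ℝ) 1) (hθ : θ ∈ Ico θ₀ 1) :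
    IsUnit (1 - h.transferOp hθ₀ hθ + h.rankOne (mem_Ioo_of_mem_Ico hθ₀ hθ)) := by
  have hθ1 := mem_Ioo_of_mem_Ico hθ₀ hθ
  have hη1 : 0 ≤ 1 - h.minorConst θ := by linarith [h.minorConst_lt_one hθ1]
  set K := h.transferOp hθ₀ hθ - h.rankOne (mem_Ioo_of_mem_Ico hθ₀ hθ) with hK
  have hlim : Filter.Tendsto (fun n : ℕ =>
      10 * (h.coneConst θ * Real.exp (2 * h.coneConst θ)) * (1 - h.minorConst θ) ^ n)
      Filter.atTop (nhds 0) := by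
    simpa using (tendsto_pow_atTop_nhds_zero_of_lt_one hη1
      (by linarith [h.minorConst_pos hθ1])).const_mul
      (10 * (h.coneConst θ * Real.exp (2 * h.coneConst θ)))
  obtain ⟨n, hn⟩ := (hlim.eventually_lt_const zero_lt_one).exists
  -- Only a power of K is known to have norm below 1. Since 1 - K divides 1 - K^n with a commuting
  -- cofactor, it is invertible as well.
  have hu : IsUnit (1 - K ^ n) := isUnit_one_sub_of_norm_lt_one ((h.norm_pow_le hθ₀ hθ n).trans_lt hn)
  have he : (1 - K) * ∑ i ∈ Finset.range n, K ^ i = 1 - K ^ n := mul_neg_geom_sum K n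
  have he' : (∑ i ∈ Finset.range n, K ^ i) * (1 - K) = 1 - K ^ n := geom_sum_mul_neg K n
  have hc : Commute (1 - K) (∑ i ∈ Finset.range n, K ^ i) := he.trans he'.symm
  rw [← he] at hu
  have := (hc.isUnit_mul_iff.1 hu).1
  rwa [hK, sub_sub_eq_add_sub, add_sub_right_comm] at this

end IsFullBranchGibbsMarkov
end

/-! ### Integration on the tower and the transfer operator of the tower map. -/

noncomputable section

theorem measurable_sum_range {Z E : Type*} [MeasurableSpace Z] [AddCommMonoid E]
    [MeasurableSpace E] [MeasurableAdd₂ E] {n : Z → ℕ} (hn : Measurable n) {H : Z → ℕ → E}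
    (hH : ∀ l, Measurable fun z => H z l) :
    Measurable fun z => ∑ l ∈ Finset.range (n z), H z l := by
  have h1 : Measurable fun p : Z × ℕ => ∑ l ∈ Finset.range p.2, H p.1 l :=
    measurable_from_prod_countable_left fun k =>
      Finset.measurable_fun_sum (Finset.range k) fun l _ => hH l
  exact h1.comp (measurable_id.prodMk hn)

namespace YoungTower

variable {X : Type*} [MeasurableSpace X] {θ₀ : ℝ} (T : YoungTower X θ₀)

theorem isFullBranch : IsFullBranchGibbsMarkov T.G T.α T.μZ θ₀ := T.gibbsMarkov

instance : IsProbabilityMeasure T.μZ := T.isFullBranch.isProbability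

theorem measurable_G : Measurable T.G := T.isFullBranch.measurable_map

/-- The values of a function on the tower along the column over `z`, extended by zero. -/
def levelFn {E : Type*} [Zero E] (v : T.Y → E) (z : T.Z) (l : ℕ) : E :=
  if hl : l < T.σ z then v ⟨(z, l), hl⟩ else 0

theorem levelFn_of_lt {E : Type*} [Zero E] (v : T.Y → E) {z : T.Z} {l : ℕ} (hl : l < T.σ z) :
    T.levelFn v z l = v ⟨(z, l), hl⟩ := dif_pos hl

theorem levelFn_coe {E : Type*} [Zero E] (v : T.Y → E) (y : T.Y) :
    T.levelFn v y.1.1 y.1.2 = v y := dif_pos y.2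

theorem measurableSet_Y : MeasurableSet {p : T.Z × ℕ | p.2 < T.σ p.1} :=
  measurableSet_lt measurable_snd (T.measurable_σ.comp measurable_fst)

theorem measurable_levelFn {E : Type*} [Zero E] [MeasurableSpace E] {v : T.Y → E}
    (hv : Measurable v) (l : ℕ) : Measurable fun z => T.levelFn v z l := by
  have h1 : Measurable fun p : T.Z × ℕ => T.levelFn v p.1 p.2 :=
    Measurable.dite (s := {p : T.Z × ℕ | p.2 < T.σ p.1}) (f := v) hv (g := fun _ => 0)
      measurable_const T.measurableSet_Y
  exact h1.comp (measurable_id.prodMk measurable_const)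

theorem measurable_levelFn_uncurry {E : Type*} [Zero E] [MeasurableSpace E] {v : T.Y → E}
    (hv : Measurable v) : Measurable fun p : T.Z × ℕ => T.levelFn v p.1 p.2 :=
  measurable_from_prod_countable_left fun l => T.measurable_levelFn hv l

/-- A function on the tower is measurable if its restriction to each level is. -/
theorem measurable_of_eq_level {E : Type*} [MeasurableSpace E] {v : T.Y → E} {H : T.Z → ℕ → E}
    (hH : ∀ l, Measurable fun z => H z l) (hv : ∀ y : T.Y, v y = H y.1.1 y.1.2) :
    Measurable v := by
  have h1 : Measurable fun p : T.Z × ℕ => H p.1 p.2 := measurable_from_prod_countable_left hH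
  rw [funext hv]
  exact h1.comp measurable_subtype_coe

/-- The mean return time. -/
def meanReturn : ℝ≥0∞ := ∫⁻ z, (T.σ z : ℝ≥0∞) ∂T.μZ

theorem μ_eq : T.μ = T.meanReturn⁻¹ •
    (T.μZ.prod (Measure.count : Measure ℕ)).comap (Subtype.val : T.Y → T.Z × ℕ) := rfl

theorem sum_count_level {E : Type*} [Zero E] (v : T.Y → E) (z : T.Z) (l : ℕ) :
    ({p : T.Z × ℕ | p.2 < T.σ p.1}.indicator (fun p => T.levelFn v p.1 p.2)) (z, l) =
      T.levelFn v z l := by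
  by_cases hl : l < T.σ z
  · rw [indicator_of_mem (by exact hl)]
  · rw [indicator_of_notMem (by exact hl), levelFn, dif_neg hl]

theorem lintegral_μ {v : T.Y → ℝ≥0∞} (hv : Measurable v) :
    ∫⁻ y, v y ∂T.μ =
      T.meanReturn⁻¹ * ∫⁻ z, ∑ l ∈ Finset.range (T.σ z), T.levelFn v z l ∂T.μZ := by
  rw [μ_eq, lintegral_smul_measure, smul_eq_mul]
  congr 1
  have hm := T.measurable_levelFn_uncurry hv
  have h1 : ∀ y : T.Y, v y = (fun p : T.Z × ℕ => T.levelFn v p.1 p.2) y :=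
    fun y => (T.levelFn_coe v y).symm
  rw [lintegral_congr h1]
  refine (lintegral_subtype_comap T.measurableSet_Y
    (fun p : T.Z × ℕ => T.levelFn v p.1 p.2)).trans ?_
  rw [← lintegral_indicator T.measurableSet_Y,
    lintegral_prod _ (hm.indicator T.measurableSet_Y).aemeasurable]
  refine lintegral_congr fun z => ?_
  simp only [sum_count_level, lintegral_count]
  exact tsum_eq_sum fun l hl => dif_neg (by simpa using hl)

/-- The event σ = n lies in σ > n - 1 and is empty for n = 0, so the series over the values of σ is
dominated by a geometric one with ratio e^{e-d}. -/
theorem exists_lintegral_exp_lt_top {d C e : ℝ} (hd : ∀ n : ℕ,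
    T.μZ.real {z | n < T.σ z} ≤ C * Real.exp (-d * n)) (he : e < d) :
    ∫⁻ z, ENNReal.ofReal (Real.exp (e * T.σ z)) ∂T.μZ < ∞ := by
  have h0 : ∫⁻ z, ENNReal.ofReal (Real.exp (e * T.σ z)) ∂T.μZ =
      ∑' n : ℕ, ENNReal.ofReal (Real.exp (e * n)) * (T.μZ.map T.σ) {n} := by
    rw [← lintegral_countable', lintegral_map (f := fun n : ℕ => ENNReal.ofReal (Real.exp (e * n)))
      (measurable_of_countable _) T.measurable_σ]
  have h1 : ∀ n : ℕ, ENNReal.ofReal (Real.exp (e * n)) * (T.μZ.map T.σ) {n} ≤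
      ENNReal.ofReal (|C| * Real.exp d * Real.exp (e - d) ^ n) := by
    intro n
    rw [Measure.map_apply T.measurable_σ (measurableSet_singleton n)]
    rcases Nat.eq_zero_or_pos n with rfl | hn
    · have : T.σ ⁻¹' {0} = ∅ := by
        ext z
        simpa using (T.σ_pos z).ne'
      simp [this]
    · have h2 : T.μZ (T.σ ⁻¹' {n}) ≤ ENNReal.ofReal (|C| * Real.exp (-d * ((n : ℝ) - 1))) := by
        calc T.μZ (T.σ ⁻¹' {n}) ≤ T.μZ {z | n - 1 < T.σ z} := by
              refine measure_mono fun z hz => ?_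
              have : T.σ z = n := hz
              change n - 1 < T.σ z
              omega
          _ = ENNReal.ofReal (T.μZ.real {z | n - 1 < T.σ z}) := by
              rw [ofReal_measureReal]
          _ ≤ _ := by
              refine ENNReal.ofReal_le_ofReal ((hd (n - 1)).trans ?_)
              rw [Nat.cast_sub hn, Nat.cast_one]
              exact mul_le_mul_of_nonneg_right (le_abs_self C) (Real.exp_pos _).le
      calc _ ≤ ENNReal.ofReal (Real.exp (e * n)) *
            ENNReal.ofReal (|C| * Real.exp (-d * ((n : ℝ) - 1))) := by gcongr
        _ = _ := by
            rw [← ENNReal.ofReal_mul (Real.exp_pos _).le, ← Real.exp_nat_mul,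
              mul_left_comm, ← Real.exp_add, mul_assoc, ← Real.exp_add]
            congr 3
            ring
  rw [h0]
  refine (ENNReal.tsum_le_tsum h1).trans_lt ?_
  rw [← ENNReal.ofReal_tsum_of_nonneg (fun n => by positivity)]
  · exact ENNReal.ofReal_lt_top
  · exact (summable_geometric_of_lt_one (Real.exp_pos _).le
      (Real.exp_lt_one_iff.2 (by linarith))).mul_left _

theorem meanReturn_ne_top : T.meanReturn ≠ ∞ := by
  obtain ⟨d, hd, C, hC⟩ := T.exp_tail
  refine ne_of_lt (lt_of_le_of_lt ?_ (ENNReal.mul_lt_top (ENNReal.ofReal_lt_top (r := 2 / d))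
    (T.exists_lintegral_exp_lt_top hC (half_lt_self hd))))
  rw [← lintegral_const_mul' _ _ ENNReal.ofReal_ne_top]
  refine lintegral_mono fun z => ?_
  change ((T.σ z : ℕ) : ℝ≥0∞) ≤ _
  rw [← ENNReal.ofReal_mul (by positivity), ← ENNReal.ofReal_natCast]
  refine ENNReal.ofReal_le_ofReal ?_
  have := Real.add_one_le_exp (d / 2 * T.σ z)
  calc (T.σ z : ℝ) = 2 / d * (d / 2 * T.σ z) := by field_simp
    _ ≤ _ := by gcongr; linarith

theorem one_le_meanReturn : 1 ≤ T.meanReturn := by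
  calc (1 : ℝ≥0∞) = ∫⁻ _, 1 ∂T.μZ := by simp
    _ ≤ _ := lintegral_mono fun z => by
      exact Nat.one_le_cast.2 (T.σ_pos z)

theorem meanReturn_ne_zero : T.meanReturn ≠ 0 := (zero_lt_one.trans_le T.one_le_meanReturn).ne'

instance : IsProbabilityMeasure T.μ := ⟨by
  rw [← lintegral_one, T.lintegral_μ measurable_const]
  have : ∀ z, ∑ l ∈ Finset.range (T.σ z), T.levelFn (fun _ => (1 : ℝ≥0∞)) z l = T.σ z := fun z => by
    rw [Finset.sum_congr rfl fun l hl => T.levelFn_of_lt _ (Finset.mem_range.1 hl)]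
    simp
  simp only [this]
  exact ENNReal.inv_mul_cancel T.meanReturn_ne_zero T.meanReturn_ne_top⟩

/-- The mean return time as a real number. -/
def meanReturnReal : ℝ := T.meanReturn.toReal

theorem meanReturnReal_pos : 0 < T.meanReturnReal :=
  ENNReal.toReal_pos T.meanReturn_ne_zero T.meanReturn_ne_top

theorem integrable_levelFn {v : T.Y → ℂ} (hv : Measurable v) (hi : Integrable v T.μ) :
    Integrable ({p : T.Z × ℕ | p.2 < T.σ p.1}.indicator (fun p => T.levelFn v p.1 p.2))
      (T.μZ.prod (Measure.count : Measure ℕ)) := by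
  have hm := T.measurable_levelFn_uncurry hv
  refine ⟨(hm.indicator T.measurableSet_Y).aestronglyMeasurable, ?_⟩
  have h1 := hi.2
  rw [HasFiniteIntegral, μ_eq, lintegral_smul_measure, smul_eq_mul] at h1
  have h2 : ∫⁻ y : T.Y, ‖v y‖ₑ ∂((T.μZ.prod (Measure.count : Measure ℕ)).comap
      (Subtype.val : T.Y → T.Z × ℕ)) < ∞ := by
    by_contra hc
    rw [not_lt, top_le_iff] at hc
    rw [hc, ENNReal.mul_top (ENNReal.inv_ne_zero.2 T.meanReturn_ne_top)] at h1
    exact lt_irrefl _ h1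
  have h3 : ∀ y : T.Y, ‖v y‖ₑ = (fun p : T.Z × ℕ => ‖T.levelFn v p.1 p.2‖ₑ) y :=
    fun y => congrArg _ (T.levelFn_coe v y).symm
  rw [lintegral_congr h3] at h2
  have h4 := lintegral_subtype_comap (μ := T.μZ.prod (Measure.count : Measure ℕ))
    T.measurableSet_Y (fun p : T.Z × ℕ => ‖T.levelFn v p.1 p.2‖ₑ)
  have h5 := h4.symm.trans_lt h2
  rw [HasFiniteIntegral]
  simp only [enorm_indicator_eq_indicator_enorm]
  rwa [lintegral_indicator T.measurableSet_Y]

theorem tsum_levelFn (v : T.Y → ℂ) (z : T.Z) :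
    ∑' l, T.levelFn v z l = ∑ l ∈ Finset.range (T.σ z), T.levelFn v z l :=
  tsum_eq_sum fun l hl => dif_neg (by simpa using hl)

theorem integral_count_levelFn (v : T.Y → ℂ) (z : T.Z) :
    ∫ l, T.levelFn v z l ∂(Measure.count : Measure ℕ) =
      ∑ l ∈ Finset.range (T.σ z), T.levelFn v z l := by
  have hi : Integrable (fun l => T.levelFn v z l) (Measure.count : Measure ℕ) := by
    rw [integrable_count_iff]
    exact summable_of_hasFiniteSupport ((Finset.range (T.σ z)).finite_toSet.subset fun l hl => by
      by_contra hc
      exact hl (by simp [levelFn, dif_neg (show ¬ l < T.σ z by simpa using hc)]))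
  rw [integral_countable hi]
  simp only [Measure.real, Measure.count_singleton, ENNReal.toReal_one, one_smul]
  exact T.tsum_levelFn v z

theorem integrable_sum_level {v : T.Y → ℂ} (hv : Measurable v) (hi : Integrable v T.μ) :
    Integrable (fun z => ∑ l ∈ Finset.range (T.σ z), T.levelFn v z l) T.μZ := by
  have := (T.integrable_levelFn hv hi).integral_prod_left
  simpa only [sum_count_level, integral_count_levelFn] using this

theorem integral_μ {v : T.Y → ℂ} (hv : Measurable v) (hi : Integrable v T.μ) :
    ∫ y, v y ∂T.μ = (T.meanReturnReal : ℂ)⁻¹ *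
      ∫ z, ∑ l ∈ Finset.range (T.σ z), T.levelFn v z l ∂T.μZ := by
  rw [μ_eq, integral_smul_measure, ENNReal.toReal_inv, Complex.real_smul, Complex.ofReal_inv]
  congr 1
  have h1 : ∀ y : T.Y, v y = (fun p : T.Z × ℕ => T.levelFn v p.1 p.2) y :=
    fun y => (T.levelFn_coe v y).symm
  rw [integral_congr_ae (Filter.Eventually.of_forall h1)]
  refine (integral_subtype_comap T.measurableSet_Y
    (fun p : T.Z × ℕ => T.levelFn v p.1 p.2)).trans ?_
  rw [← integral_indicator T.measurableSet_Y, integral_prod _ (T.integrable_levelFn hv hi)]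
  simp only [sum_count_level, integral_count_levelFn]

/-- Almost everywhere statements on the base lift to the tower. -/
theorem ae_tower {p : T.Z → Prop} (hp : ∀ᵐ z ∂T.μZ, p z) : ∀ᵐ y ∂T.μ, p y.1.1 := by
  obtain ⟨N, hN, hNm, hN0⟩ := exists_measurable_superset_of_null hp
  have hm : MeasurableSet {y : T.Y | y.1.1 ∈ N} := (measurable_fst.comp measurable_subtype_coe) hNm
  have : T.μ {y : T.Y | y.1.1 ∈ N} = 0 := by
    rw [← lintegral_indicator_one hm, T.lintegral_μ (measurable_one.indicator hm)]
    refine mul_eq_zero.2 (Or.inr ?_)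
    rw [lintegral_eq_zero_iff (measurable_sum_range T.measurable_σ
      (T.measurable_levelFn (measurable_one.indicator hm)))]
    filter_upwards [measure_eq_zero_iff_ae_notMem.1 hN0] with z hz
    refine Finset.sum_eq_zero fun l hl => ?_
    rw [T.levelFn_of_lt _ (Finset.mem_range.1 hl)]
    exact indicator_of_notMem (by exact hz) _
  refine measure_mono_null (fun y hy => ?_) this
  exact hN hy

/-- Almost everywhere statements on the tower hold along almost every column. -/
theorem ae_base {p : T.Y → Prop} (hp : ∀ᵐ y ∂T.μ, p y) :
    ∀ᵐ z ∂T.μZ, ∀ (l : ℕ) (hl : l < T.σ z), p ⟨(z, l), hl⟩ := by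
  obtain ⟨N, hN, hNm, hN0⟩ := exists_measurable_superset_of_null hp
  rw [← lintegral_indicator_one hNm, T.lintegral_μ (measurable_one.indicator hNm)] at hN0
  have h1 := (mul_eq_zero.1 hN0).resolve_left (ENNReal.inv_ne_zero.2 T.meanReturn_ne_top)
  rw [lintegral_eq_zero_iff (measurable_sum_range T.measurable_σ
    (T.measurable_levelFn (measurable_one.indicator hNm)))] at h1
  filter_upwards [h1] with z hz l hl
  have h2 := Finset.sum_eq_zero_iff.1 hz l (Finset.mem_range.2 hl)
  rw [T.levelFn_of_lt _ hl] at h2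
  by_contra hc
  have h3 : (⟨(z, l), hl⟩ : T.Y) ∈ N := hN hc
  simp [indicator_of_mem h3] at h2

/-- The values of a function at the top level of the tower. -/
def top (v : T.Y → ℂ) (z : T.Z) : ℂ :=
  v ⟨(z, T.σ z - 1), Nat.sub_lt (T.σ_pos z) zero_lt_one⟩

/-- The transfer operator of the tower map, as an operator on functions. -/
def towerTransfer (v : T.Y → ℂ) (y : T.Y) : ℂ :=
  match y.1.2 with
  | 0 => T.isFullBranch.transfer (T.top v) y.1.1
  | l + 1 => T.levelFn v y.1.1 l

theorem towerTransfer_zero (v : T.Y → ℂ) (z : T.Z) (hl : 0 < T.σ z) :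
    T.towerTransfer v ⟨(z, 0), hl⟩ = T.isFullBranch.transfer (T.top v) z := rfl

theorem towerTransfer_succ (v : T.Y → ℂ) (z : T.Z) {l : ℕ} (hl : l + 1 < T.σ z) :
    T.towerTransfer v ⟨(z, l + 1), hl⟩ = v ⟨(z, l), (Nat.lt_succ_self l).trans hl⟩ :=
  T.levelFn_of_lt v ((Nat.lt_succ_self l).trans hl)

theorem measurable_towerTransfer {v : T.Y → ℂ} (hv : Measurable v)
    (ht : Measurable (T.isFullBranch.transfer (T.top v))) : Measurable (T.towerTransfer v) := by
  refine T.measurable_of_eq_level (H := fun z l => match l with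
    | 0 => T.isFullBranch.transfer (T.top v) z
    | l + 1 => T.levelFn v z l) (fun l => ?_) fun y => rfl
  cases l with
  | zero => exact ht
  | succ l => exact T.measurable_levelFn hv l

theorem measurable_F : Measurable T.F := by
  have h1 : Measurable fun y : T.Y => if y.1.2 + 1 < T.σ y.1.1 then (y.1.1, y.1.2 + 1)
      else (T.G y.1.1, 0) := by
    have hf : Measurable fun y : T.Y => y.1.1 := measurable_fst.comp measurable_subtype_coe
    have hs : Measurable fun y : T.Y => y.1.2 + 1 :=
      (measurable_snd.comp measurable_subtype_coe).add_const 1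
    exact Measurable.ite (measurableSet_lt hs (T.measurable_σ.comp hf)) (hf.prodMk hs)
      ((T.measurable_G.comp hf).prodMk measurable_const)
  refine (MeasurableEmbedding.subtype_coe T.measurableSet_Y).measurable_comp_iff.1 ?_
  convert! h1 using 2 with y
  simp only [Function.comp, F]
  split_ifs <;> rfl

theorem levelFn_mul_comp_F (v g : T.Y → ℂ) (z : T.Z) :
    ∑ l ∈ Finset.range (T.σ z), T.levelFn (fun y => v y * g (T.F y)) z l =
      (∑ l ∈ Finset.range (T.σ z - 1), T.levelFn v z l * T.levelFn g z (l + 1)) +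
        T.top v z * g ⟨(T.G z, 0), T.σ_pos _⟩ := by
  obtain ⟨n, hn⟩ : ∃ n, T.σ z = n + 1 := ⟨T.σ z - 1, by have := T.σ_pos z; omega⟩
  have hn' : T.σ z - 1 = n := by omega
  conv_lhs => rw [hn]
  rw [Finset.sum_range_succ, hn']
  congr 1
  · refine Finset.sum_congr rfl fun l hl => ?_
    have hl' : l + 1 < T.σ z := by have := Finset.mem_range.1 hl; omega
    rw [T.levelFn_of_lt _ (by omega), T.levelFn_of_lt v (by omega), T.levelFn_of_lt g hl']
    simp only [F, dif_pos hl']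
  · have hl' : ¬ n + 1 < T.σ z := by omega
    rw [T.levelFn_of_lt _ (by omega)]
    simp only [F, dif_neg hl', top, hn']

/-- The sum over levels that F moves upwards is the same as in `levelFn_mul_comp_F`. The two column
sums differ only in the return term, where duality between G and its transfer operator applies. -/
theorem levelFn_towerTransfer_mul (v g : T.Y → ℂ) (z : T.Z) :
    ∑ l ∈ Finset.range (T.σ z), T.levelFn (fun y => T.towerTransfer v y * g y) z l =
      (∑ l ∈ Finset.range (T.σ z - 1), T.levelFn v z l * T.levelFn g z (l + 1)) +
        T.isFullBranch.transfer (T.top v) z * g ⟨(z, 0), T.σ_pos _⟩ := by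
  obtain ⟨n, hn⟩ : ∃ n, T.σ z = n + 1 := ⟨T.σ z - 1, by have := T.σ_pos z; omega⟩
  have hn' : T.σ z - 1 = n := by omega
  conv_lhs => rw [hn]
  rw [Finset.sum_range_succ', hn']
  congr 1
  · refine Finset.sum_congr rfl fun l hl => ?_
    have hl' : l + 1 < T.σ z := by have := Finset.mem_range.1 hl; omega
    rw [T.levelFn_of_lt _ hl', T.towerTransfer_succ, T.levelFn_of_lt v (by omega),
      T.levelFn_of_lt g hl']
  · rw [T.levelFn_of_lt _ (T.σ_pos z), T.towerTransfer_zero]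

theorem integral_towerTransfer_mul (hθ₀ : θ₀ ∈ Ioo (0 : ℝ) 1) {θ : ℝ} (hθ : θ ∈ Ico θ₀ 1)
    {v : T.Y → ℂ} (hv : Measurable v) (hi : Integrable v T.μ) {V : T.α → ℝ}
    (hV : T.isFullBranch.BranchBound θ (T.top v) V) :
    Integrable (T.towerTransfer v) T.μ ∧ ∀ g : T.Y → ℂ, Measurable g → (∃ C : ℝ, ∀ y, ‖g y‖ ≤ C) →
      ∫ y, T.towerTransfer v y * g y ∂T.μ = ∫ y, v y * g (T.F y) ∂T.μ := by
  have hθ1 := IsFullBranchGibbsMarkov.mem_Ioo_of_mem_Ico hθ₀ hθ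
  have htm := hV.measurable_transfer hθ₀ hθ
  have hRm := T.measurable_towerTransfer hv htm
  have hsumi : Integrable (fun z => ∑ l ∈ Finset.range (T.σ z), T.levelFn (fun y => (‖v y‖ : ℂ)) z l)
      T.μZ := T.integrable_sum_level (Complex.measurable_ofReal.comp hv.norm) hi.norm.ofReal
  have hsumr : Integrable (fun z => ∑ l ∈ Finset.range (T.σ z), ‖T.levelFn v z l‖) T.μZ := by
    have := hsumi.norm
    refine this.congr (Filter.Eventually.of_forall fun z => ?_)
    have e : ∑ l ∈ Finset.range (T.σ z), T.levelFn (fun y => (‖v y‖ : ℂ)) z l =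
        ((∑ l ∈ Finset.range (T.σ z), ‖T.levelFn v z l‖ : ℝ) : ℂ) := by
      rw [Complex.ofReal_sum]
      refine Finset.sum_congr rfl fun l hl => ?_
      rw [T.levelFn_of_lt _ (Finset.mem_range.1 hl), T.levelFn_of_lt _ (Finset.mem_range.1 hl)]
    simp only [e]
    rw [Complex.norm_real, Real.norm_of_nonneg (Finset.sum_nonneg fun _ _ => norm_nonneg _)]
  have hRi : Integrable (T.towerTransfer v) T.μ := by
    refine ⟨hRm.aestronglyMeasurable, ?_⟩
    rw [HasFiniteIntegral, T.lintegral_μ hRm.enorm]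
    refine ENNReal.mul_lt_top (ENNReal.inv_lt_top.2 (pos_iff_ne_zero.2 T.meanReturn_ne_zero)) ?_
    have hbound : Integrable (fun z => (∑ l ∈ Finset.range (T.σ z), ‖T.levelFn v z l‖) +
        ‖T.isFullBranch.transfer (T.top v) z‖) T.μZ :=
      hsumr.add (Integrable.of_bound htm.norm.aestronglyMeasurable _
        (Filter.Eventually.of_forall fun z => by
          simpa only [norm_norm] using hV.norm_transfer_le hθ₀ z))
    refine lt_of_le_of_lt (lintegral_mono fun z => ?_) hbound.lintegral_lt_top
    have e : ∑ l ∈ Finset.range (T.σ z), T.levelFn (fun y => ‖T.towerTransfer v y‖ₑ) z l =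
        ENNReal.ofReal (∑ l ∈ Finset.range (T.σ z), ‖T.levelFn (T.towerTransfer v) z l‖) := by
      rw [ENNReal.ofReal_sum_of_nonneg fun _ _ => norm_nonneg _]
      refine Finset.sum_congr rfl fun l hl => ?_
      rw [T.levelFn_of_lt _ (Finset.mem_range.1 hl), T.levelFn_of_lt _ (Finset.mem_range.1 hl),
        ofReal_norm]
    change ∑ l ∈ Finset.range (T.σ z), T.levelFn (fun y => ‖T.towerTransfer v y‖ₑ) z l ≤ _
    rw [e]
    refine ENNReal.ofReal_le_ofReal ?_
    obtain ⟨n, hn⟩ : ∃ n, T.σ z = n + 1 := ⟨T.σ z - 1, by have := T.σ_pos z; omega⟩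
    rw [hn, Finset.sum_range_succ', T.levelFn_of_lt _ (T.σ_pos z), T.towerTransfer_zero]
    gcongr
    rw [Finset.sum_range_succ]
    refine le_add_of_le_of_nonneg (Finset.sum_le_sum fun l hl => ?_) (norm_nonneg _)
    have hl' : l + 1 < T.σ z := by have := Finset.mem_range.1 hl; omega
    rw [T.levelFn_of_lt _ hl', T.towerTransfer_succ, T.levelFn_of_lt v (by omega)]
  refine ⟨hRi, fun g hg ⟨C, hC⟩ => ?_⟩
  have hgF : Measurable fun y => g (T.F y) := hg.comp T.measurable_F
  rw [T.integral_μ (v := fun y => T.towerTransfer v y * g y) (hRm.mul hg) (hRi.mul_bdd (c := C) hg.aestronglyMeasurable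
      (Filter.Eventually.of_forall hC)),
    T.integral_μ (v := fun y => v y * g (T.F y)) (hv.mul hgF) (hi.mul_bdd (c := C) hgF.aestronglyMeasurable
      (Filter.Eventually.of_forall fun y => hC _))]
  congr 1
  have hg0 : Measurable fun z => g ⟨(z, 0), T.σ_pos _⟩ := by
    simpa only [T.levelFn_of_lt g (T.σ_pos _)] using T.measurable_levelFn hg 0
  have hSm : Measurable fun z =>
      ∑ l ∈ Finset.range (T.σ z - 1), T.levelFn v z l * T.levelFn g z (l + 1) :=
    measurable_sum_range ((measurable_of_countable fun n : ℕ => n - 1).comp T.measurable_σ)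
      fun l => (T.measurable_levelFn hv l).mul (T.measurable_levelFn hg (l + 1))
  have hSi : Integrable (fun z =>
      ∑ l ∈ Finset.range (T.σ z - 1), T.levelFn v z l * T.levelFn g z (l + 1)) T.μZ := by
    refine (hsumr.mul_const C).mono' hSm.aestronglyMeasurable
      (Filter.Eventually.of_forall fun z => (norm_sum_le _ _).trans ?_)
    rw [Finset.sum_mul]
    refine (Finset.sum_le_sum fun l hl => ?_).trans (Finset.sum_le_sum_of_subset_of_nonneg
      (Finset.range_subset_range.2 (Nat.sub_le _ _)) fun l _ _ => mul_nonneg (norm_nonneg _)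
        ((norm_nonneg _).trans (hC ⟨(z, 0), T.σ_pos z⟩)))
    have hl' : l + 1 < T.σ z := by have := Finset.mem_range.1 hl; omega
    rw [norm_mul, T.levelFn_of_lt g hl']
    exact mul_le_mul_of_nonneg_left (hC _) (norm_nonneg _)
  have hti : Integrable (fun z => T.top v z * g ⟨(T.G z, 0), T.σ_pos _⟩) T.μZ :=
    (hV.integrable hθ1).mul_bdd (c := C) (hg0.comp T.measurable_G).aestronglyMeasurable
      (Filter.Eventually.of_forall fun z => hC _)
  have hri : Integrable (fun z => T.isFullBranch.transfer (T.top v) z * g ⟨(z, 0), T.σ_pos _⟩)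
      T.μZ :=
    (Integrable.of_bound htm.aestronglyMeasurable _
      (Filter.Eventually.of_forall (hV.norm_transfer_le hθ₀))).mul_bdd (c := C)
      hg0.aestronglyMeasurable (Filter.Eventually.of_forall fun z => hC _)
  simp only [levelFn_mul_comp_F, levelFn_towerTransfer_mul]
  rw [integral_add hSi hti, integral_add hSi hri]
  congr 1
  exact hV.integral_transfer_mul hθ₀ hθ hg0 fun z => hC _

/-- The weak and the pointwise descriptions of the transfer operator agree. -/
theorem isTransfer_iff (hθ₀ : θ₀ ∈ Ioo (0 : ℝ) 1) {θ : ℝ} (hθ : θ ∈ Ico θ₀ 1)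
    {v u : T.Y → ℂ} (hv : Measurable v) (hi : Integrable v T.μ) {V : T.α → ℝ}
    (hV : T.isFullBranch.BranchBound θ (T.top v) V) :
    T.IsTransfer v u ↔ u =ᵐ[T.μ] T.towerTransfer v := by
  obtain ⟨hRi, hR⟩ := T.integral_towerTransfer_mul hθ₀ hθ hv hi hV
  constructor
  · rintro ⟨-, hu, hug⟩
    refine hu.ae_eq_of_forall_setIntegral_eq _ _ hRi fun s hs _ => ?_
    have hgm : Measurable (s.indicator fun _ => (1 : ℂ)) := measurable_const.indicator hs
    have hgb : ∃ C : ℝ, ∀ y, ‖s.indicator (fun _ => (1 : ℂ)) y‖ ≤ C :=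
      ⟨1, fun y => by by_cases hy : y ∈ s <;> simp [hy]⟩
    have e1 := (hug _ hgm hgb).trans (hR _ hgm hgb).symm
    have e2 : ∀ (w : T.Y → ℂ) y, w y * s.indicator (fun _ => (1 : ℂ)) y = s.indicator w y :=
      fun w y => by by_cases hy : y ∈ s <;> simp [hy]
    simp only [e2] at e1
    rwa [integral_indicator hs, integral_indicator hs] at e1
  · intro he
    refine ⟨hi, hRi.congr he.symm, fun g hg hgb => ?_⟩
    rw [← hR g hg hgb]
    refine integral_congr_ae ?_
    filter_upwards [he] with y hy
    rw [hy]

end YoungTower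
end

/-! ### Moments of the roof function and of the return time. -/

noncomputable section

/-- A power moment is finite on a set where the tail decays fast enough. -/
theorem setLIntegral_rpow_lt_top {X : Type*} [MeasurableSpace X] {ν : Measure X}
    [IsFiniteMeasure ν] {t : X → ℝ} (ht : Measurable t) (ht0 : ∀ x, 0 < t x) {S : Set X}
    {b C γ : ℝ} (hγ0 : 0 ≤ γ) (hγ1 : γ ≤ 1) (hγb : γ < b)
    (hC : ∀ n : ℕ, 1 ≤ n → ν.real (S ∩ {x | n ≤ ⌊t x⌋₊}) ≤ C * (n : ℝ) ^ (-b)) :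
    ∫⁻ x in S, ENNReal.ofReal (t x ^ γ) ∂ν < ∞ := by
  set c : ℕ → ℝ≥0∞ := fun n => ENNReal.ofReal (2 * ((n + 1 : ℕ) : ℝ) ^ (γ - 1)) with hc
  have hmS : ∀ n : ℕ, MeasurableSet {x | n + 1 ≤ ⌊t x⌋₊} := fun n =>
    measurableSet_le measurable_const (Nat.measurable_floor.comp ht)
  -- A discrete layer cake: with k = ⌊t⌋ one has t^γ ≤ 2k^γ, and k^γ = k · k^{γ-1} is at most the
  -- sum of n^{γ-1} over 1 ≤ n ≤ k, because γ ≤ 1.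
  have hpt : ∀ x, ENNReal.ofReal (t x ^ γ) ≤
      1 + ∑' n : ℕ, {x | n + 1 ≤ ⌊t x⌋₊}.indicator (fun _ => c n) x := by
    intro x
    rcases Nat.eq_zero_or_pos ⌊t x⌋₊ with h0 | h0
    · have h1 : t x < 1 := Nat.floor_eq_zero.1 h0
      refine le_add_right ?_
      rw [← ENNReal.ofReal_one]
      exact ENNReal.ofReal_le_ofReal (Real.rpow_le_one (ht0 x).le h1.le hγ0)
    · refine le_add_left ?_
      set k := ⌊t x⌋₊ with hk
      have hk1 : (1 : ℝ) ≤ k := by exact_mod_cast h0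
      have h1 : t x ≤ 2 * k := by linarith [Nat.lt_floor_add_one (t x)]
      have h2 : t x ^ γ ≤ 2 * (k : ℝ) ^ γ := by
        calc t x ^ γ ≤ (2 * (k : ℝ)) ^ γ := Real.rpow_le_rpow (ht0 x).le h1 hγ0
          _ = 2 ^ γ * (k : ℝ) ^ γ := Real.mul_rpow (by norm_num) (by positivity)
          _ ≤ 2 ^ (1 : ℝ) * (k : ℝ) ^ γ := by gcongr; norm_num
          _ = _ := by rw [Real.rpow_one]
      have h3 : (k : ℝ) ^ γ ≤ ∑ n ∈ Finset.range k, ((n + 1 : ℕ) : ℝ) ^ (γ - 1) := by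
        calc (k : ℝ) ^ γ = ∑ n ∈ Finset.range k, (k : ℝ) ^ (γ - 1) := by
              rw [Finset.sum_const, Finset.card_range, nsmul_eq_mul, Real.rpow_sub_one (by positivity)]
              field_simp
          _ ≤ _ := Finset.sum_le_sum fun n hn => by
              refine Real.rpow_le_rpow_of_nonpos (by positivity) ?_ (by linarith)
              exact_mod_cast Finset.mem_range.1 hn
      calc ENNReal.ofReal (t x ^ γ)
          ≤ ENNReal.ofReal (∑ n ∈ Finset.range k, 2 * ((n + 1 : ℕ) : ℝ) ^ (γ - 1)) := by
            refine ENNReal.ofReal_le_ofReal ?_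
            rw [← Finset.mul_sum]
            linarith
        _ = ∑ n ∈ Finset.range k, {x | n + 1 ≤ ⌊t x⌋₊}.indicator (fun _ => c n) x := by
            rw [ENNReal.ofReal_sum_of_nonneg fun n _ => by positivity]
            refine Finset.sum_congr rfl fun n hn => ?_
            rw [indicator_of_mem (by exact Finset.mem_range.1 hn)]
        _ ≤ _ := ENNReal.sum_le_tsum _
  refine (lintegral_mono hpt).trans_lt ?_
  rw [lintegral_add_left measurable_const, lintegral_tsum fun n =>
    (measurable_const.indicator (hmS n)).aemeasurable]
  refine ENNReal.add_lt_top.2 ⟨by simp, ?_⟩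
  have hterm : ∀ n : ℕ, ∫⁻ x in S, {x | n + 1 ≤ ⌊t x⌋₊}.indicator (fun _ => c n) x ∂ν ≤
      ENNReal.ofReal (2 * |C| * ((n + 1 : ℕ) : ℝ) ^ (γ - 1 - b)) := fun n => by
    rw [lintegral_indicator_const (hmS n), Measure.restrict_apply (hmS n), inter_comm,
      ← ofReal_measureReal, hc, ← ENNReal.ofReal_mul (by positivity)]
    refine ENNReal.ofReal_le_ofReal ?_
    have h1 : ν.real (S ∩ {x | n + 1 ≤ ⌊t x⌋₊}) ≤ |C| * ((n + 1 : ℕ) : ℝ) ^ (-b) :=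
      (hC (n + 1) (by omega)).trans (mul_le_mul_of_nonneg_right (le_abs_self C) (by positivity))
    calc _ ≤ 2 * ((n + 1 : ℕ) : ℝ) ^ (γ - 1) * (|C| * ((n + 1 : ℕ) : ℝ) ^ (-b)) := by gcongr
      _ = 2 * |C| * (((n + 1 : ℕ) : ℝ) ^ (γ - 1) * ((n + 1 : ℕ) : ℝ) ^ (-b)) := by ring
      _ = _ := by rw [← Real.rpow_add (by positivity), sub_eq_add_neg (γ - 1) b]
  refine (ENNReal.tsum_le_tsum hterm).trans_lt ?_
  rw [← ENNReal.ofReal_tsum_of_nonneg (fun n => by positivity)]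
  · exact ENNReal.ofReal_lt_top
  · have := (summable_nat_add_iff 1).2 (Real.summable_nat_rpow.2
      (show γ - 1 - b < -1 by linarith))
    exact this.mul_left _

theorem rpow_sum_le_sum_rpow {γ : ℝ} (hγ0 : 0 < γ) (hγ1 : γ ≤ 1) (n : ℕ) {t : ℕ → ℝ}
    (ht : ∀ j, 0 ≤ t j) :
    (∑ j ∈ Finset.range n, t j) ^ γ ≤ ∑ j ∈ Finset.range n, t j ^ γ := by
  induction n with
  | zero => simp [Real.zero_rpow hγ0.ne']
  | succ n ih =>
    rw [Finset.sum_range_succ, Finset.sum_range_succ]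
    exact (Real.rpow_add_le_add_rpow (Finset.sum_nonneg fun j _ => ht j) (ht n) hγ0.le hγ1).trans
      (by gcongr)

namespace YoungTower

variable {X : Type*} [MeasurableSpace X] {θ₀ : ℝ} (T : YoungTower X θ₀) {τ₀ : X → ℝ} {β κ : ℝ}

theorem measurable_iterate (l : ℕ) : Measurable fun z : T.Z => T.f^[l] (z : X) :=
  (T.measurable_f.iterate l).comp measurable_subtype_coe

theorem measurable_proj : Measurable T.proj :=
  T.measurable_of_eq_level (H := fun z l => T.f^[l] (z : X)) T.measurable_iterate fun _ => rfl

instance : IsProbabilityMeasure T.μX :=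
  Measure.isProbabilityMeasure_map T.measurable_proj.aemeasurable

variable {T}

theorem IsRoof.measurable_birk (hτ : T.IsRoof τ₀ β κ) (l : ℕ) : Measurable (T.birk τ₀ l) :=
  Finset.measurable_fun_sum (Finset.range l) fun j _ => hτ.measurable.comp (T.measurable_iterate j)

theorem IsRoof.measurable_φ (hτ : T.IsRoof τ₀ β κ) : Measurable (T.φ τ₀) :=
  measurable_sum_range T.measurable_σ fun j => hτ.measurable.comp (T.measurable_iterate j)

theorem IsRoof.measurable_τ (hτ : T.IsRoof τ₀ β κ) : Measurable (T.τ τ₀) :=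
  hτ.measurable.comp T.measurable_proj

theorem IsRoof.measurable_ψ (hτ : T.IsRoof τ₀ β κ) : Measurable (T.ψ τ₀) :=
  T.measurable_of_eq_level (H := fun z l => T.birk τ₀ l z) hτ.measurable_birk fun _ => rfl

theorem IsRoof.birk_nonneg (hτ : T.IsRoof τ₀ β κ) (l : ℕ) (z : T.Z) : 0 ≤ T.birk τ₀ l z :=
  Finset.sum_nonneg fun _ _ => (hτ.pos _).le

theorem IsRoof.birk_mono (hτ : T.IsRoof τ₀ β κ) {l l' : ℕ} (hl : l ≤ l') (z : T.Z) :
    T.birk τ₀ l z ≤ T.birk τ₀ l' z :=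
  Finset.sum_le_sum_of_subset_of_nonneg (Finset.range_subset_range.2 hl) fun _ _ _ => (hτ.pos _).le

theorem IsRoof.φ_pos (hτ : T.IsRoof τ₀ β κ) (z : T.Z) : 0 < T.φ τ₀ z :=
  Finset.sum_pos (fun _ _ => hτ.pos _) ⟨0, Finset.mem_range.2 (T.σ_pos z)⟩

theorem IsRoof.τ_pos (hτ : T.IsRoof τ₀ β κ) (y : T.Y) : 0 < T.τ τ₀ y := hτ.pos _

theorem IsRoof.ψ_nonneg (hτ : T.IsRoof τ₀ β κ) (y : T.Y) : 0 ≤ T.ψ τ₀ y := hτ.birk_nonneg _ _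

theorem IsRoof.ψ_le_φ (hτ : T.IsRoof τ₀ β κ) (y : T.Y) : T.ψ τ₀ y ≤ T.φ τ₀ y.1.1 :=
  hτ.birk_mono y.2.le _

theorem IsRoof.τ_le_φ (hτ : T.IsRoof τ₀ β κ) (y : T.Y) : T.τ τ₀ y ≤ T.φ τ₀ y.1.1 :=
  Finset.single_le_sum (f := fun j => τ₀ (T.f^[j] (y.1.1 : X))) (fun _ _ => (hτ.pos _).le)
    (Finset.mem_range.2 y.2)

theorem IsRoof.exists_tail (hτ : T.IsRoof τ₀ β κ) (hβκ : β ≤ κ) :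
    ∃ C : ℝ, ∀ n : ℕ, 1 ≤ n → T.μX.real (univ ∩ {x | n ≤ ⌊τ₀ x⌋₊}) ≤ C * (n : ℝ) ^ (-β) := by
  obtain ⟨c, hc, K, hK⟩ := hτ.tail
  refine ⟨(c + |K|) * (2 : ℝ)⁻¹ ^ (-β) + 1, fun n hn => ?_⟩
  rw [univ_inter]
  have hpos : (0 : ℝ) ≤ (c + |K|) * (2 : ℝ)⁻¹ ^ (-β) := by positivity
  rcases hn.eq_or_lt with rfl | hn
  · rw [Nat.cast_one, Real.one_rpow, mul_one]
    exact measureReal_le_one.trans (by linarith)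
  · have hn2 : (2 : ℝ) ≤ n := by exact_mod_cast hn
    have h1 : (1 : ℝ) ≤ 2⁻¹ * n := by linarith
    -- The tail hypothesis is about τ₀ > t with t ≥ 1. Passing from ≥ n to > n/2 costs a factor 2^β
    -- and needs n ≥ 2; for n = 1 the trivial bound 1 suffices.
    calc T.μX.real {x | n ≤ ⌊τ₀ x⌋₊} ≤ T.μX.real {x | 2⁻¹ * (n : ℝ) < τ₀ x} := by
          refine measureReal_mono fun x hx => ?_
          have hx' : (n : ℝ) ≤ τ₀ x := (Nat.le_floor_iff (hτ.pos x).le).1 hx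
          change 2⁻¹ * (n : ℝ) < τ₀ x
          linarith
      _ ≤ c * (2⁻¹ * n) ^ (-β) + K * (2⁻¹ * n) ^ (-κ) := by
          linarith [(abs_le.1 (hK _ h1)).2]
      _ ≤ c * (2⁻¹ * n) ^ (-β) + |K| * (2⁻¹ * n) ^ (-β) := by
          gcongr
          · exact le_abs_self K
      _ = (c + |K|) * (2 : ℝ)⁻¹ ^ (-β) * (n : ℝ) ^ (-β) := by
          rw [Real.mul_rpow (by norm_num) (by positivity)]
          ring
      _ ≤ _ := by gcongr; linarith

theorem IsRoof.lintegral_τ_rpow_lt_top (hτ : T.IsRoof τ₀ β κ) (hβκ : β ≤ κ) (hβ1 : β ≤ 1) {γ : ℝ}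
    (hγ0 : 0 ≤ γ) (hγ : γ < β) : ∫⁻ y, ENNReal.ofReal (T.τ τ₀ y ^ γ) ∂T.μ < ∞ := by
  obtain ⟨C, hC⟩ := hτ.exists_tail hβκ
  have h1 := setLIntegral_rpow_lt_top hτ.measurable hτ.pos hγ0 (hγ.le.trans hβ1) hγ hC
  rw [Measure.restrict_univ, μX, lintegral_map ((hτ.measurable.pow_const γ).ennreal_ofReal)
    T.measurable_proj] at h1
  exact h1

variable (T τ₀) in
/-- The weight `(1 + φ ^ γ) e ^ (e σ)` that dominates all error terms. -/
def weight (γ e : ℝ) (z : T.Z) : ℝ := (1 + T.φ τ₀ z ^ γ) * Real.exp (e * T.σ z)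

theorem natCast_le_div_mul_exp {e : ℝ} (he : 0 < e) (n : ℕ) : (n : ℝ) ≤ e⁻¹ * Real.exp (e * n) := by
  have := Real.add_one_le_exp (e * n)
  rw [← div_eq_inv_mul, le_div_iff₀ he]
  linarith

theorem lintegral_comp_fst {u : T.Z → ℝ≥0∞} (hu : Measurable u) :
    ∫⁻ y : T.Y, u y.1.1 ∂T.μ = T.meanReturn⁻¹ * ∫⁻ z, T.σ z * u z ∂T.μZ := by
  rw [T.lintegral_μ (v := fun y => u y.1.1) (hu.comp (measurable_fst.comp measurable_subtype_coe))]
  congr 1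
  refine lintegral_congr fun z => ?_
  have h1 : ∀ l ∈ Finset.range (T.σ z), T.levelFn (fun y => u y.1.1) z l = u z := fun l hl =>
    T.levelFn_of_lt _ (Finset.mem_range.1 hl)
  rw [Finset.sum_congr rfl h1]
  simp

/-- The cases are a ≤ t^{γ'-γ} and its opposite. The inequality trades an unbounded factor a for a
slightly higher moment of t plus a pure power of a, so that no independence of the two is needed. -/
theorem mul_le_rpow_add_rpow {t a γ γ' : ℝ} (ht : 0 < t) (ha : 0 < a) (hγ : 0 < γ) (hγγ' : γ < γ') :
    t ^ γ * a ≤ t ^ γ' + a ^ (γ' / (γ' - γ)) := by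
  have hd : 0 < γ' - γ := by linarith
  rcases le_or_gt a (t ^ (γ' - γ)) with h | h
  · have : t ^ γ * a ≤ t ^ γ * t ^ (γ' - γ) := by gcongr
    rw [← Real.rpow_add ht, add_sub_cancel] at this
    have h2 : 0 ≤ a ^ (γ' / (γ' - γ)) := by positivity
    linarith
  · have h1 : t ≤ a ^ (γ' - γ)⁻¹ := by
      rw [Real.le_rpow_inv_iff_of_pos ht.le ha.le hd]
      exact h.le
    have h2 : t ^ γ * a ≤ (a ^ (γ' - γ)⁻¹) ^ γ * a := by gcongr
    have h3 : (a ^ (γ' - γ)⁻¹) ^ γ * a = a ^ (γ' / (γ' - γ)) := by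
      rw [← Real.rpow_mul ha.le]
      conv_lhs => rw [← Real.rpow_one a, ← Real.rpow_mul ha.le, one_mul, ← Real.rpow_add ha]
      congr 1
      field_simp
      ring
    have h4 : 0 ≤ t ^ γ' := by positivity
    linarith

theorem lintegral_σ_mul_exp_lt_top {d C e : ℝ} (hd : ∀ n : ℕ,
    T.μZ.real {z | n < T.σ z} ≤ C * Real.exp (-d * n)) (he : e < d) :
    ∫⁻ z, ENNReal.ofReal (T.σ z * Real.exp (e * T.σ z)) ∂T.μZ < ∞ := by
  have h1 : 0 < (d - e) / 2 := by linarith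
  have h2 := T.exists_lintegral_exp_lt_top hd (e := e + (d - e) / 2) (by linarith)
  refine lt_of_le_of_lt ?_ (ENNReal.mul_lt_top (ENNReal.ofReal_lt_top (r := ((d - e) / 2)⁻¹)) h2)
  rw [← lintegral_const_mul' _ _ ENNReal.ofReal_ne_top]
  refine lintegral_mono fun z => ?_
  rw [← ENNReal.ofReal_mul (by positivity)]
  refine ENNReal.ofReal_le_ofReal ?_
  rw [add_mul, Real.exp_add]
  nlinarith [natCast_le_div_mul_exp h1 (T.σ z), Real.exp_pos (e * T.σ z)]

theorem integrable_exp_σ {d C e : ℝ} (hd : ∀ n : ℕ,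
    T.μZ.real {z | n < T.σ z} ≤ C * Real.exp (-d * n)) (he : e < d) :
    Integrable (fun y : T.Y => Real.exp (e * T.σ y.1.1)) T.μ := by
  have hm : Measurable fun z => Real.exp (e * T.σ z) :=
    (measurable_of_countable fun n : ℕ => Real.exp (e * n)).comp T.measurable_σ
  refine ⟨(hm.comp (measurable_fst.comp measurable_subtype_coe)).aestronglyMeasurable, ?_⟩
  rw [HasFiniteIntegral, lintegral_comp_fst hm.enorm]
  refine ENNReal.mul_lt_top (ENNReal.inv_lt_top.2 (pos_iff_ne_zero.2 T.meanReturn_ne_zero)) ?_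
  refine lt_of_le_of_lt (lintegral_mono fun z => ?_) (lintegral_σ_mul_exp_lt_top hd he)
  rw [ENNReal.ofReal_mul (by positivity), ENNReal.ofReal_natCast,
    Real.enorm_of_nonneg (Real.exp_pos _).le]

theorem IsRoof.measurable_weight (hτ : T.IsRoof τ₀ β κ) (γ e : ℝ) :
    Measurable (T.weight τ₀ γ e) :=
  (measurable_const.add (hτ.measurable_φ.pow_const γ)).mul
    ((measurable_of_countable fun n : ℕ => Real.exp (e * n)).comp T.measurable_σ)

theorem IsRoof.weight_pos (hτ : T.IsRoof τ₀ β κ) (γ e : ℝ) (z : T.Z) : 0 < T.weight τ₀ γ e z := by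
  have := Real.rpow_pos_of_pos (hτ.φ_pos z) γ
  unfold weight
  positivity

/-- Subadditivity bounds φ^γ by the column sum of τ^γ, and each term times σe^{eσ} is split by
`mul_le_rpow_add_rpow`. The sum of τ^{γ'} is integrable since γ' < β, and the powers of σe^{eσ} are
integrable by the exponential tail. -/
theorem IsRoof.exists_lintegral_weight_lt_top (hτ : T.IsRoof τ₀ β κ) (hβκ : β ≤ κ) (hβ1 : β ≤ 1)
    {γ : ℝ} (hγ0 : 0 < γ) (hγ : γ < β) :
    ∃ e > 0, ∫⁻ z, ENNReal.ofReal (T.σ z * T.weight τ₀ γ e z) ∂T.μZ < ∞ := by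
  obtain ⟨d, hd, C, hC⟩ := T.exp_tail
  obtain ⟨γ', hγγ', hγ'⟩ := exists_between hγ
  set ρ := γ' / (γ' - γ) with hρ
  have hρ1 : 1 ≤ ρ := by rw [hρ, le_div_iff₀ (by linarith)]; linarith
  -- The ρ-th power of σe^{eσ} is bounded by a multiple of e^{2eρσ}, so 2eρ < d is required. Here
  -- 2eρ = d/3.
  set e := d / (6 * ρ) with he
  have he0 : 0 < e := by positivity
  refine ⟨e, he0, ?_⟩
  have hfin1 := hτ.lintegral_τ_rpow_lt_top hβκ hβ1 (hγ0.le.trans hγγ'.le) hγ'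
  rw [T.lintegral_μ ((hτ.measurable_τ.pow_const γ').ennreal_ofReal)] at hfin1
  have hfin2 : ∫⁻ z, ∑ l ∈ Finset.range (T.σ z),
      T.levelFn (fun y => ENNReal.ofReal (T.τ τ₀ y ^ γ')) z l ∂T.μZ < ∞ := by
    by_contra hc
    rw [not_lt, top_le_iff] at hc
    rw [hc, ENNReal.mul_top (ENNReal.inv_ne_zero.2 T.meanReturn_ne_top)] at hfin1
    exact lt_irrefl _ hfin1
  have hfin3 := lintegral_σ_mul_exp_lt_top hC (e := 2 * e * ρ) (by
    rw [he]; field_simp; linarith)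
  have hfin4 := lintegral_σ_mul_exp_lt_top hC (e := e) (by
    rw [he, div_lt_iff₀ (by positivity)]; nlinarith)
  have hpt : ∀ z, ENNReal.ofReal (T.σ z * T.weight τ₀ γ e z) ≤
      (∑ l ∈ Finset.range (T.σ z), T.levelFn (fun y => ENNReal.ofReal (T.τ τ₀ y ^ γ')) z l) +
      (ENNReal.ofReal (e⁻¹ ^ ρ) * ENNReal.ofReal (T.σ z * Real.exp (2 * e * ρ * T.σ z)) +
        ENNReal.ofReal (T.σ z * Real.exp (e * T.σ z))) := by
    intro z
    have hsum : ∑ l ∈ Finset.range (T.σ z), T.levelFn (fun y => ENNReal.ofReal (T.τ τ₀ y ^ γ')) z l =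
        ENNReal.ofReal (∑ l ∈ Finset.range (T.σ z), τ₀ (T.f^[l] (z : X)) ^ γ') := by
      rw [ENNReal.ofReal_sum_of_nonneg fun _ _ => Real.rpow_nonneg (hτ.pos _).le _]
      exact Finset.sum_congr rfl fun l hl => T.levelFn_of_lt _ (Finset.mem_range.1 hl)
    have hp1 : ∀ l, 0 ≤ τ₀ (T.f^[l] (z : X)) ^ γ' := fun l => Real.rpow_nonneg (hτ.pos _).le _
    rw [hsum, ← ENNReal.ofReal_mul (by positivity), ← ENNReal.ofReal_add (by positivity)
      (by positivity), ← ENNReal.ofReal_add (Finset.sum_nonneg fun l _ => hp1 l) (by positivity)]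
    refine ENNReal.ofReal_le_ofReal ?_
    have hσ : (0 : ℝ) < T.σ z := by exact_mod_cast T.σ_pos z
    set a := (T.σ z : ℝ) * Real.exp (e * T.σ z) with ha
    have ha0 : 0 < a := by positivity
    have ha1 : a ^ ρ ≤ e⁻¹ ^ ρ * Real.exp (2 * e * ρ * T.σ z) := by
      have h1 : a ≤ e⁻¹ * Real.exp (2 * e * T.σ z) := by
        have := mul_le_mul_of_nonneg_right (natCast_le_div_mul_exp he0 (T.σ z))
          (Real.exp_pos (e * T.σ z)).le
        rw [mul_assoc, ← Real.exp_add] at this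
        refine this.trans (le_of_eq ?_)
        congr 2
        ring
      calc a ^ ρ ≤ (e⁻¹ * Real.exp (2 * e * T.σ z)) ^ ρ :=
            Real.rpow_le_rpow ha0.le h1 (by linarith)
        _ = _ := by
            rw [Real.mul_rpow (by positivity) (Real.exp_pos _).le, ← Real.exp_mul]
            congr 2
            ring
    have hφ : T.φ τ₀ z ^ γ ≤ ∑ l ∈ Finset.range (T.σ z), τ₀ (T.f^[l] (z : X)) ^ γ :=
      rpow_sum_le_sum_rpow hγ0 (hγ.le.trans hβ1) _ fun j => (hτ.pos _).le
    calc (T.σ z : ℝ) * T.weight τ₀ γ e z = a + T.φ τ₀ z ^ γ * a := by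
          rw [weight, ha]; ring
      _ ≤ a + ∑ l ∈ Finset.range (T.σ z), τ₀ (T.f^[l] (z : X)) ^ γ * a := by
          rw [← Finset.sum_mul]; gcongr
      _ ≤ a + ∑ l ∈ Finset.range (T.σ z), (τ₀ (T.f^[l] (z : X)) ^ γ' +
            e⁻¹ ^ ρ * Real.exp (2 * e * ρ * T.σ z)) := by
          gcongr with l _
          exact (mul_le_rpow_add_rpow (hτ.pos _) ha0 hγ0 hγγ').trans (by gcongr)
      _ = _ := by
          rw [Finset.sum_add_distrib, Finset.sum_const, Finset.card_range, nsmul_eq_mul]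
          ring
  refine (lintegral_mono hpt).trans_lt ?_
  have hmm : ∀ c : ℝ, Measurable fun z => ENNReal.ofReal (T.σ z * Real.exp (c * T.σ z)) := fun c =>
    (measurable_of_countable fun n : ℕ => ENNReal.ofReal (n * Real.exp (c * n))).comp T.measurable_σ
  have hA : Measurable fun z => ENNReal.ofReal (e⁻¹ ^ ρ) *
      ENNReal.ofReal (T.σ z * Real.exp (2 * e * ρ * T.σ z)) +
        ENNReal.ofReal (T.σ z * Real.exp (e * T.σ z)) := ((hmm _).const_mul _).add (hmm _)
  rw [lintegral_add_right _ hA, lintegral_add_right _ (hmm _),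
    lintegral_const_mul _ (hmm _)]
  exact ENNReal.add_lt_top.2 ⟨hfin2, ENNReal.add_lt_top.2
    ⟨ENNReal.mul_lt_top ENNReal.ofReal_lt_top hfin3, hfin4⟩⟩

theorem IsRoof.exists_integrable_weight (hτ : T.IsRoof τ₀ β κ) (hβκ : β ≤ κ) (hβ1 : β ≤ 1)
    {γ : ℝ} (hγ0 : 0 < γ) (hγ : γ < β) :
    ∃ e > 0, ∀ e' ≤ e, Integrable (T.weight τ₀ γ e') T.μZ ∧
      Integrable (fun y : T.Y => T.weight τ₀ γ e' y.1.1) T.μ := by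
  obtain ⟨e, he, hfin⟩ := hτ.exists_lintegral_weight_lt_top hβκ hβ1 hγ0 hγ
  have hm := hτ.measurable_weight (T := T) γ
  have hZ : Integrable (T.weight τ₀ γ e) T.μZ := by
    refine ⟨(hm e).aestronglyMeasurable, lt_of_le_of_lt (lintegral_mono fun z => ?_) hfin⟩
    rw [Real.enorm_of_nonneg (hτ.weight_pos γ e z).le]
    refine ENNReal.ofReal_le_ofReal (le_mul_of_one_le_left (hτ.weight_pos γ e z).le ?_)
    exact_mod_cast T.σ_pos z
  have hY : Integrable (fun y : T.Y => T.weight τ₀ γ e y.1.1) T.μ := by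
    refine ⟨((hm e).comp (measurable_fst.comp measurable_subtype_coe)).aestronglyMeasurable, ?_⟩
    rw [HasFiniteIntegral, lintegral_comp_fst (hm e).enorm]
    refine ENNReal.mul_lt_top (ENNReal.inv_lt_top.2 (pos_iff_ne_zero.2 T.meanReturn_ne_zero)) ?_
    refine lt_of_le_of_lt (lintegral_mono fun z => ?_) hfin
    rw [Real.enorm_of_nonneg (hτ.weight_pos γ e z).le, ENNReal.ofReal_mul (by positivity),
      ENNReal.ofReal_natCast]
  have hle : ∀ e' ≤ e, ∀ z, ‖T.weight τ₀ γ e' z‖ ≤ T.weight τ₀ γ e z := fun e' he' z => by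
    rw [Real.norm_of_nonneg (hτ.weight_pos γ e' z).le]
    have := Real.rpow_pos_of_pos (hτ.φ_pos z) γ
    unfold weight
    gcongr
  exact ⟨e, he, fun e' he' => ⟨hZ.mono' (hm e').aestronglyMeasurable
    (Filter.Eventually.of_forall (hle e' he')), hY.mono'
    ((hm e').comp (measurable_fst.comp measurable_subtype_coe)).aestronglyMeasurable
    (Filter.Eventually.of_forall fun y => hle e' he' y.1.1)⟩⟩

/-- Sums over the partition are controlled by integrals. -/
theorem summable_of_le_integrable {u : T.Z → ℝ} (hu : Integrable u T.μZ) {V : T.α → ℝ} {K : ℝ}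
    (hV0 : ∀ a, 0 ≤ V a) (hV : ∀ a : T.α, ∀ z ∈ a.1, V a ≤ K * u z) :
    Summable fun a : T.α => V a * T.μZ.real a.1 := by
  have := T.isFullBranch.countable.to_subtype
  have hm : ∀ a : T.α, MeasurableSet a.1 := fun a => T.isFullBranch.measurableSet a a.2
  have h1 := (hasSum_integral_iUnion hm T.isFullBranch.pairwise_disjoint
    (f := fun z => K * u z) (hu.const_mul K).integrableOn).summable
  refine Summable.of_nonneg_of_le (fun a => mul_nonneg (hV0 a) measureReal_nonneg) (fun a => ?_) h1
  calc V a * T.μZ.real a.1 = ∫ _ in a.1, V a ∂T.μZ := by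
        rw [setIntegral_const, smul_eq_mul, mul_comm]
    _ ≤ _ := setIntegral_mono_on (integrable_const _) (hu.const_mul K).integrableOn (hm a) (hV a)

variable (T τ₀) in
/-- The infimum of `φ` over a partition element. -/
def phiInf (a : T.α) : ℝ := sInf (T.φ τ₀ '' a.1)

theorem IsRoof.phiInf_nonneg (hτ : T.IsRoof τ₀ β κ) (a : T.α) : 0 ≤ T.phiInf τ₀ a :=
  Real.sInf_nonneg (by rintro _ ⟨z, -, rfl⟩; exact (hτ.φ_pos z).le)

theorem IsRoof.phiInf_le (hτ : T.IsRoof τ₀ β κ) {a : T.α} {z : T.Z} (hz : z ∈ a.1) :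
    T.phiInf τ₀ a ≤ T.φ τ₀ z :=
  csInf_le ⟨0, by rintro _ ⟨z, -, rfl⟩; exact (hτ.φ_pos z).le⟩ ⟨z, hz, rfl⟩

/-- The Hölder constant of the roof function. -/
def IsRoof.holderConst (hτ : T.IsRoof τ₀ β κ) : ℝ := hτ.holder.choose

theorem IsRoof.holderConst_pos (hτ : T.IsRoof τ₀ β κ) : 0 < hτ.holderConst :=
  hτ.holder.choose_spec.1

theorem IsRoof.abs_birk_sub_le (hτ : T.IsRoof τ₀ β κ) (a : T.α) {z z' : T.Z} (hz : z ∈ a.1)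
    (hz' : z' ∈ a.1) {l : ℕ} (hl : l ≤ T.σ z) : |T.birk τ₀ l z - T.birk τ₀ l z'| ≤
      hτ.holderConst * T.phiInf τ₀ a * symbDist T.G T.α θ₀ z z' :=
  hτ.holder.choose_spec.2 a a.2 z hz z' hz' l hl

theorem IsRoof.abs_φ_sub_le (hτ : T.IsRoof τ₀ β κ) (a : T.α) {z z' : T.Z} (hz : z ∈ a.1)
    (hz' : z' ∈ a.1) : |T.φ τ₀ z - T.φ τ₀ z'| ≤
      hτ.holderConst * T.phiInf τ₀ a * symbDist T.G T.α θ₀ z z' := by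
  have := hτ.abs_birk_sub_le a hz hz' (l := T.σ z) le_rfl
  rwa [φ, φ, ← T.σ_const a a.2 z hz z' hz']

/-- An element has diameter at most 1, so the Hölder condition makes φ comparable with its infimum.
Bounds valid at one point can thus be summed over the partition. -/
theorem IsRoof.φ_le (hτ : T.IsRoof τ₀ β κ) (hθ₀ : θ₀ ∈ Ioo (0 : ℝ) 1) {a : T.α} {z : T.Z}
    (hz : z ∈ a.1) : T.φ τ₀ z ≤ (1 + hτ.holderConst) * T.phiInf τ₀ a := by
  have h1 : T.φ τ₀ z - hτ.holderConst * T.phiInf τ₀ a ≤ T.phiInf τ₀ a := by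
    refine le_csInf ⟨_, z, hz, rfl⟩ ?_
    rintro _ ⟨z', hz', rfl⟩
    have h2 := (le_abs_self _).trans (hτ.abs_φ_sub_le a hz hz')
    have h3 := mul_le_of_le_one_right (mul_nonneg hτ.holderConst_pos.le (hτ.phiInf_nonneg a))
      (symbDist_le_one (G := T.G) (α := T.α) hθ₀.1.le hθ₀.2.le z z')
    linarith
  linarith

end YoungTower
end

/-! ### Fractional-power estimates for e^{-sφ} on the branches. -/

noncomputable section

/-- Interpolation between the linear bound for ‖w - w'‖ ≤ 1 and the trivial bound 2. The fractional
exponent is indispensable because φ has moments only of order below β < 1. -/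
theorem norm_cexp_sub_cexp_le {w w' : ℂ} (hw : w.re ≤ 0) (hw' : w'.re ≤ 0) {γ : ℝ} (hγ0 : 0 ≤ γ)
    (hγ1 : γ ≤ 1) : ‖Complex.exp w - Complex.exp w'‖ ≤ 2 * ‖w - w'‖ ^ γ := by
  have h1 : ‖Complex.exp w‖ ≤ 1 := by rw [Complex.norm_exp]; exact Real.exp_le_one_iff.2 hw
  have h1' : ‖Complex.exp w'‖ ≤ 1 := by rw [Complex.norm_exp]; exact Real.exp_le_one_iff.2 hw'
  rcases le_or_gt ‖w - w'‖ 1 with h | h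
  · have e : Complex.exp w - Complex.exp w' = Complex.exp w' * (Complex.exp (w - w') - 1) := by
      rw [mul_sub, ← Complex.exp_add, add_sub_cancel, mul_one]
    have h2 := Complex.norm_exp_sub_one_le h
    have h3 : ‖w - w'‖ ≤ ‖w - w'‖ ^ γ := by
      rcases (norm_nonneg (w - w')).eq_or_lt with h0 | h0
      · rw [← h0]; exact Real.rpow_nonneg le_rfl _
      · simpa using Real.rpow_le_rpow_of_exponent_ge h0 h hγ1
    rw [e, norm_mul]
    calc _ ≤ 1 * (2 * ‖w - w'‖) := mul_le_mul h1' h2 (norm_nonneg _) zero_le_one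
      _ ≤ _ := by linarith
  · have h2 := Real.one_le_rpow h.le hγ0
    calc _ ≤ ‖Complex.exp w‖ + ‖Complex.exp w'‖ := norm_sub_le _ _
      _ ≤ _ := by linarith

theorem norm_cexp_neg_mul_le_one {s : ℂ} (hs : 0 ≤ s.re) {t : ℝ} (ht : 0 ≤ t) :
    ‖Complex.exp (-s * t)‖ ≤ 1 := by
  rw [Complex.norm_exp]
  refine Real.exp_le_one_iff.2 ?_
  simpa using mul_nonneg hs ht

theorem re_neg_mul_nonpos {s : ℂ} (hs : 0 ≤ s.re) {t : ℝ} (ht : 0 ≤ t) : (-s * (t : ℂ)).re ≤ 0 := by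
  simpa using mul_nonneg hs ht

theorem norm_cexp_neg_mul_sub_le {s s' : ℂ} (hs : 0 ≤ s.re) (hs' : 0 ≤ s'.re) {t : ℝ} (ht : 0 ≤ t)
    {γ : ℝ} (hγ0 : 0 ≤ γ) (hγ1 : γ ≤ 1) :
    ‖Complex.exp (-s * t) - Complex.exp (-s' * t)‖ ≤ 2 * (‖s - s'‖ * t) ^ γ := by
  refine (norm_cexp_sub_cexp_le (re_neg_mul_nonpos hs ht) (re_neg_mul_nonpos hs' ht)
    hγ0 hγ1).trans (le_of_eq ?_)
  rw [← sub_mul, norm_mul, Complex.norm_real, Real.norm_of_nonneg ht, neg_sub_neg, norm_sub_rev]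

theorem norm_cexp_neg_mul_sub_le' {s : ℂ} (hs : 0 ≤ s.re) {t t' : ℝ} (ht : 0 ≤ t) (ht' : 0 ≤ t')
    {γ : ℝ} (hγ0 : 0 ≤ γ) (hγ1 : γ ≤ 1) :
    ‖Complex.exp (-s * t) - Complex.exp (-s * t')‖ ≤ 2 * (‖s‖ * |t - t'|) ^ γ := by
  refine (norm_cexp_sub_cexp_le (re_neg_mul_nonpos hs ht) (re_neg_mul_nonpos hs ht')
    hγ0 hγ1).trans (le_of_eq ?_)
  rw [← mul_sub, norm_mul, ← Complex.ofReal_sub, Complex.norm_real, norm_neg, Real.norm_eq_abs]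

theorem norm_cexp_neg_mul_sub_one_le {s : ℂ} (hs : 0 ≤ s.re) {t : ℝ} (ht : 0 ≤ t)
    {γ : ℝ} (hγ0 : 0 ≤ γ) (hγ1 : γ ≤ 1) :
    ‖Complex.exp (-s * t) - 1‖ ≤ 2 * (‖s‖ * t) ^ γ := by
  simpa using norm_cexp_neg_mul_sub_le (s' := 0) hs le_rfl ht hγ0 hγ1

/-- Writing e^{-wt} = e^{-wt'} e^{-w(t-t')} for w = s and w = s' splits the double difference into
two products. The factor ‖s‖^γ is kept on purpose: for s' = 0 and small s the bound has full order
‖s‖^γ, although for general s' only the exponent κ is available. The price is a moment of order γ +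
κ. -/
theorem norm_cexp_second_difference_le {s s' : ℂ} (hs : 0 ≤ s.re) (hs' : 0 ≤ s'.re) {t t' M : ℝ}
    (ht : 0 ≤ t) (ht' : 0 ≤ t') (htM : t ≤ M) (htM' : t' ≤ M) {γ κ : ℝ} (hγ0 : 0 ≤ γ) (hγ1 : γ ≤ 1)
    (hκ0 : 0 ≤ κ) (hκ1 : κ ≤ 1) :
    ‖(Complex.exp (-s * t) - Complex.exp (-s' * t)) -
      (Complex.exp (-s * t') - Complex.exp (-s' * t'))‖ ≤
      4 * (‖s - s'‖ * M) ^ κ * (‖s‖ * |t - t'|) ^ γ + 2 * (‖s - s'‖ * |t - t'|) ^ γ := by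
  wlog h : t' ≤ t generalizing t t'
  · have := this ht' ht htM' htM (le_of_not_ge h)
    rwa [norm_sub_rev, abs_sub_comm] at this
  have hh : 0 ≤ t - t' := sub_nonneg.2 h
  have e : (Complex.exp (-s * t) - Complex.exp (-s' * t)) -
      (Complex.exp (-s * t') - Complex.exp (-s' * t')) =
      (Complex.exp (-s * t') - Complex.exp (-s' * t')) *
        (Complex.exp (-s * (t - t' : ℝ)) - 1) + Complex.exp (-s' * t') *
        (Complex.exp (-s * (t - t' : ℝ)) - Complex.exp (-s' * (t - t' : ℝ))) := by
    have e1 : ∀ w : ℂ, Complex.exp (-w * t) = Complex.exp (-w * t') *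
        Complex.exp (-w * (t - t' : ℝ)) := fun w => by
      rw [← Complex.exp_add]; congr 1; push_cast; ring
    rw [e1 s, e1 s']
    ring
  rw [e]
  refine (norm_add_le _ _).trans ?_
  rw [norm_mul, norm_mul, abs_of_nonneg hh]
  have b1 := norm_cexp_neg_mul_sub_le hs hs' ht' hκ0 hκ1
  have b1' : 2 * (‖s - s'‖ * t') ^ κ ≤ 2 * (‖s - s'‖ * M) ^ κ := by gcongr
  have b2 := norm_cexp_neg_mul_sub_one_le hs hh hγ0 hγ1
  have b3 := norm_cexp_neg_mul_le_one hs' ht'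
  have b4 := norm_cexp_neg_mul_sub_le hs hs' hh hγ0 hγ1
  have hM : 0 ≤ M := ht.trans htM
  have b5 := mul_le_mul (b1.trans b1') b2 (norm_nonneg _) (by positivity)
  have b6 := mul_le_mul b3 b4 (norm_nonneg _) zero_le_one
  linarith

theorem norm_pow_sub_pow_le {x y : ℂ} {r : ℝ} (hr : 1 ≤ r) (hx : ‖x‖ ≤ r) (hy : ‖y‖ ≤ r) (n : ℕ) :
    ‖x ^ n - y ^ n‖ ≤ n * r ^ n * ‖x - y‖ := by
  induction n with
  | zero => simp
  | succ n ih =>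
    have e : x ^ (n + 1) - y ^ (n + 1) = x ^ n * (x - y) + (x ^ n - y ^ n) * y := by ring
    rw [e]
    refine (norm_add_le _ _).trans ?_
    rw [norm_mul, norm_mul, norm_pow]
    have h1 : ‖x‖ ^ n ≤ r ^ (n + 1) :=
      (pow_le_pow_left₀ (norm_nonneg _) hx n).trans (pow_le_pow_right₀ hr (Nat.le_succ n))
    have h2 := mul_le_mul ih hy (norm_nonneg _) (by positivity)
    have h3 := mul_le_mul_of_nonneg_right h1 (norm_nonneg (x - y))
    push_cast
    calc _ ≤ r ^ (n + 1) * ‖x - y‖ + n * r ^ n * ‖x - y‖ * r := add_le_add h3 h2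
      _ = _ := by ring

theorem exists_inverse_bound {A : Type*} [NormedRing A] [CompleteSpace A] {a₀ : A}
    (h : IsUnit a₀) : ∃ ρ > 0, ∃ C > 0, ∀ a : A, ‖a - a₀‖ < ρ → IsUnit a ∧ ‖Ring.inverse a‖ ≤ C := by
  obtain ⟨u, rfl⟩ := h
  have h1 : ∀ᶠ a in nhds (u : A), IsUnit a := Units.isOpen.mem_nhds u.isUnit
  have h2 : ∀ᶠ a in nhds (u : A), ‖Ring.inverse a‖ < ‖Ring.inverse (u : A)‖ + 1 :=
    (NormedRing.inverse_continuousAt u).norm.eventually_lt_const (lt_add_one _)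
  obtain ⟨ρ, hρ, hb⟩ := Metric.eventually_nhds_iff.1 (h1.and h2)
  exact ⟨ρ, hρ, ‖Ring.inverse (u : A)‖ + 1, by positivity, fun a ha =>
    ⟨(hb (by rwa [dist_eq_norm])).1, (hb (by rwa [dist_eq_norm])).2.le⟩⟩

theorem norm_inverse_sub_inverse_le {A : Type*} [NormedRing A] {a b : A} (ha : IsUnit a)
    (hb : IsUnit b) {C : ℝ} (hC : ‖Ring.inverse a‖ ≤ C) (hC' : ‖Ring.inverse b‖ ≤ C) :
    ‖Ring.inverse a - Ring.inverse b‖ ≤ C * C * ‖a - b‖ := by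
  have e : Ring.inverse a - Ring.inverse b = Ring.inverse a * (b - a) * Ring.inverse b := by
    rw [mul_sub, sub_mul, Ring.inverse_mul_cancel _ ha, one_mul, mul_assoc,
      Ring.mul_inverse_cancel _ hb, mul_one]
  rw [e]
  have hC0 : 0 ≤ C := (norm_nonneg _).trans hC
  calc _ ≤ ‖Ring.inverse a‖ * ‖b - a‖ * ‖Ring.inverse b‖ :=
        (norm_mul_le _ _).trans (mul_le_mul_of_nonneg_right (norm_mul_le _ _) (norm_nonneg _))
    _ ≤ C * ‖b - a‖ * C := by gcongr
    _ = _ := by rw [norm_sub_rev]; ring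

namespace YoungTower

open IsFullBranchGibbsMarkov LipSpace

variable {X : Type*} [MeasurableSpace X] {θ₀ : ℝ} {T : YoungTower X θ₀} {τ₀ : X → ℝ} {β κ : ℝ}

variable (T) in
/-- The return time on a partition element. -/
def sigmaAt (a : T.α) : ℕ := T.σ (T.isFullBranch.branch a (T.μZ.nonempty_of_neZero).some)

theorem σ_eq_sigmaAt {a : T.α} {z : T.Z} (hz : z ∈ a.1) : T.σ z = T.sigmaAt a :=
  T.σ_const a a.2 z hz _ (T.isFullBranch.branch_mem a _)

variable (T τ₀) in
/-- The weight `(1 + (inf φ) ^ γ) e ^ (e σ)` of a partition element. -/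
def weightInf (γ e : ℝ) (a : T.α) : ℝ := (1 + T.phiInf τ₀ a ^ γ) * Real.exp (e * T.sigmaAt a)

theorem IsRoof.weightInf_pos (hτ : T.IsRoof τ₀ β κ) (γ e : ℝ) (a : T.α) :
    0 < T.weightInf τ₀ γ e a := by
  have := Real.rpow_nonneg (hτ.phiInf_nonneg a) γ
  unfold weightInf
  positivity

theorem IsRoof.exp_le_weightInf (hτ : T.IsRoof τ₀ β κ) (γ e : ℝ) (a : T.α) :
    Real.exp (e * T.sigmaAt a) ≤ T.weightInf τ₀ γ e a :=
  le_mul_of_one_le_left (Real.exp_pos _).le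
    (le_add_of_nonneg_right (Real.rpow_nonneg (hτ.phiInf_nonneg a) γ))

theorem IsRoof.rpow_mul_exp_le_weightInf (hτ : T.IsRoof τ₀ β κ) {γ γ' : ℝ} (hγ : 0 ≤ γ)
    (hγγ' : γ ≤ γ') (e : ℝ) (a : T.α) :
    T.phiInf τ₀ a ^ γ * Real.exp (e * T.sigmaAt a) ≤ T.weightInf τ₀ γ' e a := by
  have h0 := hτ.phiInf_nonneg a
  refine mul_le_mul_of_nonneg_right ?_ (Real.exp_pos _).le
  rcases le_or_gt (T.phiInf τ₀ a) 1 with h | h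
  · have := Real.rpow_le_one h0 h hγ
    have := Real.rpow_nonneg h0 γ'
    linarith
  · have := Real.rpow_le_rpow_of_exponent_le h.le hγγ'
    linarith

theorem IsRoof.summable_weightInf (hτ : T.IsRoof τ₀ β κ) {γ e : ℝ} (hγ : 0 ≤ γ)
    (hi : Integrable (T.weight τ₀ γ e) T.μZ) :
    Summable fun a : T.α => T.weightInf τ₀ γ e a * T.μZ.real a.1 := by
  refine summable_of_le_integrable hi (K := 1) (fun a => (hτ.weightInf_pos γ e a).le)
    fun a z hz => ?_
  have h0 := hτ.phiInf_nonneg a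
  have h1 := hτ.phiInf_le hz
  rw [one_mul, weight, weightInf, σ_eq_sigmaAt hz]
  gcongr

theorem symbDist_rpow_le {Z : Type*} {G : Z → Z} {α : Set (Set Z)} {θ γ : ℝ} (hθ₀ : 0 < θ₀)
    (hγ : 0 < γ) (h : θ₀ ^ γ ≤ θ) (z z' : Z) :
    symbDist G α θ₀ z z' ^ γ ≤ symbDist G α θ z z' := by
  rw [symbDist_rpow hθ₀.le hγ]
  exact symbDist_mono (by positivity) h z z'

/-- Differences controlled by the Hölder condition, raised to a small power. -/
theorem rpow_le_of_holder (hθ₀ : 0 < θ₀) {Z : Type*} {G : Z → Z}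
    {α : Set (Set Z)} {θ γ H Φ h : ℝ} (hγ0 : 0 < γ) (hγ1 : γ ≤ 1) (hγθ : θ₀ ^ γ ≤ θ) {z z' : Z}
    (hH : 0 ≤ H) (hΦ : 0 ≤ Φ) (h0 : 0 ≤ h) (hh : h ≤ H * Φ * symbDist G α θ₀ z z') :
    h ^ γ ≤ (1 + H) * Φ ^ γ * symbDist G α θ z z' := by
  have hd := symbDist_nonneg (G := G) (α := α) hθ₀.le z z'
  calc h ^ γ ≤ (H * Φ * symbDist G α θ₀ z z') ^ γ := Real.rpow_le_rpow h0 hh hγ0.le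
    _ = H ^ γ * Φ ^ γ * symbDist G α θ₀ z z' ^ γ := by
        rw [Real.mul_rpow (by positivity) hd, Real.mul_rpow hH hΦ]
    _ ≤ (1 + H) * Φ ^ γ * symbDist G α θ z z' := by
        have h1 : H ^ γ ≤ 1 + H := by
          calc H ^ γ ≤ (1 + H) ^ γ := by gcongr; linarith
            _ ≤ (1 + H) ^ (1 : ℝ) := by gcongr; linarith
            _ = 1 + H := Real.rpow_one _
        have h2 := symbDist_rpow_le (G := G) (α := α) hθ₀ hγ0 hγθ z z'
        gcongr

theorem IsRoof.abs_φ_branch_sub_le (hτ : T.IsRoof τ₀ β κ) (hθ₀ : θ₀ ∈ Ioo (0 : ℝ) 1) (a : T.α)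
    (z z' : T.Z) :
    |T.φ τ₀ (T.isFullBranch.branch a z) - T.φ τ₀ (T.isFullBranch.branch a z')| ≤
      hτ.holderConst * T.phiInf τ₀ a * symbDist T.G T.α θ₀ z z' := by
  refine (hτ.abs_φ_sub_le a (T.isFullBranch.branch_mem a z)
    (T.isFullBranch.branch_mem a z')).trans ?_
  rw [T.isFullBranch.symbDist_branch]
  exact mul_le_mul_of_nonneg_left
    (mul_le_of_le_one_left (symbDist_nonneg hθ₀.1.le z z') hθ₀.2.le)
    (mul_nonneg hτ.holderConst_pos.le (hτ.phiInf_nonneg a))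

/-- The supremum over an element costs e^{eσ}. The Lipschitz constant costs in addition (inf φ)^γ,
from the γ-th power of the Hölder condition. Both are below the weight, which is summable against
the measure. -/
theorem IsRoof.branchBound_coeff_mul_exp (hτ : T.IsRoof τ₀ β κ) (hθ₀ : θ₀ ∈ Ioo (0 : ℝ) 1)
    {θ γ γ₁ e B : ℝ} (hγ0 : 0 < γ) (hγ1 : γ ≤ 1) (hγγ : γ ≤ γ₁) (hγθ : θ₀ ^ γ ≤ θ)
    (hi : Integrable (T.weight τ₀ γ₁ e) T.μZ) {c : ℕ → ℂ} (hc : ∀ n, ‖c n‖ ≤ B * Real.exp (e * n))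
    {s : ℂ} (hs : 0 ≤ s.re) (hs1 : ‖s‖ ≤ 1) :
    T.isFullBranch.BranchBound θ (fun z => c (T.σ z) * Complex.exp (-s * T.φ τ₀ z))
      (fun a => B * (2 * (1 + hτ.holderConst)) * T.weightInf τ₀ γ₁ e a) where
  bound a z := by
    have hH := hτ.holderConst_pos
    have hB : 0 ≤ B := by simpa using (norm_nonneg _).trans (hc 0)
    rw [norm_mul, σ_eq_sigmaAt (T.isFullBranch.branch_mem a z)]
    have h1 := mul_le_mul (hc (T.sigmaAt a)) (norm_cexp_neg_mul_le_one hs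
      (hτ.φ_pos (T.isFullBranch.branch a z)).le) (norm_nonneg _) (by positivity)
    have h2 := hτ.exp_le_weightInf γ₁ e a
    have h3 := (hτ.weightInf_pos γ₁ e a).le
    calc _ ≤ B * Real.exp (e * T.sigmaAt a) * 1 := h1
      _ ≤ B * T.weightInf τ₀ γ₁ e a := by rw [mul_one]; gcongr
      _ ≤ _ := by
        rw [mul_assoc]
        gcongr
        exact le_mul_of_one_le_left h3 (by linarith)
  lip a z z' := by
    have hH := hτ.holderConst_pos
    have hB : 0 ≤ B := by simpa using (norm_nonneg _).trans (hc 0)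
    have hΦ := hτ.phiInf_nonneg a
    have hθp : 0 ≤ θ := (Real.rpow_nonneg hθ₀.1.le γ).trans hγθ
    have hd := symbDist_nonneg (G := T.G) (α := T.α) hθp z z'
    rw [σ_eq_sigmaAt (T.isFullBranch.branch_mem a z), σ_eq_sigmaAt (T.isFullBranch.branch_mem a z'),
      ← mul_sub, norm_mul]
    have h1 := norm_cexp_neg_mul_sub_le' hs (hτ.φ_pos (T.isFullBranch.branch a z)).le
      (hτ.φ_pos (T.isFullBranch.branch a z')).le hγ0.le hγ1
    have h2 := rpow_le_of_holder hθ₀.1 hγ0 hγ1 hγθ hH.le hΦ (abs_nonneg _)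
      (hτ.abs_φ_branch_sub_le hθ₀ a z z')
    have h3 := hτ.rpow_mul_exp_le_weightInf hγ0.le hγγ e a
    set h := |T.φ τ₀ (T.isFullBranch.branch a z) - T.φ τ₀ (T.isFullBranch.branch a z')|
    have h4 : (‖s‖ * h) ^ γ ≤ h ^ γ := by
      gcongr
      exact mul_le_of_le_one_left (abs_nonneg _) hs1
    calc _ ≤ B * Real.exp (e * T.sigmaAt a) *
          (2 * ((1 + hτ.holderConst) * T.phiInf τ₀ a ^ γ * symbDist T.G T.α θ z z')) :=
          mul_le_mul (hc _) (h1.trans (by linarith)) (norm_nonneg _) (by positivity)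
      _ = B * (2 * (1 + hτ.holderConst)) * (T.phiInf τ₀ a ^ γ * Real.exp (e * T.sigmaAt a)) *
          symbDist T.G T.α θ z z' := by ring
      _ ≤ _ := by gcongr
  summable := by
    simpa only [mul_assoc] using (hτ.summable_weightInf (hγ0.le.trans hγγ) hi).mul_left
      (B * (2 * (1 + hτ.holderConst)))

theorem IsRoof.branchBound_coeff_mul_exp_sub (hτ : T.IsRoof τ₀ β κ) (hθ₀ : θ₀ ∈ Ioo (0 : ℝ) 1)
    {θ γ κ₁ e B : ℝ} (hγ0 : 0 < γ) (hκ0 : 0 < κ₁) (hγκ : γ + κ₁ ≤ 1) (hγθ : θ₀ ^ γ ≤ θ)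
    (hi : Integrable (T.weight τ₀ (γ + κ₁) e) T.μZ) {c : ℕ → ℂ}
    (hc : ∀ n, ‖c n‖ ≤ B * Real.exp (e * n)) {s s' : ℂ} (hs : 0 ≤ s.re) (hs' : 0 ≤ s'.re) :
    T.isFullBranch.BranchBound θ
      (fun z => c (T.σ z) * (Complex.exp (-s * T.φ τ₀ z) - Complex.exp (-s' * T.φ τ₀ z)))
      (fun a => B * (4 * (1 + hτ.holderConst) * (‖s - s'‖ ^ κ₁ * ‖s‖ ^ γ + ‖s - s'‖ ^ γ)) *
        T.weightInf τ₀ (γ + κ₁) e a) where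
  bound a z := by
    have hH := hτ.holderConst_pos
    have hB : 0 ≤ B := by simpa using (norm_nonneg _).trans (hc 0)
    have hΦ := hτ.phiInf_nonneg a
    rw [norm_mul, σ_eq_sigmaAt (T.isFullBranch.branch_mem a z)]
    have hz := T.isFullBranch.branch_mem a z
    have h1 := norm_cexp_neg_mul_sub_le hs hs' (hτ.φ_pos (T.isFullBranch.branch a z)).le hγ0.le
      (by linarith : γ ≤ 1)
    have h2 : (‖s - s'‖ * T.φ τ₀ (T.isFullBranch.branch a z)) ^ γ ≤
        ‖s - s'‖ ^ γ * ((1 + hτ.holderConst) * T.phiInf τ₀ a ^ γ) := by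
      rw [Real.mul_rpow (norm_nonneg _) (hτ.φ_pos _).le]
      gcongr
      calc _ ≤ ((1 + hτ.holderConst) * T.phiInf τ₀ a) ^ γ :=
            Real.rpow_le_rpow (hτ.φ_pos _).le (hτ.φ_le hθ₀ hz) hγ0.le
        _ = (1 + hτ.holderConst) ^ γ * T.phiInf τ₀ a ^ γ := Real.mul_rpow (by linarith) hΦ
        _ ≤ (1 + hτ.holderConst) ^ (1 : ℝ) * T.phiInf τ₀ a ^ γ := by
            gcongr <;> linarith
        _ = _ := by rw [Real.rpow_one]
    have h3 := hτ.rpow_mul_exp_le_weightInf hγ0.le (by linarith : γ ≤ γ + κ₁) e a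
    have h4 := hτ.weightInf_pos (γ + κ₁) e a
    have h5 : 0 ≤ ‖s - s'‖ ^ κ₁ * ‖s‖ ^ γ := by positivity
    have h6 : 0 ≤ ‖s - s'‖ ^ γ := by positivity
    calc _ ≤ B * Real.exp (e * T.sigmaAt a) *
          (2 * (‖s - s'‖ ^ γ * ((1 + hτ.holderConst) * T.phiInf τ₀ a ^ γ))) :=
          mul_le_mul (hc _) (h1.trans (by linarith)) (norm_nonneg _) (by positivity)
      _ = B * (2 * (1 + hτ.holderConst) * ‖s - s'‖ ^ γ) *
          (T.phiInf τ₀ a ^ γ * Real.exp (e * T.sigmaAt a)) := by ring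
      _ ≤ B * (4 * (1 + hτ.holderConst) * (‖s - s'‖ ^ κ₁ * ‖s‖ ^ γ + ‖s - s'‖ ^ γ)) *
          T.weightInf τ₀ (γ + κ₁) e a := by
          gcongr
          · linarith
          · linarith
  lip a z z' := by
    have hH := hτ.holderConst_pos
    have hB : 0 ≤ B := by simpa using (norm_nonneg _).trans (hc 0)
    have hΦ := hτ.phiInf_nonneg a
    have hθp : 0 ≤ θ := (Real.rpow_nonneg hθ₀.1.le γ).trans hγθ
    have hd := symbDist_nonneg (G := T.G) (α := T.α) hθp z z'
    rw [σ_eq_sigmaAt (T.isFullBranch.branch_mem a z), σ_eq_sigmaAt (T.isFullBranch.branch_mem a z'),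
      ← mul_sub, norm_mul]
    have h1 := norm_cexp_second_difference_le hs hs' (hτ.φ_pos (T.isFullBranch.branch a z)).le
      (hτ.φ_pos (T.isFullBranch.branch a z')).le (hτ.φ_le hθ₀ (T.isFullBranch.branch_mem a z))
      (hτ.φ_le hθ₀ (T.isFullBranch.branch_mem a z')) hγ0.le (by linarith : γ ≤ 1) hκ0.le
      (by linarith : κ₁ ≤ 1)
    have hh := hτ.abs_φ_branch_sub_le hθ₀ a z z'
    set h := |T.φ τ₀ (T.isFullBranch.branch a z) - T.φ τ₀ (T.isFullBranch.branch a z')|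
    have hh0 : 0 ≤ h := abs_nonneg _
    set H := hτ.holderConst
    set Φ := T.phiInf τ₀ a
    set d := symbDist T.G T.α θ z z'
    have hΦ0 : 0 ≤ Φ := hΦ
    have h3 := hτ.rpow_mul_exp_le_weightInf hγ0.le (by linarith : γ ≤ γ + κ₁) e a
    have h4 := hτ.rpow_mul_exp_le_weightInf (by linarith : 0 ≤ γ + κ₁) le_rfl e a
    have hr := rpow_le_of_holder hθ₀.1 hγ0 (by linarith : γ ≤ 1) hγθ hH.le hΦ hh0 hh
    have hHγ : (1 + H) ^ κ₁ * (1 + H) ^ γ ≤ 1 + H := by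
      rw [← Real.rpow_add (by linarith)]
      calc (1 + H) ^ (κ₁ + γ) ≤ (1 + H) ^ (1 : ℝ) := by gcongr <;> linarith
        _ = _ := Real.rpow_one _
    have hr' : h ^ γ ≤ (1 + H) ^ γ * Φ ^ γ * d := by
      have hd0 := symbDist_nonneg (G := T.G) (α := T.α) hθ₀.1.le z z'
      calc h ^ γ ≤ (H * Φ * symbDist T.G T.α θ₀ z z') ^ γ := Real.rpow_le_rpow hh0 hh hγ0.le
        _ = H ^ γ * Φ ^ γ * symbDist T.G T.α θ₀ z z' ^ γ := by
            rw [Real.mul_rpow (by positivity) hd0, Real.mul_rpow hH.le hΦ]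
        _ ≤ _ := by
            have := symbDist_rpow_le (G := T.G) (α := T.α) hθ₀.1 hγ0 hγθ z z'
            gcongr
            linarith
    have e1 : 4 * (‖s - s'‖ * ((1 + H) * Φ)) ^ κ₁ * (‖s‖ * h) ^ γ ≤
        4 * (1 + H) * (‖s - s'‖ ^ κ₁ * ‖s‖ ^ γ) * (Φ ^ (γ + κ₁) * d) := by
      rw [Real.mul_rpow (norm_nonneg _) (by positivity), Real.mul_rpow (norm_nonneg _) hh0,
        Real.mul_rpow (by positivity) hΦ]
      calc _ ≤ 4 * (‖s - s'‖ ^ κ₁ * ((1 + H) ^ κ₁ * Φ ^ κ₁)) *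
            (‖s‖ ^ γ * ((1 + H) ^ γ * Φ ^ γ * d)) := by gcongr
        _ = 4 * ((1 + H) ^ κ₁ * (1 + H) ^ γ) * (‖s - s'‖ ^ κ₁ * ‖s‖ ^ γ) *
            ((Φ ^ γ * Φ ^ κ₁) * d) := by ring
        _ ≤ _ := by
            rw [← Real.rpow_add_of_nonneg hΦ hγ0.le hκ0.le]
            gcongr
    have e2 : 2 * (‖s - s'‖ * h) ^ γ ≤ 2 * (1 + H) * ‖s - s'‖ ^ γ * (Φ ^ γ * d) := by
      rw [Real.mul_rpow (norm_nonneg _) hh0]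
      calc _ ≤ 2 * (‖s - s'‖ ^ γ * ((1 + H) * Φ ^ γ * d)) := by gcongr
        _ = _ := by ring
    have h5 : 0 ≤ ‖s - s'‖ ^ γ := by positivity
    calc _ ≤ B * Real.exp (e * T.sigmaAt a) *
          (4 * (1 + H) * (‖s - s'‖ ^ κ₁ * ‖s‖ ^ γ) * (Φ ^ (γ + κ₁) * d) +
            2 * (1 + H) * ‖s - s'‖ ^ γ * (Φ ^ γ * d)) :=
          mul_le_mul (hc _) (h1.trans (add_le_add e1 e2)) (norm_nonneg _) (by positivity)
      _ = B * (4 * (1 + H) * (‖s - s'‖ ^ κ₁ * ‖s‖ ^ γ) *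
          (Φ ^ (γ + κ₁) * Real.exp (e * T.sigmaAt a)) + 2 * (1 + H) * ‖s - s'‖ ^ γ *
          (Φ ^ γ * Real.exp (e * T.sigmaAt a))) * d := by ring
      _ ≤ B * (4 * (1 + H) * (‖s - s'‖ ^ κ₁ * ‖s‖ ^ γ) * T.weightInf τ₀ (γ + κ₁) e a +
          4 * (1 + H) * ‖s - s'‖ ^ γ * T.weightInf τ₀ (γ + κ₁) e a) * d := by
          gcongr
          linarith
      _ = _ := by ring
  summable := by
    simpa only [mul_assoc] using (hτ.summable_weightInf (by linarith : 0 ≤ γ + κ₁) hi).mul_left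
      (B * (4 * (1 + hτ.holderConst) * (‖s - s'‖ ^ κ₁ * ‖s‖ ^ γ + ‖s - s'‖ ^ γ)))

end YoungTower
end

/-! ### The induced twisted operators L(s, x) and the inverse of 1 - L(s, x) + ηP. -/

noncomputable section

theorem pow_le_exp_mul {r e : ℝ} (hr0 : 0 ≤ r) (hr : r ≤ Real.exp e) (n : ℕ) :
    r ^ n ≤ Real.exp (e * n) := by
  rw [mul_comm, Real.exp_nat_mul]
  exact pow_le_pow_left₀ hr0 hr n

namespace YoungTower

open IsFullBranchGibbsMarkov LipSpace

variable {X : Type*} [MeasurableSpace X] {θ₀ : ℝ} {T : YoungTower X θ₀} {τ₀ : X → ℝ} {β κ : ℝ}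
  {θ γ κ₁ e : ℝ}

theorem norm_pow_le_exp {x : ℂ} (hx : ‖x‖ ≤ Real.exp (e / 4)) (n : ℕ) :
    ‖x ^ n‖ ≤ Real.exp (e / 4 * n) := by
  rw [norm_pow]
  exact pow_le_exp_mul (norm_nonneg _) hx n

theorem natCast_mul_norm_pow_le {x : ℂ} (he : 0 < e) (hx : ‖x‖ ≤ Real.exp (e / 4)) (n : ℕ) :
    n * ‖x ^ n‖ ≤ 4 / e * Real.exp (e / 2 * n) := by
  have h1 := natCast_le_div_mul_exp (by positivity : 0 < e / 4) n
  have h2 := norm_pow_le_exp hx n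
  calc n * ‖x ^ n‖ ≤ ((e / 4)⁻¹ * Real.exp (e / 4 * n)) * Real.exp (e / 4 * n) := by gcongr
    _ = _ := by rw [mul_assoc, ← Real.exp_add, inv_div]; congr 2; ring

/-- The difference of n-th powers produces a factor n, paid for by raising the rate from e/4 to e/2.
This is why x is confined to ‖x‖ ≤ e^{e/4}. -/
theorem norm_pow_sub_pow_le_exp {x x' : ℂ} (he : 0 < e) (hx : ‖x‖ ≤ Real.exp (e / 4))
    (hx' : ‖x'‖ ≤ Real.exp (e / 4)) (n : ℕ) :
    ‖x ^ n - x' ^ n‖ ≤ 4 / e * ‖x - x'‖ * Real.exp (e / 2 * n) := by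
  have h1 := natCast_le_div_mul_exp (by positivity : 0 < e / 4) n
  have h2 : Real.exp (e / 4) ^ n = Real.exp (e / 4 * n) := by rw [mul_comm, Real.exp_nat_mul]
  have h3 := norm_pow_sub_pow_le (Real.one_le_exp (by positivity)) hx hx' n
  calc _ ≤ n * Real.exp (e / 4 * n) * ‖x - x'‖ := by rwa [← h2]
    _ ≤ ((e / 4)⁻¹ * Real.exp (e / 4 * n)) * Real.exp (e / 4 * n) * ‖x - x'‖ := by gcongr
    _ = _ := by rw [mul_assoc (e / 4)⁻¹, ← Real.exp_add, inv_div]; ring_nf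

variable (T τ₀) in
/-- The multiplier `x ^ σ e ^ (-s φ)` of the induced twisted transfer operator. -/
def mult (s x : ℂ) (z : T.Z) : ℂ := x ^ T.σ z * Complex.exp (-s * T.φ τ₀ z)

variable (T τ₀) in
/-- Exponents for which the operators below depend continuously on the parameters. -/
structure Exponents (θ γ κ₁ e : ℝ) : Prop where
  γ_pos : 0 < γ
  κ_pos : 0 < κ₁
  add_le : γ + κ₁ ≤ 1
  rpow_le : θ₀ ^ γ ≤ θ
  e_pos : 0 < e
  integrable_base : Integrable (T.weight τ₀ (γ + κ₁) e) T.μZ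
  integrable_tower : Integrable (fun y : T.Y => T.weight τ₀ (γ + κ₁) e y.1.1) T.μ

theorem Exponents.γ_le_one (E : T.Exponents τ₀ θ γ κ₁ e) : γ ≤ 1 := by
  linarith [E.add_le, E.κ_pos]

theorem Exponents.branchBound_coeff (E : T.Exponents τ₀ θ γ κ₁ e) (hτ : T.IsRoof τ₀ β κ)
    (hθ₀ : θ₀ ∈ Ioo (0 : ℝ) 1) {B : ℝ} {c : ℕ → ℂ} (hc : ∀ n, ‖c n‖ ≤ B * Real.exp (e / 2 * n))
    {s : ℂ} (hs : 0 ≤ s.re) (hs1 : ‖s‖ ≤ 1) :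
    T.isFullBranch.BranchBound θ (fun z => c (T.σ z) * Complex.exp (-s * T.φ τ₀ z))
      (fun a => B * (2 * (1 + hτ.holderConst)) * T.weightInf τ₀ (γ + κ₁) e a) := by
  refine hτ.branchBound_coeff_mul_exp hθ₀ E.γ_pos E.γ_le_one (by linarith [E.κ_pos]) E.rpow_le
    E.integrable_base (fun n => (hc n).trans ?_) hs hs1
  have hB : 0 ≤ B := by simpa using (norm_nonneg _).trans (hc 0)
  have := E.e_pos
  gcongr
  linarith

theorem Exponents.branchBound_mult (E : T.Exponents τ₀ θ γ κ₁ e) (hτ : T.IsRoof τ₀ β κ)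
    (hθ₀ : θ₀ ∈ Ioo (0 : ℝ) 1) {s x : ℂ} (hs : 0 ≤ s.re) (hs1 : ‖s‖ ≤ 1)
    (hx : ‖x‖ ≤ Real.exp (e / 4)) : T.isFullBranch.BranchBound θ (T.mult τ₀ s x)
      (fun a => 1 * (2 * (1 + hτ.holderConst)) * T.weightInf τ₀ (γ + κ₁) e a) := by
  refine E.branchBound_coeff hτ hθ₀ (c := fun n => x ^ n) (fun n => ?_) hs hs1
  rw [one_mul]
  have := E.e_pos
  refine (norm_pow_le_exp hx n).trans ?_
  gcongr
  linarith

theorem Exponents.branchBound_mult_sub (E : T.Exponents τ₀ θ γ κ₁ e) (hτ : T.IsRoof τ₀ β κ)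
    (hθ₀ : θ₀ ∈ Ioo (0 : ℝ) 1) {s x s' x' : ℂ} (hs : 0 ≤ s.re) (hs1 : ‖s‖ ≤ 1)
    (hx : ‖x‖ ≤ Real.exp (e / 4)) (hs' : 0 ≤ s'.re) (hx' : ‖x'‖ ≤ Real.exp (e / 4)) :
    T.isFullBranch.BranchBound θ (fun z => T.mult τ₀ s x z - T.mult τ₀ s' x' z)
      (fun a => 4 * (1 + hτ.holderConst) * (1 + 4 / e) *
        (‖s - s'‖ ^ κ₁ * ‖s‖ ^ γ + ‖s - s'‖ ^ γ + ‖x - x'‖) * T.weightInf τ₀ (γ + κ₁) e a) := by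
  have he := E.e_pos
  have b1 := E.branchBound_coeff hτ hθ₀ (c := fun n => x ^ n - x' ^ n)
    (fun n => norm_pow_sub_pow_le_exp he hx hx' n) hs hs1
  have b2 := hτ.branchBound_coeff_mul_exp_sub hθ₀ (c := fun n => x' ^ n) (B := 1) E.γ_pos E.κ_pos
    E.add_le E.rpow_le E.integrable_base (fun n => by
      rw [one_mul]
      refine (norm_pow_le_exp hx' n).trans ?_
      gcongr
      linarith) hs hs'
  have b := b1.add b2
  have hH := hτ.holderConst_pos
  have hle : ∀ a : T.α, 4 / e * ‖x - x'‖ * (2 * (1 + hτ.holderConst)) * T.weightInf τ₀ (γ + κ₁) e a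
      + 1 * (4 * (1 + hτ.holderConst) * (‖s - s'‖ ^ κ₁ * ‖s‖ ^ γ + ‖s - s'‖ ^ γ)) *
        T.weightInf τ₀ (γ + κ₁) e a ≤ 4 * (1 + hτ.holderConst) * (1 + 4 / e) *
        (‖s - s'‖ ^ κ₁ * ‖s‖ ^ γ + ‖s - s'‖ ^ γ + ‖x - x'‖) * T.weightInf τ₀ (γ + κ₁) e a := by
    intro a
    rw [← add_mul]
    refine mul_le_mul_of_nonneg_right ?_ (hτ.weightInf_pos _ _ a).le
    set D := ‖s - s'‖ ^ κ₁ * ‖s‖ ^ γ + ‖s - s'‖ ^ γ with hD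
    have hD0 : 0 ≤ D := by positivity
    set k := 4 / e
    have hk : 0 ≤ k := by positivity
    have : 4 * (1 + hτ.holderConst) * (1 + k) * (D + ‖x - x'‖) -
      (k * ‖x - x'‖ * (2 * (1 + hτ.holderConst)) + 1 * (4 * (1 + hτ.holderConst) * D)) =
      4 * (1 + hτ.holderConst) * (k * D + ‖x - x'‖ + k * ‖x - x'‖ / 2) := by ring
    have h2 : 0 ≤ 4 * (1 + hτ.holderConst) * (k * D + ‖x - x'‖ + k * ‖x - x'‖ / 2) := by positivity
    linarith
  have e1 : ∀ z, T.mult τ₀ s x z - T.mult τ₀ s' x' z =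
      (x ^ T.σ z - x' ^ T.σ z) * Complex.exp (-s * T.φ τ₀ z) +
      x' ^ T.σ z * (Complex.exp (-s * T.φ τ₀ z) - Complex.exp (-s' * T.φ τ₀ z)) := fun z => by
    unfold mult; ring
  have hθp : 0 ≤ θ := (Real.rpow_nonneg hθ₀.1.le γ).trans E.rpow_le
  refine ⟨fun a z => ?_, fun a z z' => ?_, ?_⟩
  · rw [e1]
    exact (b.bound a z).trans (hle a)
  · rw [e1, e1]
    exact (b.lip a z z').trans (mul_le_mul_of_nonneg_right (hle a) (symbDist_nonneg hθp z z'))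
  · simpa only [mul_assoc] using
      (hτ.summable_weightInf (by linarith [E.γ_pos, E.κ_pos]) E.integrable_base).mul_left
        (4 * (1 + hτ.holderConst) * (1 + 4 / e) *
        (‖s - s'‖ ^ κ₁ * ‖s‖ ^ γ + ‖s - s'‖ ^ γ + ‖x - x'‖))

open Classical in
variable (T τ₀) in
/-- The induced twisted transfer operator `w ↦ R_Z (x ^ σ e ^ (-s φ) w)`. -/
def twisted (hθ₀ : θ₀ ∈ Ioo (0 : ℝ) 1) (hθ : θ ∈ Ico θ₀ 1) (s x : ℂ) :
    LipSpace T.G T.α θ →L[ℂ] LipSpace T.G T.α θ :=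
  if hV : ∃ V, T.isFullBranch.BranchBound θ (T.mult τ₀ s x) V then
    hV.choose_spec.mulTransfer hθ₀ hθ else 0

variable {hθ₀ : θ₀ ∈ Ioo (0 : ℝ) 1} {hθ : θ ∈ Ico θ₀ 1}

theorem fn_twisted {s x : ℂ} {V : T.α → ℝ} (hV : T.isFullBranch.BranchBound θ (T.mult τ₀ s x) V)
    (w : LipSpace T.G T.α θ) (z : T.Z) : fn (T.twisted τ₀ hθ₀ hθ s x w) z =
      T.isFullBranch.transfer (fun y => T.mult τ₀ s x y * fn w y) z := by
  rw [twisted, dif_pos ⟨V, hV⟩, BranchBound.fn_mulTransfer]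

theorem norm_twisted_sub_le {s x s' x' : ℂ} {V V' V'' : T.α → ℝ}
    (hV : T.isFullBranch.BranchBound θ (T.mult τ₀ s x) V)
    (hV' : T.isFullBranch.BranchBound θ (T.mult τ₀ s' x') V')
    (hd : T.isFullBranch.BranchBound θ (fun z => T.mult τ₀ s x z - T.mult τ₀ s' x' z) V'') :
    ‖T.twisted τ₀ hθ₀ hθ s x - T.twisted τ₀ hθ₀ hθ s' x'‖ ≤
      2 * T.isFullBranch.transferConst * ∑' a : T.α, V'' a * T.μZ.real a.1 := by
  rw [twisted, dif_pos ⟨V, hV⟩, twisted, dif_pos ⟨V', hV'⟩]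
  exact BranchBound.norm_mulTransfer_sub_le _ _ hd hθ₀ hθ

variable (T τ₀) in
/-- `1 - L(s, x) + η P`, invertible for `(s, x)` near `(0, 1)`. -/
def resolvent (hθ₀ : θ₀ ∈ Ioo (0 : ℝ) 1) (hθ : θ ∈ Ico θ₀ 1) (s x : ℂ) :
    LipSpace T.G T.α θ →L[ℂ] LipSpace T.G T.α θ :=
  1 - T.twisted τ₀ hθ₀ hθ s x + T.isFullBranch.rankOne (mem_Ioo_of_mem_Ico hθ₀ hθ)

theorem twisted_zero_one : T.twisted τ₀ hθ₀ hθ 0 1 = T.isFullBranch.transferOp hθ₀ hθ := by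
  have h1 : T.mult τ₀ 0 1 = fun _ => 1 := by ext z; simp [mult]
  have hp := mem_Ioo_of_mem_Ico hθ₀ hθ
  have hV : T.isFullBranch.BranchBound θ (T.mult τ₀ 0 1) (fun _ => 1) := by
    rw [h1]; exact T.isFullBranch.branchBound_one hp.1.le
  refine ContinuousLinearMap.ext fun w => T.isFullBranch.lipSpace_ext hp.1 fun z => ?_
  rw [fn_twisted hV, fn_transferOp, h1]
  simp

theorem isUnit_resolvent_zero_one : IsUnit (T.resolvent τ₀ hθ₀ hθ 0 1) := by
  rw [resolvent, twisted_zero_one]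
  exact T.isFullBranch.isUnit_one_sub_transferOp_add_rankOne hθ₀ hθ

/-- Uniform estimates for `(s, x)` near `(0, 1)`. -/
structure Regime (T : YoungTower X θ₀) (τ₀ : X → ℝ) (hθ₀ : θ₀ ∈ Ioo (0 : ℝ) 1)
    (hθ : θ ∈ Ico θ₀ 1) (γ κ₁ e r C : ℝ) : Prop extends T.Exponents τ₀ θ γ κ₁ e where
  r_pos : 0 < r
  r_le : r ≤ 1
  C_pos : 0 < C
  norm_le : ∀ x : ℂ, ‖x - 1‖ < r → ‖x‖ ≤ Real.exp (e / 4)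
  isUnit : ∀ s x : ℂ, 0 ≤ s.re → ‖s‖ < r → ‖x - 1‖ < r → IsUnit (T.resolvent τ₀ hθ₀ hθ s x)
  norm_inverse_le : ∀ s x : ℂ, 0 ≤ s.re → ‖s‖ < r → ‖x - 1‖ < r →
    ‖Ring.inverse (T.resolvent τ₀ hθ₀ hθ s x)‖ ≤ C
  norm_sub_le : ∀ s x s' x' : ℂ, 0 ≤ s.re → ‖s‖ < r → ‖x - 1‖ < r → 0 ≤ s'.re → ‖s'‖ < r →
    ‖x' - 1‖ < r → ‖T.resolvent τ₀ hθ₀ hθ s x - T.resolvent τ₀ hθ₀ hθ s' x'‖ ≤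
      C * (‖s - s'‖ ^ κ₁ * ‖s‖ ^ γ + ‖s - s'‖ ^ γ + ‖x - x'‖)

/-- Invertibility at (0, 1) is the Doeblin estimate for G. It is an open condition with locally
bounded inverse, and the operator at (s, x) is within a multiple of r^γ of the one at (0, 1), so a
small r suffices. -/
theorem Exponents.exists_regime (E : T.Exponents τ₀ θ γ κ₁ e) (hτ : T.IsRoof τ₀ β κ)
    (hθ₀ : θ₀ ∈ Ioo (0 : ℝ) 1) (hθ : θ ∈ Ico θ₀ 1) :
    ∃ r C, Regime T τ₀ hθ₀ hθ γ κ₁ e r C := by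
  have he := E.e_pos
  have hH := hτ.holderConst_pos
  have hγ := E.γ_pos
  obtain ⟨ρ, hρ, C₀, hC₀, hinv⟩ := exists_inverse_bound
    (isUnit_resolvent_zero_one (T := T) (τ₀ := τ₀) (hθ₀ := hθ₀) (hθ := hθ))
  set S := ∑' a : T.α, T.weightInf τ₀ (γ + κ₁) e a * T.μZ.real a.1
  have hS : 0 ≤ S := tsum_nonneg fun a =>
    mul_nonneg (hτ.weightInf_pos _ _ a).le measureReal_nonneg
  have hR := T.isFullBranch.transferConst_pos
  set K := 2 * T.isFullBranch.transferConst * (4 * (1 + hτ.holderConst) * (1 + 4 / e) * S) with hK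
  have hK0 : 0 ≤ K := by positivity
  have hx1 : ∀ x : ℂ, ‖x - 1‖ ≤ e / 4 → ‖x‖ ≤ Real.exp (e / 4) := fun x hx => by
    have h1 : ‖x‖ ≤ ‖x - 1‖ + ‖(1 : ℂ)‖ := by simpa using norm_add_le (x - 1) 1
    have := Real.add_one_le_exp (e / 4)
    rw [norm_one] at h1
    linarith
  have hsub : ∀ s x s' x' : ℂ, 0 ≤ s.re → ‖s‖ ≤ 1 → ‖x - 1‖ ≤ e / 4 → 0 ≤ s'.re → ‖s'‖ ≤ 1 →
      ‖x' - 1‖ ≤ e / 4 → ‖T.resolvent τ₀ hθ₀ hθ s x - T.resolvent τ₀ hθ₀ hθ s' x'‖ ≤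
      K * (‖s - s'‖ ^ κ₁ * ‖s‖ ^ γ + ‖s - s'‖ ^ γ + ‖x - x'‖) := by
    intro s x s' x' hs hs1 hx hs' hs1' hx'
    have e1 : T.resolvent τ₀ hθ₀ hθ s x - T.resolvent τ₀ hθ₀ hθ s' x' =
        -(T.twisted τ₀ hθ₀ hθ s x - T.twisted τ₀ hθ₀ hθ s' x') := by
      unfold resolvent; abel
    rw [e1, norm_neg]
    refine (norm_twisted_sub_le (E.branchBound_mult hτ hθ₀ hs hs1 (hx1 x hx))
      (E.branchBound_mult hτ hθ₀ hs' hs1' (hx1 x' hx'))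
      (E.branchBound_mult_sub hτ hθ₀ hs hs1 (hx1 x hx) hs' (hx1 x' hx'))).trans (le_of_eq ?_)
    simp only [mul_assoc _ (T.weightInf τ₀ (γ + κ₁) e _) _]
    rw [tsum_mul_left, hK]
    ring
  obtain ⟨r₀, hr₀, hr₀ρ⟩ : ∃ r₀ > 0, 3 * K * r₀ ^ γ < ρ := by
    have hc : Filter.Tendsto (fun t : ℝ => 3 * K * t ^ γ) (nhdsWithin 0 (Ioi 0)) (nhds 0) := by
      have := ((Real.continuousAt_rpow_const 0 γ (Or.inr hγ.le)).tendsto.const_mul (3 * K))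
      rw [Real.zero_rpow hγ.ne', mul_zero] at this
      exact this.mono_left nhdsWithin_le_nhds
    have := (hc.eventually_lt_const hρ).and self_mem_nhdsWithin
    obtain ⟨r₀, h1, h2⟩ := this.exists
    exact ⟨r₀, h2, h1⟩
  set r := min 1 (min (e / 4) r₀)
  have hr0 : 0 < r := by positivity
  have hr1 : r ≤ 1 := min_le_left _ _
  have hr2 : r ≤ e / 4 := (min_le_right _ _).trans (min_le_left _ _)
  have hr3 : r ≤ r₀ := (min_le_right _ _).trans (min_le_right _ _)
  have hball : ∀ s x : ℂ, 0 ≤ s.re → ‖s‖ < r → ‖x - 1‖ < r →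
      ‖T.resolvent τ₀ hθ₀ hθ s x - T.resolvent τ₀ hθ₀ hθ 0 1‖ < ρ := by
    intro s x hs hsr hx
    refine (hsub s x 0 1 hs (hsr.le.trans hr1) (hx.le.trans hr2) le_rfl (by simp)
      (by simp; positivity)).trans_lt (lt_of_le_of_lt ?_ hr₀ρ)
    rw [sub_zero]
    have h1 : ‖s‖ ^ γ ≤ r₀ ^ γ := by gcongr; linarith
    have h2 : ‖s‖ ^ κ₁ ≤ 1 := Real.rpow_le_one (norm_nonneg _) (hsr.le.trans hr1) E.κ_pos.le
    have h3 : ‖s‖ ^ κ₁ * ‖s‖ ^ γ ≤ ‖s‖ ^ γ :=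
      mul_le_of_le_one_left (by positivity) h2
    have h4 : r ≤ r₀ ^ γ := by
      calc r ≤ r ^ γ := by
            simpa using Real.rpow_le_rpow_of_exponent_ge hr0 hr1 E.γ_le_one
        _ ≤ r₀ ^ γ := by gcongr
    have h5 : ‖s‖ ^ κ₁ * ‖s‖ ^ γ + ‖s‖ ^ γ + ‖x - 1‖ ≤ 3 * r₀ ^ γ := by linarith
    calc _ ≤ K * (3 * r₀ ^ γ) := by gcongr
      _ = _ := by ring
  refine ⟨r, max C₀ K, ⟨E, hr0, hr1, lt_max_of_lt_left hC₀, fun x hx => hx1 x (hx.le.trans hr2),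
    fun s x hs hsr hx => (hinv _ (hball s x hs hsr hx)).1,
    fun s x hs hsr hx => (hinv _ (hball s x hs hsr hx)).2.trans (le_max_left _ _),
    fun s x s' x' hs hsr hx hs' hsr' hx' => ?_⟩⟩
  refine (hsub s x s' x' hs (hsr.le.trans hr1) (hx.le.trans hr2) hs' (hsr'.le.trans hr1)
    (hx'.le.trans hr2)).trans ?_
  gcongr
  exact le_max_right _ _

theorem IsRoof.exists_regime (hτ : T.IsRoof τ₀ β κ) (hβκ : β ≤ κ) (hβ1 : β ≤ 1)
    (hθ₀ : θ₀ ∈ Ioo (0 : ℝ) 1) (hθ : θ ∈ Ico θ₀ 1) (hγ0 : 0 < γ) (hγ : γ < β)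
    (hγθ : θ₀ ^ γ ≤ θ) {emax : ℝ} (hemax : 0 < emax) :
    ∃ κ₁ e r C, e ≤ emax ∧ Regime T τ₀ hθ₀ hθ γ κ₁ e r C := by
  -- Half of the gap between γ and β is spent on κ₁, so the moment of order γ + κ₁ is still finite.
  obtain ⟨e, he, hi⟩ := hτ.exists_integrable_weight hβκ hβ1 (by linarith : 0 < γ + (β - γ) / 2)
    (by linarith : γ + (β - γ) / 2 < β)
  have h := hi (min e emax) (min_le_left _ _)
  have E : T.Exponents τ₀ θ γ ((β - γ) / 2) (min e emax) :=
    ⟨hγ0, by linarith, by linarith, hγθ, lt_min he hemax, h.1, h.2⟩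
  obtain ⟨r, C, hR⟩ := E.exists_regime hτ hθ₀ hθ
  exact ⟨_, _, r, C, min_le_right _ _, hR⟩

variable (T τ₀) in
/-- The solution `W` of `W - L(s, x) W + η P W = 1`. -/
def baseFn (hθ₀ : θ₀ ∈ Ioo (0 : ℝ) 1) (hθ : θ ∈ Ico θ₀ 1) (s x : ℂ) : LipSpace T.G T.α θ :=
  Ring.inverse (T.resolvent τ₀ hθ₀ hθ s x) (T.isFullBranch.lipOne (mem_Ioo_of_mem_Ico hθ₀ hθ))

theorem inverse_apply_self {A : LipSpace T.G T.α θ →L[ℂ] LipSpace T.G T.α θ} (hA : IsUnit A)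
    (w : LipSpace T.G T.α θ) : Ring.inverse A (A w) = w :=
  congrArg (fun B : LipSpace T.G T.α θ →L[ℂ] LipSpace T.G T.α θ => B w)
    (Ring.inverse_mul_cancel A hA)

theorem apply_inverse_self {A : LipSpace T.G T.α θ →L[ℂ] LipSpace T.G T.α θ} (hA : IsUnit A)
    (w : LipSpace T.G T.α θ) : A (Ring.inverse A w) = w :=
  congrArg (fun B : LipSpace T.G T.α θ →L[ℂ] LipSpace T.G T.α θ => B w)
    (Ring.mul_inverse_cancel A hA)

theorem resolvent_apply (s x : ℂ) (w : LipSpace T.G T.α θ) :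
    T.resolvent τ₀ hθ₀ hθ s x w = w - T.twisted τ₀ hθ₀ hθ s x w +
      ((T.isFullBranch.minorConst θ : ℂ) * T.isFullBranch.mean (mem_Ioo_of_mem_Ico hθ₀ hθ) w) •
        T.isFullBranch.lipOne (mem_Ioo_of_mem_Ico hθ₀ hθ) := by
  simp [resolvent, rankOne_apply]

/-- Since W solves A W = 1, it is fixed by L(s, x) up to a multiple of the constant function. That
scalar is what the choice of x has to annihilate. -/
theorem baseFn_sub_twisted {s x : ℂ} (hA : IsUnit (T.resolvent τ₀ hθ₀ hθ s x)) :
    T.twisted τ₀ hθ₀ hθ s x (T.baseFn τ₀ hθ₀ hθ s x) = T.baseFn τ₀ hθ₀ hθ s x -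
      (1 - (T.isFullBranch.minorConst θ : ℂ) * T.isFullBranch.mean (mem_Ioo_of_mem_Ico hθ₀ hθ)
        (T.baseFn τ₀ hθ₀ hθ s x)) • T.isFullBranch.lipOne (mem_Ioo_of_mem_Ico hθ₀ hθ) := by
  have h : T.resolvent τ₀ hθ₀ hθ s x (T.baseFn τ₀ hθ₀ hθ s x) = _ := apply_inverse_self hA _
  rw [resolvent_apply] at h
  linear_combination (norm := module) (-1 : ℂ) • h

/-- For a fixed point w the operator A gives A w = η (∫ w) 1, and A is invertible. So fixed points
form a space of dimension at most one, with an explicit generator. -/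
theorem eq_smul_baseFn {s x : ℂ} (hA : IsUnit (T.resolvent τ₀ hθ₀ hθ s x))
    {w : LipSpace T.G T.α θ} (hw : T.twisted τ₀ hθ₀ hθ s x w = w) :
    w = ((T.isFullBranch.minorConst θ : ℂ) *
      T.isFullBranch.mean (mem_Ioo_of_mem_Ico hθ₀ hθ) w) • T.baseFn τ₀ hθ₀ hθ s x := by
  have h := resolvent_apply (τ₀ := τ₀) (hθ₀ := hθ₀) (hθ := hθ) s x w
  rw [hw, sub_self, zero_add] at h
  rw [baseFn, ← map_smul, ← h, inverse_apply_self hA]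

theorem baseFn_zero_one : T.baseFn τ₀ hθ₀ hθ 0 1 = ((T.isFullBranch.minorConst θ : ℂ))⁻¹ •
    T.isFullBranch.lipOne (mem_Ioo_of_mem_Ico hθ₀ hθ) := by
  have h := eq_smul_baseFn (T := T) (τ₀ := τ₀) (hθ₀ := hθ₀) (hθ := hθ) isUnit_resolvent_zero_one
    (w := T.isFullBranch.lipOne (mem_Ioo_of_mem_Ico hθ₀ hθ))
    (by rw [twisted_zero_one, transferOp_lipOne])
  have hη : (T.isFullBranch.minorConst θ : ℂ) ≠ 0 := by
    exact_mod_cast (T.isFullBranch.minorConst_pos (mem_Ioo_of_mem_Ico hθ₀ hθ)).ne'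
  rw [mean_lipOne, mul_one] at h
  conv_rhs => rw [h]
  rw [smul_smul, inv_mul_cancel₀ hη, one_smul]

theorem fn_baseFn_zero_one (z : T.Z) :
    fn (T.baseFn τ₀ hθ₀ hθ 0 1) z = ((T.isFullBranch.minorConst θ : ℂ))⁻¹ := by
  rw [baseFn_zero_one, fn_smul, fn_lipOne, mul_one]

namespace Regime

variable {r C : ℝ}

theorem norm_baseFn_le (R : Regime T τ₀ hθ₀ hθ γ κ₁ e r C) {s x : ℂ} (hs : 0 ≤ s.re)
    (hsr : ‖s‖ < r) (hx : ‖x - 1‖ < r) : ‖T.baseFn τ₀ hθ₀ hθ s x‖ ≤ C := by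
  have h1 := (Ring.inverse (T.resolvent τ₀ hθ₀ hθ s x)).le_opNorm
    (T.isFullBranch.lipOne (mem_Ioo_of_mem_Ico hθ₀ hθ))
  have h2 := R.norm_inverse_le s x hs hsr hx
  have h3 := T.isFullBranch.norm_lipOne_le (mem_Ioo_of_mem_Ico hθ₀ hθ)
  have := R.C_pos
  calc _ ≤ _ := h1
    _ ≤ C * 1 := by gcongr
    _ = C := mul_one C

theorem norm_baseFn_sub_le (R : Regime T τ₀ hθ₀ hθ γ κ₁ e r C) {s x s' x' : ℂ} (hs : 0 ≤ s.re)
    (hsr : ‖s‖ < r) (hx : ‖x - 1‖ < r) (hs' : 0 ≤ s'.re) (hsr' : ‖s'‖ < r) (hx' : ‖x' - 1‖ < r) :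
    ‖T.baseFn τ₀ hθ₀ hθ s x - T.baseFn τ₀ hθ₀ hθ s' x'‖ ≤
      C * C * C * (‖s - s'‖ ^ κ₁ * ‖s‖ ^ γ + ‖s - s'‖ ^ γ + ‖x - x'‖) := by
  have h1 := (Ring.inverse (T.resolvent τ₀ hθ₀ hθ s x) -
    Ring.inverse (T.resolvent τ₀ hθ₀ hθ s' x')).le_opNorm
    (T.isFullBranch.lipOne (mem_Ioo_of_mem_Ico hθ₀ hθ))
  have h2 := norm_inverse_sub_inverse_le (R.isUnit s x hs hsr hx) (R.isUnit s' x' hs' hsr' hx')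
    (R.norm_inverse_le s x hs hsr hx) (R.norm_inverse_le s' x' hs' hsr' hx')
  have h3 := T.isFullBranch.norm_lipOne_le (mem_Ioo_of_mem_Ico hθ₀ hθ)
  have h4 := R.norm_sub_le s x s' x' hs hsr hx hs' hsr' hx'
  have := R.C_pos
  calc _ ≤ _ := h1
    _ ≤ (C * C * (C * (‖s - s'‖ ^ κ₁ * ‖s‖ ^ γ + ‖s - s'‖ ^ γ + ‖x - x'‖))) * 1 := by
      gcongr
      exact h2.trans (by gcongr)
    _ = _ := by ring

/-- Comparison with (0, 1), where W is the constant 1/η. There the mixed term ‖s‖^κ₁ ‖s‖^γ is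
absorbed by ‖s‖^γ, so no order is lost. -/
theorem norm_baseFn_sub_const_le (R : Regime T τ₀ hθ₀ hθ γ κ₁ e r C) {s x : ℂ} (hs : 0 ≤ s.re)
    (hsr : ‖s‖ < r) (hx : ‖x - 1‖ < r) (z : T.Z) :
    ‖fn (T.baseFn τ₀ hθ₀ hθ s x) z - (T.isFullBranch.minorConst θ : ℂ)⁻¹‖ ≤
      2 * (C * C * C) * (‖s‖ ^ γ + ‖x - 1‖) := by
  have h := R.norm_baseFn_sub_le hs hsr hx (s' := 0) (x' := 1) le_rfl
    (by simpa using R.r_pos) (by simpa using R.r_pos)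
  have h2 := norm_fn_le (T.baseFn τ₀ hθ₀ hθ s x - T.baseFn τ₀ hθ₀ hθ 0 1) z
  rw [fn_sub, fn_baseFn_zero_one] at h2
  refine h2.trans (h.trans ?_)
  have h5 : ‖s‖ ^ κ₁ * ‖s‖ ^ γ ≤ ‖s‖ ^ γ := mul_le_of_le_one_left (by positivity)
    (Real.rpow_le_one (norm_nonneg _) (hsr.le.trans R.r_le) R.κ_pos.le)
  have := R.C_pos
  rw [sub_zero]
  have h6 : ‖s‖ ^ κ₁ * ‖s‖ ^ γ + ‖s‖ ^ γ + ‖x - 1‖ ≤ 2 * (‖s‖ ^ γ + ‖x - 1‖) := by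
    linarith [norm_nonneg (x - 1)]
  calc _ ≤ C * C * C * (2 * (‖s‖ ^ γ + ‖x - 1‖)) := by gcongr
    _ = _ := by ring

end Regime

end YoungTower
end

/-! ### The space `𝓑(Y)` and its invariance under the operators. -/

noncomputable section

namespace YoungTower

open IsFullBranchGibbsMarkov LipSpace

variable {X : Type*} [MeasurableSpace X] {θ₀ : ℝ} {T : YoungTower X θ₀} {τ₀ : X → ℝ} {β κ : ℝ}
  {θ γ ε : ℝ}

/-- An element has positive measure, hence contains a point where the essential lower bound of τ₀
holds. There φ exceeds 1, and φ is comparable with its infimum. -/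
theorem IsRoof.le_phiInf (hτ : T.IsRoof τ₀ β κ) (hθ₀ : θ₀ ∈ Ioo (0 : ℝ) 1) (a : T.α) :
    (1 + hτ.holderConst)⁻¹ ≤ T.phiInf τ₀ a := by
  obtain ⟨b, hb, hae⟩ := hτ.essInf
  have h1 := T.ae_base (ae_of_ae_map T.measurable_proj.aemeasurable hae)
  obtain ⟨z, hz, hza⟩ : ∃ z, (∀ (l : ℕ) (hl : l < T.σ z), b ≤ τ₀ (T.proj ⟨(z, l), hl⟩)) ∧ z ∈ a.1 := by
    by_contra! hcon
    refine T.isFullBranch.pos a a.2 (measure_mono_null (fun z hz => ?_) h1)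
    exact fun h => hcon z h hz
  have h2 : b ≤ T.φ τ₀ z := (hz 0 (T.σ_pos z)).trans (hτ.τ_le_φ ⟨(z, 0), T.σ_pos z⟩)
  have hH := hτ.holderConst_pos
  rw [inv_le_iff_one_le_mul₀ (by linarith)]
  linarith [hτ.φ_le hθ₀ hza, mul_comm (T.phiInf τ₀ a) (1 + hτ.holderConst)]

/-- This lets an unweighted Lipschitz function on Z satisfy the seminorm of `𝓑(Y)`, which divides by
φ^γ. -/
theorem IsRoof.one_le_mul_rpow_φ (hτ : T.IsRoof τ₀ β κ) (hθ₀ : θ₀ ∈ Ioo (0 : ℝ) 1) (hγ0 : 0 ≤ γ)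
    (hγ1 : γ ≤ 1) (z : T.Z) : 1 ≤ (1 + hτ.holderConst) * T.φ τ₀ z ^ γ := by
  obtain ⟨a, ha⟩ := T.isFullBranch.exists_mem z
  have hH := hτ.holderConst_pos
  have h1 := (hτ.le_phiInf hθ₀ a).trans (hτ.phiInf_le ha)
  have h2 : 1 ≤ (1 + hτ.holderConst) * T.φ τ₀ z := by
    rwa [inv_le_iff_one_le_mul₀' (by linarith)] at h1
  have h3 := Real.one_le_rpow h2 hγ0
  rw [Real.mul_rpow (by linarith) (hτ.φ_pos z).le] at h3
  refine h3.trans (mul_le_mul_of_nonneg_right ?_ (Real.rpow_nonneg (hτ.φ_pos z).le _))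
  simpa using Real.rpow_le_rpow_of_exponent_le (by linarith : 1 ≤ 1 + hτ.holderConst) hγ1

variable (T τ₀) in
/-- Explicit bounds on an element of `𝓑(Y)`. -/
structure SpaceBound (γ θ ε : ℝ) (v : T.Y → ℂ) (C : ℝ) : Prop where
  bound : ∀ y, ‖v y‖ ≤ C * Real.exp (ε * y.1.2)
  lip : ∀ a : T.α, ∀ z ∈ a.1, ∀ z' ∈ a.1, ∀ (l : ℕ) (hl : l < T.σ z) (hl' : l < T.σ z'),
    ‖v ⟨(z, l), hl⟩ - v ⟨(z', l), hl'⟩‖ ≤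
      C * Real.exp (ε * l) * T.φ τ₀ z ^ γ * symbDist T.G T.α θ z z'

theorem SpaceBound.nonneg {v : T.Y → ℂ} {C : ℝ} (hv : T.SpaceBound τ₀ γ θ ε v C) : 0 ≤ C := by
  have h := (norm_nonneg _).trans (hv.bound ⟨((T.μZ.nonempty_of_neZero).some, 0), T.σ_pos _⟩)
  simpa using h

theorem IsRoof.mem_spaceB_iff (hτ : T.IsRoof τ₀ β κ) (hθ : 0 < θ) {v : T.Y → ℂ} :
    v ∈ T.spaceB τ₀ γ θ ε ↔ ∃ C, T.SpaceBound τ₀ γ θ ε v C := by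
  rw [spaceB, mem_ofPred_eq, max_lt_iff]
  constructor
  · rintro ⟨h1, h2⟩
    set A := (T.weightedSup ε v).toReal
    set B := (T.weightedLip τ₀ γ θ ε v).toReal
    refine ⟨max A B, fun y => ?_, fun a z hz z' hz' l hl hl' => ?_⟩
    · have h3 : Real.exp (-ε * y.1.2) * ‖v y‖ ≤ A := by
        rw [← ENNReal.ofReal_le_iff_le_toReal h1.ne]
        exact le_iSup (fun y : T.Y => ENNReal.ofReal (Real.exp (-ε * y.1.2) * ‖v y‖)) y
      rw [neg_mul, Real.exp_neg, inv_mul_le_iff₀ (Real.exp_pos _), mul_comm] at h3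
      exact h3.trans (mul_le_mul_of_nonneg_right (le_max_left _ _) (Real.exp_pos _).le)
    · rcases eq_or_ne z z' with rfl | hne
      · rw [sub_self, norm_zero, symbDist_self T.isFullBranch.partition, mul_zero]
      · have hd := T.isFullBranch.symbDist_pos hθ hne
        have hφ := Real.rpow_pos_of_pos (hτ.φ_pos z) γ
        have h3 : Real.exp (-ε * l) * T.φ τ₀ z ^ (-γ) * ‖v ⟨(z, l), hl⟩ - v ⟨(z', l), hl'⟩‖ /
            symbDist T.G T.α θ z z' ≤ B := by
          rw [← ENNReal.ofReal_le_iff_le_toReal h2.ne]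
          exact le_iSup_of_le (ι := T.Y) ⟨(z, l), hl⟩ (le_iSup_of_le (ι := T.Y) ⟨(z', l), hl'⟩
            (le_iSup_of_le ⟨rfl, hne, a.1, a.2, hz, hz'⟩ le_rfl))
        rw [div_le_iff₀ hd, Real.rpow_neg (hτ.φ_pos z).le, neg_mul, Real.exp_neg, mul_assoc,
          inv_mul_le_iff₀ (Real.exp_pos _), inv_mul_le_iff₀ hφ] at h3
        refine h3.trans (le_trans (le_of_eq ?_) (mul_le_mul_of_nonneg_right
          (mul_le_mul_of_nonneg_right (mul_le_mul_of_nonneg_right (le_max_right A B)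
            (Real.exp_pos (ε * l)).le) hφ.le) hd.le))
        ring
  · rintro ⟨C, hC⟩
    constructor
    · refine lt_of_le_of_lt (iSup_le fun y => ENNReal.ofReal_le_ofReal (q := C) ?_)
        ENNReal.ofReal_lt_top
      rw [neg_mul, Real.exp_neg, inv_mul_le_iff₀ (Real.exp_pos _), mul_comm]
      exact hC.bound y
    · refine lt_of_le_of_lt (iSup_le fun y => iSup_le fun y' => iSup_le fun h =>
        ENNReal.ofReal_le_ofReal (q := C) ?_) ENNReal.ofReal_lt_top
      obtain ⟨⟨z, l⟩, hl⟩ := y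
      obtain ⟨⟨z', l'⟩, hl'⟩ := y'
      obtain ⟨he, hne, a, ha, hz, hz'⟩ := h
      dsimp only at he hne hz hz' ⊢
      subst he
      have hd := T.isFullBranch.symbDist_pos hθ hne
      rw [div_le_iff₀ hd, Real.rpow_neg (hτ.φ_pos z).le, neg_mul, Real.exp_neg, mul_assoc,
          inv_mul_le_iff₀ (Real.exp_pos _),
          inv_mul_le_iff₀ (Real.rpow_pos_of_pos (hτ.φ_pos z) γ)]
      refine (hC.lip ⟨a, ha⟩ z hz z' hz' l hl hl').trans (le_of_eq ?_)
      ring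

variable (T τ₀) in
/-- Exponents for which `𝓑(Y)` is well behaved. -/
structure SpaceExponents (γ θ ε : ℝ) : Prop where
  γ_pos : 0 < γ
  γ_le_one : γ ≤ 1
  rpow_le : θ₀ ^ γ ≤ θ
  ε_pos : 0 < ε
  integrable_base : Integrable (T.weight τ₀ γ ε) T.μZ
  integrable_tower : Integrable (fun y : T.Y => T.weight τ₀ γ ε y.1.1) T.μ

theorem IsRoof.exp_le_weight (hτ : T.IsRoof τ₀ β κ) (hε : 0 ≤ ε) {γ' : ℝ} (y : T.Y) :
    Real.exp (ε * y.1.2) ≤ T.weight τ₀ γ' ε y.1.1 := by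
  have h1 : Real.exp (ε * y.1.2) ≤ Real.exp (ε * T.σ y.1.1) := by
    have : (y.1.2 : ℝ) ≤ T.σ y.1.1 := by exact_mod_cast y.2.le
    gcongr
  refine h1.trans (le_mul_of_one_le_left (Real.exp_pos _).le ?_)
  linarith [Real.rpow_nonneg (hτ.φ_pos y.1.1).le γ']

theorem SpaceBound.add {v v' : T.Y → ℂ} {C C' : ℝ} (hv : T.SpaceBound τ₀ γ θ ε v C)
    (hv' : T.SpaceBound τ₀ γ θ ε v' C') :
    T.SpaceBound τ₀ γ θ ε (fun y => v y + v' y) (C + C') where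
  bound y := (norm_add_le _ _).trans (by linarith [hv.bound y, hv'.bound y])
  lip a z hz z' hz' l hl hl' := by
    rw [add_sub_add_comm]
    exact (norm_add_le _ _).trans
      (by linarith [hv.lip a z hz z' hz' l hl hl', hv'.lip a z hz z' hz' l hl hl'])

theorem SpaceBound.const_mul {v : T.Y → ℂ} {C : ℝ} (hv : T.SpaceBound τ₀ γ θ ε v C) (c : ℂ) :
    T.SpaceBound τ₀ γ θ ε (fun y => c * v y) (‖c‖ * C) where
  bound y := by
    rw [norm_mul, mul_assoc]
    exact mul_le_mul_of_nonneg_left (hv.bound y) (norm_nonneg _)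
  lip a z hz z' hz' l hl hl' := by
    rw [← mul_sub, norm_mul]
    exact (mul_le_mul_of_nonneg_left (hv.lip a z hz z' hz' l hl hl') (norm_nonneg _)).trans
      (le_of_eq (by ring))

theorem φ_branch_rpow_le (hτ : T.IsRoof τ₀ β κ) (hθ₀ : θ₀ ∈ Ioo (0 : ℝ) 1) (hγ0 : 0 ≤ γ)
    (hγ1 : γ ≤ 1) {a : T.α} {z : T.Z} (hz : z ∈ a.1) :
    T.φ τ₀ z ^ γ ≤ (1 + hτ.holderConst) * T.phiInf τ₀ a ^ γ := by
  have hH := hτ.holderConst_pos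
  have hΦ := hτ.phiInf_nonneg a
  calc _ ≤ ((1 + hτ.holderConst) * T.phiInf τ₀ a) ^ γ :=
        Real.rpow_le_rpow (hτ.φ_pos _).le (hτ.φ_le hθ₀ hz) hγ0
    _ = (1 + hτ.holderConst) ^ γ * T.phiInf τ₀ a ^ γ := Real.mul_rpow (by linarith) hΦ
    _ ≤ (1 + hτ.holderConst) ^ (1 : ℝ) * T.phiInf τ₀ a ^ γ := by gcongr; linarith
    _ = _ := by rw [Real.rpow_one]

/-- Membership in `𝓑(Y)` does not include measurability. On each level of each element the function
is Lipschitz after composition with the branch, and such functions are measurable. -/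
theorem SpaceBound.measurable {v : T.Y → ℂ} {C : ℝ} (hv : T.SpaceBound τ₀ γ θ ε v C)
    (hτ : T.IsRoof τ₀ β κ) (hE : T.SpaceExponents τ₀ γ θ ε) (hθ₀ : θ₀ ∈ Ioo (0 : ℝ) 1)
    (hθ : θ ∈ Ico θ₀ 1) : Measurable v := by
  refine T.measurable_of_eq_level (H := T.levelFn v) (fun l => ?_) (fun y => (T.levelFn_coe v y).symm)
  refine T.isFullBranch.measurable_of_comp_branch fun a => ?_
  have hp := mem_Ioo_of_mem_Ico hθ₀ hθ
  have hC := hv.nonneg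
  have hH := hτ.holderConst_pos
  have hΦ := Real.rpow_nonneg (hτ.phiInf_nonneg a) γ
  refine T.isFullBranch.measurable_of_lipschitz hp
    (K := C * Real.exp (ε * l) * ((1 + hτ.holderConst) * T.phiInf τ₀ a ^ γ)) fun z z' => ?_
  have hz := T.isFullBranch.branch_mem a z
  have hz' := T.isFullBranch.branch_mem a z'
  have hs := σ_eq_sigmaAt hz
  have hs' := σ_eq_sigmaAt hz'
  have hd := symbDist_nonneg (G := T.G) (α := T.α) hp.1.le z z'
  by_cases hl : l < T.sigmaAt a
  · rw [T.levelFn_of_lt v (hs ▸ hl), T.levelFn_of_lt v (hs' ▸ hl)]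
    refine (hv.lip a _ hz _ hz' l _ _).trans ?_
    rw [T.isFullBranch.symbDist_branch]
    have h1 := φ_branch_rpow_le hτ hθ₀ hE.γ_pos.le hE.γ_le_one hz
    have h2 : θ * symbDist T.G T.α θ z z' ≤ symbDist T.G T.α θ z z' :=
      mul_le_of_le_one_left hd hp.2.le
    have := hp.1
    gcongr
  · rw [levelFn, levelFn, dif_neg (hs ▸ hl), dif_neg (hs' ▸ hl), sub_self, norm_zero]
    positivity

theorem SpaceBound.integrable {v : T.Y → ℂ} {C : ℝ} (hv : T.SpaceBound τ₀ γ θ ε v C)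
    (hτ : T.IsRoof τ₀ β κ) (hE : T.SpaceExponents τ₀ γ θ ε) (hθ₀ : θ₀ ∈ Ioo (0 : ℝ) 1)
    (hθ : θ ∈ Ico θ₀ 1) : Integrable v T.μ := by
  refine (hE.integrable_tower.const_mul C).mono'
    (hv.measurable hτ hE hθ₀ hθ).aestronglyMeasurable (ae_of_all _ fun y => (hv.bound y).trans ?_)
  exact mul_le_mul_of_nonneg_left (hτ.exp_le_weight hE.ε_pos.le y) hv.nonneg

theorem SpaceBound.branchBound_top {v : T.Y → ℂ} {C : ℝ} (hv : T.SpaceBound τ₀ γ θ ε v C)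
    (hτ : T.IsRoof τ₀ β κ) (hE : T.SpaceExponents τ₀ γ θ ε) (hθ₀ : θ₀ ∈ Ioo (0 : ℝ) 1)
    (hθ : θ ∈ Ico θ₀ 1) : T.isFullBranch.BranchBound θ (T.top v)
      (fun a => C * (1 + hτ.holderConst) * T.weightInf τ₀ γ ε a) := by
  have hp := mem_Ioo_of_mem_Ico hθ₀ hθ
  have hC := hv.nonneg
  have hH := hτ.holderConst_pos
  have hε := hE.ε_pos
  refine ⟨fun a z => ?_, fun a z z' => ?_, ?_⟩
  · have h1 := hτ.exp_le_weightInf γ ε a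
    have h2 := (hτ.weightInf_pos γ ε a).le
    rw [top]
    refine (hv.bound _).trans ?_
    dsimp only
    rw [σ_eq_sigmaAt (T.isFullBranch.branch_mem a z), mul_assoc]
    have h3 : ((T.sigmaAt a - 1 : ℕ) : ℝ) ≤ T.sigmaAt a := by exact_mod_cast Nat.sub_le _ _
    calc _ ≤ C * Real.exp (ε * T.sigmaAt a) := by gcongr
      _ ≤ C * T.weightInf τ₀ γ ε a := by gcongr
      _ ≤ _ := by
        gcongr
        exact le_mul_of_one_le_left h2 (by linarith)
  · have hz := T.isFullBranch.branch_mem a z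
    have hz' := T.isFullBranch.branch_mem a z'
    have hd := symbDist_nonneg (G := T.G) (α := T.α) hp.1.le z z'
    have hs := σ_eq_sigmaAt hz
    have hs' := σ_eq_sigmaAt hz'
    have hpos : 0 < T.sigmaAt a := hs ▸ T.σ_pos _
    have hlt : T.sigmaAt a - 1 < T.σ (T.isFullBranch.branch a z) := by omega
    have hlt' : T.sigmaAt a - 1 < T.σ (T.isFullBranch.branch a z') := by omega
    have e1 : T.top v (T.isFullBranch.branch a z) =
        v ⟨(T.isFullBranch.branch a z, T.sigmaAt a - 1), hlt⟩ := by simp only [top, hs]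
    have e2 : T.top v (T.isFullBranch.branch a z') =
        v ⟨(T.isFullBranch.branch a z', T.sigmaAt a - 1), hlt'⟩ := by simp only [top, hs']
    rw [e1, e2]
    refine (hv.lip a _ hz _ hz' _ hlt hlt').trans ?_
    rw [T.isFullBranch.symbDist_branch]
    have h1 := φ_branch_rpow_le hτ hθ₀ hE.γ_pos.le hE.γ_le_one hz
    have h2 : θ * symbDist T.G T.α θ z z' ≤ symbDist T.G T.α θ z z' :=
      mul_le_of_le_one_left hd hp.2.le
    have h3 : ((T.sigmaAt a - 1 : ℕ) : ℝ) ≤ T.sigmaAt a := by exact_mod_cast Nat.sub_le _ _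
    have h4 := hτ.rpow_mul_exp_le_weightInf hE.γ_pos.le le_rfl ε a
    have h5 := hp.1
    have hΦ := Real.rpow_nonneg (hτ.phiInf_nonneg a) γ
    have hφ := Real.rpow_nonneg (hτ.φ_pos (T.isFullBranch.branch a z)).le γ
    calc _ ≤ C * Real.exp (ε * T.sigmaAt a) * ((1 + hτ.holderConst) * T.phiInf τ₀ a ^ γ) *
          symbDist T.G T.α θ z z' := by gcongr
      _ = C * (1 + hτ.holderConst) * (T.phiInf τ₀ a ^ γ * Real.exp (ε * T.sigmaAt a)) *
          symbDist T.G T.α θ z z' := by ring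
      _ ≤ _ := by gcongr
  · simpa only [mul_assoc] using
      (hτ.summable_weightInf hE.γ_pos.le hE.integrable_base).mul_left (C * (1 + hτ.holderConst))

theorem SpaceBound.exp_mul {v : T.Y → ℂ} {C : ℝ} (hv : T.SpaceBound τ₀ γ θ ε v C)
    (hτ : T.IsRoof τ₀ β κ) (hE : T.SpaceExponents τ₀ γ θ ε) (hθ₀ : θ₀ ∈ Ioo (0 : ℝ) 1)
    (hθ : θ ∈ Ico θ₀ 1) {s : ℂ} (hs : 0 ≤ s.re) (hs1 : ‖s‖ ≤ 1) :
    T.SpaceBound τ₀ γ θ ε (fun y => Complex.exp (-s * (T.τ τ₀ y : ℂ)) * v y)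
      (C * (3 + 4 * hτ.holderConst)) := by
  have hp := mem_Ioo_of_mem_Ico hθ₀ hθ
  have hC := hv.nonneg
  have hH := hτ.holderConst_pos
  refine ⟨fun y => ?_, fun a z hz z' hz' l hl hl' => ?_⟩
  · rw [norm_mul]
    have h1 := norm_cexp_neg_mul_le_one hs (hτ.τ_pos y).le
    calc _ ≤ 1 * (C * Real.exp (ε * y.1.2)) :=
          mul_le_mul h1 (hv.bound y) (norm_nonneg _) zero_le_one
      _ ≤ (3 + 4 * hτ.holderConst) * (C * Real.exp (ε * y.1.2)) := by
          gcongr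
          linarith
      _ = _ := by ring
  · set y : T.Y := ⟨(z, l), hl⟩
    set y' : T.Y := ⟨(z', l), hl'⟩
    have hd := symbDist_nonneg (G := T.G) (α := T.α) hp.1.le z z'
    have h1 := hv.lip a z hz z' hz' l hl hl'
    -- The value of τ at level l is a difference of two consecutive Birkhoff sums, each controlled
    -- by the Hölder condition; hence the factor 2.
    have hτd : |T.τ τ₀ y - T.τ τ₀ y'| ≤
        2 * hτ.holderConst * T.phiInf τ₀ a * symbDist T.G T.α θ₀ z z' := by
      have b1 := hτ.abs_birk_sub_le a hz hz' (Nat.succ_le_of_lt hl)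
      have b2 := hτ.abs_birk_sub_le a hz hz' hl.le
      have e1 : T.τ τ₀ y - T.τ τ₀ y' = (T.birk τ₀ (l + 1) z - T.birk τ₀ (l + 1) z') -
          (T.birk τ₀ l z - T.birk τ₀ l z') := by
        simp only [birk, Finset.sum_range_succ, τ, proj, y, y']
        ring
      rw [e1]
      exact (abs_sub _ _).trans (by linarith)
    have h2 := norm_cexp_neg_mul_sub_le' hs (hτ.τ_pos y).le (hτ.τ_pos y').le hE.γ_pos.le hE.γ_le_one
    have h3 := rpow_le_of_holder hθ₀.1 hE.γ_pos hE.γ_le_one hE.rpow_le (by positivity)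
      (hτ.phiInf_nonneg a) (abs_nonneg _) hτd
    have h4 : (‖s‖ * |T.τ τ₀ y - T.τ τ₀ y'|) ^ γ ≤ |T.τ τ₀ y - T.τ τ₀ y'| ^ γ := by
      have := hE.γ_pos
      gcongr
      exact mul_le_of_le_one_left (abs_nonneg _) hs1
    have h5 : T.phiInf τ₀ a ^ γ ≤ T.φ τ₀ z ^ γ :=
      Real.rpow_le_rpow (hτ.phiInf_nonneg a) (hτ.phiInf_le hz) hE.γ_pos.le
    have h6 : ‖Complex.exp (-s * (T.τ τ₀ y : ℂ)) - Complex.exp (-s * (T.τ τ₀ y' : ℂ))‖ ≤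
        2 * ((1 + 2 * hτ.holderConst) * T.φ τ₀ z ^ γ * symbDist T.G T.α θ z z') := by
      refine h2.trans (mul_le_mul_of_nonneg_left (h4.trans (h3.trans ?_)) zero_le_two)
      gcongr
    have e : Complex.exp (-s * (T.τ τ₀ y : ℂ)) * v y - Complex.exp (-s * (T.τ τ₀ y' : ℂ)) * v y' =
        Complex.exp (-s * (T.τ τ₀ y : ℂ)) * (v y - v y') +
        (Complex.exp (-s * (T.τ τ₀ y : ℂ)) - Complex.exp (-s * (T.τ τ₀ y' : ℂ))) * v y' := by ring
    rw [e]
    refine (norm_add_le _ _).trans ?_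
    rw [norm_mul, norm_mul]
    have h7 := mul_le_mul (norm_cexp_neg_mul_le_one hs (hτ.τ_pos y).le) h1 (norm_nonneg _)
      zero_le_one
    have h8 := mul_le_mul h6 (hv.bound y') (norm_nonneg _) (by
      have := Real.rpow_nonneg (hτ.φ_pos z).le γ
      positivity)
    dsimp only [y'] at h8
    calc _ ≤ _ := add_le_add h7 h8
      _ = _ := by ring

/-- Above the base the operator only shifts levels, and at the base it smooths. In the simplicity
argument this provides a representative in `𝓑(Y)` of a function that is known only almost
everywhere. -/
theorem SpaceBound.towerTransfer {v : T.Y → ℂ} {C : ℝ} (hv : T.SpaceBound τ₀ γ θ ε v C)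
    (hτ : T.IsRoof τ₀ β κ) (hE : T.SpaceExponents τ₀ γ θ ε) (hθ₀ : θ₀ ∈ Ioo (0 : ℝ) 1)
    (hθ : θ ∈ Ico θ₀ 1) : ∃ C', T.SpaceBound τ₀ γ θ ε (T.towerTransfer v) C' := by
  have hp := mem_Ioo_of_mem_Ico hθ₀ hθ
  obtain ⟨hK, hb, hl⟩ := (hv.branchBound_top hτ hE hθ₀ hθ).bound_transfer hθ₀ hθ
  set K := T.isFullBranch.transferConst *
    ∑' a : T.α, C * (1 + hτ.holderConst) * T.weightInf τ₀ γ ε a * T.μZ.real a.1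
  have hC := hv.nonneg
  have hH := hτ.holderConst_pos
  have hε := hE.ε_pos
  refine ⟨K * (1 + hτ.holderConst) + C, ?_, ?_⟩
  · rintro ⟨⟨z, l⟩, hlz⟩
    cases l with
    | zero =>
      rw [T.towerTransfer_zero]
      refine (hb z).trans ?_
      simp only [Nat.cast_zero, mul_zero, Real.exp_zero, mul_one]
      nlinarith
    | succ l =>
      rw [T.towerTransfer_succ]
      refine (hv.bound _).trans ?_
      dsimp only
      gcongr
      · linarith [mul_nonneg hK (by linarith : 0 ≤ 1 + hτ.holderConst)]
      · exact Nat.le_succ l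
  · intro a z hz z' hz' l hlz hlz'
    have hd := symbDist_nonneg (G := T.G) (α := T.α) hp.1.le z z'
    have hφ := Real.rpow_nonneg (hτ.φ_pos z).le γ
    cases l with
    | zero =>
      rw [T.towerTransfer_zero, T.towerTransfer_zero]
      refine (hl z z').trans ?_
      simp only [Nat.cast_zero, mul_zero, Real.exp_zero, mul_one]
      have h1 := hτ.one_le_mul_rpow_φ hθ₀ hE.γ_pos.le hE.γ_le_one z
      gcongr
      calc K = K * 1 := (mul_one K).symm
        _ ≤ K * ((1 + hτ.holderConst) * T.φ τ₀ z ^ γ) := by gcongr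
        _ ≤ K * ((1 + hτ.holderConst) * T.φ τ₀ z ^ γ) + C * T.φ τ₀ z ^ γ :=
          le_add_of_nonneg_right (by positivity)
        _ = _ := by ring
    | succ l =>
      rw [T.towerTransfer_succ, T.towerTransfer_succ]
      refine (hv.lip a z hz z' hz' l _ _).trans ?_
      gcongr
      · linarith [mul_nonneg hK (by linarith : 0 ≤ 1 + hτ.holderConst)]
      · exact Nat.le_succ l

theorem SpaceBound.isTwistedTransfer_iff {v u : T.Y → ℂ} {C : ℝ}
    (hv : T.SpaceBound τ₀ γ θ ε v C) (hτ : T.IsRoof τ₀ β κ) (hE : T.SpaceExponents τ₀ γ θ ε)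
    (hθ₀ : θ₀ ∈ Ioo (0 : ℝ) 1) (hθ : θ ∈ Ico θ₀ 1) {s : ℂ} (hs : 0 ≤ s.re) (hs1 : ‖s‖ ≤ 1) :
    T.IsTwistedTransfer τ₀ s v u ↔
      u =ᵐ[T.μ] T.towerTransfer (fun y => Complex.exp (-s * (T.τ τ₀ y : ℂ)) * v y) := by
  have h := hv.exp_mul hτ hE hθ₀ hθ hs hs1
  exact T.isTransfer_iff hθ₀ hθ (h.measurable hτ hE hθ₀ hθ) (h.integrable hτ hE hθ₀ hθ)
    (h.branchBound_top hτ hE hθ₀ hθ)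

theorem IsTransfer.congr {v v' u u' : T.Y → ℂ} (h : T.IsTransfer v u) (hv : v =ᵐ[T.μ] v')
    (hu : u =ᵐ[T.μ] u') : T.IsTransfer v' u' := by
  refine ⟨h.1.congr hv, h.2.1.congr hu, fun g hg hb => ?_⟩
  exact (integral_congr_ae (hu.symm.mul (ae_eq_refl g))).trans ((h.2.2 g hg hb).trans
    (integral_congr_ae (hv.mul (ae_eq_refl fun y => g (T.F y)))))

variable (T τ₀) in
/-- The function `x ^ ℓ e ^ (-s ψ) w` on the tower. -/
def towerFn (s x : ℂ) (w : LipSpace T.G T.α θ) (y : T.Y) : ℂ :=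
  x ^ y.1.2 * Complex.exp (-s * T.ψ τ₀ y) * fn w y.1.1

/-- The power x^ℓ is paid for by e^{εℓ}, the variation of e^{-sψ} by φ^γ, and the Lipschitz constant
of w by the lower bound on φ. -/
theorem spaceBound_towerFn (hτ : T.IsRoof τ₀ β κ) (hE : T.SpaceExponents τ₀ γ θ ε)
    (hθ₀ : θ₀ ∈ Ioo (0 : ℝ) 1) (hθ : θ ∈ Ico θ₀ 1) {s x : ℂ} (hs : 0 ≤ s.re) (hs1 : ‖s‖ ≤ 1)
    (hx : ‖x‖ ≤ Real.exp ε) (w : LipSpace T.G T.α θ) :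
    T.SpaceBound τ₀ γ θ ε (T.towerFn τ₀ s x w) (‖w‖ * (3 * (1 + hτ.holderConst))) := by
  have hp := mem_Ioo_of_mem_Ico hθ₀ hθ
  have hH := hτ.holderConst_pos
  have hxl : ∀ l : ℕ, ‖x ^ l‖ ≤ Real.exp (ε * l) := fun l => by
    rw [norm_pow]; exact pow_le_exp_mul (norm_nonneg _) hx l
  refine ⟨fun y => ?_, fun a z hz z' hz' l hl hl' => ?_⟩
  · rw [towerFn, norm_mul, norm_mul]
    calc _ ≤ Real.exp (ε * y.1.2) * 1 * ‖w‖ := by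
          gcongr
          · exact hxl _
          · exact norm_cexp_neg_mul_le_one hs (hτ.ψ_nonneg y)
          · exact norm_fn_le w _
      _ ≤ Real.exp (ε * y.1.2) * (3 * (1 + hτ.holderConst)) * ‖w‖ := by
          gcongr
          linarith
      _ = _ := by ring
  · set y : T.Y := ⟨(z, l), hl⟩
    set y' : T.Y := ⟨(z', l), hl'⟩
    have hd := symbDist_nonneg (G := T.G) (α := T.α) hp.1.le z z'
    have hψd : |T.ψ τ₀ y - T.ψ τ₀ y'| ≤
        hτ.holderConst * T.phiInf τ₀ a * symbDist T.G T.α θ₀ z z' :=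
      hτ.abs_birk_sub_le a hz hz' hl.le
    have h2 := norm_cexp_neg_mul_sub_le' hs (hτ.ψ_nonneg y) (hτ.ψ_nonneg y') hE.γ_pos.le hE.γ_le_one
    have h3 := rpow_le_of_holder hθ₀.1 hE.γ_pos hE.γ_le_one hE.rpow_le hH.le
      (hτ.phiInf_nonneg a) (abs_nonneg _) hψd
    have h4 : (‖s‖ * |T.ψ τ₀ y - T.ψ τ₀ y'|) ^ γ ≤ |T.ψ τ₀ y - T.ψ τ₀ y'| ^ γ := by
      have := hE.γ_pos
      gcongr
      exact mul_le_of_le_one_left (abs_nonneg _) hs1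
    have h5 : T.phiInf τ₀ a ^ γ ≤ T.φ τ₀ z ^ γ :=
      Real.rpow_le_rpow (hτ.phiInf_nonneg a) (hτ.phiInf_le hz) hE.γ_pos.le
    have h6 : ‖Complex.exp (-s * (T.ψ τ₀ y : ℂ)) - Complex.exp (-s * (T.ψ τ₀ y' : ℂ))‖ ≤
        2 * ((1 + hτ.holderConst) * T.φ τ₀ z ^ γ * symbDist T.G T.α θ z z') := by
      refine h2.trans (mul_le_mul_of_nonneg_left (h4.trans (h3.trans ?_)) zero_le_two)
      gcongr
    have h7 : ‖fn w z - fn w z'‖ ≤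
        ‖w‖ * ((1 + hτ.holderConst) * T.φ τ₀ z ^ γ * symbDist T.G T.α θ z z') :=
      (norm_fn_sub_le hp.1.le w z z').trans (by
        gcongr
        exact le_mul_of_one_le_left hd (hτ.one_le_mul_rpow_φ hθ₀ hE.γ_pos.le hE.γ_le_one z))
    have e : T.towerFn τ₀ s x w y - T.towerFn τ₀ s x w y' =
        x ^ l * ((Complex.exp (-s * (T.ψ τ₀ y : ℂ)) - Complex.exp (-s * (T.ψ τ₀ y' : ℂ))) * fn w z +
          Complex.exp (-s * (T.ψ τ₀ y' : ℂ)) * (fn w z - fn w z')) := by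
      simp only [towerFn, y, y']
      ring
    rw [e, norm_mul]
    have hφ := Real.rpow_nonneg (hτ.φ_pos z).le γ
    have h8 := mul_le_mul h6 (norm_fn_le w z) (norm_nonneg _) (by positivity)
    have h9 := mul_le_mul (norm_cexp_neg_mul_le_one hs (hτ.ψ_nonneg y')) h7 (norm_nonneg _)
      zero_le_one
    calc _ ≤ Real.exp (ε * l) * (2 * ((1 + hτ.holderConst) * T.φ τ₀ z ^ γ *
          symbDist T.G T.α θ z z') * ‖w‖ + 1 * (‖w‖ * ((1 + hτ.holderConst) * T.φ τ₀ z ^ γ *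
            symbDist T.G T.α θ z z'))) := by
          refine mul_le_mul (hxl l) ((norm_add_le _ _).trans ?_) (norm_nonneg _) (by positivity)
          rw [norm_mul, norm_mul]
          exact add_le_add h8 h9
      _ = _ := by ring

end YoungTower
end

/-! ### Reduction of eigenfunction equations from the tower to the base. -/

noncomputable section

namespace YoungTower

open IsFullBranchGibbsMarkov LipSpace

variable {X : Type*} [MeasurableSpace X] {θ₀ : ℝ} {T : YoungTower X θ₀} {τ₀ : X → ℝ} {β κ : ℝ}
  {θ γ ε : ℝ}

theorem towerFn_zero (s x : ℂ) (w : LipSpace T.G T.α θ) (z : T.Z) (h : 0 < T.σ z) :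
    T.towerFn τ₀ s x w ⟨(z, 0), h⟩ = fn w z := by
  simp [towerFn, ψ, birk]

theorem towerFn_succ (s x : ℂ) (w : LipSpace T.G T.α θ) (z : T.Z) {l : ℕ} (h : l + 1 < T.σ z) :
    T.towerFn τ₀ s x w ⟨(z, l + 1), h⟩ = x * (Complex.exp
      (-s * (T.τ τ₀ ⟨(z, l), (Nat.lt_succ_self l).trans h⟩ : ℂ)) *
      T.towerFn τ₀ s x w ⟨(z, l), (Nat.lt_succ_self l).trans h⟩) := by
  have e : T.ψ τ₀ ⟨(z, l + 1), h⟩ = T.ψ τ₀ ⟨(z, l), (Nat.lt_succ_self l).trans h⟩ +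
      T.τ τ₀ ⟨(z, l), (Nat.lt_succ_self l).trans h⟩ := by
    simp [ψ, birk, Finset.sum_range_succ, τ, proj]
  simp only [towerFn]
  rw [e]
  push_cast
  rw [mul_add, Complex.exp_add]
  ring

/-- At the top of a column the last factor e^{-sτ} completes e^{-sψ} to e^{-sφ}, and one more x
completes x^{σ-1} to x^σ. This is how `R̂(s)` on the tower induces L(s, x) on the base. -/
theorem top_exp_mul_towerFn (s x : ℂ) (w : LipSpace T.G T.α θ) (z : T.Z) :
    x * T.top (fun y => Complex.exp (-s * (T.τ τ₀ y : ℂ)) * T.towerFn τ₀ s x w y) z =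
      T.mult τ₀ s x z * fn w z := by
  obtain ⟨l, hl⟩ : ∃ l, T.σ z = l + 1 := Nat.exists_eq_succ_of_ne_zero (T.σ_pos z).ne'
  have e : T.φ τ₀ z = T.birk τ₀ l z + τ₀ (T.f^[l] z) := by
    rw [φ, hl, birk, Finset.sum_range_succ]; rfl
  simp only [top, towerFn, mult, ψ, τ, proj, e, hl]
  push_cast
  rw [mul_add, Complex.exp_add, pow_succ]
  ring

/-- A generalized eigenfunction equation on the tower reduces to one on the base. -/
theorem exists_base_of_transfer (hτ : T.IsRoof τ₀ β κ) (hE : T.SpaceExponents τ₀ γ θ ε)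
    (hθ₀ : θ₀ ∈ Ioo (0 : ℝ) 1) (hθ : θ ∈ Ico θ₀ 1) {s x : ℂ} (hs : 0 ≤ s.re) (hs1 : ‖s‖ ≤ 1)
    (hx : x ≠ 0) {V V₁ : T.α → ℝ} (hV : T.isFullBranch.BranchBound θ (T.mult τ₀ s x) V)
    (hV₁ : T.isFullBranch.BranchBound θ (fun z => T.σ z * T.mult τ₀ s x z) V₁)
    {u₀ : LipSpace T.G T.α θ} (hu₀ : T.twisted τ₀ hθ₀ hθ s x u₀ = u₀) {v : T.Y → ℂ} {C : ℝ}
    (hv : T.SpaceBound τ₀ γ θ ε v C)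
    (htr : T.IsTwistedTransfer τ₀ s v (fun y => x⁻¹ * v y + T.towerFn τ₀ s x u₀ y)) :
    ∃ v₀ : LipSpace T.G T.α θ,
      (∀ᵐ y ∂T.μ, v y = T.towerFn τ₀ s x v₀ y - y.1.2 * x * T.towerFn τ₀ s x u₀ y) ∧
      T.twisted τ₀ hθ₀ hθ s x v₀ = v₀ + x • hV₁.mulTransfer hθ₀ hθ u₀ := by
  have hp := mem_Ioo_of_mem_Ico hθ₀ hθ
  have hb := T.ae_base ((hv.isTwistedTransfer_iff hτ hE hθ₀ hθ hs hs1).1 htr)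
  set d : T.Y → ℂ := fun y => Complex.exp (-s * (T.τ τ₀ y : ℂ)) * v y with hd
  have hB := (hv.exp_mul hτ hE hθ₀ hθ hs hs1).branchBound_top hτ hE hθ₀ hθ
  -- The value of v at level 0 is read off from the transfer of its top level, which is Lipschitz on
  -- all of Z. This replaces v at the base by an element of `LipSpace`.
  obtain ⟨w₁, hw₁, -⟩ := T.isFullBranch.exists_lipSpace hp.1 (hB.bound_transfer hθ₀ hθ)
  set v₀ : LipSpace T.G T.α θ := x • w₁ - x • u₀ with hv₀
  -- Climbing one level multiplies by x e^{-sτ} and subtracts x times the inhomogeneity. The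
  -- subtractions accumulate to the factor ℓx, as in a Jordan block.
  have hlev : ∀ᵐ z ∂T.μZ, ∀ (l : ℕ) (hl : l < T.σ z), v ⟨(z, l), hl⟩ =
      T.towerFn τ₀ s x v₀ ⟨(z, l), hl⟩ - l * x * T.towerFn τ₀ s x u₀ ⟨(z, l), hl⟩ := by
    filter_upwards [hb] with z hz l
    induction l with
    | zero =>
      intro hl
      have h := hz 0 hl
      rw [T.towerTransfer_zero, towerFn_zero] at h
      rw [towerFn_zero, towerFn_zero, hv₀, fn_sub, fn_smul, fn_smul, hw₁, ← h]
      field_simp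
      push_cast
      ring
    | succ l ih =>
      intro hl
      have h := hz (l + 1) hl
      have hl' : l < T.σ z := (Nat.lt_succ_self l).trans hl
      rw [T.towerTransfer_succ, hd] at h
      dsimp only at h
      rw [ih hl'] at h
      have h2 : v ⟨(z, l + 1), hl⟩ = x * (x⁻¹ * v ⟨(z, l + 1), hl⟩) := by
        rw [mul_inv_cancel_left₀ hx]
      rw [h2, eq_sub_of_add_eq h, towerFn_succ, towerFn_succ]
      push_cast
      ring
  refine ⟨v₀, ?_, ?_⟩
  · filter_upwards [T.ae_tower hlev] with y hy
    exact hy y.1.2 y.2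
  · have ht : T.top d =ᵐ[T.μZ] fun z => x⁻¹ * (T.mult τ₀ s x z * fn v₀ z +
        (x * (T.mult τ₀ s x z * fn u₀ z) - x * (T.σ z * T.mult τ₀ s x z * fn u₀ z))) := by
      filter_upwards [hlev] with z hz
      have h1 := hz (T.σ z - 1) (Nat.sub_lt (T.σ_pos z) zero_lt_one)
      have h2 : T.top d z = T.top (fun y => Complex.exp (-s * (T.τ τ₀ y : ℂ)) *
          T.towerFn τ₀ s x v₀ y) z - (T.σ z - 1) * x * T.top (fun y =>
          Complex.exp (-s * (T.τ τ₀ y : ℂ)) * T.towerFn τ₀ s x u₀ y) z := by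
        simp only [top, hd]
        rw [h1, Nat.cast_pred (T.σ_pos z)]
        ring
      rw [h2, ← top_exp_mul_towerFn, mul_assoc (T.σ z : ℂ), ← top_exp_mul_towerFn]
      field_simp
      ring
    have ht' := T.isFullBranch.transfer_congr_ae ht
    have b1 := hV.mul_fn hp v₀
    have b2 := (hV.mul_fn hp u₀).const_mul x
    have b3 := (hV₁.mul_fn hp u₀).const_mul x
    have key : w₁ = x⁻¹ • (T.twisted τ₀ hθ₀ hθ s x v₀ + (x • u₀ -
        x • hV₁.mulTransfer hθ₀ hθ u₀)) := by
      refine T.isFullBranch.lipSpace_ext_ae hp ?_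
      filter_upwards [ht'] with z hz
      rw [hw₁, hz, transfer_const_mul, b1.transfer_add (b2.sub b3) hθ₀, b2.transfer_sub b3 hθ₀,
        transfer_const_mul, transfer_const_mul, fn_smul, fn_add, fn_sub, fn_smul, fn_smul,
        fn_twisted hV, BranchBound.fn_mulTransfer]
      nth_rw 3 [← hu₀]
      rw [fn_twisted hV]
    have h3 : x • w₁ = T.twisted τ₀ hθ₀ hθ s x v₀ + (x • u₀ -
        x • hV₁.mulTransfer hθ₀ hθ u₀) := by
      rw [key, smul_smul, mul_inv_cancel₀ hx, one_smul]
    nth_rw 2 [hv₀]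
    rw [h3]
    abel

/-- The transfer operator applied to `e ^ (-s τ) x ^ ℓ e ^ (-s ψ) w`. -/
theorem mul_towerTransfer_exp_mul_towerFn {s x : ℂ} {V : T.α → ℝ}
    (hV : T.isFullBranch.BranchBound θ (T.mult τ₀ s x) V) (hθ₀ : θ₀ ∈ Ioo (0 : ℝ) 1)
    (hθ : θ ∈ Ico θ₀ 1) (w : LipSpace T.G T.α θ) (y : T.Y) :
    x * T.towerTransfer (fun y => Complex.exp (-s * (T.τ τ₀ y : ℂ)) * T.towerFn τ₀ s x w y) y =
      T.towerFn τ₀ s x w y + if y.1.2 = 0 then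
        fn (T.twisted τ₀ hθ₀ hθ s x w) y.1.1 - fn w y.1.1 else 0 := by
  obtain ⟨⟨z, l⟩, hl⟩ := y
  cases l with
  | zero =>
    rw [T.towerTransfer_zero, ← transfer_const_mul, towerFn_zero, if_pos rfl, fn_twisted hV,
      add_sub_cancel]
    congr 1
    ext z
    exact top_exp_mul_towerFn s x w z
  | succ l =>
    rw [T.towerTransfer_succ, towerFn_succ, if_neg (Nat.succ_ne_zero l), add_zero]

theorem integral_ite_zero (c : ℂ) :
    ∫ y : T.Y, (if y.1.2 = 0 then c else 0) ∂T.μ = (T.meanReturnReal : ℂ)⁻¹ * c := by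
  have hm : Measurable fun y : T.Y => if y.1.2 = 0 then c else 0 :=
    T.measurable_of_eq_level (H := fun _ l => if l = 0 then c else 0)
      (fun l => measurable_const) fun _ => rfl
  have hi : Integrable (fun y : T.Y => if y.1.2 = 0 then c else 0) T.μ :=
    (integrable_const ‖c‖).mono' hm.aestronglyMeasurable (ae_of_all _ fun y => by
      split_ifs <;> simp)
  rw [T.integral_μ hm hi]
  congr 1
  have : ∀ z, ∑ l ∈ Finset.range (T.σ z),
      T.levelFn (fun y : T.Y => if y.1.2 = 0 then c else 0) z l = c := fun z => by
    rw [Finset.sum_eq_single_of_mem 0 (Finset.mem_range.2 (T.σ_pos z)) fun l hl h0 => by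
      rw [T.levelFn_of_lt _ (Finset.mem_range.1 hl)]; simp [h0], T.levelFn_of_lt _ (T.σ_pos z)]
    simp
  simp_rw [this]
  simp

end YoungTower
end

/-! ### The candidate eigenfunction x^ℓ e^{-sψ} W and its integrals N and J. -/

noncomputable section

theorem rpow_le_one_add_rpow {t γ γ' : ℝ} (ht : 0 ≤ t) (hγ : 0 ≤ γ) (h : γ ≤ γ') :
    t ^ γ ≤ 1 + t ^ γ' := by
  rcases le_or_gt t 1 with h1 | h1
  · linarith [Real.rpow_le_one ht h1 hγ, Real.rpow_nonneg ht γ']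
  · linarith [Real.rpow_le_rpow_of_exponent_le h1.le h]

namespace YoungTower

open IsFullBranchGibbsMarkov LipSpace

variable {X : Type*} [MeasurableSpace X] {θ₀ : ℝ} {T : YoungTower X θ₀} {τ₀ : X → ℝ} {β κ : ℝ}
  {θ γ κ₁ e r C : ℝ} {hθ₀ : θ₀ ∈ Ioo (0 : ℝ) 1} {hθ : θ ∈ Ico θ₀ 1}

variable (T τ₀) in
/-- The unnormalized eigenfunction `x ^ ℓ e ^ (-s ψ) W(s, x)`. -/
def preFn (hθ₀ : θ₀ ∈ Ioo (0 : ℝ) 1) (hθ : θ ∈ Ico θ₀ 1) (s x : ℂ) : T.Y → ℂ :=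
  T.towerFn τ₀ s x (T.baseFn τ₀ hθ₀ hθ s x)

theorem exp_level_le {e : ℝ} (he : 0 ≤ e) (y : T.Y) :
    Real.exp (e * y.1.2) ≤ Real.exp (e * T.σ y.1.1) := by
  have : (y.1.2 : ℝ) ≤ T.σ y.1.1 := by exact_mod_cast y.2.le
  gcongr

theorem measurable_towerFn (hτ : T.IsRoof τ₀ β κ) (hp : θ ∈ Ioo (0 : ℝ) 1) (s x : ℂ)
    (w : LipSpace T.G T.α θ) : Measurable (T.towerFn τ₀ s x w) := by
  refine T.measurable_of_eq_level (H := fun z l => x ^ l * Complex.exp (-s * T.birk τ₀ l z) *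
    fn w z) (fun l => ?_) fun _ => rfl
  exact (((Complex.measurable_ofReal.comp (hτ.measurable_birk l)).const_mul (-s)).cexp.const_mul
    (x ^ l)).mul (T.isFullBranch.measurable_fn hp w)

theorem preFn_zero_one (y : T.Y) :
    T.preFn τ₀ hθ₀ hθ 0 1 y = (T.isFullBranch.minorConst θ : ℂ)⁻¹ := by
  simp [preFn, towerFn, fn_baseFn_zero_one]

theorem norm_towerFn_le (hτ : T.IsRoof τ₀ β κ) (he : 0 < e) {s x : ℂ} (hs : 0 ≤ s.re)
    (hx : ‖x‖ ≤ Real.exp (e / 4)) (w : LipSpace T.G T.α θ) (y : T.Y) :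
    ‖T.towerFn τ₀ s x w y‖ ≤ ‖w‖ * Real.exp (e / 4 * T.σ y.1.1) := by
  rw [towerFn, norm_mul, norm_mul]
  calc _ ≤ Real.exp (e / 4 * T.σ y.1.1) * 1 * ‖w‖ := by
        gcongr
        · exact (norm_pow_le_exp hx _).trans (exp_level_le (by positivity) y)
        · exact norm_cexp_neg_mul_le_one hs (hτ.ψ_nonneg y)
        · exact norm_fn_le w _
    _ = _ := by ring

theorem integrable_of_norm_le_exp {f : T.Y → ℂ} (hf : Measurable f) (hτ : T.IsRoof τ₀ β κ)
    (E : T.Exponents τ₀ θ γ κ₁ e) {B : ℝ} (hB : ∀ y, ‖f y‖ ≤ B * Real.exp (e * T.σ y.1.1)) :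
    Integrable f T.μ := by
  refine (E.integrable_tower.const_mul (max B 0)).mono' hf.aestronglyMeasurable
    (ae_of_all _ fun y => (hB y).trans ?_)
  refine mul_le_mul (le_max_left _ _) (le_mul_of_one_le_left (Real.exp_pos _).le ?_)
    (Real.exp_pos _).le (le_max_right _ _)
  linarith [Real.rpow_nonneg (hτ.φ_pos y.1.1).le (γ + κ₁)]

variable (T τ₀) in
/-- The integral of the weight over the tower. -/
def weightInt (γ e : ℝ) : ℝ := ∫ y : T.Y, T.weight τ₀ γ e y.1.1 ∂T.μ

theorem IsRoof.weightInt_nonneg (hτ : T.IsRoof τ₀ β κ) (γ e : ℝ) : 0 ≤ T.weightInt τ₀ γ e :=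
  integral_nonneg fun y => (hτ.weight_pos γ e y.1.1).le

theorem norm_integral_le_weightInt {f : T.Y → ℂ} (E : T.Exponents τ₀ θ γ κ₁ e) {B : ℝ}
    (hB : ∀ᵐ y ∂T.μ, ‖f y‖ ≤ B * T.weight τ₀ (γ + κ₁) e y.1.1) :
    ‖∫ y, f y ∂T.μ‖ ≤ B * T.weightInt τ₀ (γ + κ₁) e := by
  rw [weightInt, ← integral_const_mul]
  exact norm_integral_le_of_norm_le (E.integrable_tower.const_mul B) hB

theorem Exponents.rpow_mul_exp_le (E : T.Exponents τ₀ θ γ κ₁ e) (hτ : T.IsRoof τ₀ β κ) {e' : ℝ}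
    (he' : e' ≤ e) (z : T.Z) :
    T.φ τ₀ z ^ γ * Real.exp (e' * T.σ z) ≤ T.weight τ₀ (γ + κ₁) e z := by
  have h1 := rpow_le_one_add_rpow (hτ.φ_pos z).le E.γ_pos.le
    (by linarith [E.κ_pos] : γ ≤ γ + κ₁)
  have h2 := Real.rpow_nonneg (hτ.φ_pos z).le γ
  unfold weight
  exact mul_le_mul h1 (Real.exp_le_exp.2 (by gcongr)) (Real.exp_pos _).le (h2.trans h1)

theorem Exponents.one_add_rpow_mul_exp_le (E : T.Exponents τ₀ θ γ κ₁ e) (hτ : T.IsRoof τ₀ β κ)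
    {e' : ℝ} (he' : e' ≤ e) (z : T.Z) :
    (1 + T.φ τ₀ z ^ γ) * Real.exp (e' * T.σ z) ≤ 2 * T.weight τ₀ (γ + κ₁) e z := by
  have h1 := rpow_le_one_add_rpow (hτ.φ_pos z).le E.γ_pos.le
    (by linarith [E.κ_pos] : γ ≤ γ + κ₁)
  have h2 := Real.rpow_nonneg (hτ.φ_pos z).le γ
  have h3 := Real.rpow_nonneg (hτ.φ_pos z).le (γ + κ₁)
  unfold weight
  calc _ ≤ (1 + (1 + T.φ τ₀ z ^ (γ + κ₁))) * Real.exp (e * T.σ z) := by gcongr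
    _ ≤ (2 * (1 + T.φ τ₀ z ^ (γ + κ₁))) * Real.exp (e * T.σ z) := by gcongr; linarith
    _ = _ := by ring

theorem Exponents.one_add_rpow_mul_rpow_mul_exp_le (E : T.Exponents τ₀ θ γ κ₁ e)
    (hτ : T.IsRoof τ₀ β κ) {e' : ℝ} (he' : e' ≤ e) (z : T.Z) :
    T.φ τ₀ z ^ κ₁ * ((1 + T.φ τ₀ z ^ γ) * Real.exp (e' * T.σ z)) ≤
      2 * T.weight τ₀ (γ + κ₁) e z := by
  have h1 := rpow_le_one_add_rpow (hτ.φ_pos z).le E.κ_pos.le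
    (by linarith [E.γ_pos] : κ₁ ≤ γ + κ₁)
  have h2 := Real.rpow_nonneg (hτ.φ_pos z).le κ₁
  have h3 := Real.rpow_nonneg (hτ.φ_pos z).le (γ + κ₁)
  unfold weight
  calc _ = (T.φ τ₀ z ^ κ₁ + T.φ τ₀ z ^ (γ + κ₁)) * Real.exp (e' * T.σ z) := by
        rw [Real.rpow_add (hτ.φ_pos z)]; ring
    _ ≤ ((1 + T.φ τ₀ z ^ (γ + κ₁)) + T.φ τ₀ z ^ (γ + κ₁)) * Real.exp (e * T.σ z) := by gcongr
    _ ≤ (2 * (1 + T.φ τ₀ z ^ (γ + κ₁))) * Real.exp (e * T.σ z) := by gcongr; linarith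
    _ = _ := by ring

/-- Integrals against `e ^ (-s τ) - 1` are of size `|s| ^ γ`. -/
theorem Exponents.norm_integral_exp_sub_one_mul_le (E : T.Exponents τ₀ θ γ κ₁ e)
    (hτ : T.IsRoof τ₀ β κ) {s : ℂ} (hs : 0 ≤ s.re) {f : T.Y → ℂ} {B : ℝ} (hB0 : 0 ≤ B)
    (hB : ∀ᵐ y ∂T.μ, ‖f y‖ ≤ B * Real.exp (e * T.σ y.1.1)) :
    ‖∫ y, (Complex.exp (-s * (T.τ τ₀ y : ℂ)) - 1) * f y ∂T.μ‖ ≤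
      2 * ‖s‖ ^ γ * B * T.weightInt τ₀ (γ + κ₁) e := by
  refine norm_integral_le_weightInt E ?_
  filter_upwards [hB] with y hy
  rw [norm_mul]
  have h1 := norm_cexp_neg_mul_sub_one_le hs (hτ.τ_pos y).le E.γ_pos.le E.γ_le_one
  have h2 : (‖s‖ * T.τ τ₀ y) ^ γ ≤ ‖s‖ ^ γ * T.φ τ₀ y.1.1 ^ γ := by
    rw [Real.mul_rpow (norm_nonneg _) (hτ.τ_pos y).le]
    have := Real.rpow_le_rpow (hτ.τ_pos y).le (hτ.τ_le_φ y) E.γ_pos.le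
    gcongr
  have h3 := E.rpow_mul_exp_le hτ le_rfl y.1.1
  have h4 := Real.rpow_nonneg (hτ.φ_pos y.1.1).le γ
  calc _ ≤ (2 * (‖s‖ ^ γ * T.φ τ₀ y.1.1 ^ γ)) * (B * Real.exp (e * T.σ y.1.1)) :=
        mul_le_mul (h1.trans (by linarith)) hy (norm_nonneg _) (by positivity)
    _ = 2 * ‖s‖ ^ γ * B * (T.φ τ₀ y.1.1 ^ γ * Real.exp (e * T.σ y.1.1)) := by ring
    _ ≤ _ := by gcongr

theorem Exponents.norm_integral_le (E : T.Exponents τ₀ θ γ κ₁ e)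
    (hτ : T.IsRoof τ₀ β κ) {f : T.Y → ℂ} {B : ℝ} (hB0 : 0 ≤ B)
    (hB : ∀ᵐ y ∂T.μ, ‖f y‖ ≤ B * Real.exp (e * T.σ y.1.1)) :
    ‖∫ y, f y ∂T.μ‖ ≤ B * T.weightInt τ₀ (γ + κ₁) e := by
  refine norm_integral_le_weightInt E ?_
  filter_upwards [hB] with y hy
  refine hy.trans (mul_le_mul_of_nonneg_left
    (le_mul_of_one_le_left (Real.exp_pos _).le ?_) hB0)
  linarith [Real.rpow_nonneg (hτ.φ_pos y.1.1).le (γ + κ₁)]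

/-- The constant in the continuity estimates for `preFn`. -/
def preConst (e C : ℝ) : ℝ := 4 / e * C + 2 * C + C * C * C

namespace Regime

theorem preConst_pos (R : Regime T τ₀ hθ₀ hθ γ κ₁ e r C) : 0 < preConst e C := by
  have := R.C_pos
  have := R.e_pos
  unfold preConst
  positivity

theorem norm_preFn_le (R : Regime T τ₀ hθ₀ hθ γ κ₁ e r C) (hτ : T.IsRoof τ₀ β κ) {s x : ℂ}
    (hs : 0 ≤ s.re) (hsr : ‖s‖ < r) (hx : ‖x - 1‖ < r) (y : T.Y) :
    ‖T.preFn τ₀ hθ₀ hθ s x y‖ ≤ C * Real.exp (e / 4 * T.σ y.1.1) :=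
  (norm_towerFn_le hτ R.e_pos hs (R.norm_le x hx) _ y).trans
    (mul_le_mul_of_nonneg_right (R.norm_baseFn_le hs hsr hx) (Real.exp_pos _).le)

theorem norm_preFn_le' (R : Regime T τ₀ hθ₀ hθ γ κ₁ e r C) (hτ : T.IsRoof τ₀ β κ) {s x : ℂ}
    (hs : 0 ≤ s.re) (hsr : ‖s‖ < r) (hx : ‖x - 1‖ < r) (y : T.Y) :
    ‖T.preFn τ₀ hθ₀ hθ s x y‖ ≤ C * Real.exp (e * T.σ y.1.1) := by
  refine (R.norm_preFn_le hτ hs hsr hx y).trans ?_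
  have := R.C_pos
  have := R.e_pos
  gcongr
  linarith

theorem measurable_preFn (_R : Regime T τ₀ hθ₀ hθ γ κ₁ e r C) (hτ : T.IsRoof τ₀ β κ) (s x : ℂ) :
    Measurable (T.preFn τ₀ hθ₀ hθ s x) :=
  measurable_towerFn hτ (mem_Ioo_of_mem_Ico hθ₀ hθ) s x _

theorem integrable_preFn (R : Regime T τ₀ hθ₀ hθ γ κ₁ e r C) (hτ : T.IsRoof τ₀ β κ) {s x : ℂ}
    (hs : 0 ≤ s.re) (hsr : ‖s‖ < r) (hx : ‖x - 1‖ < r) :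
    Integrable (T.preFn τ₀ hθ₀ hθ s x) T.μ :=
  integrable_of_norm_le_exp (R.measurable_preFn hτ s x) hτ R.toExponents
    (R.norm_preFn_le' hτ hs hsr hx)

/-- The factors x^ℓ, e^{-sψ} and W are changed one at a time. The first costs a factor ℓ, hence the
rate e/2; the second costs φ^γ; the third is the resolvent estimate. -/
theorem norm_preFn_sub_le (R : Regime T τ₀ hθ₀ hθ γ κ₁ e r C) (hτ : T.IsRoof τ₀ β κ)
    {s x s' x' : ℂ} (hs : 0 ≤ s.re) (hsr : ‖s‖ < r) (hx : ‖x - 1‖ < r) (hs' : 0 ≤ s'.re)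
    (hsr' : ‖s'‖ < r) (hx' : ‖x' - 1‖ < r) (y : T.Y) :
    ‖T.preFn τ₀ hθ₀ hθ s x y - T.preFn τ₀ hθ₀ hθ s' x' y‖ ≤
      preConst e C * (‖s - s'‖ ^ κ₁ * ‖s‖ ^ γ + ‖s - s'‖ ^ γ + ‖x - x'‖) *
        ((1 + T.φ τ₀ y.1.1 ^ γ) * Real.exp (e / 2 * T.σ y.1.1)) := by
  have hC := R.C_pos
  have he := R.e_pos
  have hγ := R.γ_pos
  set D := ‖s - s'‖ ^ κ₁ * ‖s‖ ^ γ + ‖s - s'‖ ^ γ + ‖x - x'‖ with hD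
  have hD1 : ‖x - x'‖ ≤ D := by
    have : 0 ≤ ‖s - s'‖ ^ κ₁ * ‖s‖ ^ γ + ‖s - s'‖ ^ γ := by positivity
    linarith
  have hD2 : ‖s - s'‖ ^ γ ≤ D := by
    have : 0 ≤ ‖s - s'‖ ^ κ₁ * ‖s‖ ^ γ + ‖x - x'‖ := by positivity
    linarith
  have hD0 : 0 ≤ D := (norm_nonneg _).trans hD1
  set Φ := T.φ τ₀ y.1.1 ^ γ
  have hΦ : 0 ≤ Φ := Real.rpow_nonneg (hτ.φ_pos y.1.1).le γ
  set P := Real.exp (e / 2 * T.σ y.1.1)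
  have hP : 0 < P := Real.exp_pos _
  have hP4 : Real.exp (e / 4 * y.1.2) ≤ P := by
    refine (exp_level_le (by positivity) y).trans ?_
    simp only [P]
    gcongr
    linarith
  have hP2 : Real.exp (e / 2 * y.1.2) ≤ P := exp_level_le (by positivity) y
  set W := T.baseFn τ₀ hθ₀ hθ s x
  set W' := T.baseFn τ₀ hθ₀ hθ s' x'
  have hW : ‖fn W y.1.1‖ ≤ C := (norm_fn_le _ _).trans (R.norm_baseFn_le hs hsr hx)
  have hWW : ‖fn W y.1.1 - fn W' y.1.1‖ ≤ C * C * C * D := by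
    rw [← fn_sub]
    exact (norm_fn_le _ _).trans (R.norm_baseFn_sub_le hs hsr hx hs' hsr' hx')
  have hψ := hτ.ψ_nonneg y
  have e1 : T.preFn τ₀ hθ₀ hθ s x y - T.preFn τ₀ hθ₀ hθ s' x' y =
      (x ^ y.1.2 - x' ^ y.1.2) * (Complex.exp (-s * T.ψ τ₀ y) * fn W y.1.1) +
      x' ^ y.1.2 * ((Complex.exp (-s * T.ψ τ₀ y) - Complex.exp (-s' * T.ψ τ₀ y)) * fn W y.1.1) +
      x' ^ y.1.2 * (Complex.exp (-s' * T.ψ τ₀ y) * (fn W y.1.1 - fn W' y.1.1)) := by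
    simp only [preFn, towerFn, W, W']
    ring
  have b1 : ‖(x ^ y.1.2 - x' ^ y.1.2) * (Complex.exp (-s * T.ψ τ₀ y) * fn W y.1.1)‖ ≤
      4 / e * D * P * (1 * C) := by
    rw [norm_mul, norm_mul]
    refine mul_le_mul ((norm_pow_sub_pow_le_exp he (R.norm_le x hx) (R.norm_le x' hx') _).trans ?_)
      (mul_le_mul (norm_cexp_neg_mul_le_one hs hψ) hW (norm_nonneg _) zero_le_one) (by positivity)
      (by positivity)
    gcongr
  have b2 : ‖x' ^ y.1.2 * ((Complex.exp (-s * T.ψ τ₀ y) - Complex.exp (-s' * T.ψ τ₀ y)) *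
      fn W y.1.1)‖ ≤ P * ((2 * (D * Φ)) * C) := by
    rw [norm_mul, norm_mul]
    refine mul_le_mul ((norm_pow_le_exp (R.norm_le x' hx') _).trans hP4)
      (mul_le_mul ((norm_cexp_neg_mul_sub_le hs hs' hψ hγ.le R.γ_le_one).trans ?_) hW
        (norm_nonneg _) (by positivity)) (by positivity) hP.le
    rw [Real.mul_rpow (norm_nonneg _) hψ]
    have := Real.rpow_le_rpow hψ (hτ.ψ_le_φ y) hγ.le
    gcongr
  have b3 : ‖x' ^ y.1.2 * (Complex.exp (-s' * T.ψ τ₀ y) * (fn W y.1.1 - fn W' y.1.1))‖ ≤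
      P * (1 * (C * C * C * D)) := by
    rw [norm_mul, norm_mul]
    exact mul_le_mul ((norm_pow_le_exp (R.norm_le x' hx') _).trans hP4)
      (mul_le_mul (norm_cexp_neg_mul_le_one hs' hψ) hWW (norm_nonneg _) zero_le_one)
      (by positivity) hP.le
  rw [e1]
  refine (norm_add₃_le.trans (add_le_add (add_le_add b1 b2) b3)).trans ?_
  unfold preConst
  have : (4 / e * C + 2 * C + C * C * C) * D * ((1 + Φ) * P) - (4 / e * D * P * (1 * C) +
      P * (2 * (D * Φ) * C) + P * (1 * (C * C * C * D))) =
      D * P * ((4 / e * C + C * C * C) * Φ + 2 * C) := by ring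
  have h2 : 0 ≤ D * P * ((4 / e * C + C * C * C) * Φ + 2 * C) := by positivity
  linarith

/-- `preFn` is close to a multiple of `e ^ (-s ψ)`. -/
theorem norm_preFn_sub_exp_le (R : Regime T τ₀ hθ₀ hθ γ κ₁ e r C) (hτ : T.IsRoof τ₀ β κ)
    {s x : ℂ} (hs : 0 ≤ s.re) (hsr : ‖s‖ < r) (hx : ‖x - 1‖ < r) (y : T.Y) :
    ‖T.preFn τ₀ hθ₀ hθ s x y -
      (T.isFullBranch.minorConst θ : ℂ)⁻¹ * Complex.exp (-s * T.ψ τ₀ y)‖ ≤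
      2 * preConst e C * (‖s‖ ^ γ + ‖x - 1‖) * Real.exp (e / 2 * T.σ y.1.1) := by
  have hC := R.C_pos
  have he := R.e_pos
  set P := Real.exp (e / 2 * T.σ y.1.1)
  have hP : 1 ≤ P := Real.one_le_exp (by positivity)
  set D := ‖s‖ ^ γ + ‖x - 1‖ with hD
  have hD1 : ‖x - 1‖ ≤ D := by
    have : 0 ≤ ‖s‖ ^ γ := by positivity
    linarith
  have hD0 : 0 ≤ D := (norm_nonneg _).trans hD1
  have hψ := hτ.ψ_nonneg y
  have hW : ‖fn (T.baseFn τ₀ hθ₀ hθ s x) y.1.1‖ ≤ C :=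
    (norm_fn_le _ _).trans (R.norm_baseFn_le hs hsr hx)
  have e1 : T.preFn τ₀ hθ₀ hθ s x y -
      (T.isFullBranch.minorConst θ : ℂ)⁻¹ * Complex.exp (-s * T.ψ τ₀ y) =
      (x ^ y.1.2 - 1 ^ y.1.2) * (Complex.exp (-s * T.ψ τ₀ y) *
        fn (T.baseFn τ₀ hθ₀ hθ s x) y.1.1) +
      Complex.exp (-s * T.ψ τ₀ y) *
        (fn (T.baseFn τ₀ hθ₀ hθ s x) y.1.1 - (T.isFullBranch.minorConst θ : ℂ)⁻¹) := by
    simp only [preFn, towerFn, one_pow]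
    ring
  rw [e1]
  refine (norm_add_le _ _).trans ?_
  rw [norm_mul, norm_mul, norm_mul]
  have b0 := norm_pow_sub_pow_le_exp he (R.norm_le x hx)
    (by rw [norm_one]; exact Real.one_le_exp (by positivity) : ‖(1 : ℂ)‖ ≤ Real.exp (e / 4)) y.1.2
  have b1 : ‖x ^ y.1.2 - 1 ^ y.1.2‖ ≤ 4 / e * D * P := b0.trans (by
    have := exp_level_le (by positivity : 0 ≤ e / 2) y
    gcongr)
  have b2 := mul_le_mul b1 (mul_le_mul (norm_cexp_neg_mul_le_one hs hψ) hW (norm_nonneg _)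
    zero_le_one) (by positivity) (by positivity)
  have b3 := mul_le_mul (norm_cexp_neg_mul_le_one hs hψ)
    (R.norm_baseFn_sub_const_le hs hsr hx y.1.1) (norm_nonneg _) zero_le_one
  refine (add_le_add b2 b3).trans ?_
  unfold preConst
  have : 2 * (4 / e * C + 2 * C + C * C * C) * D * P - (4 / e * D * P * (1 * C) +
      1 * (2 * (C * C * C) * D)) = 4 / e * D * P * C + 4 * C * D * P +
      2 * (C * C * C) * D * (P - 1) := by ring
  have h2 : 0 ≤ 4 / e * D * P * C + 4 * C * D * P + 2 * (C * C * C) * D * (P - 1) := by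
    have : 0 ≤ P - 1 := by linarith
    positivity
  linarith

end Regime

variable (T τ₀) in
/-- The integral `N` of `preFn`. -/
def preInt (hθ₀ : θ₀ ∈ Ioo (0 : ℝ) 1) (hθ : θ ∈ Ico θ₀ 1) (s x : ℂ) : ℂ :=
  ∫ y, T.preFn τ₀ hθ₀ hθ s x y ∂T.μ

variable (T τ₀) in
/-- The integral `J` of `(e ^ (-s τ) - 1) preFn`. -/
def preJump (hθ₀ : θ₀ ∈ Ioo (0 : ℝ) 1) (hθ : θ ∈ Ico θ₀ 1) (s x : ℂ) : ℂ :=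
  ∫ y, (Complex.exp (-s * (T.τ τ₀ y : ℂ)) - 1) * T.preFn τ₀ hθ₀ hθ s x y ∂T.μ

theorem measurable_exp_τ (hτ : T.IsRoof τ₀ β κ) (s : ℂ) :
    Measurable fun y : T.Y => Complex.exp (-s * (T.τ τ₀ y : ℂ)) :=
  ((Complex.measurable_ofReal.comp hτ.measurable_τ).const_mul (-s)).cexp

theorem integrable_exp_τ_mul (hτ : T.IsRoof τ₀ β κ) {s : ℂ} (hs : 0 ≤ s.re) {f : T.Y → ℂ}
    (hf : Integrable f T.μ) :
    Integrable (fun y => Complex.exp (-s * (T.τ τ₀ y : ℂ)) * f y) T.μ :=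
  hf.bdd_mul (measurable_exp_τ hτ s).aestronglyMeasurable
    (ae_of_all _ fun y => norm_cexp_neg_mul_le_one hs (hτ.τ_pos y).le)

theorem integrable_exp_τ_sub_one_mul (hτ : T.IsRoof τ₀ β κ) {s : ℂ} (hs : 0 ≤ s.re) {f : T.Y → ℂ}
    (hf : Integrable f T.μ) :
    Integrable (fun y => (Complex.exp (-s * (T.τ τ₀ y : ℂ)) - 1) * f y) T.μ := by
  simp only [sub_mul, one_mul]
  exact (integrable_exp_τ_mul hτ hs hf).sub hf

theorem integral_exp_τ_sub_one_mul (hτ : T.IsRoof τ₀ β κ) {s : ℂ} (hs : 0 ≤ s.re) {f : T.Y → ℂ}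
    (hf : Integrable f T.μ) : ∫ y, (Complex.exp (-s * (T.τ τ₀ y : ℂ)) - 1) * f y ∂T.μ =
      ∫ y, Complex.exp (-s * (T.τ τ₀ y : ℂ)) * f y ∂T.μ - ∫ y, f y ∂T.μ := by
  rw [← integral_sub (integrable_exp_τ_mul hτ hs hf) hf]
  simp only [sub_mul, one_mul]

namespace Regime

theorem norm_preInt_sub_le (R : Regime T τ₀ hθ₀ hθ γ κ₁ e r C) (hτ : T.IsRoof τ₀ β κ)
    {s x s' x' : ℂ} (hs : 0 ≤ s.re) (hsr : ‖s‖ < r) (hx : ‖x - 1‖ < r) (hs' : 0 ≤ s'.re)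
    (hsr' : ‖s'‖ < r) (hx' : ‖x' - 1‖ < r) :
    ‖T.preInt τ₀ hθ₀ hθ s x - T.preInt τ₀ hθ₀ hθ s' x'‖ ≤
      2 * preConst e C * T.weightInt τ₀ (γ + κ₁) e *
        (‖s - s'‖ ^ κ₁ * ‖s‖ ^ γ + ‖s - s'‖ ^ γ + ‖x - x'‖) := by
  have hK := R.preConst_pos
  have he := R.e_pos
  rw [preInt, preInt, ← integral_sub (R.integrable_preFn hτ hs hsr hx)
    (R.integrable_preFn hτ hs' hsr' hx')]
  refine (norm_integral_le_weightInt R.toExponents (B := preConst e C * (‖s - s'‖ ^ κ₁ * ‖s‖ ^ γ +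
    ‖s - s'‖ ^ γ + ‖x - x'‖) * 2) (ae_of_all _ fun y => ?_)).trans (le_of_eq (by ring))
  refine (R.norm_preFn_sub_le hτ hs hsr hx hs' hsr' hx' y).trans ?_
  rw [mul_assoc _ (2 : ℝ)]
  have := R.one_add_rpow_mul_exp_le hτ (by linarith : e / 2 ≤ e) y.1.1
  gcongr

theorem norm_preInt_sub_const_le (R : Regime T τ₀ hθ₀ hθ γ κ₁ e r C) (hτ : T.IsRoof τ₀ β κ)
    {s x : ℂ} (hs : 0 ≤ s.re) (hsr : ‖s‖ < r) (hx : ‖x - 1‖ < r) :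
    ‖T.preInt τ₀ hθ₀ hθ s x - (T.isFullBranch.minorConst θ : ℂ)⁻¹‖ ≤
      4 * preConst e C * T.weightInt τ₀ (γ + κ₁) e * (‖s‖ ^ γ + ‖x - 1‖) := by
  have h := R.norm_preInt_sub_le hτ hs hsr hx (s' := 0) (x' := 1) le_rfl
    (by simpa using R.r_pos) (by simpa using R.r_pos)
  have e1 : T.preInt τ₀ hθ₀ hθ 0 1 = (T.isFullBranch.minorConst θ : ℂ)⁻¹ := by
    simp [preInt, preFn_zero_one]
  rw [e1, sub_zero] at h
  refine h.trans ?_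
  have h5 : ‖s‖ ^ κ₁ * ‖s‖ ^ γ ≤ ‖s‖ ^ γ := mul_le_of_le_one_left (by positivity)
    (Real.rpow_le_one (norm_nonneg _) (hsr.le.trans R.r_le) R.κ_pos.le)
  have h6 : ‖s‖ ^ κ₁ * ‖s‖ ^ γ + ‖s‖ ^ γ + ‖x - 1‖ ≤ 2 * (‖s‖ ^ γ + ‖x - 1‖) := by
    linarith [norm_nonneg (x - 1)]
  have hK := R.preConst_pos
  have hM := hτ.weightInt_nonneg (γ + κ₁) e
  calc _ ≤ 2 * preConst e C * T.weightInt τ₀ (γ + κ₁) e * (2 * (‖s‖ ^ γ + ‖x - 1‖)) := by gcongr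
    _ = _ := by ring

theorem norm_preJump_le (R : Regime T τ₀ hθ₀ hθ γ κ₁ e r C) (hτ : T.IsRoof τ₀ β κ)
    {s x : ℂ} (hs : 0 ≤ s.re) (hsr : ‖s‖ < r) (hx : ‖x - 1‖ < r) :
    ‖T.preJump τ₀ hθ₀ hθ s x‖ ≤ 2 * ‖s‖ ^ γ * C * T.weightInt τ₀ (γ + κ₁) e :=
  R.norm_integral_exp_sub_one_mul_le hτ hs R.C_pos.le
    (ae_of_all _ (R.norm_preFn_le' hτ hs hsr hx))

/-- The bound on the difference of `preFn` already contains φ^γ, so e^{-sτ} - 1 is estimated with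
the small exponent κ₁. The product then fits the weight of order γ + κ₁, and ‖s‖^κ₁ is enough for a
contraction in x. -/
theorem norm_preJump_sub_le_right (R : Regime T τ₀ hθ₀ hθ γ κ₁ e r C) (hτ : T.IsRoof τ₀ β κ)
    {s x x' : ℂ} (hs : 0 ≤ s.re) (hsr : ‖s‖ < r) (hx : ‖x - 1‖ < r) (hx' : ‖x' - 1‖ < r) :
    ‖T.preJump τ₀ hθ₀ hθ s x - T.preJump τ₀ hθ₀ hθ s x'‖ ≤
      4 * preConst e C * T.weightInt τ₀ (γ + κ₁) e * (‖s‖ ^ κ₁ * ‖x - x'‖) := by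
  have hK := R.preConst_pos
  have he := R.e_pos
  rw [preJump, preJump, ← integral_sub
    (integrable_exp_τ_sub_one_mul hτ hs (R.integrable_preFn hτ hs hsr hx))
    (integrable_exp_τ_sub_one_mul hτ hs (R.integrable_preFn hτ hs hsr hx'))]
  refine (norm_integral_le_weightInt R.toExponents (B := 4 * preConst e C * (‖s‖ ^ κ₁ * ‖x - x'‖))
    (ae_of_all _ fun y => ?_)).trans (le_of_eq (by ring))
  rw [← mul_sub, norm_mul]
  have h1 := norm_cexp_neg_mul_sub_one_le hs (hτ.τ_pos y).le R.κ_pos.le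
    (by linarith [R.add_le, R.γ_pos] : κ₁ ≤ 1)
  have h2 : (‖s‖ * T.τ τ₀ y) ^ κ₁ ≤ ‖s‖ ^ κ₁ * T.φ τ₀ y.1.1 ^ κ₁ := by
    rw [Real.mul_rpow (norm_nonneg _) (hτ.τ_pos y).le]
    have := Real.rpow_le_rpow (hτ.τ_pos y).le (hτ.τ_le_φ y) R.κ_pos.le
    gcongr
  have h3 := R.norm_preFn_sub_le hτ hs hsr hx hs hsr hx' y
  rw [sub_self, norm_zero, Real.zero_rpow R.κ_pos.ne', Real.zero_rpow R.γ_pos.ne', zero_mul,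
    zero_add, zero_add] at h3
  have h4 := R.one_add_rpow_mul_rpow_mul_exp_le hτ (by linarith : e / 2 ≤ e) y.1.1
  have h5 := Real.rpow_nonneg (hτ.φ_pos y.1.1).le κ₁
  have h6 := Real.rpow_nonneg (hτ.φ_pos y.1.1).le γ
  calc _ ≤ (2 * (‖s‖ ^ κ₁ * T.φ τ₀ y.1.1 ^ κ₁)) * (preConst e C * ‖x - x'‖ *
        ((1 + T.φ τ₀ y.1.1 ^ γ) * Real.exp (e / 2 * T.σ y.1.1))) :=
        mul_le_mul (h1.trans (by linarith)) h3 (norm_nonneg _) (by positivity)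
    _ = 2 * preConst e C * (‖s‖ ^ κ₁ * ‖x - x'‖) * (T.φ τ₀ y.1.1 ^ κ₁ *
        ((1 + T.φ τ₀ y.1.1 ^ γ) * Real.exp (e / 2 * T.σ y.1.1))) := by ring
    _ ≤ 2 * preConst e C * (‖s‖ ^ κ₁ * ‖x - x'‖) * (2 * T.weight τ₀ (γ + κ₁) e y.1.1) := by gcongr
    _ = _ := by ring

theorem norm_preJump_sub_le_left (R : Regime T τ₀ hθ₀ hθ γ κ₁ e r C) (hτ : T.IsRoof τ₀ β κ)
    {s s' x : ℂ} (hs : 0 ≤ s.re) (hsr : ‖s‖ < r) (hx : ‖x - 1‖ < r) (hs' : 0 ≤ s'.re)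
    (hsr' : ‖s'‖ < r) :
    ‖T.preJump τ₀ hθ₀ hθ s x - T.preJump τ₀ hθ₀ hθ s' x‖ ≤
      (2 * C + 4 * preConst e C) * T.weightInt τ₀ (γ + κ₁) e *
        (‖s - s'‖ ^ κ₁ * ‖s‖ ^ γ + ‖s - s'‖ ^ γ) := by
  have hK := R.preConst_pos
  have he := R.e_pos
  have hC := R.C_pos
  rw [preJump, preJump, ← integral_sub
    (integrable_exp_τ_sub_one_mul hτ hs (R.integrable_preFn hτ hs hsr hx))
    (integrable_exp_τ_sub_one_mul hτ hs' (R.integrable_preFn hτ hs' hsr' hx))]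
  set D := ‖s - s'‖ ^ κ₁ * ‖s‖ ^ γ + ‖s - s'‖ ^ γ with hD
  have hD2 : ‖s - s'‖ ^ γ ≤ D := by
    have : 0 ≤ ‖s - s'‖ ^ κ₁ * ‖s‖ ^ γ := by positivity
    linarith
  have hD0 : 0 ≤ D := by positivity
  refine (norm_integral_le_weightInt R.toExponents (B := (2 * C + 4 * preConst e C) * D)
    (ae_of_all _ fun y => ?_)).trans (le_of_eq (by ring))
  have e1 : (Complex.exp (-s * (T.τ τ₀ y : ℂ)) - 1) * T.preFn τ₀ hθ₀ hθ s x y -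
      (Complex.exp (-s' * (T.τ τ₀ y : ℂ)) - 1) * T.preFn τ₀ hθ₀ hθ s' x y =
      (Complex.exp (-s * (T.τ τ₀ y : ℂ)) - Complex.exp (-s' * (T.τ τ₀ y : ℂ))) *
        T.preFn τ₀ hθ₀ hθ s x y + (Complex.exp (-s' * (T.τ τ₀ y : ℂ)) - 1) *
        (T.preFn τ₀ hθ₀ hθ s x y - T.preFn τ₀ hθ₀ hθ s' x y) := by ring
  rw [e1]
  refine (norm_add_le _ _).trans ?_
  rw [norm_mul, norm_mul]
  have hφ := Real.rpow_nonneg (hτ.φ_pos y.1.1).le γ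
  have h1 : ‖Complex.exp (-s * (T.τ τ₀ y : ℂ)) - Complex.exp (-s' * (T.τ τ₀ y : ℂ))‖ ≤
      2 * (D * T.φ τ₀ y.1.1 ^ γ) := by
    refine (norm_cexp_neg_mul_sub_le hs hs' (hτ.τ_pos y).le R.γ_pos.le R.γ_le_one).trans ?_
    rw [Real.mul_rpow (norm_nonneg _) (hτ.τ_pos y).le]
    have := Real.rpow_le_rpow (hτ.τ_pos y).le (hτ.τ_le_φ y) R.γ_pos.le
    have := Real.rpow_nonneg (hτ.τ_pos y).le γ
    gcongr
  have h2 : ‖Complex.exp (-s' * (T.τ τ₀ y : ℂ)) - 1‖ ≤ 2 := by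
    refine (_root_.norm_sub_le _ _).trans ?_
    rw [norm_one]
    linarith [norm_cexp_neg_mul_le_one hs' (hτ.τ_pos y).le]
  have h3 := R.norm_preFn_sub_le hτ hs hsr hx hs' hsr' hx y
  rw [sub_self x, norm_zero, add_zero, ← hD] at h3
  have h4 := R.one_add_rpow_mul_exp_le hτ (by linarith : e / 2 ≤ e) y.1.1
  have h5 := R.rpow_mul_exp_le hτ le_rfl y.1.1
  have hw := (hτ.weight_pos (γ + κ₁) e y.1.1).le
  have b1 := mul_le_mul h1 (R.norm_preFn_le' hτ hs hsr hx y) (norm_nonneg _) (by positivity)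
  have b2 := mul_le_mul h2 h3 (norm_nonneg _) zero_le_two
  calc _ ≤ _ := add_le_add b1 b2
    _ = 2 * C * D * (T.φ τ₀ y.1.1 ^ γ * Real.exp (e * T.σ y.1.1)) + 2 * preConst e C * D *
        ((1 + T.φ τ₀ y.1.1 ^ γ) * Real.exp (e / 2 * T.σ y.1.1)) := by ring
    _ ≤ 2 * C * D * T.weight τ₀ (γ + κ₁) e y.1.1 + 2 * preConst e C * D *
        (2 * T.weight τ₀ (γ + κ₁) e y.1.1) := by gcongr
    _ = _ := by ring

end Regime

end YoungTower
end

/-! ### The scalar equation for the eigenvalue. -/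

noncomputable section

theorem exists_eq_of_contraction {f : ℂ → ℂ} {ρ : ℝ} (hρ : 0 ≤ ρ)
    (h1 : ∀ x, ‖x - 1‖ ≤ ρ → ‖f x - 1‖ ≤ ρ)
    (h2 : ∀ x x', ‖x - 1‖ ≤ ρ → ‖x' - 1‖ ≤ ρ → ‖f x - f x'‖ ≤ 1 / 2 * ‖x - x'‖) :
    ∃ x, ‖x - 1‖ ≤ ρ ∧ f x = x := by
  have hm : MapsTo f (Metric.closedBall 1 ρ) (Metric.closedBall 1 ρ) := fun x hx => by
    rw [mem_closedBall_iff_norm] at hx ⊢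
    exact h1 x hx
  have hc : ContractingWith (1 / 2) (hm.restrict f _ _) := by
    refine ⟨by
      rw [← NNReal.coe_lt_coe]
      norm_num, LipschitzWith.of_dist_le_mul fun x y => ?_⟩
    have := h2 x y (mem_closedBall_iff_norm.1 x.2) (mem_closedBall_iff_norm.1 y.2)
    rw [Subtype.dist_eq, Subtype.dist_eq, dist_eq_norm, dist_eq_norm]
    simpa using this
  obtain ⟨x, hx, hfx, -⟩ := hc.exists_fixedPoint' Metric.isClosed_closedBall.isComplete hm
    (Metric.mem_closedBall_self hρ) (edist_ne_top _ _)
  exact ⟨x, mem_closedBall_iff_norm.1 hx, hfx⟩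

/-- Implicit function `x(s)` solving `x J(s, x) + (x - 1) N(s, x) = 0`. -/
theorem exists_implicit_function {J N : ℂ → ℂ → ℂ} {η K r γ κ : ℝ} (hη : 0 < η) (hη1 : η ≤ 1)
    (hr : 0 < r) (hr1 : r ≤ 1) (hγ : 0 < γ) (hκ : 0 < κ) (hK : 1 ≤ K)
    (hJ : ∀ s x : ℂ, 0 ≤ s.re → ‖s‖ < r → ‖x - 1‖ < r → ‖J s x‖ ≤ K * ‖s‖ ^ γ)
    (hJx : ∀ s x x' : ℂ, 0 ≤ s.re → ‖s‖ < r → ‖x - 1‖ < r → ‖x' - 1‖ < r →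
      ‖J s x - J s x'‖ ≤ K * (‖s‖ ^ κ * ‖x - x'‖))
    (hJs : ∀ s s' x : ℂ, 0 ≤ s.re → ‖s‖ < r → 0 ≤ s'.re → ‖s'‖ < r → ‖x - 1‖ < r →
      ‖J s x - J s' x‖ ≤ K * (‖s - s'‖ ^ κ + ‖s - s'‖ ^ γ))
    (hN : ∀ s x : ℂ, 0 ≤ s.re → ‖s‖ < r → ‖x - 1‖ < r →
      ‖N s x - (η : ℂ)⁻¹‖ ≤ K * (‖s‖ ^ γ + ‖x - 1‖))
    (hNx : ∀ s x x' : ℂ, 0 ≤ s.re → ‖s‖ < r → ‖x - 1‖ < r → ‖x' - 1‖ < r →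
      ‖N s x - N s x'‖ ≤ K * ‖x - x'‖)
    (hNs : ∀ s s' x : ℂ, 0 ≤ s.re → ‖s‖ < r → 0 ≤ s'.re → ‖s'‖ < r → ‖x - 1‖ < r →
      ‖N s x - N s' x‖ ≤ K * (‖s - s'‖ ^ κ + ‖s - s'‖ ^ γ)) :
    ∃ δ > 0, δ ≤ r ∧ ∃ x : ℂ → ℂ, ContinuousOn x (YoungTower.halfDisc δ) ∧ x 0 = 1 ∧
      ∀ s ∈ YoungTower.halfDisc δ, ‖x s - 1‖ < r ∧ x s * J s (x s) + (x s - 1) * N s (x s) = 0 := by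
  -- With Kρ ≤ 1/8, and δ below such that K‖s‖^γ and K‖s‖^κ are at most ρ/16, the map Φ sends the
  -- ρ-disc around 1 into itself and contracts by 1/2.
  set ρ := min (r / 2) (1 / (8 * K)) with hρ
  have hρ0 : 0 < ρ := by positivity
  have hρr : ρ < r := (min_le_left _ _).trans_lt (by linarith)
  have hρ1 : ρ ≤ 1 := (hρr.le.trans hr1)
  have hKρ : K * ρ ≤ 1 / 8 := by
    calc K * ρ ≤ K * (1 / (8 * K)) := by gcongr; exact min_le_right _ _
      _ = 1 / 8 := by field_simp
  obtain ⟨δ, hδ0, hδr, hδ⟩ : ∃ δ > 0, δ ≤ r ∧ ∀ t : ℝ, 0 ≤ t → t < δ →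
      K * t ^ γ ≤ ρ / 16 ∧ K * t ^ κ ≤ ρ / 16 := by
    have hc : ∀ g : ℝ, 0 < g → ∀ᶠ t in nhds (0 : ℝ), K * t ^ g < ρ / 16 := fun g hg => by
      have h := (Real.continuousAt_rpow_const 0 g (Or.inr hg.le)).tendsto.const_mul K
      rw [Real.zero_rpow hg.ne', mul_zero] at h
      exact h.eventually_lt_const (by positivity)
    obtain ⟨δ, hδ, hb⟩ := Metric.eventually_nhds_iff.1 ((hc γ hγ).and (hc κ hκ))
    refine ⟨min δ r, lt_min hδ hr, min_le_right _ _, fun t ht htδ => ?_⟩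
    have := hb (y := t) (by
      rw [Real.dist_eq, sub_zero, abs_of_nonneg ht]; exact htδ.trans_le (min_le_left _ _))
    exact ⟨this.1.le, this.2.le⟩
  -- The identity x - Φ(s, x) = η(xJ + (x - 1)N) makes fixed points the solutions. Since N is close
  -- to 1/η, the term ηN - 1 is small, which makes Φ a contraction in x.
  set Φ : ℂ → ℂ → ℂ := fun s x => 1 - η * (x * J s x) - (x - 1) * (η * N s x - 1) with hΦ
  have hηn : ‖(η : ℂ)‖ ≤ 1 := by rw [Complex.norm_real, Real.norm_of_nonneg hη.le]; exact hη1
  have hη0 : (η : ℂ) ≠ 0 := by exact_mod_cast hη.ne'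
  have hxn : ∀ x : ℂ, ‖x - 1‖ ≤ ρ → ‖x‖ ≤ 2 := fun x hx => by
    have h1 : ‖x‖ ≤ ‖x - 1‖ + ‖(1 : ℂ)‖ := by simpa using norm_add_le (x - 1) 1
    rw [norm_one] at h1
    linarith
  have ha : ∀ s x : ℂ, 0 ≤ s.re → ‖s‖ < δ → ‖x - 1‖ ≤ ρ → ‖η * N s x - 1‖ ≤ 1 / 4 := by
    intro s x hs hsδ hx
    have e1 : η * N s x - 1 = η * (N s x - (η : ℂ)⁻¹) := by
      rw [mul_sub, mul_inv_cancel₀ hη0]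
    rw [e1, norm_mul]
    have h1 := hN s x hs (hsδ.trans_le hδr) (hx.trans_lt hρr)
    have h2 := (hδ ‖s‖ (norm_nonneg _) hsδ).1
    have h3 : K * ‖x - 1‖ ≤ K * ρ := by gcongr
    calc _ ≤ 1 * ‖N s x - (η : ℂ)⁻¹‖ := by gcongr
      _ ≤ 1 / 4 := by linarith
  have hself : ∀ s, 0 ≤ s.re → ‖s‖ < δ → ∀ x, ‖x - 1‖ ≤ ρ → ‖Φ s x - 1‖ ≤ ρ := by
    intro s hs hsδ x hx
    have e1 : Φ s x - 1 = -(η * (x * J s x) + (x - 1) * (η * N s x - 1)) := by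
      simp only [hΦ]; ring
    rw [e1, norm_neg]
    refine (norm_add_le _ _).trans ?_
    rw [norm_mul, norm_mul, norm_mul]
    have h1 := (hJ s x hs (hsδ.trans_le hδr) (hx.trans_lt hρr)).trans
      (hδ ‖s‖ (norm_nonneg _) hsδ).1
    have h2 := mul_le_mul hηn (mul_le_mul (hxn x hx) h1 (norm_nonneg _) zero_le_two)
      (by positivity) zero_le_one
    have h3 := mul_le_mul hx (ha s x hs hsδ hx) (norm_nonneg _) hρ0.le
    linarith
  have hcon : ∀ s, 0 ≤ s.re → ‖s‖ < δ → ∀ x x', ‖x - 1‖ ≤ ρ → ‖x' - 1‖ ≤ ρ →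
      ‖Φ s x - Φ s x'‖ ≤ 1 / 2 * ‖x - x'‖ := by
    intro s hs hsδ x x' hx hx'
    have e1 : Φ s x - Φ s x' = -(η * ((x - x') * J s x + x' * (J s x - J s x')) +
        ((x - x') * (η * N s x - 1) + (x' - 1) * (η * (N s x - N s x')))) := by
      simp only [hΦ]; ring
    have hsr := hsδ.trans_le hδr
    have h1 := (hJ s x hs hsr (hx.trans_lt hρr)).trans (hδ ‖s‖ (norm_nonneg _) hsδ).1
    have h2 : ‖J s x - J s x'‖ ≤ ρ / 16 * ‖x - x'‖ := by
      refine (hJx s x x' hs hsr (hx.trans_lt hρr) (hx'.trans_lt hρr)).trans ?_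
      rw [← mul_assoc]
      exact mul_le_mul_of_nonneg_right (hδ ‖s‖ (norm_nonneg _) hsδ).2 (norm_nonneg _)
    have h3 := hNx s x x' hs hsr (hx.trans_lt hρr) (hx'.trans_lt hρr)
    have h4 : ‖(η : ℂ) * ((x - x') * J s x + x' * (J s x - J s x'))‖ ≤
        1 * (‖x - x'‖ * (ρ / 16) + 2 * (ρ / 16 * ‖x - x'‖)) := by
      rw [norm_mul]
      refine mul_le_mul hηn ((norm_add_le _ _).trans ?_) (norm_nonneg _) zero_le_one
      rw [norm_mul, norm_mul]
      exact add_le_add (mul_le_mul_of_nonneg_left h1 (norm_nonneg _))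
        (mul_le_mul (hxn x' hx') h2 (norm_nonneg _) zero_le_two)
    have h5 : ‖(x - x') * (η * N s x - 1) + (x' - 1) * (η * (N s x - N s x'))‖ ≤
        ‖x - x'‖ * (1 / 4) + ρ * (1 * (K * ‖x - x'‖)) := by
      refine (norm_add_le _ _).trans ?_
      rw [norm_mul, norm_mul, norm_mul]
      exact add_le_add (mul_le_mul_of_nonneg_left (ha s x hs hsδ hx) (norm_nonneg _))
        (mul_le_mul hx' (mul_le_mul hηn h3 (norm_nonneg _) zero_le_one) (by positivity) hρ0.le)
    rw [e1, norm_neg]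
    refine (norm_add_le _ _).trans ((add_le_add h4 h5).trans ?_)
    have e2 : 1 * (‖x - x'‖ * (ρ / 16) + 2 * (ρ / 16 * ‖x - x'‖)) +
        (‖x - x'‖ * (1 / 4) + ρ * (1 * (K * ‖x - x'‖))) =
        (3 * ρ / 16 + 1 / 4 + K * ρ) * ‖x - x'‖ := by ring
    rw [e2]
    have hρ8 : ρ ≤ 1 / 8 := by
      calc ρ = 1 * ρ := (one_mul ρ).symm
        _ ≤ K * ρ := by gcongr
        _ ≤ _ := hKρ
    exact mul_le_mul_of_nonneg_right (by linarith) (norm_nonneg _)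
  have hex : ∀ s : ℂ, ∃ x : ℂ, 0 ≤ s.re → ‖s‖ < δ → ‖x - 1‖ ≤ ρ ∧ Φ s x = x := fun s => by
    by_cases hs : 0 ≤ s.re ∧ ‖s‖ < δ
    · obtain ⟨x, hx⟩ := exists_eq_of_contraction hρ0.le (hself s hs.1 hs.2) (hcon s hs.1 hs.2)
      exact ⟨x, fun _ _ => hx⟩
    · exact ⟨0, fun h1 h2 => (hs ⟨h1, h2⟩).elim⟩
  choose x hx using hex
  refine ⟨δ, hδ0, hδr, x, ?_, ?_, ?_⟩
  · intro s₀ hs₀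
    rw [ContinuousWithinAt, tendsto_iff_norm_sub_tendsto_zero]
    have hg : Filter.Tendsto (fun s : ℂ => 6 * K * (‖s - s₀‖ ^ κ + ‖s - s₀‖ ^ γ))
        (nhdsWithin s₀ (YoungTower.halfDisc δ)) (nhds 0) := by
      have h1 : Filter.Tendsto (fun s : ℂ => ‖s - s₀‖) (nhds s₀) (nhds 0) :=
        tendsto_norm_sub_self s₀
      have h2 : ∀ g : ℝ, 0 < g → Filter.Tendsto (fun s : ℂ => ‖s - s₀‖ ^ g) (nhds s₀) (nhds 0) :=
        fun g hg => by
          have := h1.rpow_const (p := g) (Or.inr hg.le)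
          rwa [Real.zero_rpow hg.ne'] at this
      have h3 := ((h2 κ hκ).add (h2 γ hγ)).const_mul (6 * K)
      rw [add_zero, mul_zero] at h3
      exact h3.mono_left nhdsWithin_le_nhds
    refine squeeze_zero' (Filter.Eventually.of_forall fun _ => norm_nonneg _) ?_ hg
    filter_upwards [self_mem_nhdsWithin] with s hs
    obtain ⟨hxs, hfs⟩ := hx s hs.1 hs.2
    obtain ⟨hxs₀, hfs₀⟩ := hx s₀ hs₀.1 hs₀.2
    have h1 := hcon s hs.1 hs.2 _ _ hxs hxs₀
    set D := ‖s - s₀‖ ^ κ + ‖s - s₀‖ ^ γ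
    have h2 := hJs s s₀ (x s₀) hs.1 (hs.2.trans_le hδr) hs₀.1 (hs₀.2.trans_le hδr)
      (hxs₀.trans_lt hρr)
    have h3 := hNs s s₀ (x s₀) hs.1 (hs.2.trans_le hδr) hs₀.1 (hs₀.2.trans_le hδr)
      (hxs₀.trans_lt hρr)
    have hD : 0 ≤ D := by positivity
    have h4 : ‖Φ s (x s₀) - Φ s₀ (x s₀)‖ ≤ 3 * (K * D) := by
      have e1 : Φ s (x s₀) - Φ s₀ (x s₀) = -(η * (x s₀ * (J s (x s₀) - J s₀ (x s₀))) +
          (x s₀ - 1) * (η * (N s (x s₀) - N s₀ (x s₀)))) := by simp only [hΦ]; ring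
      rw [e1, norm_neg]
      refine (norm_add_le _ _).trans ?_
      rw [norm_mul, norm_mul, norm_mul, norm_mul]
      have a1 := mul_le_mul hηn (mul_le_mul (hxn _ hxs₀) h2 (norm_nonneg _) zero_le_two)
        (by positivity) zero_le_one
      have a2 := mul_le_mul (hxs₀.trans hρ1) (mul_le_mul hηn h3 (norm_nonneg _) zero_le_one)
        (by positivity) zero_le_one
      linarith
    -- The first term is at most half of the left side by contraction. The distance of the two fixed
    -- points is therefore at most twice the variation of Φ in s, which proves continuity.
    have h5 : ‖x s - x s₀‖ ≤ ‖Φ s (x s) - Φ s (x s₀)‖ + ‖Φ s (x s₀) - Φ s₀ (x s₀)‖ := by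
      nth_rw 1 [← hfs, ← hfs₀]
      exact norm_sub_le_norm_sub_add_norm_sub _ _ _
    linarith
  · obtain ⟨hx0, hf0⟩ := hx 0 le_rfl (by simpa using hδ0)
    have h1 := hcon 0 le_rfl (by simpa using hδ0) _ 1 hx0 (by simpa using hρ0.le)
    have hJ0 : J 0 1 = 0 := by
      have := hJ 0 1 le_rfl (by simpa using hr) (by simpa using hr)
      rw [norm_zero, Real.zero_rpow hγ.ne', mul_zero] at this
      exact norm_le_zero_iff.1 this
    have h2 : Φ 0 1 = 1 := by simp [hΦ, hJ0]
    rw [hf0, h2] at h1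
    exact sub_eq_zero.1 (norm_le_zero_iff.1 (by linarith [norm_nonneg (x 0 - 1)]))
  · intro s hs
    obtain ⟨hxs, hfs⟩ := hx s hs.1 hs.2
    refine ⟨hxs.trans_lt hρr, ?_⟩
    have h1 : η * (x s * J s (x s) + (x s - 1) * N s (x s)) = x s - Φ s (x s) := by
      simp only [hΦ]; ring
    rw [hfs, sub_self] at h1
    exact (mul_eq_zero.1 h1).resolve_left hη0

end

/-! ### Existence and simplicity of the eigenvalue. -/

noncomputable section

namespace YoungTower

open IsFullBranchGibbsMarkov LipSpace

variable {X : Type*} [MeasurableSpace X] {θ₀ : ℝ} {T : YoungTower X θ₀} {τ₀ : X → ℝ} {β κ : ℝ}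
  {θ γ κ₁ e r C : ℝ} {hθ₀ : θ₀ ∈ Ioo (0 : ℝ) 1} {hθ : θ ∈ Ico θ₀ 1} {γ' ε : ℝ}

theorem towerFn_smul (s x c : ℂ) (w : LipSpace T.G T.α θ) (y : T.Y) :
    T.towerFn τ₀ s x (c • w) y = c * T.towerFn τ₀ s x w y := by
  simp only [towerFn, fn_smul]; ring

theorem towerFn_add (s x : ℂ) (w w' : LipSpace T.G T.α θ) (y : T.Y) :
    T.towerFn τ₀ s x (w + w') y = T.towerFn τ₀ s x w y + T.towerFn τ₀ s x w' y := by
  simp only [towerFn, fn_add]; ring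

theorem isTwistedTransfer_towerFn (hτ : T.IsRoof τ₀ β κ) (hE : T.SpaceExponents τ₀ γ' θ ε)
    {s x : ℂ} (hs : 0 ≤ s.re) (hs1 : ‖s‖ ≤ 1) (hx0 : x ≠ 0) (hx : ‖x‖ ≤ Real.exp ε)
    {V : T.α → ℝ} (hV : T.isFullBranch.BranchBound θ (T.mult τ₀ s x) V)
    {w : LipSpace T.G T.α θ} (hw : T.twisted τ₀ hθ₀ hθ s x w = w) :
    T.IsTwistedTransfer τ₀ s (T.towerFn τ₀ s x w) (fun y => x⁻¹ * T.towerFn τ₀ s x w y) := by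
  rw [(spaceBound_towerFn hτ hE hθ₀ hθ hs hs1 hx w).isTwistedTransfer_iff hτ hE hθ₀ hθ hs hs1]
  refine ae_of_all _ fun y => ?_
  have h := mul_towerTransfer_exp_mul_towerFn hV hθ₀ hθ w y
  rw [hw, sub_self, ite_self, add_zero] at h
  dsimp only
  rw [← h, inv_mul_cancel_left₀ hx0]

namespace Regime

theorem branchBound_mult' (R : Regime T τ₀ hθ₀ hθ γ κ₁ e r C) (hτ : T.IsRoof τ₀ β κ)
    {s x : ℂ} (hs : 0 ≤ s.re) (hsr : ‖s‖ < r) (hx : ‖x - 1‖ < r) :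
    T.isFullBranch.BranchBound θ (T.mult τ₀ s x)
      (fun a => 1 * (2 * (1 + hτ.holderConst)) * T.weightInf τ₀ (γ + κ₁) e a) :=
  R.branchBound_mult hτ hθ₀ hs (hsr.le.trans R.r_le) (R.norm_le x hx)

/-- The multiplier σx^σ e^{-sφ} is x times the x-derivative of `mult`. It appears when a
hypothetical Jordan block is pushed down to the base. -/
theorem branchBound_σ_mul_mult (R : Regime T τ₀ hθ₀ hθ γ κ₁ e r C) (hτ : T.IsRoof τ₀ β κ)
    {s x : ℂ} (hs : 0 ≤ s.re) (hsr : ‖s‖ < r) (hx : ‖x - 1‖ < r) :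
    T.isFullBranch.BranchBound θ (fun z => T.σ z * T.mult τ₀ s x z)
      (fun a => 4 / e * (2 * (1 + hτ.holderConst)) * T.weightInf τ₀ (γ + κ₁) e a) := by
  have h := R.branchBound_coeff hτ hθ₀ (c := fun n => n * x ^ n) (B := 4 / e) (fun n => by
    rw [norm_mul, Complex.norm_natCast]
    exact natCast_mul_norm_pow_le R.e_pos (R.norm_le x hx) n) hs (hsr.le.trans R.r_le)
  simpa only [mult, mul_assoc] using h

/-- The equation `x J + (x - 1) N = 0` characterizes the eigenvalue. -/
theorem twisted_baseFn_eq (R : Regime T τ₀ hθ₀ hθ γ κ₁ e r C) (hτ : T.IsRoof τ₀ β κ)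
    (hE : T.SpaceExponents τ₀ γ' θ ε) (heε : e / 4 ≤ ε) {s x : ℂ} (hs : 0 ≤ s.re) (hsr : ‖s‖ < r)
    (hx : ‖x - 1‖ < r)
    (h : x * T.preJump τ₀ hθ₀ hθ s x + (x - 1) * T.preInt τ₀ hθ₀ hθ s x = 0) :
    T.twisted τ₀ hθ₀ hθ s x (T.baseFn τ₀ hθ₀ hθ s x) = T.baseFn τ₀ hθ₀ hθ s x := by
  have hs1 := hsr.le.trans R.r_le
  have hxe : ‖x‖ ≤ Real.exp ε := (R.norm_le x hx).trans (Real.exp_le_exp.2 heε)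
  have hb := baseFn_sub_twisted (R.isUnit s x hs hsr hx)
  set c := 1 - (T.isFullBranch.minorConst θ : ℂ) * T.isFullBranch.mean (mem_Ioo_of_mem_Ico hθ₀ hθ)
        (T.baseFn τ₀ hθ₀ hθ s x)
  have hB := (spaceBound_towerFn hτ hE hθ₀ hθ hs hs1 hxe (T.baseFn τ₀ hθ₀ hθ s x)).exp_mul hτ hE
    hθ₀ hθ hs hs1
  have hi := R.integrable_preFn hτ hs hsr hx
  have h1 := (T.integral_towerTransfer_mul hθ₀ hθ (hB.measurable hτ hE hθ₀ hθ)
    (hB.integrable hτ hE hθ₀ hθ) (hB.branchBound_top hτ hE hθ₀ hθ)).2 (fun _ => 1)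
    measurable_const ⟨1, fun _ => by simp⟩
  simp only [mul_one] at h1
  -- One application of the operator reproduces `preFn` up to -c at level 0. Integration gives xJ +
  -- (x - 1)N = -c/σ̄, with σ̄ the mean return time, so the assumed equation forces c = 0.
  have h2 : ∫ y, x * T.towerTransfer (fun y => Complex.exp (-s * (T.τ τ₀ y : ℂ)) *
      T.towerFn τ₀ s x (T.baseFn τ₀ hθ₀ hθ s x) y) y ∂T.μ =
      T.preInt τ₀ hθ₀ hθ s x + (T.meanReturnReal : ℂ)⁻¹ * (-c) := by
    rw [← integral_ite_zero, preInt, ← integral_add hi]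
    · refine integral_congr_ae (ae_of_all _ fun y => ?_)
      dsimp only
      rw [mul_towerTransfer_exp_mul_towerFn (R.branchBound_mult' hτ hs hsr hx) hθ₀ hθ, hb,
        fn_sub, fn_smul, fn_lipOne, sub_sub_cancel_left, mul_one]
      rfl
    · refine (integrable_const ‖c‖).mono' (T.measurable_of_eq_level
        (H := fun _ l => if l = 0 then -c else 0) (fun l => measurable_const)
        fun _ => rfl).aestronglyMeasurable (ae_of_all _ fun y => ?_)
      split_ifs <;> simp
  rw [integral_const_mul, h1] at h2
  have h3 : T.preJump τ₀ hθ₀ hθ s x = _ := integral_exp_τ_sub_one_mul hτ hs hi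
  rw [preFn] at h3
  have h4 : (T.meanReturnReal : ℂ)⁻¹ * c = 0 := by
    rw [h3] at h
    have h5 : T.preInt τ₀ hθ₀ hθ s x =
      ∫ y, T.towerFn τ₀ s x (T.baseFn τ₀ hθ₀ hθ s x) y ∂T.μ := rfl
    rw [← h5] at h
    linear_combination h2 - h
  have h6 : c = 0 := (mul_eq_zero.1 h4).resolve_left
    (inv_ne_zero (by exact_mod_cast T.meanReturnReal_pos.ne'))
  rw [hb, h6, zero_smul, sub_zero]

end Regime

/-- Bound for the correction term in the simplicity argument. -/
def IsRoof.simpleConst (hτ : T.IsRoof τ₀ β κ) (γ e C : ℝ) : ℝ :=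
  2 * C * (2 * T.isFullBranch.transferConst * (∑' a : T.α,
    4 / e * (2 * (1 + hτ.holderConst)) * T.weightInf τ₀ γ e a * T.μZ.real a.1)) * C +
    2 * (4 / e) * C

namespace Regime

/-- The homogeneous case u₀ = 0 of `exists_base_of_transfer`. Any element of `𝓑(Y)` with eigenvalue
1/x is a multiple of `preFn`, whichever way x was found. -/
theorem eq_smul_preFn_of_transfer (R : Regime T τ₀ hθ₀ hθ γ κ₁ e r C) (hτ : T.IsRoof τ₀ β κ)
    (hE : T.SpaceExponents τ₀ γ' θ ε) {s x : ℂ} (hs : 0 ≤ s.re)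
    (hsr : ‖s‖ < r) (hx : ‖x - 1‖ < r) (hx0 : x ≠ 0) {v : T.Y → ℂ} {B : ℝ}
    (hv : T.SpaceBound τ₀ γ' θ ε v B) (htr : T.IsTwistedTransfer τ₀ s v (fun y => x⁻¹ * v y)) :
    ∃ w : LipSpace T.G T.α θ, ∃ c : ℂ, T.twisted τ₀ hθ₀ hθ s x w = w ∧
      w = c • T.baseFn τ₀ hθ₀ hθ s x ∧ v =ᵐ[T.μ] T.towerFn τ₀ s x w := by
  have h0 : ∀ y, T.towerFn τ₀ s x (0 : LipSpace T.G T.α θ) y = 0 := fun y => by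
    have := towerFn_smul (τ₀ := τ₀) s x 0 (0 : LipSpace T.G T.α θ) y
    rwa [smul_zero, zero_mul] at this
  obtain ⟨w, hvw, hw⟩ := exists_base_of_transfer hτ hE hθ₀ hθ hs (hsr.le.trans R.r_le) hx0
    (R.branchBound_mult' hτ hs hsr hx) (R.branchBound_σ_mul_mult hτ hs hsr hx) (u₀ := 0)
    (map_zero _) hv (by simpa only [h0, add_zero] using htr)
  rw [map_zero, smul_zero, add_zero] at hw
  refine ⟨w, _, hw, eq_smul_baseFn (R.isUnit s x hs hsr hx) hw, ?_⟩
  filter_upwards [hvw] with y hy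
  rw [hy, h0, mul_zero, sub_zero]

/-- Generalized eigenfunctions are multiples of the eigenfunction. -/
theorem simple (R : Regime T τ₀ hθ₀ hθ γ κ₁ e r C) (hτ : T.IsRoof τ₀ β κ)
    (hE : T.SpaceExponents τ₀ γ' θ ε) (heε : e / 4 ≤ ε) {s x : ℂ} (hs : 0 ≤ s.re)
    (hsr : ‖s‖ < r) (hx : ‖x - 1‖ < r) (hx0 : x ≠ 0)
    (hL : T.twisted τ₀ hθ₀ hθ s x (T.baseFn τ₀ hθ₀ hθ s x) = T.baseFn τ₀ hθ₀ hθ s x)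
    (hsmall : 2 * ‖s‖ ^ γ * hτ.simpleConst (γ + κ₁) e C * T.weightInt τ₀ (γ + κ₁) e +
      ‖1 - x⁻¹‖ * (hτ.simpleConst (γ + κ₁) e C * T.weightInt τ₀ (γ + κ₁) e) <
        ‖T.preInt τ₀ hθ₀ hθ s x‖) {v u : T.Y → ℂ} {B : ℝ} (hv : T.SpaceBound τ₀ γ' θ ε v B)
    (htr : T.IsTwistedTransfer τ₀ s v (fun y => x⁻¹ * v y + u y))
    (hu : T.IsTwistedTransfer τ₀ s u (fun y => x⁻¹ * u y)) :
    ∃ c : ℂ, ∀ᵐ y ∂T.μ, v y = c * T.preFn τ₀ hθ₀ hθ s x y := by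
  have hs1 := hsr.le.trans R.r_le
  have hxe : ‖x‖ ≤ Real.exp ε := (R.norm_le x hx).trans (Real.exp_le_exp.2 heε)
  have hC := R.C_pos
  have he := R.e_pos
  set W := T.baseFn τ₀ hθ₀ hθ s x with hW
  have hV := R.branchBound_mult' hτ hs hsr hx
  have hV₁ := R.branchBound_σ_mul_mult hτ hs hsr hx
  have hae := (hv.isTwistedTransfer_iff hτ hE hθ₀ hθ hs hs1).1 htr
  -- The function u is given only as an L¹ function. Its pointwise version (R̂(s) - λ)v lies in
  -- `𝓑(Y)`, so the classification of eigenfunctions applies to it.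
  obtain ⟨B', hB'⟩ := (hv.exp_mul hτ hE hθ₀ hθ hs hs1).towerTransfer hτ hE hθ₀ hθ
  have hũ := hB'.add (hv.const_mul (-x⁻¹))
  set ũ : T.Y → ℂ := fun y =>
    T.towerTransfer (fun y => Complex.exp (-s * (T.τ τ₀ y : ℂ)) * v y) y + -x⁻¹ * v y with hũd
  have huũ : u =ᵐ[T.μ] ũ := by
    filter_upwards [hae] with y hy
    rw [hũd]
    dsimp only
    rw [← hy]
    ring
  have hũt : T.IsTwistedTransfer τ₀ s ũ (fun y => x⁻¹ * ũ y) :=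
    IsTransfer.congr hu (by filter_upwards [huũ] with y hy; rw [hy])
      (by filter_upwards [huũ] with y hy; rw [hy])
  obtain ⟨u₀, k, hu₀, hk, hũ₀⟩ := R.eq_smul_preFn_of_transfer hτ hE hs hsr hx hx0 hũ hũt
  have hu' : u =ᵐ[T.μ] T.towerFn τ₀ s x u₀ := huũ.trans hũ₀
  have htr' : T.IsTwistedTransfer τ₀ s v (fun y => x⁻¹ * v y + T.towerFn τ₀ s x u₀ y) :=
    IsTransfer.congr htr (ae_eq_refl _) (by filter_upwards [hu'] with y hy; rw [hy])
  obtain ⟨v₀, hv₀, hLv⟩ := exists_base_of_transfer hτ hE hθ₀ hθ hs hs1 hx0 hV hV₁ hu₀ hv htr'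
  set L₁ := hV₁.mulTransfer hθ₀ hθ with hL₁
  set A' := Ring.inverse (T.resolvent τ₀ hθ₀ hθ s x) with hA'
  set c := (T.isFullBranch.minorConst θ : ℂ) *
    T.isFullBranch.mean (mem_Ioo_of_mem_Ico hθ₀ hθ) v₀ with hc
  -- Applying A to v₀ leaves only the Jordan term and a constant. Inverting A gives v₀ = kp + cW
  -- with p bounded independently of v, and v becomes c times the eigenfunction plus kq.
  have hAv : T.resolvent τ₀ hθ₀ hθ s x v₀ = -(x * k) • L₁ W +
      c • T.isFullBranch.lipOne (mem_Ioo_of_mem_Ico hθ₀ hθ) := by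
    rw [resolvent_apply, hLv, hk, map_smul, sub_add_cancel_left, smul_smul, neg_smul]
  set p : LipSpace T.G T.α θ := -x • A' (L₁ W) with hp
  have hv₀' : v₀ = k • p + c • W := by
    rw [← inverse_apply_self (R.isUnit s x hs hsr hx) v₀, hAv, map_add, map_smul, map_smul, hp,
      smul_smul, hW, baseFn, ← hA']
    congr 2
    ring
  set q : T.Y → ℂ := fun y => T.towerFn τ₀ s x p y - y.1.2 * x * T.preFn τ₀ hθ₀ hθ s x y with hq
  have hvq : v =ᵐ[T.μ] fun y => c * T.preFn τ₀ hθ₀ hθ s x y + k * q y := by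
    filter_upwards [hv₀] with y hy
    rw [hy, hv₀', towerFn_add, towerFn_smul s x k, towerFn_smul s x c, hk, towerFn_smul s x k, hq]
    simp only [preFn]
    ring
  have hx2 : ‖x‖ ≤ 2 := by
    have h1 : ‖x‖ ≤ ‖x - 1‖ + ‖(1 : ℂ)‖ := by simpa using norm_add_le (x - 1) 1
    rw [norm_one] at h1
    linarith [R.r_le]
  have hpn : ‖p‖ ≤ 2 * C * (2 * T.isFullBranch.transferConst * (∑' a : T.α,
    4 / e * (2 * (1 + hτ.holderConst)) * T.weightInf τ₀ (γ + κ₁) e a * T.μZ.real a.1)) * C := by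
    have h1 := hV₁.norm_mulTransfer_le hθ₀ hθ
    have h2 := R.norm_inverse_le s x hs hsr hx
    have h3 := R.norm_baseFn_le hs hsr hx
    rw [hp, norm_smul, norm_neg]
    calc _ ≤ 2 * (C * (_ * C)) := by
          refine mul_le_mul hx2 ((A'.le_opNorm _).trans (mul_le_mul h2 ((L₁.le_opNorm _).trans
            (mul_le_mul h1 h3 (norm_nonneg _) ?_)) (norm_nonneg _) hC.le)) (norm_nonneg _)
            zero_le_two
          exact (norm_nonneg _).trans h1
      _ = _ := by ring
  have hqB : ∀ y, ‖q y‖ ≤ hτ.simpleConst (γ + κ₁) e C * Real.exp (e * T.σ y.1.1) := by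
    intro y
    have h1 := norm_towerFn_le hτ he hs (R.norm_le x hx) p y
    have h2 : ‖(y.1.2 : ℂ) * x * T.preFn τ₀ hθ₀ hθ s x y‖ ≤
        2 * (4 / e) * C * Real.exp (e / 2 * T.σ y.1.1) := by
      have e1 : (y.1.2 : ℂ) * x * T.preFn τ₀ hθ₀ hθ s x y = x * ((y.1.2 * x ^ y.1.2) *
          (Complex.exp (-s * T.ψ τ₀ y) * fn W y.1.1)) := by
        simp only [preFn, towerFn, hW]; ring
      have e2 : ‖(y.1.2 : ℂ) * x ^ y.1.2‖ ≤ 4 / e * Real.exp (e / 2 * T.σ y.1.1) := by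
        rw [norm_mul, Complex.norm_natCast]
        exact (natCast_mul_norm_pow_le he (R.norm_le x hx) _).trans
          (mul_le_mul_of_nonneg_left (exp_level_le (by positivity) y) (by positivity))
      rw [e1, norm_mul, norm_mul, norm_mul (Complex.exp _)]
      calc _ ≤ 2 * ((4 / e * Real.exp (e / 2 * T.σ y.1.1)) * (1 * C)) := by
            refine mul_le_mul hx2 (mul_le_mul e2 (mul_le_mul
              (norm_cexp_neg_mul_le_one hs (hτ.ψ_nonneg y))
              ((norm_fn_le _ _).trans (R.norm_baseFn_le hs hsr hx)) (norm_nonneg _) zero_le_one)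
              (by positivity) (by positivity)) (by positivity) zero_le_two
        _ = _ := by ring
    have h3 : Real.exp (e / 4 * T.σ y.1.1) ≤ Real.exp (e * T.σ y.1.1) := by
      gcongr; linarith
    have h4 : Real.exp (e / 2 * T.σ y.1.1) ≤ Real.exp (e * T.σ y.1.1) := by
      gcongr; linarith
    rw [hq, IsRoof.simpleConst, add_mul]
    refine (_root_.norm_sub_le _ _).trans (add_le_add (h1.trans ?_) (h2.trans ?_))
    · exact mul_le_mul hpn h3 (Real.exp_pos _).le ((norm_nonneg _).trans hpn)
    · gcongr
  have hS : 0 ≤ hτ.simpleConst (γ + κ₁) e C := by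
    have hY : Nonempty T.Y := ⟨⟨((T.μZ.nonempty_of_neZero).some, 0), T.σ_pos _⟩⟩
    have h := (norm_nonneg _).trans (hqB hY.some)
    exact nonneg_of_mul_nonneg_left h (Real.exp_pos _)
  have hqm : Measurable q := by
    have h1 : Measurable fun y : T.Y => (y.1.2 : ℂ) :=
      T.measurable_of_eq_level (H := fun _ l => (l : ℂ)) (fun _ => measurable_const) fun _ => rfl
    exact (measurable_towerFn hτ (mem_Ioo_of_mem_Ico hθ₀ hθ) s x p).sub
      ((h1.mul_const x).mul (R.measurable_preFn hτ s x))
  have hqi : Integrable q T.μ := integrable_of_norm_le_exp hqm hτ R.toExponents hqB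
  have hPi := R.integrable_preFn hτ hs hsr hx
  have hPe := (isTwistedTransfer_towerFn hτ hE hs hs1 hx0 hxe hV hL).2.2 (fun _ => 1)
    measurable_const ⟨1, fun _ => by simp⟩
  have hve := htr'.2.2 (fun _ => 1) measurable_const ⟨1, fun _ => by simp⟩
  simp only [mul_one] at hPe hve
  rw [integral_const_mul] at hPe
  have hPe' : x⁻¹ * T.preInt τ₀ hθ₀ hθ s x =
    ∫ y, Complex.exp (-s * (T.τ τ₀ y : ℂ)) * T.preFn τ₀ hθ₀ hθ s x y ∂T.μ := hPe
  have hl : ∫ y, x⁻¹ * v y + T.towerFn τ₀ s x u₀ y ∂T.μ =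
      x⁻¹ * (c * T.preInt τ₀ hθ₀ hθ s x + k * ∫ y, q y ∂T.μ) + k * T.preInt τ₀ hθ₀ hθ s x := by
    have hi : Integrable (fun y => x⁻¹ * (c * T.preFn τ₀ hθ₀ hθ s x y + k * q y)) T.μ :=
      ((hPi.const_mul c).add (hqi.const_mul k)).const_mul _
    rw [preInt, ← integral_const_mul c, ← integral_const_mul k, ← integral_add (hPi.const_mul c)
      (hqi.const_mul k), ← integral_const_mul, ← integral_const_mul, ← integral_add hi
      (hPi.const_mul k)]
    refine integral_congr_ae ?_
    filter_upwards [hvq] with y hy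
    rw [hy, hk, towerFn_smul, preFn]
  have hr : ∫ y, Complex.exp (-s * (T.τ τ₀ y : ℂ)) * v y ∂T.μ =
      c * (x⁻¹ * T.preInt τ₀ hθ₀ hθ s x) +
        k * ∫ y, Complex.exp (-s * (T.τ τ₀ y : ℂ)) * q y ∂T.μ := by
    rw [hPe', ← integral_const_mul c, ← integral_const_mul k, ← integral_add
      ((integrable_exp_τ_mul hτ hs hPi).const_mul c) ((integrable_exp_τ_mul hτ hs hqi).const_mul k)]
    refine integral_congr_ae ?_
    filter_upwards [hvq] with y hy
    rw [hy]
    ring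
  rw [hl, hr] at hve
  have hq1 := R.norm_integral_exp_sub_one_mul_le hτ hs hS (ae_of_all _ hqB)
  have hq2 := R.norm_integral_le hτ hS (ae_of_all _ hqB)
  rw [integral_exp_τ_sub_one_mul hτ hs hqi] at hq1
  set Iq := ∫ y, q y ∂T.μ
  set Ie := ∫ y, Complex.exp (-s * (T.τ τ₀ y : ℂ)) * q y ∂T.μ
  -- After integration of the generalized equation the terms with c cancel. The coefficient of k is
  -- N - ∫ (e^{-sτ} - λ) q, and `hsmall` makes N dominate, so k = 0.
  have hk0 : k * (T.preInt τ₀ hθ₀ hθ s x - ((Ie - Iq) + (1 - x⁻¹) * Iq)) = 0 := by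
    linear_combination hve
  have hne : T.preInt τ₀ hθ₀ hθ s x - ((Ie - Iq) + (1 - x⁻¹) * Iq) ≠ 0 := by
    intro h0
    have h1 : ‖T.preInt τ₀ hθ₀ hθ s x‖ ≤ ‖Ie - Iq‖ + ‖1 - x⁻¹‖ * ‖Iq‖ := by
      rw [sub_eq_zero.1 h0, ← norm_mul]
      exact norm_add_le _ _
    have h2 : ‖1 - x⁻¹‖ * ‖Iq‖ ≤ ‖1 - x⁻¹‖ *
      (hτ.simpleConst (γ + κ₁) e C * T.weightInt τ₀ (γ + κ₁) e) := by gcongr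
    linarith
  have hk00 : k = 0 := (mul_eq_zero.1 hk0).resolve_right hne
  refine ⟨c, ?_⟩
  filter_upwards [hvq] with y hy
  rw [hy, hk00, zero_mul, add_zero]

/-- Existence of the (inverse) eigenvalue. -/
theorem exists_eigenvalue (R : Regime T τ₀ hθ₀ hθ γ κ₁ e r C) (hτ : T.IsRoof τ₀ β κ) :
    ∃ δ > 0, δ ≤ r ∧ ∃ x : ℂ → ℂ, ContinuousOn x (halfDisc δ) ∧ x 0 = 1 ∧ ∀ s ∈ halfDisc δ,
      ‖x s - 1‖ < r ∧ x s ≠ 0 ∧ T.preInt τ₀ hθ₀ hθ s (x s) ≠ 0 ∧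
      x s * T.preJump τ₀ hθ₀ hθ s (x s) + (x s - 1) * T.preInt τ₀ hθ₀ hθ s (x s) = 0 ∧
      2 * ‖s‖ ^ γ * hτ.simpleConst (γ + κ₁) e C * T.weightInt τ₀ (γ + κ₁) e +
        ‖1 - (x s)⁻¹‖ * (hτ.simpleConst (γ + κ₁) e C * T.weightInt τ₀ (γ + κ₁) e) <
          ‖T.preInt τ₀ hθ₀ hθ s (x s)‖ := by
  have hp := mem_Ioo_of_mem_Ico hθ₀ hθ
  have hη := T.isFullBranch.minorConst_pos hp
  have hη1 := (T.isFullBranch.minorConst_lt_one hp).le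
  have hK := R.preConst_pos
  have hC := R.C_pos
  set M := T.weightInt τ₀ (γ + κ₁) e with hM
  have hM0 : 0 ≤ M := hτ.weightInt_nonneg _ _
  set k₀ := preConst e C with hk₀
  set K := 1 + (4 * k₀ + 2 * C) * M with hKd
  have hKM : 0 ≤ k₀ * M := by positivity
  have hCM : 0 ≤ C * M := by positivity
  have hK4 : 4 * k₀ * M ≤ K := by rw [hKd]; linarith
  have hK2 : 2 * k₀ * M ≤ K := by rw [hKd]; linarith
  have hKC : 2 * C * M ≤ K := by rw [hKd]; linarith
  have hKs : (2 * C + 4 * k₀) * M ≤ K := by rw [hKd]; linarith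
  have hD : ∀ s s' : ℂ, ‖s‖ < r →
      ‖s - s'‖ ^ κ₁ * ‖s‖ ^ γ + ‖s - s'‖ ^ γ ≤ ‖s - s'‖ ^ κ₁ + ‖s - s'‖ ^ γ := by
    intro s s' hsr
    have h1 : ‖s‖ ^ γ ≤ 1 := Real.rpow_le_one (norm_nonneg _) (hsr.le.trans R.r_le) R.γ_pos.le
    have h2 : ‖s - s'‖ ^ κ₁ * ‖s‖ ^ γ ≤ ‖s - s'‖ ^ κ₁ :=
      mul_le_of_le_one_right (by positivity) h1
    linarith
  obtain ⟨δ₀, hδ₀, hδr, x, hxc, hx0, hx⟩ := exists_implicit_function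
    (J := T.preJump τ₀ hθ₀ hθ) (N := T.preInt τ₀ hθ₀ hθ) (K := K) hη hη1 R.r_pos R.r_le R.γ_pos
    R.κ_pos (by rw [hKd]; nlinarith)
    (fun s x hs hsr hx => (R.norm_preJump_le hτ hs hsr hx).trans (by
      have : 0 ≤ ‖s‖ ^ γ := by positivity
      calc _ = (2 * C * M) * ‖s‖ ^ γ := by ring
        _ ≤ _ := by gcongr))
    (fun s x x' hs hsr hx hx' => (R.norm_preJump_sub_le_right hτ hs hsr hx hx').trans (by gcongr))
    (fun s s' x hs hsr hs' hsr' hx => (R.norm_preJump_sub_le_left hτ hs hsr hx hs' hsr').trans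
      (mul_le_mul hKs (hD s s' hsr) (by positivity) (by positivity)))
    (fun s x hs hsr hx => (R.norm_preInt_sub_const_le hτ hs hsr hx).trans (by gcongr))
    (fun s x x' hs hsr hx hx' => by
      have h := R.norm_preInt_sub_le hτ hs hsr hx hs hsr hx'
      rw [sub_self, norm_zero, Real.zero_rpow R.κ_pos.ne', Real.zero_rpow R.γ_pos.ne', zero_mul,
        zero_add, zero_add] at h
      exact h.trans (by gcongr))
    (fun s s' x hs hsr hs' hsr' hx => by
      have h := R.norm_preInt_sub_le hτ hs hsr hx hs' hsr' hx
      rw [sub_self x, norm_zero, add_zero] at h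
      exact h.trans (mul_le_mul hK2 (hD s s' hsr) (by positivity) (by positivity)))
  set S := hτ.simpleConst (γ + κ₁) e C
  have h0mem : (0 : ℂ) ∈ halfDisc δ₀ := ⟨le_rfl, by simpa using hδ₀⟩
  have hxt : Filter.Tendsto x (nhdsWithin 0 (halfDisc δ₀)) (nhds 1) := by
    have := hxc 0 h0mem
    rwa [ContinuousWithinAt, hx0] at this
  have hst : Filter.Tendsto (fun s : ℂ => ‖s‖ ^ γ) (nhdsWithin 0 (halfDisc δ₀)) (nhds 0) := by
    have h1 := (tendsto_norm_zero (E := ℂ)).rpow_const (p := γ) (Or.inr R.γ_pos.le)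
    rw [Real.zero_rpow R.γ_pos.ne'] at h1
    exact h1.mono_left nhdsWithin_le_nhds
  have hxt1 : Filter.Tendsto (fun s => ‖x s - 1‖) (nhdsWithin 0 (halfDisc δ₀)) (nhds 0) := by
    have := (hxt.sub_const 1).norm
    rwa [sub_self, norm_zero] at this
  have hN : Filter.Tendsto (fun s => 4 * k₀ * M * (‖s‖ ^ γ + ‖x s - 1‖))
      (nhdsWithin 0 (halfDisc δ₀)) (nhds 0) := by
    have := (hst.add hxt1).const_mul (4 * k₀ * M)
    rwa [add_zero, mul_zero] at this
  have hsm : Filter.Tendsto (fun s => 2 * ‖s‖ ^ γ * S * M + ‖1 - (x s)⁻¹‖ * (S * M))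
      (nhdsWithin 0 (halfDisc δ₀)) (nhds 0) := by
    have h1 := ((tendsto_const_nhds (x := (1 : ℂ))).sub (hxt.inv₀ one_ne_zero)).norm
    rw [inv_one, sub_self, norm_zero] at h1
    have h2 := (((hst.const_mul 2).mul_const S).mul_const M).add (h1.mul_const (S * M))
    simpa using h2
  -- As 1/η ≥ 1, the first bound gives |N| ≥ 1/2, and the second keeps the correction term of the
  -- simplicity argument below 1/2.
  have hev := ((hN.eventually_lt_const (by norm_num : (0 : ℝ) < 1 / 2)).and
    (hsm.eventually_lt_const (by norm_num : (0 : ℝ) < 1 / 2))).and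
    (hxt.eventually_ne one_ne_zero)
  obtain ⟨δ₁, hδ₁, hsub⟩ := Metric.mem_nhdsWithin_iff.1 hev
  set δ := min δ₀ δ₁
  have hmem : ∀ s ∈ halfDisc δ, s ∈ halfDisc δ₀ := fun s hs =>
    ⟨hs.1, hs.2.trans_le (min_le_left _ _)⟩
  have hP : ∀ s ∈ halfDisc δ, (4 * k₀ * M * (‖s‖ ^ γ + ‖x s - 1‖) < 1 / 2 ∧
      2 * ‖s‖ ^ γ * S * M + ‖1 - (x s)⁻¹‖ * (S * M) < 1 / 2) ∧ x s ≠ 0 := fun s hs =>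
    hsub ⟨by simpa using hs.2.trans_le (min_le_right _ _), hmem s hs⟩
  have hNge : ∀ s ∈ halfDisc δ, 1 / 2 ≤ ‖T.preInt τ₀ hθ₀ hθ s (x s)‖ := by
    intro s hs
    obtain ⟨hs0, hsδ⟩ := hmem s hs
    have h1 := R.norm_preInt_sub_const_le hτ hs0 (hsδ.trans_le hδr) (hx s (hmem s hs)).1
    have h2 : 1 ≤ ‖(T.isFullBranch.minorConst θ : ℂ)⁻¹‖ := by
      rw [norm_inv, Complex.norm_real, Real.norm_of_nonneg hη.le]
      exact (one_le_inv₀ hη).2 hη1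
    have h3 := norm_sub_norm_le (T.isFullBranch.minorConst θ : ℂ)⁻¹ (T.preInt τ₀ hθ₀ hθ s (x s))
    rw [norm_sub_rev] at h3
    linarith [(hP s hs).1.1]
  exact ⟨δ, lt_min hδ₀ hδ₁, (min_le_left _ _).trans hδr, x, hxc.mono hmem, hx0, fun s hs =>
    ⟨(hx s (hmem s hs)).1, (hP s hs).2,
      norm_pos_iff.1 ((by norm_num : (0 : ℝ) < 1 / 2).trans_le (hNge s hs)),
      (hx s (hmem s hs)).2, (hP s hs).1.2.trans_le (hNge s hs)⟩⟩

/-- Existence of the family of eigenfunctions. -/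
theorem exists_isEigenfamily (R : Regime T τ₀ hθ₀ hθ γ κ₁ e r C) (hτ : T.IsRoof τ₀ β κ)
    (hE : T.SpaceExponents τ₀ γ' θ ε) (heε : e / 4 ≤ ε) :
    ∃ δ > 0, ∃ lam : ℂ → ℂ, ∃ ζ : ℂ → T.Y → ℂ, T.IsEigenfamily τ₀ γ' θ ε δ lam ζ := by
  have hp := mem_Ioo_of_mem_Ico hθ₀ hθ
  obtain ⟨δ, hδ, hδr, x, hxc, hx0, hx⟩ := R.exists_eigenvalue hτ
  have hL : ∀ s ∈ halfDisc δ, T.twisted τ₀ hθ₀ hθ s (x s) (T.baseFn τ₀ hθ₀ hθ s (x s)) =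
      T.baseFn τ₀ hθ₀ hθ s (x s) := fun s hs =>
    R.twisted_baseFn_eq hτ hE heε hs.1 (hs.2.trans_le hδr) (hx s hs).1 (hx s hs).2.2.2.1
  have e1 : ∀ s y, T.towerFn τ₀ s (x s) ((T.preInt τ₀ hθ₀ hθ s (x s))⁻¹ •
      T.baseFn τ₀ hθ₀ hθ s (x s)) y = (T.preInt τ₀ hθ₀ hθ s (x s))⁻¹ *
        T.preFn τ₀ hθ₀ hθ s (x s) y := fun s y => towerFn_smul _ _ _ _ _
  refine ⟨δ, hδ, fun s => (x s)⁻¹, fun s => T.towerFn τ₀ s (x s)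
    ((T.preInt τ₀ hθ₀ hθ s (x s))⁻¹ • T.baseFn τ₀ hθ₀ hθ s (x s)), ?_, ?_, ?_, ?_, ?_, ?_⟩
  · exact hxc.inv₀ fun s hs => (hx s hs).2.1
  · rw [hx0, inv_one]
  · intro s hs
    have hsr := hs.2.trans_le hδr
    exact (hτ.mem_spaceB_iff hp.1).2 ⟨_, spaceBound_towerFn hτ hE hθ₀ hθ hs.1
      (hsr.le.trans R.r_le) ((R.norm_le _ (hx s hs).1).trans (Real.exp_le_exp.2 heε)) _⟩
  · intro s hs
    have hsr := hs.2.trans_le hδr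
    have hxr := (hx s hs).1
    exact isTwistedTransfer_towerFn hτ hE hs.1 (hsr.le.trans R.r_le) (hx s hs).2.1
      ((R.norm_le _ hxr).trans (Real.exp_le_exp.2 heε)) (R.branchBound_mult' hτ hs.1 hsr hxr)
      (by rw [map_smul, hL s hs])
  · intro s hs
    have hi := R.integrable_preFn hτ hs.1 (hs.2.trans_le hδr) (hx s hs).1
    have e2 := funext (e1 s)
    rw [e2, integral_const_mul]
    exact ⟨hi.const_mul _, inv_mul_cancel₀ (hx s hs).2.2.1⟩
  · intro s hs v hv u htr hu
    obtain ⟨B, hB⟩ := (hτ.mem_spaceB_iff hp.1).1 hv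
    obtain ⟨c, hc⟩ := R.simple hτ hE heε hs.1 (hs.2.trans_le hδr) (hx s hs).1 (hx s hs).2.1 (hL s hs)
      (hx s hs).2.2.2.2 hB htr hu
    refine ⟨c * T.preInt τ₀ hθ₀ hθ s (x s), ?_⟩
    filter_upwards [hc] with y hy
    rw [hy, e1, mul_assoc, mul_inv_cancel_left₀ (hx s hs).2.2.1]

end Regime

end YoungTower
end

/-! ### Closeness of the eigenfunctions to e^{-sψ}, and the equivalence of the two conditions. -/

noncomputable section

namespace YoungTower

open IsFullBranchGibbsMarkov LipSpace

variable {X : Type*} [MeasurableSpace X] {θ₀ : ℝ} {T : YoungTower X θ₀} {τ₀ : X → ℝ} {β κ : ℝ}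
  {θ γ κ₁ e r C : ℝ} {hθ₀ : θ₀ ∈ Ioo (0 : ℝ) 1} {hθ : θ ∈ Ico θ₀ 1} {γ' ε δ : ℝ}
  {lam : ℂ → ℂ} {ζ : ℂ → T.Y → ℂ}

/-- Pointwise closeness of the eigenfunctions to `e ^ (-s ψ)`. -/
theorem Regime.norm_eigenfunction_sub_exp_le (R : Regime T τ₀ hθ₀ hθ γ κ₁ e r C)
    (hτ : T.IsRoof τ₀ β κ) (hE : T.SpaceExponents τ₀ γ' θ ε) (hδ : 0 < δ)
    (hfam : T.IsEigenfamily τ₀ γ' θ ε δ lam ζ) :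
    ∃ δ' > 0, δ' ≤ δ ∧ δ' ≤ 1 ∧ ∃ K ≥ 0, ∀ s ∈ halfDisc δ', ∀ᵐ y ∂T.μ,
      ‖ζ s y - Complex.exp (-s * (T.ψ τ₀ y : ℂ))‖ ≤
        K * ‖s‖ ^ γ * Real.exp (e / 2 * T.σ y.1.1) := by
  have hp := mem_Ioo_of_mem_Ico hθ₀ hθ
  have hη := T.isFullBranch.minorConst_pos hp
  have hη1 := (T.isFullBranch.minorConst_lt_one hp).le
  have hK := R.preConst_pos
  have hC := R.C_pos
  have he := R.e_pos
  set M := T.weightInt τ₀ (γ + κ₁) e with hM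
  have hM0 : 0 ≤ M := hτ.weightInt_nonneg _ _
  set k₀ := preConst e C with hk₀
  have h0mem : (0 : ℂ) ∈ halfDisc δ := ⟨le_rfl, by simpa using hδ⟩
  have hlt : Filter.Tendsto lam (nhdsWithin 0 (halfDisc δ)) (nhds 1) := by
    have := hfam.continuousOn 0 h0mem
    rwa [ContinuousWithinAt, hfam.lam_zero] at this
  have hxt : Filter.Tendsto (fun s => ‖(lam s)⁻¹ - 1‖) (nhdsWithin 0 (halfDisc δ)) (nhds 0) := by
    have := ((hlt.inv₀ one_ne_zero).sub_const 1).norm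
    rwa [inv_one, sub_self, norm_zero] at this
  have hst : Filter.Tendsto (fun s : ℂ => ‖s‖ ^ γ) (nhdsWithin 0 (halfDisc δ)) (nhds 0) := by
    have h1 := (tendsto_norm_zero (E := ℂ)).rpow_const (p := γ) (Or.inr R.γ_pos.le)
    rw [Real.zero_rpow R.γ_pos.ne'] at h1
    exact h1.mono_left nhdsWithin_le_nhds
  have hN : Filter.Tendsto (fun s => 4 * k₀ * M * (‖s‖ ^ γ + ‖(lam s)⁻¹ - 1‖))
      (nhdsWithin 0 (halfDisc δ)) (nhds 0) := by
    have := (hst.add hxt).const_mul (4 * k₀ * M)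
    rwa [add_zero, mul_zero] at this
  have hev := ((hN.eventually_lt_const (by norm_num : (0 : ℝ) < 1 / 2)).and
    (hxt.eventually_lt_const R.r_pos)).and (hlt.eventually_ne one_ne_zero)
  obtain ⟨δ₁, hδ₁, hsub⟩ := Metric.mem_nhdsWithin_iff.1 hev
  refine ⟨min (min δ r) δ₁, lt_min (lt_min hδ R.r_pos) hδ₁,
    (min_le_left _ _).trans (min_le_left _ _), ((min_le_left _ _).trans (min_le_right _ _)).trans
    R.r_le, (4 * k₀ + 8 * k₀ * M) * (1 + 8 * C * M), by positivity, fun s hs => ?_⟩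
  have hsδ : s ∈ halfDisc δ :=
    ⟨hs.1, hs.2.trans_le ((min_le_left _ _).trans (min_le_left _ _))⟩
  have hsr : ‖s‖ < r := hs.2.trans_le ((min_le_left _ _).trans (min_le_right _ _))
  obtain ⟨⟨h1, h2⟩, h3⟩ := hsub ⟨by simpa using hs.2.trans_le (min_le_right _ _), hsδ⟩
  have hs0 := hs.1
  clear hsub hev hN hxt hlt
  set x := (lam s)⁻¹ with hx
  have hx0 : x ≠ 0 := inv_ne_zero h3
  have hlx : lam s = x⁻¹ := by rw [hx, inv_inv]
  obtain ⟨B, hB⟩ := (hτ.mem_spaceB_iff hp.1).1 (hfam.mem s hsδ)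
  have heig := hfam.eigen s hsδ
  rw [hlx] at heig
  -- The family is arbitrary, not the constructed one. By continuity 1/λ(s) is near 1, and this
  -- alone makes ζ(s) a multiple of `preFn`; uniqueness of λ is not needed.
  obtain ⟨w, c, -, hw, hζ⟩ := R.eq_smul_preFn_of_transfer hτ hE hs0 hsr h2 hx0 hB heig
  have hζ' : ∀ᵐ y ∂T.μ, ζ s y = c * T.preFn τ₀ hθ₀ hθ s x y := by
    filter_upwards [hζ] with y hy
    rw [hy, hw, towerFn_smul, preFn]
  have hcN : c * T.preInt τ₀ hθ₀ hθ s x = 1 := by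
    rw [← (hfam.normalized s hsδ).2, preInt, ← integral_const_mul]
    exact (integral_congr_ae hζ').symm
  have hNd := R.norm_preInt_sub_const_le hτ hs0 hsr h2
  have hNge : 1 / 2 ≤ ‖T.preInt τ₀ hθ₀ hθ s x‖ := by
    have h5 : 1 ≤ ‖(T.isFullBranch.minorConst θ : ℂ)⁻¹‖ := by
      rw [norm_inv, Complex.norm_real, Real.norm_of_nonneg hη.le]
      exact (one_le_inv₀ hη).2 hη1
    have h6 := norm_sub_norm_le (T.isFullBranch.minorConst θ : ℂ)⁻¹ (T.preInt τ₀ hθ₀ hθ s x)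
    rw [norm_sub_rev] at h6
    linarith
  have hc2 : ‖c‖ ≤ 2 := by
    have h5 : ‖c‖ * ‖T.preInt τ₀ hθ₀ hθ s x‖ = 1 := by rw [← norm_mul, hcN, norm_one]
    nlinarith [norm_nonneg c]
  have hζb : ∀ᵐ y ∂T.μ, ‖ζ s y‖ ≤ 2 * C * Real.exp (e * T.σ y.1.1) := by
    filter_upwards [hζ'] with y hy
    rw [hy, norm_mul, mul_assoc]
    exact mul_le_mul hc2 (R.norm_preFn_le' hτ hs0 hsr h2 y) (norm_nonneg _) zero_le_two
  -- Integrating the eigenvalue equation with ∫ ζ = 1 gives λ - 1 = ∫ (e^{-sτ} - 1) ζ, which is of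
  -- order ‖s‖^γ.
  have hlam : ‖lam s - 1‖ ≤ 4 * C * M * ‖s‖ ^ γ := by
    have h5 := heig.2.2 (fun _ => 1) measurable_const ⟨1, fun _ => by simp⟩
    simp only [mul_one] at h5
    rw [integral_const_mul, (hfam.normalized s hsδ).2, mul_one] at h5
    have h6 := integral_exp_τ_sub_one_mul hτ hs0 (hfam.normalized s hsδ).1
    rw [← h5, (hfam.normalized s hsδ).2, ← hlx] at h6
    rw [← h6]
    refine (R.norm_integral_exp_sub_one_mul_le hτ hs0 (by positivity) hζb).trans (le_of_eq ?_)
    ring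
  have hxd : ‖x - 1‖ ≤ 8 * C * M * ‖s‖ ^ γ := by
    have e1 : x - 1 = -(x * (lam s - 1)) := by
      rw [mul_sub, hlx, mul_inv_cancel₀ hx0]; ring
    have hx2 : ‖x‖ ≤ 2 := by
      have h1 : ‖x‖ ≤ ‖x - 1‖ + ‖(1 : ℂ)‖ := by simpa using norm_add_le (x - 1) 1
      rw [norm_one] at h1
      linarith [R.r_le]
    rw [e1, norm_neg, norm_mul]
    calc _ ≤ 2 * (4 * C * M * ‖s‖ ^ γ) := mul_le_mul hx2 hlam (norm_nonneg _) zero_le_two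
      _ = _ := by ring
  set D := ‖s‖ ^ γ + ‖x - 1‖ with hD
  have hDle : D ≤ (1 + 8 * C * M) * ‖s‖ ^ γ := by linarith
  have hD0 : 0 ≤ D := by positivity
  filter_upwards [hζ'] with y hy
  -- Because cN = 1, the multiples of 1/η cancel. What remains are the errors of `preFn` and of its
  -- integral N.
  have e2 : ζ s y - Complex.exp (-s * (T.ψ τ₀ y : ℂ)) =
      c * (T.preFn τ₀ hθ₀ hθ s x y - (T.isFullBranch.minorConst θ : ℂ)⁻¹ *
        Complex.exp (-s * (T.ψ τ₀ y : ℂ))) - c * (T.preInt τ₀ hθ₀ hθ s x -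
        (T.isFullBranch.minorConst θ : ℂ)⁻¹) * Complex.exp (-s * (T.ψ τ₀ y : ℂ)) := by
    rw [hy]
    linear_combination (Complex.exp (-s * (T.ψ τ₀ y : ℂ))) * hcN
  have hP : 1 ≤ Real.exp (e / 2 * T.σ y.1.1) := Real.one_le_exp (by positivity)
  set P := Real.exp (e / 2 * T.σ y.1.1)
  rw [e2]
  refine (_root_.norm_sub_le _ _).trans ?_
  rw [norm_mul, norm_mul, norm_mul]
  have b1 := mul_le_mul hc2 (R.norm_preFn_sub_exp_le hτ hs0 hsr h2 y) (norm_nonneg _) zero_le_two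
  have b2 := mul_le_mul (mul_le_mul hc2 hNd (norm_nonneg _) zero_le_two)
    (norm_cexp_neg_mul_le_one hs0 (hτ.ψ_nonneg y)) (norm_nonneg _) (by positivity)
  calc _ ≤ _ := add_le_add b1 b2
    _ = 4 * k₀ * D * P + 8 * k₀ * M * D * 1 := by ring
    _ ≤ 4 * k₀ * D * P + 8 * k₀ * M * D * P := by gcongr
    _ = (4 * k₀ + 8 * k₀ * M) * D * P := by ring
    _ ≤ (4 * k₀ + 8 * k₀ * M) * ((1 + 8 * C * M) * ‖s‖ ^ γ) * P := by gcongr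
    _ = _ := by ring

/-- The eigenfunctions are close to `e ^ (-s ψ)` in `L ^ p`. -/
theorem Regime.eLpNorm_eigenfunction_sub_exp_le (R : Regime T τ₀ hθ₀ hθ γ κ₁ e r C)
    (hτ : T.IsRoof τ₀ β κ) (hE : T.SpaceExponents τ₀ γ' θ ε) (hδ : 0 < δ)
    (hfam : T.IsEigenfamily τ₀ γ' θ ε δ lam ζ) {p : ℝ} (hp : 1 ≤ p)
    (hi : Integrable (fun y : T.Y => Real.exp (p * (e / 2) * T.σ y.1.1)) T.μ) {γ₀ : ℝ}
    (hγ₀ : 0 ≤ γ₀) (hγ : γ₀ ≤ γ) :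
    ∃ δ' > 0, ∃ C' : ℝ, ∀ s ∈ halfDisc δ',
      eLpNorm (fun y => ζ s y - Complex.exp (-s * (T.ψ τ₀ y : ℂ))) (ENNReal.ofReal p) T.μ ≤
        ENNReal.ofReal (C' * ‖s‖ ^ γ₀) := by
  obtain ⟨δ', hδ', -, hδ1, K, hK, hb⟩ := R.norm_eigenfunction_sub_exp_le hτ hE hδ hfam
  have hm : Measurable fun y : T.Y => Real.exp (e / 2 * T.σ y.1.1) :=
    Real.measurable_exp.comp (((measurable_from_nat (f := fun n : ℕ => (n : ℝ))).comp
      (T.measurable_σ.comp (measurable_fst.comp measurable_subtype_coe))).const_mul _)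
  have hL : MemLp (fun y : T.Y => Real.exp (e / 2 * T.σ y.1.1)) (ENNReal.ofReal p) T.μ := by
    rw [← integrable_norm_rpow_iff hm.aestronglyMeasurable
      (by simpa using by linarith) ENNReal.ofReal_ne_top]
    refine hi.congr (ae_of_all _ fun y => ?_)
    dsimp only
    rw [Real.norm_of_nonneg (Real.exp_pos _).le, ENNReal.toReal_ofReal (by linarith),
      ← Real.exp_mul]
    ring_nf
  set L := eLpNorm (fun y : T.Y => Real.exp (e / 2 * T.σ y.1.1)) (ENNReal.ofReal p) T.μ with hLd
  refine ⟨δ', hδ', K * L.toReal, fun s hs => ?_⟩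
  refine (eLpNorm_mono_ae_real (hb s hs)).trans ?_
  have h1 : (fun y : T.Y => K * ‖s‖ ^ γ * Real.exp (e / 2 * T.σ y.1.1)) =
      (K * ‖s‖ ^ γ) • fun y : T.Y => Real.exp (e / 2 * T.σ y.1.1) := rfl
  have h2 : 0 ≤ ‖s‖ ^ γ := by positivity
  have hLt : eLpNorm (fun y : T.Y => Real.exp (e / 2 * T.σ y.1.1)) (ENNReal.ofReal p) T.μ =
      ENNReal.ofReal L.toReal := (ENNReal.ofReal_toReal hL.2.ne).symm
  rw [h1, eLpNorm_const_smul, Real.enorm_of_nonneg (by positivity), hLt,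
    ← ENNReal.ofReal_mul (by positivity)]
  refine ENNReal.ofReal_le_ofReal ?_
  have h3 : ‖s‖ ^ γ ≤ ‖s‖ ^ γ₀ :=
    Real.rpow_le_rpow_of_exponent_ge' (norm_nonneg _) (hs.2.le.trans hδ1) hγ₀ hγ
  calc K * ‖s‖ ^ γ * L.toReal = K * L.toReal * ‖s‖ ^ γ := by ring
    _ ≤ _ := by gcongr

/-- Equivalence of the conditions on the eigenfunctions and on `ψ`. -/
theorem Regime.condA1iii_iff_condPsi (R : Regime T τ₀ hθ₀ hθ γ κ₁ e r C)
    (hτ : T.IsRoof τ₀ β κ) (hE : T.SpaceExponents τ₀ γ' θ ε) (hδ : 0 < δ)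
    (hfam : T.IsEigenfamily τ₀ γ' θ ε δ lam ζ) {βp : ℝ} (hβp : 0 ≤ βp) (h2γ : βp ≤ 2 * γ) :
    T.CondA1iii τ₀ ζ βp ↔ T.CondPsi τ₀ βp := by
  obtain ⟨δ', hδ', hδδ, hδ1, K, hK, hb⟩ := R.norm_eigenfunction_sub_exp_le hτ hE hδ hfam
  set M := T.weightInt τ₀ (γ + κ₁) e with hM
  have he := R.e_pos
  have hM0 : 0 ≤ M := hτ.weightInt_nonneg _ _
  have hmψ : ∀ s : ℂ, Measurable fun y : T.Y => Complex.exp (-s * (T.ψ τ₀ y : ℂ)) := fun s =>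
    ((Complex.measurable_ofReal.comp hτ.measurable_ψ).const_mul (-s)).cexp
  have hd : ∀ s ∈ halfDisc δ',
      ‖∫ y, (Complex.exp (-s * (T.τ τ₀ y : ℂ)) - 1) * (ζ s y - 1) ∂T.μ -
        ∫ y, (Complex.exp (-s * (T.τ τ₀ y : ℂ)) - 1) *
          (Complex.exp (-s * (T.ψ τ₀ y : ℂ)) - 1) ∂T.μ‖ ≤ 2 * K * M * ‖s‖ ^ βp := by
    intro s hs
    have hsδ : s ∈ halfDisc δ := ⟨hs.1, hs.2.trans_le hδδ⟩
    have hi1 : Integrable (fun y => ζ s y - 1) T.μ :=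
      (hfam.normalized s hsδ).1.sub (integrable_const 1)
    have hi2 : Integrable (fun y => Complex.exp (-s * (T.ψ τ₀ y : ℂ)) - 1) T.μ :=
      (Integrable.mono' (integrable_const 1) (hmψ s).aestronglyMeasurable
        (ae_of_all _ fun y => norm_cexp_neg_mul_le_one hs.1 (hτ.ψ_nonneg y))).sub
        (integrable_const 1)
    rw [← integral_sub (integrable_exp_τ_sub_one_mul hτ hs.1 hi1)
      (integrable_exp_τ_sub_one_mul hτ hs.1 hi2)]
    have e1 : ∀ y, (Complex.exp (-s * (T.τ τ₀ y : ℂ)) - 1) * (ζ s y - 1) -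
        (Complex.exp (-s * (T.τ τ₀ y : ℂ)) - 1) * (Complex.exp (-s * (T.ψ τ₀ y : ℂ)) - 1) =
        (Complex.exp (-s * (T.τ τ₀ y : ℂ)) - 1) *
          (ζ s y - Complex.exp (-s * (T.ψ τ₀ y : ℂ))) := fun y => by ring
    simp only [e1]
    have h1 : ∀ᵐ y ∂T.μ, ‖ζ s y - Complex.exp (-s * (T.ψ τ₀ y : ℂ))‖ ≤
        K * ‖s‖ ^ γ * Real.exp (e * T.σ y.1.1) := by
      filter_upwards [hb s hs] with y hy
      refine hy.trans ?_
      gcongr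
      linarith
    refine (R.norm_integral_exp_sub_one_mul_le hτ hs.1 (by positivity) h1).trans ?_
    -- One factor comes from e^{-sτ} - 1 and the other from ζ - e^{-sψ}; their product has exponent
    -- 2γ ≥ `βp`.
    have h3 : ‖s‖ ^ γ * ‖s‖ ^ γ ≤ ‖s‖ ^ βp := by
      rw [← Real.rpow_add_of_nonneg (norm_nonneg _) R.γ_pos.le R.γ_pos.le]
      exact Real.rpow_le_rpow_of_exponent_ge' (norm_nonneg _) (hs.2.le.trans hδ1) hβp (by linarith)
    calc _ = 2 * K * M * (‖s‖ ^ γ * ‖s‖ ^ γ) := by ring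
      _ ≤ _ := by gcongr
  constructor
  · rintro ⟨δ₁, hδ₁, C₁, h₁⟩
    refine ⟨min δ₁ δ', lt_min hδ₁ hδ', C₁ + 2 * K * M, fun s hs => ?_⟩
    have a1 := h₁ s ⟨hs.1, hs.2.trans_le (min_le_left _ _)⟩
    have a2 := hd s ⟨hs.1, hs.2.trans_le (min_le_right _ _)⟩
    rw [norm_sub_rev] at a2
    rw [add_mul]
    have a3 := norm_add_le_of_le a2 a1
    rw [sub_add_cancel] at a3
    linarith
  · rintro ⟨δ₁, hδ₁, C₁, h₁⟩
    refine ⟨min δ₁ δ', lt_min hδ₁ hδ', C₁ + 2 * K * M, fun s hs => ?_⟩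
    have a1 := h₁ s ⟨hs.1, hs.2.trans_le (min_le_left _ _)⟩
    have a2 := hd s ⟨hs.1, hs.2.trans_le (min_le_right _ _)⟩
    rw [add_mul]
    have a3 := norm_add_le_of_le a2 a1
    rw [sub_add_cancel] at a3
    linarith

end YoungTower
end

/-! ### Admissible constants and double excursions. -/

noncomputable section

namespace YoungTower

variable {X : Type*} [MeasurableSpace X] {θ₀ : ℝ} {T : YoungTower X θ₀} {τ₀ : X → ℝ} {β κ : ℝ}

theorem le_ψStar (y : T.Y) {j : ℕ} (hj : j < y.1.2) :
    τ₀ (T.f^[j] (y.1.1 : X)) ≤ T.ψStar τ₀ y :=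
  le_ciSup (f := fun j : Fin y.1.2 => τ₀ (T.f^[(j : ℕ)] (y.1.1 : X)))
    (finite_range _).bddAbove ⟨j, hj⟩

theorem exists_eq_ψStar (y : T.Y) (hy : 0 < y.1.2) :
    ∃ j < y.1.2, τ₀ (T.f^[j] (y.1.1 : X)) = T.ψStar τ₀ y := by
  have : Nonempty (Fin y.1.2) := ⟨⟨0, hy⟩⟩
  obtain ⟨j, hj⟩ := exists_eq_ciSup_of_finite
    (f := fun j : Fin y.1.2 => τ₀ (T.f^[(j : ℕ)] (y.1.1 : X)))
  exact ⟨j, j.2, hj⟩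

theorem ψ_le_mul_ψStar (y : T.Y) : T.ψ τ₀ y ≤ y.1.2 * T.ψStar τ₀ y := by
  have h := Finset.sum_le_card_nsmul (Finset.range y.1.2)
    (fun j => τ₀ (T.f^[j] (y.1.1 : X))) (T.ψStar τ₀ y)
    fun j hj => le_ψStar y (Finset.mem_range.1 hj)
  rwa [Finset.card_range, nsmul_eq_mul] at h

/-- The tangent of the logarithm at a, weakened by dropping -1. It absorbs log σ into a small
multiple of σ. -/
theorem log_le_div_add_log {t a : ℝ} (ht : 0 < t) (ha : 0 < a) :
    Real.log t ≤ t / a + Real.log a := by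
  have h := Real.log_le_sub_one_of_pos (div_pos ht ha)
  rw [Real.log_div ht.ne' ha.ne'] at h
  linarith

/-- All sufficiently large constants are admissible. -/
theorem IsRoof.exists_isAdmissible (hτ : T.IsRoof τ₀ β κ) :
    ∃ D : ℝ, ∀ dstar ≥ D, T.IsAdmissible τ₀ dstar := by
  obtain ⟨d, hd, C, hC⟩ := T.exp_tail
  set d₀ := 2 / d with hd₀
  have hd₀0 : 0 < d₀ := by positivity
  set M₁ := 2 * d₀
  set M₂ := |2 * d₀ * Real.log (2 * d₀)| + 1
  have hM₁ : 0 < M₁ := by positivity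
  have hM₂ : 0 < M₂ := by positivity
  have hlog2 := Real.log_pos one_lt_two
  refine ⟨M₁ + M₂ / Real.log 2, fun dstar hD => ⟨d, hd, ⟨C, hC⟩, d₀, ?_, M₁, hM₁, M₂, hM₂, ?_, ?_⟩⟩
  · rw [hd₀, inv_eq_one_div]
    gcongr
    norm_num
  · intro y hy
    have hσ : (1 : ℝ) ≤ T.σ y.1.1 := by exact_mod_cast T.σ_pos y.1.1
    have hl : 0 < y.1.2 := by
      by_contra h0
      have h1 : y.1.2 = 0 := by omega
      rw [ψ, birk, h1, Finset.range_zero, Finset.sum_empty, Real.log_zero, mul_zero] at hy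
      linarith
    have hψS : 0 < T.ψStar τ₀ y := (hτ.pos _).trans_le (le_ψStar y hl)
    have hl' : (0 : ℝ) < y.1.2 := by exact_mod_cast hl
    have hls : (y.1.2 : ℝ) ≤ T.σ y.1.1 := by exact_mod_cast y.2.le
    have hψ : 0 < T.ψ τ₀ y := by
      have h := hτ.birk_mono hl y.1.1
      have h1 : T.birk τ₀ (Nat.succ 0) y.1.1 = τ₀ (y.1.1 : X) := by simp [birk]
      rw [h1] at h
      exact (hτ.pos _).trans_le h
    have h2 : Real.log (T.ψ τ₀ y) ≤ Real.log (T.σ y.1.1) + Real.log (T.ψStar τ₀ y) := by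
      rw [← Real.log_mul (by linarith) hψS.ne']
      refine Real.log_le_log hψ ((ψ_le_mul_ψStar y).trans ?_)
      gcongr
    -- With a = 2d₀, the term d₀ log σ in d₀ log(σψ_*) is at most σ/2 plus a constant. Moving σ/2 to
    -- the left doubles the rest, which explains M₁ = 2d₀ and the form of M₂.
    have h3 := log_le_div_add_log (by linarith : (0 : ℝ) < T.σ y.1.1)
      (by positivity : 0 < 2 * d₀)
    have h4 : d₀ * Real.log (T.ψ τ₀ y) ≤ d₀ * (T.σ y.1.1 / (2 * d₀) + Real.log (2 * d₀) +
        Real.log (T.ψStar τ₀ y)) := by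
      gcongr
      linarith
    have h5 : d₀ * (T.σ y.1.1 / (2 * d₀) + Real.log (2 * d₀) + Real.log (T.ψStar τ₀ y)) =
        T.σ y.1.1 / 2 + d₀ * Real.log (2 * d₀) + d₀ * Real.log (T.ψStar τ₀ y) := by
      field_simp
    have h6 := le_abs_self (2 * d₀ * Real.log (2 * d₀))
    simp only [M₁, M₂]
    linarith
  · intro n hn
    have hn' : Real.log 2 ≤ Real.log n := Real.log_le_log two_pos (by exact_mod_cast hn)
    have h1 : M₂ ≤ M₂ / Real.log 2 * Real.log n := by
      rw [div_mul_eq_mul_div, le_div_iff₀ hlog2]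
      gcongr
    have h2 : (M₁ + M₂ / Real.log 2) * Real.log n ≤ dstar * Real.log n :=
      mul_le_mul_of_nonneg_right hD (hlog2.le.trans hn')
    linarith

variable (T τ₀) in
/-- The points with a long excursion followed, after a logarithmic time, by another one. -/
def doubleExcursion (dstar q : ℝ) : Set X :=
  {x | ∃ j : ℕ, 1 ≤ j ∧ (j : ℝ) < dstar * Real.log ((⌊τ₀ x⌋₊ : ℝ) + 1) ∧
    (⌊τ₀ x⌋₊ : ℝ) ^ (1 - q) ≤ τ₀ (T.f^[j] x)}

theorem IsRoof.measurableSet_doubleExcursion (hτ : T.IsRoof τ₀ β κ) (dstar q : ℝ) :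
    MeasurableSet (T.doubleExcursion τ₀ dstar q) := by
  have hfl : Measurable fun x => (⌊τ₀ x⌋₊ : ℝ) :=
    (measurable_from_nat (f := fun n : ℕ => (n : ℝ))).comp (Nat.measurable_floor.comp hτ.measurable)
  have : T.doubleExcursion τ₀ dstar q = ⋃ j : ℕ, {x | 1 ≤ j ∧
      (j : ℝ) < dstar * Real.log ((⌊τ₀ x⌋₊ : ℝ) + 1) ∧
      (⌊τ₀ x⌋₊ : ℝ) ^ (1 - q) ≤ τ₀ (T.f^[j] x)} := by
    ext x
    simp [doubleExcursion]
  rw [this]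
  refine MeasurableSet.iUnion fun j => (MeasurableSet.const _).inter
    ((measurableSet_lt measurable_const
      ((Real.measurable_log.comp (hfl.add_const 1)).const_mul dstar)).inter
    (measurableSet_le (hfl.pow_const _) (hτ.measurable.comp (T.measurable_f.iterate j))))

/-- A second excursion at a time j < d_* log n lies in X_q⁺(n). A later one, at time j, is assigned
to the level m = ⌊e^{j/d_*}⌋, for which d_* log m ≤ j < d_* log(m + 1). The time bound in the
definition gives m ≤ ⌊τ₀⌋, so it lies in X_q'(m). -/
theorem doubleExcursion_inter_subset {dstar q : ℝ} (hd : 0 < dstar) (hq : q < 1) {n : ℕ} :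
    T.doubleExcursion τ₀ dstar q ∩ {x | n ≤ ⌊τ₀ x⌋₊} ⊆
      T.XPlus τ₀ dstar q n ∪ ⋃ i : ℕ, T.XPrime τ₀ dstar q
        ⌊Real.exp (((⌈dstar * Real.log n⌉₊ + i : ℕ) : ℝ) / dstar)⌋₊ := by
  rintro x ⟨⟨j, hj1, hj, hjτ⟩, hnx⟩
  have hnx' : n ≤ ⌊τ₀ x⌋₊ := hnx
  have hmono : ∀ m : ℕ, m ≤ ⌊τ₀ x⌋₊ → (m : ℝ) ^ (1 - q) ≤ τ₀ (T.f^[j] x) := fun m hm =>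
    (Real.rpow_le_rpow (Nat.cast_nonneg _) (by exact_mod_cast hm) (by linarith)).trans hjτ
  rcases lt_or_ge (j : ℝ) (dstar * Real.log n) with h | h
  · exact Or.inl ⟨hnx', j, hj1, h, hmono n hnx'⟩
  · right
    have hceil : ⌈dstar * Real.log n⌉₊ ≤ j := Nat.ceil_le.2 h
    refine mem_iUnion.2 ⟨j - ⌈dstar * Real.log n⌉₊, ?_⟩
    rw [Nat.add_sub_cancel' hceil]
    set u := Real.exp ((j : ℝ) / dstar) with hu
    have hlogu : dstar * Real.log u = j := by
      rw [hu, Real.log_exp]; field_simp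
    have hu1 : 1 ≤ u := Real.one_le_exp (by positivity)
    have hfl1 : 1 ≤ ⌊u⌋₊ := Nat.le_floor (by exact_mod_cast hu1)
    have hfl0 : (0 : ℝ) < ⌊u⌋₊ := by exact_mod_cast hfl1
    have hle : ⌊u⌋₊ ≤ ⌊τ₀ x⌋₊ := by
      have h1 : u < (⌊τ₀ x⌋₊ : ℝ) + 1 := by
        rw [hu, ← Real.lt_log_iff_exp_lt (by positivity), div_lt_iff₀ hd, mul_comm]
        exact hj
      have h2 : (⌊u⌋₊ : ℝ) < ((⌊τ₀ x⌋₊ + 1 : ℕ) : ℝ) := by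
        push_cast
        exact (Nat.floor_le (by linarith)).trans_lt h1
      have h3 : ⌊u⌋₊ < ⌊τ₀ x⌋₊ + 1 := by exact_mod_cast h2
      omega
    refine ⟨hle, j, ?_, ?_, hmono _ hle⟩
    · rw [← hlogu]
      gcongr
      exact Nat.floor_le (by linarith)
    · rw [← hlogu]
      gcongr
      exact Nat.lt_floor_add_one u

/-- The measure of the set of double excursions above level `n`. -/
theorem exists_measureReal_doubleExcursion_le {dstar q b C : ℝ} (hd : 0 < dstar) (hq : q < 1)
    (hb : 0 < b) (hC : 0 < C)
    (h : ∀ n : ℕ, 1 ≤ n → T.μX.real (T.XPlus τ₀ dstar q n) ≤ C * (n : ℝ) ^ (-b) ∧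
      T.μX.real (T.XPrime τ₀ dstar q n) ≤ C * (n : ℝ) ^ (-b)) :
    ∃ C' : ℝ, ∀ n : ℕ, 1 ≤ n →
      T.μX.real (T.doubleExcursion τ₀ dstar q ∩ {x | n ≤ ⌊τ₀ x⌋₊}) ≤ C' * (n : ℝ) ^ (-b) := by
  -- The levels m grow at least like n e^{i/d_*}/2, so the bounds on X_q'(m) form a geometric series
  -- with this ratio. The sum is again of order n^{-b}.
  set ρ := Real.exp (-(b / dstar)) with hρ
  have hρ0 : 0 < ρ := Real.exp_pos _
  have hρ1 : ρ < 1 := Real.exp_lt_one_iff.2 (by simpa using div_pos hb hd)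
  refine ⟨C + C * 2 ^ b * (1 - ρ)⁻¹, fun n hn => ?_⟩
  have hn0 : (0 : ℝ) < n := by exact_mod_cast hn
  have hnb : 0 < (n : ℝ) ^ (-b) := Real.rpow_pos_of_pos hn0 _
  have hlog : 0 ≤ Real.log n := Real.log_nonneg (by exact_mod_cast hn)
  have hR : 0 < (1 - ρ)⁻¹ := inv_pos.2 (by linarith)
  refine ENNReal.toReal_le_of_le_ofReal (by positivity) ?_
  refine (measure_mono (doubleExcursion_inter_subset hd hq)).trans
    ((measure_union_le _ _).trans ?_)
  have h1 : T.μX (T.XPlus τ₀ dstar q n) ≤ ENNReal.ofReal (C * (n : ℝ) ^ (-b)) := by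
    rw [← ENNReal.ofReal_toReal (measure_ne_top T.μX _)]
    exact ENNReal.ofReal_le_ofReal (h n hn).1
  have h2 : ∀ i : ℕ, T.μX (T.XPrime τ₀ dstar q
      ⌊Real.exp (((⌈dstar * Real.log n⌉₊ + i : ℕ) : ℝ) / dstar)⌋₊) ≤
      ENNReal.ofReal (C * 2 ^ b * (n : ℝ) ^ (-b) * ρ ^ i) := by
    intro i
    set u := Real.exp (((⌈dstar * Real.log n⌉₊ + i : ℕ) : ℝ) / dstar) with hu
    have hun : n * Real.exp (i / dstar) ≤ u := by
      have h3 : Real.log n + i / dstar ≤ ((⌈dstar * Real.log n⌉₊ + i : ℕ) : ℝ) / dstar := by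
        rw [Nat.cast_add, add_div]
        gcongr
        rw [le_div_iff₀ hd, mul_comm]
        exact Nat.le_ceil _
      calc _ = Real.exp (Real.log n + i / dstar) := by rw [Real.exp_add, Real.exp_log hn0]
        _ ≤ u := Real.exp_le_exp.2 h3
    have hu1 : 1 ≤ u := Real.one_le_exp (by positivity)
    have hfl1 : 1 ≤ ⌊u⌋₊ := Nat.le_floor (by exact_mod_cast hu1)
    have hfl : u / 2 ≤ ⌊u⌋₊ := by
      have h3 := Nat.lt_floor_add_one u
      have h4 : (1 : ℝ) ≤ ⌊u⌋₊ := by exact_mod_cast hfl1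
      linarith
    rw [← ENNReal.ofReal_toReal (measure_ne_top T.μX _)]
    refine ENNReal.ofReal_le_ofReal (((h _ hfl1).2).trans ?_)
    have h5 : (⌊u⌋₊ : ℝ) ^ (-b) ≤ (n * Real.exp (i / dstar) / 2) ^ (-b) := by
      refine Real.rpow_le_rpow_of_nonpos (by positivity) ?_ (by linarith)
      linarith
    have h6 : (n * Real.exp (i / dstar) / 2) ^ (-b) = 2 ^ b * (n : ℝ) ^ (-b) * ρ ^ i := by
      rw [Real.div_rpow (by positivity) zero_le_two, Real.mul_rpow hn0.le (Real.exp_pos _).le,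
        Real.rpow_neg zero_le_two b, div_inv_eq_mul, ← Real.exp_mul, hρ, ← Real.exp_nat_mul,
        mul_comm _ ((2 : ℝ) ^ b), mul_assoc]
      congr 3
      ring
    calc _ ≤ C * (2 ^ b * (n : ℝ) ^ (-b) * ρ ^ i) := by rw [← h6]; gcongr
      _ = _ := by ring
  have h3 : ∑' i : ℕ, ENNReal.ofReal (C * 2 ^ b * (n : ℝ) ^ (-b) * ρ ^ i) =
      ENNReal.ofReal (C * 2 ^ b * (n : ℝ) ^ (-b) * (1 - ρ)⁻¹) := by
    rw [← ENNReal.ofReal_tsum_of_nonneg (fun i => by positivity)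
      ((summable_geometric_of_lt_one hρ0.le hρ1).mul_left _), tsum_mul_left,
      tsum_geometric_of_lt_one hρ0.le hρ1]
  calc _ ≤ ENNReal.ofReal (C * (n : ℝ) ^ (-b)) +
        ∑' i : ℕ, ENNReal.ofReal (C * 2 ^ b * (n : ℝ) ^ (-b) * ρ ^ i) :=
        add_le_add h1 ((measure_iUnion_le _).trans (ENNReal.tsum_le_tsum h2))
    _ = ENNReal.ofReal ((C + C * 2 ^ b * (1 - ρ)⁻¹) * (n : ℝ) ^ (-b)) := by
        rw [h3, ← ENNReal.ofReal_add (by positivity) (by positivity)]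
        congr 1
        ring

/-- Either `ψ` is controlled by the return time, or `τ` is small, or there is a double excursion. -/
theorem IsRoof.ψ_cases (hτ : T.IsRoof τ₀ β κ) {d₀ M₁ M₂ dstar q : ℝ} (hd₀ : 0 < d₀) (hM₁ : 0 < M₁)
    (hq : q < 1)
    (h1 : ∀ y : T.Y, (T.σ y.1.1 : ℝ) < d₀ * Real.log (T.ψ τ₀ y) →
      (T.σ y.1.1 : ℝ) < M₁ * Real.log (T.ψStar τ₀ y) + M₂)
    (h2 : ∀ n : ℕ, 2 ≤ n → M₁ * Real.log n + M₂ ≤ dstar * Real.log n) (y : T.Y) :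
    T.ψ τ₀ y ≤ (1 + 2 * d₀) * Real.exp (d₀⁻¹ * T.σ y.1.1) ∨
    T.τ τ₀ y ≤ T.φ τ₀ y.1.1 ^ (1 - q) ∨
    ∃ j < T.σ y.1.1, T.f^[j] (y.1.1 : X) ∈ T.doubleExcursion τ₀ dstar q ∧
      T.ψ τ₀ y ≤ T.σ y.1.1 * τ₀ (T.f^[j] (y.1.1 : X)) ∧ 1 ≤ τ₀ (T.f^[j] (y.1.1 : X)) ∧
      (T.σ y.1.1 : ℝ) < dstar * Real.log ((⌊τ₀ (T.f^[j] (y.1.1 : X))⌋₊ : ℝ) + 1) := by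
  have hls : (y.1.2 : ℝ) ≤ T.σ y.1.1 := by exact_mod_cast y.2.le
  have hE := Real.exp_pos (d₀⁻¹ * T.σ y.1.1)
  rcases le_or_gt (T.ψ τ₀ y) (Real.exp (d₀⁻¹ * T.σ y.1.1)) with hi | hi
  · left
    refine hi.trans (le_mul_of_one_le_left hE.le (by linarith))
  -- If every value below the given level is less than 2, then ψ ≤ 2σ. Otherwise ψ_* ≥ 2 excludes
  -- level 0 and makes the bounds for integers n ≥ 2 applicable. The remaining inequality ψ >
  -- e^{σ/d₀} is the premise of `h1`.
  rcases lt_or_ge (T.ψStar τ₀ y) 2 with hii | hii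
  · left
    have a1 := natCast_le_div_mul_exp (inv_pos.2 hd₀) (T.σ y.1.1)
    rw [inv_inv] at a1
    calc T.ψ τ₀ y ≤ y.1.2 * T.ψStar τ₀ y := ψ_le_mul_ψStar y
      _ ≤ y.1.2 * 2 := by gcongr
      _ ≤ T.σ y.1.1 * 2 := by gcongr
      _ ≤ (d₀ * Real.exp (d₀⁻¹ * T.σ y.1.1)) * 2 := by gcongr
      _ = 2 * d₀ * Real.exp (d₀⁻¹ * T.σ y.1.1) := by ring
      _ ≤ _ := by gcongr; linarith
  right
  have hσ : (T.σ y.1.1 : ℝ) < M₁ * Real.log (T.ψStar τ₀ y) + M₂ := by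
    refine h1 y ?_
    rw [← Real.lt_log_iff_exp_lt (hE.trans hi), inv_mul_lt_iff₀ hd₀] at hi
    exact hi
  have hl : 0 < y.1.2 := by
    by_contra h0
    have h1 : y.1.2 = 0 := by omega
    have : IsEmpty (Fin y.1.2) := by rw [h1]; infer_instance
    rw [ψStar, Real.iSup_of_isEmpty] at hii
    linarith
  -- The first excursion is the maximal one, at time j. The second is the value of τ at the given
  -- point, reached after ℓ - j ≥ 1 further steps, where ℓ is its level.
  obtain ⟨j, hj, hjψ⟩ := exists_eq_ψStar (τ₀ := τ₀) y hl
  set x := T.f^[j] (y.1.1 : X) with hx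
  have hjσ : j < T.σ y.1.1 := hj.trans y.2
  have hk2 : 2 ≤ ⌊τ₀ x⌋₊ := Nat.le_floor (by rw [hjψ]; exact_mod_cast hii)
  have hk0 : (0 : ℝ) ≤ ⌊τ₀ x⌋₊ := Nat.cast_nonneg _
  have hkle : (⌊τ₀ x⌋₊ : ℝ) ≤ τ₀ x := Nat.floor_le (hτ.pos x).le
  have hσ' : (T.σ y.1.1 : ℝ) < dstar * Real.log ((⌊τ₀ x⌋₊ : ℝ) + 1) := by
    have a1 := h2 (⌊τ₀ x⌋₊ + 1) (by omega)
    push_cast at a1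
    refine hσ.trans_le (le_trans ?_ a1)
    gcongr
    rw [← hjψ]
    exact (Nat.lt_floor_add_one _).le
  rcases lt_or_ge (T.τ τ₀ y) ((⌊τ₀ x⌋₊ : ℝ) ^ (1 - q)) with hiii | hiii
  · left
    refine hiii.le.trans (Real.rpow_le_rpow hk0 (hkle.trans ?_) (by linarith))
    exact hτ.τ_le_φ ⟨(y.1.1, j), hjσ⟩
  · right
    refine ⟨j, hjσ, ⟨y.1.2 - j, by omega, lt_of_le_of_lt ?_ hσ', ?_⟩, ?_, ?_, hσ'⟩
    · refine le_trans ?_ hls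
      exact_mod_cast Nat.sub_le _ _
    · have h3 : T.f^[y.1.2 - j] x = T.proj y := by
        rw [hx, ← Function.iterate_add_apply, Nat.sub_add_cancel hj.le, proj]
      exact hiii.trans_eq (congrArg τ₀ h3.symm)
    · rw [hjψ]
      refine (ψ_le_mul_ψStar y).trans ?_
      gcongr
    · rw [hjψ]; linarith

end YoungTower
end

/-! ### From rare double excursions to the condition on ψ. -/

noncomputable section

namespace YoungTower

variable {X : Type*} [MeasurableSpace X] {θ₀ : ℝ} {T : YoungTower X θ₀} {τ₀ : X → ℝ} {β κ : ℝ}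

/-- Averaging an observable over the fibres of the tower does not change its integral. -/
theorem lintegral_average_iterate {g : X → ℝ≥0∞} (hg : Measurable g) :
    ∫⁻ y : T.Y, (T.σ y.1.1 : ℝ≥0∞)⁻¹ * ∑ j ∈ Finset.range (T.σ y.1.1), g (T.f^[j] (y.1.1 : X)) ∂T.μ =
      ∫⁻ x, g x ∂T.μX := by
  have hσ : Measurable fun z => (T.σ z : ℝ≥0∞) :=
    (measurable_of_countable fun n : ℕ => (n : ℝ≥0∞)).comp T.measurable_σ
  rw [lintegral_comp_fst (u := fun z => (T.σ z : ℝ≥0∞)⁻¹ *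
      ∑ j ∈ Finset.range (T.σ z), g (T.f^[j] (z : X)))
      (hσ.inv.mul (measurable_sum_range T.measurable_σ fun j => hg.comp (T.measurable_iterate j))),
    μX, lintegral_map hg T.measurable_proj, T.lintegral_μ (v := fun y => g (T.proj y)) (hg.comp T.measurable_proj)]
  congr 1
  refine lintegral_congr fun z => ?_
  rw [← mul_assoc, ENNReal.mul_inv_cancel (by exact_mod_cast (T.σ_pos z).ne')
    (ENNReal.natCast_ne_top _), one_mul]
  exact Finset.sum_congr rfl fun j hj =>
    (T.levelFn_of_lt (fun y => g (T.proj y)) (Finset.mem_range.1 hj)).symm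

/-- Since n is at most logarithmic in t, it is at most a constant times t^η. The extra factor n pays
for averaging over a column of height n, and u ≤ nt costs another n, hence the exponent b + 2η. -/
theorem natCast_mul_rpow_le {n : ℕ} (hn : 1 ≤ n) {a t u b η : ℝ} (ht : 1 ≤ t) (hη : 0 < η)
    (hu : 0 ≤ u) (hb0 : 0 ≤ b) (hb1 : b ≤ 1) (ha : 0 ≤ a) (hut : u ≤ n * t)
    (hnt : (n : ℝ) < a * Real.log ((⌊t⌋₊ : ℝ) + 1)) :
    n * u ^ b ≤ (a * (2 ^ η / η)) ^ 2 * t ^ (b + 2 * η) := by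
  have ht0 : 0 < t := by linarith
  have hn1 : (1 : ℝ) ≤ n := by exact_mod_cast hn
  have h1 : (n : ℝ) ≤ a * (2 ^ η / η) * t ^ η := by
    have h2 : Real.log ((⌊t⌋₊ : ℝ) + 1) ≤ Real.log (2 * t) := by
      refine Real.log_le_log (by positivity) ?_
      linarith [Nat.floor_le ht0.le]
    have h3 := Real.log_le_rpow_div (by positivity : 0 ≤ 2 * t) hη
    rw [Real.mul_rpow zero_le_two ht0.le] at h3
    calc (n : ℝ) ≤ a * (2 ^ η * t ^ η / η) := by
          refine hnt.le.trans ?_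
          gcongr
          exact h2.trans h3
      _ = _ := by ring
  have h4 : u ^ b ≤ n * t ^ b := by
    refine (Real.rpow_le_rpow hu hut hb0).trans ?_
    rw [Real.mul_rpow (by linarith) ht0.le]
    gcongr
    exact (Real.rpow_le_rpow_of_exponent_le hn1 hb1).trans_eq (Real.rpow_one _)
  have h5 : t ^ (b + 2 * η) = t ^ b * (t ^ η) ^ 2 := by
    rw [Real.rpow_add ht0, ← Real.rpow_natCast (t ^ η), ← Real.rpow_mul ht0.le]
    norm_num [mul_comm]
  calc n * u ^ b ≤ n * (n * t ^ b) := by gcongr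
    _ = (n : ℝ) ^ 2 * t ^ b := by ring
    _ ≤ (a * (2 ^ η / η) * t ^ η) ^ 2 * t ^ b := by gcongr
    _ = _ := by rw [h5]; ring

/-- One factor is bounded trivially by 2 and the other by interpolation. The roles of τ and ψ can be
exchanged, which the three cases exploit. -/
theorem norm_exp_sub_one_mul_exp_sub_one_le {s : ℂ} (hs : 0 ≤ s.re) {t u : ℝ} (ht : 0 ≤ t)
    (hu : 0 ≤ u) {b : ℝ} (hb0 : 0 ≤ b) (hb1 : b ≤ 1) :
    ‖(Complex.exp (-s * t) - 1) * (Complex.exp (-s * u) - 1)‖ ≤ 4 * (‖s‖ ^ b * u ^ b) := by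
  have h1 : ‖Complex.exp (-s * t) - 1‖ ≤ 2 := by
    simpa using norm_cexp_neg_mul_sub_one_le hs ht le_rfl zero_le_one
  have h2 := norm_cexp_neg_mul_sub_one_le hs hu hb0 hb1
  rw [Real.mul_rpow (norm_nonneg _) hu] at h2
  rw [norm_mul]
  calc _ ≤ 2 * (2 * (‖s‖ ^ b * u ^ b)) := mul_le_mul h1 h2 (norm_nonneg _) zero_le_two
    _ = _ := by ring

/-- Rare double excursions imply the condition on `ψ`. -/
theorem IsRoof.condPsi_of_doubleExcursion (hτ : T.IsRoof τ₀ β κ) (hβκ : β ≤ κ) (hβ1 : β ≤ 1)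
    {d C d₀ M₁ M₂ dstar q r C' b : ℝ}
    (hd : ∀ n : ℕ, T.μZ.real {z | n < T.σ z} ≤ C * Real.exp (-d * n)) (hd₀ : 0 < d₀)
    (hd₀d : d₀⁻¹ < d) (hM₁ : 0 < M₁)
    (h1 : ∀ y : T.Y, (T.σ y.1.1 : ℝ) < d₀ * Real.log (T.ψ τ₀ y) →
      (T.σ y.1.1 : ℝ) < M₁ * Real.log (T.ψStar τ₀ y) + M₂)
    (h2 : ∀ n : ℕ, 2 ≤ n → M₁ * Real.log n + M₂ ≤ dstar * Real.log n) (hdstar : 0 ≤ dstar)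
    (hq : q < 1)
    (hr : ∀ n : ℕ, 1 ≤ n →
      T.μX.real (T.doubleExcursion τ₀ dstar q ∩ {x | n ≤ ⌊τ₀ x⌋₊}) ≤ C' * (n : ℝ) ^ (-r))
    (hb0 : 0 < b) (hb1 : b < 1) (hbr : b < r) (hbq : (1 - q) * b < β) :
    T.CondPsi τ₀ b := by
  -- The strict room between b and min(1, r) is used to absorb the two logarithmic factors t^η.
  obtain ⟨η, hη, hη1, hηr⟩ : ∃ η : ℝ, 0 < η ∧ b + 2 * η ≤ 1 ∧ b + 2 * η < r := by
    have h3 : b < min 1 r := lt_min hb1 hbr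
    refine ⟨(min 1 r - b) / 4, by linarith, ?_, ?_⟩ <;>
    linarith [min_le_left 1 r, min_le_right 1 r]
  set K := (dstar * (2 ^ η / η)) ^ 2
  have hK : 0 ≤ K := sq_nonneg _
  have hq0 : 0 < 1 - q := by linarith
  set D := T.doubleExcursion τ₀ dstar q with hD
  have hmD : MeasurableSet D := hτ.measurableSet_doubleExcursion dstar q
  set g : X → ℝ≥0∞ := D.indicator fun x => ENNReal.ofReal (τ₀ x ^ (b + 2 * η)) with hg
  have hgm : Measurable g :=
    (ENNReal.measurable_ofReal.comp (hτ.measurable.pow_const _)).indicator hmD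
  have hgi : ∫⁻ x, g x ∂T.μX < ∞ := by
    rw [hg, lintegral_indicator hmD]
    exact setLIntegral_rpow_lt_top hτ.measurable hτ.pos (by positivity) hη1 hηr hr
  obtain ⟨e, he, hw⟩ := hτ.exists_integrable_weight hβκ hβ1 (mul_pos hq0 hb0) hbq
  have hi1 := (integrable_exp_σ hd hd₀d).const_mul (4 * (1 + 2 * d₀))
  have hi2 := (hw 0 he.le).2.const_mul 4
  -- One integrable majorant for each case of `ψ_cases`: an exponential moment of σ, finite since
  -- 1/d₀ < d; a moment of φ of order (1 - q)b < β; and a moment of τ₀ of order b + 2η < r on the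
  -- double excursions. The last one is averaged over the column, so that its integral is computed
  -- on X.
  set B₁ : T.Y → ℝ≥0∞ := fun y =>
    ENNReal.ofReal (4 * (1 + 2 * d₀) * Real.exp (d₀⁻¹ * T.σ y.1.1)) with hB₁
  set B₂ : T.Y → ℝ≥0∞ := fun y => ENNReal.ofReal (4 * T.weight τ₀ ((1 - q) * b) 0 y.1.1) with hB₂
  set B₃ : T.Y → ℝ≥0∞ := fun y => (T.σ y.1.1 : ℝ≥0∞)⁻¹ *
    ∑ j ∈ Finset.range (T.σ y.1.1), g (T.f^[j] (y.1.1 : X)) with hB₃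
  have hmB₁ : Measurable B₁ := ENNReal.measurable_ofReal.comp
    (((measurable_of_countable fun n : ℕ => Real.exp (d₀⁻¹ * n)).comp
      (T.measurable_σ.comp (measurable_fst.comp measurable_subtype_coe))).const_mul _)
  have hmB₂ : Measurable B₂ := ENNReal.measurable_ofReal.comp
    (((hτ.measurable_weight _ _).comp (measurable_fst.comp measurable_subtype_coe)).const_mul _)
  have hfin : ∫⁻ y, (B₁ y + B₂ y) + ENNReal.ofReal (4 * K) * B₃ y ∂T.μ < ∞ := by
    rw [lintegral_add_left (f := fun y => B₁ y + B₂ y) (hmB₁.add hmB₂), lintegral_add_left hmB₁,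
      lintegral_const_mul' _ _ ENNReal.ofReal_ne_top, lintegral_average_iterate hgm]
    exact ENNReal.add_lt_top.2 ⟨ENNReal.add_lt_top.2 ⟨hi1.lintegral_lt_top, hi2.lintegral_lt_top⟩,
      ENNReal.mul_lt_top ENNReal.ofReal_lt_top hgi⟩
  refine ⟨1, one_pos, (∫⁻ y, (B₁ y + B₂ y) + ENNReal.ofReal (4 * K) * B₃ y ∂T.μ).toReal,
    fun s hs => ?_⟩
  have hsb : 0 ≤ ‖s‖ ^ b := Real.rpow_nonneg (norm_nonneg _) _
  have hs1 : ‖s‖ ≤ ‖s‖ ^ b := Real.self_le_rpow_of_le_one (norm_nonneg _) hs.2.le hb1.le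
  have hpt : ∀ y : T.Y, ‖(Complex.exp (-s * (T.τ τ₀ y : ℂ)) - 1) *
      (Complex.exp (-s * (T.ψ τ₀ y : ℂ)) - 1)‖ₑ ≤
      ENNReal.ofReal (‖s‖ ^ b) * ((B₁ y + B₂ y) + ENNReal.ofReal (4 * K) * B₃ y) := by
    intro y
    have hψ := hτ.ψ_nonneg y
    have hτy := (hτ.τ_pos y).le
    rw [← ofReal_norm]
    rcases hτ.ψ_cases hd₀ hM₁ hq h1 h2 y with h | h | ⟨j, hj, hjD, hjψ, hj1, hjσ⟩
    · have h3 := norm_exp_sub_one_mul_exp_sub_one_le hs.1 hτy hψ zero_le_one le_rfl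
      rw [Real.rpow_one, Real.rpow_one] at h3
      calc _ ≤ ENNReal.ofReal (‖s‖ ^ b * (4 * (1 + 2 * d₀) * Real.exp (d₀⁻¹ * T.σ y.1.1))) := by
            refine ENNReal.ofReal_le_ofReal (h3.trans ?_)
            calc _ ≤ 4 * (‖s‖ ^ b * ((1 + 2 * d₀) * Real.exp (d₀⁻¹ * T.σ y.1.1))) := by gcongr
              _ = _ := by ring
        _ = ENNReal.ofReal (‖s‖ ^ b) * B₁ y := ENNReal.ofReal_mul hsb
        _ ≤ _ := by
            gcongr
            exact le_self_add.trans le_self_add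
    · have h3 := norm_exp_sub_one_mul_exp_sub_one_le hs.1 hψ hτy hb0.le hb1.le
      have h4 : T.τ τ₀ y ^ b ≤ T.φ τ₀ y.1.1 ^ ((1 - q) * b) := by
        rw [Real.rpow_mul (hτ.φ_pos _).le]
        exact Real.rpow_le_rpow hτy h hb0.le
      have h5 : T.φ τ₀ y.1.1 ^ ((1 - q) * b) ≤ T.weight τ₀ ((1 - q) * b) 0 y.1.1 := by
        simp [weight]
      calc _ ≤ ENNReal.ofReal (‖s‖ ^ b * (4 * T.weight τ₀ ((1 - q) * b) 0 y.1.1)) := by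
            refine ENNReal.ofReal_le_ofReal ?_
            rw [mul_comm (Complex.exp _ - 1)]
            refine h3.trans ?_
            calc _ ≤ 4 * (‖s‖ ^ b * T.weight τ₀ ((1 - q) * b) 0 y.1.1) := by
                  gcongr
                  exact h4.trans h5
              _ = _ := by ring
        _ = ENNReal.ofReal (‖s‖ ^ b) * B₂ y := ENNReal.ofReal_mul hsb
        _ ≤ _ := by
            gcongr
            exact le_add_self.trans le_self_add
    · have h3 := norm_exp_sub_one_mul_exp_sub_one_le hs.1 hτy hψ hb0.le hb1.le
      set t := τ₀ (T.f^[j] (y.1.1 : X)) with ht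
      have hσ : (0 : ℝ) < T.σ y.1.1 := by exact_mod_cast T.σ_pos y.1.1
      have h4 := natCast_mul_rpow_le (T.σ_pos y.1.1) hj1 hη hψ hb0.le hb1.le hdstar hjψ hjσ
      have h5 : T.ψ τ₀ y ^ b ≤ K * ((T.σ y.1.1 : ℝ)⁻¹ * t ^ (b + 2 * η)) := by
        rw [mul_left_comm, ← div_eq_inv_mul, le_div_iff₀ hσ, mul_comm]
        exact h4
      have h6 : ENNReal.ofReal (t ^ (b + 2 * η)) = g (T.f^[j] (y.1.1 : X)) := by
        rw [hg, indicator_of_mem hjD]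
      have h7 : g (T.f^[j] (y.1.1 : X)) ≤
          ∑ j ∈ Finset.range (T.σ y.1.1), g (T.f^[j] (y.1.1 : X)) :=
        Finset.single_le_sum (f := fun j => g (T.f^[j] (y.1.1 : X))) (fun _ _ => zero_le)
          (Finset.mem_range.2 hj)
      calc _ ≤ ENNReal.ofReal (‖s‖ ^ b * ((4 * K) * ((T.σ y.1.1 : ℝ)⁻¹ * t ^ (b + 2 * η)))) := by
            refine ENNReal.ofReal_le_ofReal (h3.trans ?_)
            calc _ ≤ 4 * (‖s‖ ^ b * (K * ((T.σ y.1.1 : ℝ)⁻¹ * t ^ (b + 2 * η)))) := by gcongr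
              _ = _ := by ring
        _ = ENNReal.ofReal (‖s‖ ^ b) * (ENNReal.ofReal (4 * K) *
              ((T.σ y.1.1 : ℝ≥0∞)⁻¹ * g (T.f^[j] (y.1.1 : X)))) := by
            rw [ENNReal.ofReal_mul hsb, ENNReal.ofReal_mul (by positivity : 0 ≤ 4 * K),
              ENNReal.ofReal_mul (by positivity : 0 ≤ (T.σ y.1.1 : ℝ)⁻¹),
              ENNReal.ofReal_inv_of_pos hσ, ENNReal.ofReal_natCast, h6]
        _ ≤ ENNReal.ofReal (‖s‖ ^ b) * (ENNReal.ofReal (4 * K) * B₃ y) := by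
            gcongr
            exact mul_le_mul_right h7 _
        _ ≤ _ := by
            gcongr
            exact le_add_self
  calc _ = ‖∫ y, (Complex.exp (-s * (T.τ τ₀ y : ℂ)) - 1) *
        (Complex.exp (-s * (T.ψ τ₀ y : ℂ)) - 1) ∂T.μ‖ₑ.toReal := (toReal_enorm _).symm
    _ ≤ (ENNReal.ofReal (‖s‖ ^ b) *
        ∫⁻ y, (B₁ y + B₂ y) + ENNReal.ofReal (4 * K) * B₃ y ∂T.μ).toReal := by
        refine ENNReal.toReal_mono (ENNReal.mul_lt_top ENNReal.ofReal_lt_top hfin).ne ?_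
        rw [← lintegral_const_mul' _ _ ENNReal.ofReal_ne_top]
        exact (enorm_integral_le_lintegral_enorm _).trans (lintegral_mono hpt)
    _ = _ := by rw [ENNReal.toReal_mul, ENNReal.toReal_ofReal hsb, mul_comm]

end YoungTower
end

/-! ### Assembly of the theorem. -/

noncomputable section

theorem mainTheorem7 {X : Type*} [MeasurableSpace X] {θ₀ : ℝ} (hθ₀ : θ₀ ∈ Set.Ioo (0 : ℝ) 1)
    (T : YoungTower X θ₀) (τ₀ : X → ℝ) (β κ : ℝ) (hβ : β ∈ Set.Ioo (1 / 2 : ℝ) 1)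
    (hκ : κ ∈ Set.Ioc 1 (2 * β)) (hτ₀ : T.IsRoof τ₀ β κ)
    (β' θ : ℝ) (hβ' : β' ∈ Set.Ioo 0 β) (hθ : θ ∈ Set.Ico (θ₀ ^ β') 1) :
    ∃ ε₀ > 0, ∀ ε ∈ Set.Ioo 0 ε₀,
      -- the family of normalized eigenfunctions exists, and
      (∃ δ > 0, ∃ lam : ℂ → ℂ, ∃ ζ : ℂ → T.Y → ℂ, T.IsEigenfamily τ₀ β' θ ε δ lam ζ) ∧
      ∀ δ > 0, ∀ (lam : ℂ → ℂ) (ζ : ℂ → T.Y → ℂ), T.IsEigenfamily τ₀ β' θ ε δ lam ζ →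
        -- the eigenfunctions are close to `e ^ (-s ψ)` in every `L ^ p`,
        (∀ βm ∈ Set.Ioo 0 β, ∀ p : ℝ, 1 ≤ p → ∃ δ' > 0, ∃ C : ℝ, ∀ s ∈ YoungTower.halfDisc δ',
          MeasureTheory.eLpNorm (fun y => ζ s y - Complex.exp (-s * (T.ψ τ₀ y : ℂ)))
            (ENNReal.ofReal p) T.μ ≤ ENNReal.ofReal (C * ‖s‖ ^ βm)) ∧
        -- the eigenfunction condition is equivalent to the one on `ψ`,
        (∀ βp ∈ Set.Ioo β (2 * β), T.CondA1iii τ₀ ζ βp ↔ T.CondPsi τ₀ βp) ∧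
        -- and a sufficient condition for it in terms of long excursions
        (∃ D : ℝ, ∀ dstar ≥ D, T.IsAdmissible τ₀ dstar) ∧
        ((∃ c > 0, ∀ A : Set T.Z, MeasurableSet A →
            ENNReal.ofReal c * T.μZ A ≤ T.μX (Subtype.val '' A)) →
          ∀ dstar > 0, T.IsAdmissible τ₀ dstar →
          ∀ p ∈ Set.Ioo (0 : ℝ) 1, ∀ q ∈ Set.Ioo (0 : ℝ) 1,
          (∃ C > 0, ∀ n : ℕ, 1 ≤ n →
            T.μX.real (T.XPlus τ₀ dstar q n) ≤ C * (n : ℝ) ^ (-(β + p)) ∧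
            T.μX.real (T.XPrime τ₀ dstar q n) ≤ C * (n : ℝ) ^ (-(β + p))) →
          ∀ βp ∈ Set.Ioo β (min 1 (min (β + p) (β / (1 - q)))), T.CondA1iii τ₀ ζ βp) := by
  have hβ0 : 0 < β := by linarith [hβ.1]
  have hβκ : β ≤ κ := by linarith [hβ.2, hκ.1]
  have hβ1 : β ≤ 1 := hβ.2.le
  have hθ' : θ ∈ Ico θ₀ 1 := by
    refine ⟨le_trans ?_ hθ.1, hθ.2⟩
    exact Real.self_le_rpow_of_le_one hθ₀.1.le hθ₀.2.le (hβ'.2.le.trans hβ1)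
  -- The exponent max(b, β') is at least the one wanted by each claim, stays below β, and satisfies
  -- θ₀^γ ≤ θ. The analysis on the base may use this larger exponent while `𝓑(Y)` keeps β'.
  have hmax : ∀ b < β, ∀ emax > 0, ∃ κ₁ e r C, e ≤ emax ∧
      YoungTower.Regime T τ₀ hθ₀ hθ' (max b β') κ₁ e r C := fun b hb emax he =>
    hτ₀.exists_regime hβκ hβ1 hθ₀ hθ' (lt_max_of_lt_right hβ'.1) (max_lt hb hβ'.2)
      ((Real.rpow_le_rpow_of_exponent_ge hθ₀.1 hθ₀.2.le (le_max_right b β')).trans hθ.1) he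
  obtain ⟨ε₀, hε₀, hw⟩ := hτ₀.exists_integrable_weight hβκ hβ1 hβ'.1 hβ'.2
  refine ⟨ε₀, hε₀, fun ε hε => ?_⟩
  have hE : T.SpaceExponents τ₀ β' θ ε :=
    ⟨hβ'.1, hβ'.2.le.trans hβ1, hθ.1, hε.1, (hw ε hε.2.le).1, (hw ε hε.2.le).2⟩
  refine ⟨?_, fun δ hδ lam ζ hfam => ?_⟩
  · obtain ⟨κ₁, e, r, C, he, R⟩ := hmax β' hβ'.2 ε hε.1
    exact R.exists_isEigenfamily hτ₀ hE (by linarith [hε.1])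
  have hiff : ∀ βp ∈ Ioo β (2 * β), T.CondA1iii τ₀ ζ βp ↔ T.CondPsi τ₀ βp := by
    intro βp hβp
    -- The exponent `βp`/2 is below β exactly because `βp` < 2β, and it makes 2γ ≥ `βp`.
    obtain ⟨κ₁, e, r, C, -, R⟩ := hmax (βp / 2) (by linarith [hβp.2]) 1 one_pos
    exact R.condA1iii_iff_condPsi hτ₀ hE hδ hfam (by linarith [hβp.1])
      (by linarith [le_max_left (βp / 2) β'])
  refine ⟨fun βm hβm p hp => ?_, hiff, hτ₀.exists_isAdmissible, ?_⟩
  · obtain ⟨d, hd, Cd, hCd⟩ := T.exp_tail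
    have hp0 : 0 < p := by linarith
    -- With e ≤ d/p the p-th power of e^{eσ/2} has rate at most d/2, so it is integrable.
    obtain ⟨κ₁, e, r, C, he, R⟩ := hmax βm hβm.2 (d / p) (by positivity)
    refine R.eLpNorm_eigenfunction_sub_exp_le hτ₀ hE hδ hfam hp
      (YoungTower.integrable_exp_σ hCd ?_) hβm.1.le (le_max_left _ _)
    rw [le_div_iff₀ hp0] at he
    linarith
  · rintro - dstar hdstar ⟨d, hd, ⟨Cd, hCd⟩, d₀, hd₀, M₁, hM₁, M₂, -, h1, h2⟩ p hp q hq
      ⟨C, hC, hX⟩ βp hβp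
    have hb1 : βp < 1 := hβp.2.trans_le (min_le_left _ _)
    have hbp : βp < β + p := hβp.2.trans_le ((min_le_right _ _).trans (min_le_left _ _))
    have hbq : βp < β / (1 - q) := hβp.2.trans_le ((min_le_right _ _).trans (min_le_right _ _))
    rw [lt_div_iff₀ (by linarith [hq.2]), mul_comm] at hbq
    have hdi : 0 < d⁻¹ := inv_pos.2 hd
    have hd₀0 : 0 < d₀ := hdi.trans hd₀
    obtain ⟨C', hC'⟩ := YoungTower.exists_measureReal_doubleExcursion_le hdstar hq.2
      (by linarith [hp.1] : 0 < β + p) hC hX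
    exact (hiff βp ⟨hβp.1, by linarith [hβ.1]⟩).2
      (hτ₀.condPsi_of_doubleExcursion hβκ hβ1 hCd hd₀0 (inv_lt_of_inv_lt₀ hd hd₀) hM₁ h1 h2
        hdstar.le hq.2 hC' (hβ0.trans hβp.1) hb1 hbp hbq)
end
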